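/- **Proposition 3.3 ($H^0$-gradient of parallel transport).** Let $M$ be a smooth Hausdorff $d$-dimensional manifold without boundary with a smooth Riemannian metric $g$ (for instance a compact connected Riemannian manifold, or $\mathbb R^d$). Let $E$ be a complex vector bundle over $M$ with fiber $\mathbb C^N$ and structure group $G\subseteq SU(N)$, given by local trivializations $\psi_a$ over open sets $W_a$ covering $M$, with smooth $G$-valued transition functions $\psi_{ab}$ ($\psi_a\psi_b^{-1}(x,v)=(x,\psi_{ab}(x)v)$). Let $A$ be a smooth connection in $E$, given by $\mathrm{Lie}(G)$-valued local 1-forms $A^a=A^a_\mu dx^\mu$ with $A^b=\psi_{ab}^{-1}A^a\psi_{ab}+\psi_{ab}^{-1}d\psi_{ab}$, and let $F$ be its curvature, $F^a_{\mu\nu}=\partial_\mu A^a_\nu-\partial_\nu A^a_\mu+[A^a_\mu,A^a_\nu]$, $F=\psi_a^{-1}F^a\psi_a$. Let $\Omega$ be the Hilbert manifold of $H^1$-curves $\gamma:[0,1]\to M$, with charts $\exp_\gamma^{-1}$, where $\exp_\gamma(X)(t)=\exp_{\gamma(t)}(X(t))$ for small $H^1$-fields $X$ along $\gamma$. Let $\mathcal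 E$ be the bundle over $\Omega$ with fiber $L(E_{\gamma(0)},E_{\gamma(1)})$ and metric $g_{\mathcal E}(\Phi,\Psi)=\mathrm{Re}\,\mathrm{tr}(\Phi^*\Psi)$, and let $\mathcal H^0$ be the bundle over $\Omega$ whose fiber at $\gamma$ is the space of $L^2$-fields along $\gamma$, with $G_0(X,Y)=\int_0^1 g(X(t),Y(t))\,dt$; $\mathcal E\otimes\mathcal H^0$ carries the product metric. For $0\le s\le t\le 1$ let $U_{t,s}(\gamma):E_{\gamma(s)}\to E_{\gamma(t)}$ be the parallel transport of $A$ along $\gamma$: $U_{t,s}U_{s,r}=U_{t,r}$ for $r\le s\le t$, and, on intervals mapped by $\gamma$ into $W_a$, $U^a_{t,s}=\psi_aU_{t,s}\psi_a^{-1}$ is absolutely continuous in $t$ with $\frac{d}{dt}U^a_{t,s}=-A^a_\mu(\gamma(t))\dot\gamma^\mu(t)U^a_{t,s}$ for almost every $t$, and $U^a_{s,s}=\mathrm{Id}$. A smooth section $\varphi$ of $\mathcal E$ lies in the domain of the $H^0$-gradient, with $\mathrm{grad}_{H^0}\varphi=J$, if $J$ is a smooth section of $\mathcal E\otimes\mathcal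 H^0$ such that $$g_{\mathcal E\otimes\mathcal H^0}(J(\gamma),\Phi\otimes X)=g_{\mathcal E}(d_X\varphi(\gamma),\Phi)$$ for every $\gamma\in\Omega$, every $H^1$-field $X$ along $\gamma$ with $X(0)=X(1)=0$ and every $\Phi\in L(E_{\gamma(0)},E_{\gamma(1)})$. Then $\gamma\mapsto U_{1,0}(\gamma)$ is a smooth section of $\mathcal E$ that lies in the domain of the $H^0$-gradient; its $H^0$-gradient is unique (up to equality for almost every $t$, for each $\gamma$), and $$\mathrm{grad}_{H^0}U_{1,0}(\gamma;t)^\mu=-U_{1,t}(\gamma)\,F^{\mu}{}_{\nu}(\gamma(t))\,\dot\gamma^\nu(t)\,U_{t,0}(\gamma),\qquad F^\mu{}_\nu=g^{\mu\lambda}F_{\lambda\nu}.$$ -/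

import Mathlib

open MeasureTheory Set Topology Bundle
open scoped Manifold ContDiff

noncomputable section

namespace LevyGrad

/-- `ℝ^d`. -/
abbrev EV (d : ℕ) : Type := EuclideanSpace ℝ (Fin d)

/-- `ℂ^N`, the model fiber. -/
abbrev CV (N : ℕ) : Type := Fin N → ℂ

/-- Complex `N × N` matrices, as a real Banach algebra (all norms on this space are equivalent). -/
def MatC (N : ℕ) : Type := Matrix (Fin N) (Fin N) ℂ

instance (N : ℕ) : NormedRing (MatC N) :=
  letI : NormedRing (Matrix (Fin N) (Fin N) ℂ) := Matrix.linftyOpNormedRing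
  inferInstanceAs (NormedRing (Matrix (Fin N) (Fin N) ℂ))

instance (N : ℕ) : NormedAlgebra ℝ (MatC N) :=
  letI : NormedRing (Matrix (Fin N) (Fin N) ℂ) := Matrix.linftyOpNormedRing
  letI : NormedAlgebra ℝ (Matrix (Fin N) (Fin N) ℂ) := Matrix.linftyOpNormedAlgebra
  inferInstanceAs (NormedAlgebra ℝ (Matrix (Fin N) (Fin N) ℂ))

instance (N : ℕ) : FiniteDimensional ℝ (MatC N) :=
  inferInstanceAs (FiniteDimensional ℝ (Matrix (Fin N) (Fin N) ℂ))

instance (N : ℕ) : CompleteSpace (MatC N) := FiniteDimensional.complete ℝ (MatC N)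

/-- Smooth Riemannian metrics on `M`. -/
abbrev RMetric (d : ℕ) (M : Type*) [TopologicalSpace M] [ChartedSpace (EV d) M]
    [IsManifold (𝓡 d) ∞ M] : Type _ :=
  ContMDiffRiemannianMetric (𝓡 d) ∞ (EV d) (fun x : M => TangentSpace (𝓡 d) x)

/-- Smooth coordinate charts of `M`. -/
abbrev IsChart {d : ℕ} {M : Type*} [TopologicalSpace M] [ChartedSpace (EV d) M]
    (φ : OpenPartialHomeomorph M (EV d)) : Prop :=
  φ ∈ IsManifold.maximalAtlas (𝓡 d) ∞ M

/-! ### Sobolev functions on intervals -/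

/-- `f` is an `H¹` function on `[a, b]`: absolutely continuous with derivative `u ∈ L²`. -/
def IsH1On {V : Type*} [NormedAddCommGroup V] [NormedSpace ℝ V] (f : ℝ → V) (a b : ℝ) : Prop :=
  ∃ u : ℝ → V, MemLp u 2 (volume.restrict (Icc a b)) ∧
    ∀ t ∈ Icc a b, f t = f a + ∫ s in a..t, u s

/-- The space `L²([0,1], V)`. -/
abbrev L2 (V : Type*) [NormedAddCommGroup V] : Type _ :=
  Lp V 2 (volume.restrict (Icc (0 : ℝ) 1))

/-- The model space `H¹([0,1], ℝ^d)`: the function `t ↦ a + ∫₀ᵗ u` is recorded by the pair `(a, u)`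
of its initial value and its derivative; the product norm is equivalent to the usual `H¹` norm. -/
abbrev H1Model (d : ℕ) : Type := EV d × L2 (EV d)

/-- The value at `t` of the `H¹` function recorded by `ξ`. -/
def H1Model.eval {d : ℕ} (ξ : H1Model d) (t : ℝ) : EV d :=
  ξ.1 + ∫ s in (0 : ℝ)..t, (ξ.2 : ℝ → EV d) s

section Geometry

variable {d : ℕ} {M : Type*} [TopologicalSpace M] [ChartedSpace (EV d) M]

/-! ### `H¹` curves and `H¹` fields along them -/

/-- `c` is continuous on `[0,1]` and of class `H¹` in every coordinate chart, on every subinterval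
that it maps into the domain of that chart. -/
def IsH1Path (c : ℝ → M) : Prop :=
  ContinuousOn c (Icc 0 1) ∧
    ∀ φ : OpenPartialHomeomorph M (EV d), IsChart φ → ∀ a b : ℝ, 0 ≤ a → a ≤ b → b ≤ 1 →
      (∀ t ∈ Icc a b, c t ∈ φ.source) → IsH1On (fun t => φ (c t)) a b

/-- A map `[0,1] → M`, as a map on `ℝ` (constant to the left and to the right of `[0,1]`). -/
def extendPath (c : unitInterval → M) (t : ℝ) : M := c (projIcc 0 1 zero_le_one t)

variable (d M) in
/-- The set `Ω` of all `H¹` curves `[0,1] → M`. -/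
structure H1Curve where
  toPath : unitInterval → M
  isH1 : IsH1Path (d := d) (extendPath toPath)

instance : CoeFun (H1Curve d M) (fun _ => ℝ → M) := ⟨fun γ => extendPath γ.toPath⟩

/-- The velocity `γ̇(t)`, which exists for almost every `t`. -/
def velocity (γ : H1Curve d M) (t : ℝ) : TangentSpace (𝓡 d) (γ t) :=
  mfderiv 𝓘(ℝ, ℝ) (𝓡 d) (γ : ℝ → M) t (1 : ℝ)

/-- `X` is an `H¹` field along `γ`, i.e. `X ∈ H¹_γ(TM)`: its components are `H¹` in every chart. -/
def IsH1Field (γ : H1Curve d M) (X : ∀ t : ℝ, TangentSpace (𝓡 d) (γ t)) : Prop :=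
  ∀ φ : OpenPartialHomeomorph M (EV d), IsChart φ → ∀ a b : ℝ, 0 ≤ a → a ≤ b → b ≤ 1 →
    (∀ t ∈ Icc a b, γ t ∈ φ.source) →
      IsH1On (fun t => (mfderiv (𝓡 d) 𝓘(ℝ, EV d) φ (γ t) (X t) : EV d)) a b

/-- An `H¹` frame along `γ`, i.e. an `H¹` trivialization of `γ^*TM`. It identifies
`H¹([0,1], ℝ^d)` with `H¹_γ(TM)` and `L²([0,1], ℝ^d)` with `H⁰_γ(TM)`, as topological vector
spaces. -/
structure H1Frame (γ : H1Curve d M) where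
  toEquiv : ∀ t : ℝ, EV d ≃L[ℝ] TangentSpace (𝓡 d) (γ t)
  isH1 : ∀ v : EV d, IsH1Field γ (fun t => toEquiv t v)

/-- The field along `γ` with components `ξ` in the frame `e`. -/
def H1Frame.field {γ : H1Curve d M} (e : H1Frame γ) (ξ : H1Model d) (t : ℝ) :
    TangentSpace (𝓡 d) (γ t) :=
  e.toEquiv t (ξ.eval t)

/-! ### Geodesics and the exponential map -/

variable [IsManifold (𝓡 d) ∞ M]

/-- The coefficients `g_{ij}` of the metric in the chart `φ`, as a bilinear form. -/
def metricIn (g : RMetric d M) (φ : OpenPartialHomeomorph M (EV d)) (y : EV d) :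
    EV d →L[ℝ] EV d →L[ℝ] ℝ :=
  let D : EV d →L[ℝ] EV d := mfderiv 𝓘(ℝ, EV d) (𝓡 d) φ.symm y
  let G : EV d →L[ℝ] EV d →L[ℝ] ℝ := g.inner (φ.symm y)
  G.bilinearComp D D

/-- The Christoffel symbols of the first kind
`Γ_{z,vw} = (∂_v g(w,z) + ∂_w g(v,z) - ∂_z g(v,w)) / 2` in the chart `φ`. -/
def christoffel (g : RMetric d M) (φ : OpenPartialHomeomorph M (EV d)) (y v w z : EV d) : ℝ :=
  (fderiv ℝ (metricIn g φ) y v w z + fderiv ℝ (metricIn g φ) y w v z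
    - fderiv ℝ (metricIn g φ) y z v w) / 2

/-- `c` is a geodesic of the Levi-Civita connection on the open set `s`: in every chart
`g_{ij} ẍ^j + Γ_{i,jk} ẋ^j ẋ^k = 0`. -/
def IsGeodesicOn (g : RMetric d M) (c : ℝ → M) (s : Set ℝ) : Prop :=
  ContMDiffOn 𝓘(ℝ, ℝ) (𝓡 d) 2 c s ∧
    ∀ φ : OpenPartialHomeomorph M (EV d), IsChart φ → ∀ t ∈ s, c t ∈ φ.source →
      ∀ z : EV d,
        metricIn g φ (φ (c t)) (deriv (deriv fun r => φ (c r)) t) z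
          + christoffel g φ (φ (c t)) (deriv (fun r => φ (c r)) t)
              (deriv (fun r => φ (c r)) t) z = 0

/-- `c` is a geodesic on a neighbourhood of `[0,1]` with `c(0) = x` and `ċ(0) = v`. -/
def IsGeodesicFrom (g : RMetric d M) (x : M) (v : TangentSpace (𝓡 d) x) (c : ℝ → M) : Prop :=
  c 0 = x ∧ HasDerivAt (fun r => chartAt (EV d) x (c r)) (v : EV d) 0 ∧
    ∃ δ : ℝ, 0 < δ ∧ IsGeodesicOn g c (Ioo (-δ) (1 + δ))

open Classical in
/-- The Riemannian exponential map `exp_x(v) = c(1)`, where `c` is the geodesic with `c(0) = x`,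
`ċ(0) = v` (with the value `x` if there is no such geodesic up to time `1`). -/
def expMap (g : RMetric d M) (x : M) (v : TangentSpace (𝓡 d) x) : M :=
  if h : ∃ c : ℝ → M, IsGeodesicFrom g x v c then h.choose 1 else x

open Classical in
/-- The map `exp_γ`, `exp_γ(X)(t) = exp_{γ(t)}(X(t))`, from fields along `γ` to `Ω` (with the value
`γ` if the right-hand side is not an `H¹` curve). -/
def expCurve (g : RMetric d M) (γ : H1Curve d M) (X : ∀ t : ℝ, TangentSpace (𝓡 d) (γ t)) :
    H1Curve d M :=
  if h : IsH1Path (d := d) (extendPath fun t : unitInterval => expMap g (γ t) (X t)) then ⟨_, h⟩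
  else γ

/-- The derivative at `ξ(t)` of `u ↦ exp_{γ(t)}(e(t) u)`. For small `ξ` it is an isomorphism from
`ℝ^d` onto the tangent space at `η(t)`, `η = exp_γ(eξ)`: the coordinate frame at `η(t)` of the
normal chart at `γ(t)`. -/
def normalFrame (g : RMetric d M) {γ : H1Curve d M} (e : H1Frame γ) (ξ : H1Model d) (t : ℝ) :
    EV d →L[ℝ] TangentSpace (𝓡 d) (expCurve g γ (e.field ξ) t) :=
  (mfderiv 𝓘(ℝ, EV d) (𝓡 d) (fun u : EV d => expMap g (γ t) (e.toEquiv t u)) (ξ.eval t) :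
    EV d →L[ℝ] EV d)

/-! ### Musical isomorphisms -/

/-- Cotangent space. -/
abbrev Cotangent (x : M) : Type := TangentSpace (𝓡 d) x →L[ℝ] ℝ

/-- Raising the index: `α^♯` is the vector with `g(α^♯, w) = α(w)`. -/
def sharp (g : RMetric d M) (x : M) : Cotangent (d := d) x →L[ℝ] TangentSpace (𝓡 d) x :=
  (g.inner x).inverse

end Geometry

/-! ### Vector bundles with structure group, connections, curvature -/

/-- The Lie algebra of a subgroup `G ⊆ SU(N)`: the matrices `T` with `exp(sT) ∈ G` for real `s`. -/
def lieAlg {N : ℕ} (G : Subgroup (Matrix.specialUnitaryGroup (Fin N) ℂ)) : Set (MatC N) :=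
  {T | ∀ s : ℝ, ∃ u ∈ G, NormedSpace.exp (s • T) = u.1}

section VB

variable {d N : ℕ} {M : Type*} [TopologicalSpace M] [ChartedSpace (EV d) M]
  {E : M → Type*} [∀ x, AddCommGroup (E x)] [∀ x, Module ℂ (E x)]
  [∀ x, TopologicalSpace (E x)] [TopologicalSpace (TotalSpace (CV N) E)]
  [FiberBundle (CV N) E] [VectorBundle ℂ (CV N) E]

/-- The matrix `ψ_b L ψ_a⁻¹` of a linear map `L : E_x → E_y` in local trivializations. -/
def conjTriv (a b : Trivialization (CV N) (π (CV N) E)) [a.IsLinear ℂ] [b.IsLinear ℂ] (x y : M)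
    (L : E x →ₗ[ℂ] E y) : MatC N :=
  LinearMap.toMatrix' (b.linearMapAt ℂ y ∘ₗ L ∘ₗ a.symmₗ ℂ x)

variable (d E) in
/-- The structure of a smooth complex vector bundle with structure group `G ⊆ SU(N)` on `E`: an
atlas of local trivializations whose transition functions are smooth and take values in `G`. -/
structure GAtlas (G : Subgroup (Matrix.specialUnitaryGroup (Fin N) ℂ)) where
  ι : Type*
  triv : ι → Trivialization (CV N) (π (CV N) E)
  isLinear : ∀ a, (triv a).IsLinear ℂ
  cover : ∀ x : M, ∃ a, x ∈ (triv a).baseSet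
  mem_group : ∀ a b, ∀ x ∈ (triv a).baseSet ∩ (triv b).baseSet,
    ∃ u ∈ G, conjTriv (triv b) (triv a) x x LinearMap.id = u.1
  smooth : ∀ a b, ContMDiffOn (𝓡 d) 𝓘(ℝ, MatC N) ∞
    (fun x => conjTriv (triv b) (triv a) x x LinearMap.id) ((triv a).baseSet ∩ (triv b).baseSet)

attribute [instance] GAtlas.isLinear

variable {G : Subgroup (Matrix.specialUnitaryGroup (Fin N) ℂ)}

/-- The domain `W_a` of a trivialization of the atlas. -/
abbrev GAtlas.dom (B : GAtlas d E G) (a : B.ι) : Set M := (B.triv a).baseSet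

/-- The transition function `ψ_{ab}(x)`, where `ψ_a ψ_b⁻¹(x, v) = (x, ψ_{ab}(x) v)`. -/
def GAtlas.trans (B : GAtlas d E G) (a b : B.ι) (x : M) : MatC N :=
  conjTriv (B.triv b) (B.triv a) x x LinearMap.id

/-- The linear map `L : E_x → E_y` in the trivializations `a` (at `x`) and `b` (at `y`). -/
abbrev GAtlas.rep (B : GAtlas d E G) (a b : B.ι) {x y : M} (L : E x →ₗ[ℂ] E y) : MatC N :=
  conjTriv (B.triv a) (B.triv b) x y L

/-- A chosen trivialization around `x`. -/
def GAtlas.idxAt (B : GAtlas d E G) (x : M) : B.ι := (B.cover x).choose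

/-- The natural metric `g(Φ, Ψ) = Re tr(Φ^* Ψ)` on `L(E_x, E_y)`, computed in trivializations (it
does not depend on them, since the transition functions are unitary). -/
def homInner (B : GAtlas d E G) {x y : M} (Φ Ψ : E x →ₗ[ℂ] E y) : ℝ :=
  let P : Matrix (Fin N) (Fin N) ℂ := B.rep (B.idxAt x) (B.idxAt y) Φ
  let Q : Matrix (Fin N) (Fin N) ℂ := B.rep (B.idxAt x) (B.idxAt y) Ψ
  (P.conjTranspose * Q).trace.re

/-- A 1-form `A` on `M` with values in matrices, in the chart `φ`: `y ↦ (w ↦ A_μ(y) w^μ)`. -/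
def formIn (A : ∀ x : M, TangentSpace (𝓡 d) x →L[ℝ] MatC N)
    (φ : OpenPartialHomeomorph M (EV d)) (y : EV d) : EV d →L[ℝ] MatC N :=
  (A (φ.symm y)).comp
    (mfderiv 𝓘(ℝ, EV d) (𝓡 d) φ.symm y : EV d →L[ℝ] TangentSpace (𝓡 d) (φ.symm y))

/-- A connection: smooth `Lie(G)`-valued local 1-forms `A^a` on the sets `W_a` with
`A^b = ψ_{ab}⁻¹ A^a ψ_{ab} + ψ_{ab}⁻¹ dψ_{ab}`. The values of `A^a` outside `W_a` are irrelevant. -/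
structure GConnection (B : GAtlas d E G) where
  form : B.ι → ∀ x : M, TangentSpace (𝓡 d) x →L[ℝ] MatC N
  mem_lie : ∀ a, ∀ x ∈ B.dom a, ∀ v : TangentSpace (𝓡 d) x, form a x v ∈ lieAlg G
  smooth : ∀ a, ∀ φ : OpenPartialHomeomorph M (EV d), IsChart φ →
    ContDiffOn ℝ ∞ (formIn (form a) φ) (φ.target ∩ φ.symm ⁻¹' B.dom a)
  compat : ∀ a b, ∀ x ∈ B.dom a ∩ B.dom b, ∀ v : TangentSpace (𝓡 d) x,
    form b x v = B.trans b a x * form a x v * B.trans a b x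
      + B.trans b a x * (show MatC N from mfderiv (𝓡 d) 𝓘(ℝ, MatC N) (B.trans a b) x v)

variable {B : GAtlas d E G}

/-- The local curvature `F^a_{μν} = ∂_μ A^a_ν - ∂_ν A^a_μ + [A^a_μ, A^a_ν]` at `x`, contracted with
`v^μ w^ν`, in the preferred chart at `x` (whose coordinates identify `T_xM` with `ℝ^d`). -/
def GConnection.localCurvature (A : GConnection B) (a : B.ι) (x : M)
    (v w : TangentSpace (𝓡 d) x) : MatC N :=
  let φ := chartAt (EV d) x
  let Aφ := formIn (A.form a) φ
  let y := φ x
  fderiv ℝ Aφ y (v : EV d) (w : EV d) - fderiv ℝ Aφ y (w : EV d) (v : EV d)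
    + (A.form a x v * A.form a x w - A.form a x w * A.form a x v)

/-- The curvature `F(v, w) = ψ_a⁻¹ F^a(v, w) ψ_a ∈ End(E_x)`. -/
def GConnection.curvature (A : GConnection B) (x : M) (v w : TangentSpace (𝓡 d) x) :
    E x →ₗ[ℂ] E x :=
  (B.triv (B.idxAt x)).symmₗ ℂ x ∘ₗ Matrix.toLin' (A.localCurvature (B.idxAt x) x v w) ∘ₗ
    (B.triv (B.idxAt x)).linearMapAt ℂ x

set_option linter.unusedSectionVars false in
theorem GConnection.localCurvature_add (A : GConnection B) (a : B.ι) (x : M)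
    (v v' w : TangentSpace (𝓡 d) x) :
    A.localCurvature a x (v + v') w = A.localCurvature a x v w + A.localCurvature a x v' w := by
  have key : ∀ (L : EV d →L[ℝ] EV d →L[ℝ] MatC N) (K : EV d →L[ℝ] MatC N) (p p' q : EV d),
      L (p + p') q - L q (p + p') + (K (p + p') * K q - K q * K (p + p')) =
        L p q - L q p + (K p * K q - K q * K p) + (L p' q - L q p' + (K p' * K q - K q * K p')) := by
    intro L K p p' q
    simp only [map_add, add_apply, add_mul, mul_add]
    abel
  exact key _ (A.form a x) v v' w

set_option linter.unusedSectionVars false in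
theorem GConnection.localCurvature_smul (A : GConnection B) (a : B.ι) (x : M) (r : ℝ)
    (v w : TangentSpace (𝓡 d) x) :
    A.localCurvature a x (r • v) w = r • A.localCurvature a x v w := by
  have key : ∀ (L : EV d →L[ℝ] EV d →L[ℝ] MatC N) (K : EV d →L[ℝ] MatC N) (p q : EV d),
      L (r • p) q - L q (r • p) + (K (r • p) * K q - K q * K (r • p)) =
        r • (L p q - L q p + (K p * K q - K q * K p)) := by
    intro L K p q
    simp only [map_smul, smul_apply, smul_mul_assoc, mul_smul_comm, smul_add, smul_sub]
  exact key _ (A.form a x) v w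

theorem GConnection.curvature_add (A : GConnection B) (x : M) (v v' w : TangentSpace (𝓡 d) x) :
    A.curvature x (v + v') w = A.curvature x v w + A.curvature x v' w := by
  have h : Matrix.toLin' (A.localCurvature (B.idxAt x) x (v + v') w) =
      Matrix.toLin' (A.localCurvature (B.idxAt x) x v w) +
        Matrix.toLin' (A.localCurvature (B.idxAt x) x v' w) := by
    rw [A.localCurvature_add]
    exact map_add Matrix.toLin' _ _
  simp only [curvature, h, LinearMap.add_comp, LinearMap.comp_add]

theorem GConnection.curvature_smul (A : GConnection B) (x : M) (r : ℝ)
    (v w : TangentSpace (𝓡 d) x) : A.curvature x (r • v) w = r • A.curvature x v w := by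
  have h : Matrix.toLin' (A.localCurvature (B.idxAt x) x (r • v) w) =
      (r : ℂ) • Matrix.toLin' (A.localCurvature (B.idxAt x) x v w) := by
    rw [A.localCurvature_smul]
    exact map_smul Matrix.toLin' (r : ℂ) _
  unfold curvature
  rw [h, LinearMap.smul_comp, LinearMap.comp_smul]
  rfl

/-! ### Parallel transport -/

/-- `U t s : E_{γ(s)} → E_{γ(t)}` (`0 ≤ s ≤ t ≤ 1`) is the parallel transport along `γ`: it is
multiplicative, and in every trivialization, on every interval that `γ` maps into its domain, it
solves `dU^a_{t,s}/dt = - A^a_μ(γ(t)) γ̇^μ(t) U^a_{t,s}` (almost everywhere, with `U^a` absolutely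
continuous), `U^a_{s,s} = Id`. -/
structure IsParallelTransport (A : GConnection B) (γ : H1Curve d M)
    (U : ∀ t s : ℝ, E (γ s) →ₗ[ℂ] E (γ t)) : Prop where
  refl : ∀ t ∈ Icc (0 : ℝ) 1, U t t = LinearMap.id
  mul : ∀ r s t : ℝ, 0 ≤ r → r ≤ s → s ≤ t → t ≤ 1 → U t s ∘ₗ U s r = U t r
  continuousOn : ∀ a : B.ι, ∀ s t : ℝ, 0 ≤ s → s ≤ t → t ≤ 1 →
    (∀ r ∈ Icc s t, γ r ∈ B.dom a) → ContinuousOn (fun r => B.rep a a (U r s)) (Icc s t)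
  equation : ∀ a : B.ι, ∀ s t : ℝ, 0 ≤ s → s ≤ t → t ≤ 1 →
    (∀ r ∈ Icc s t, γ r ∈ B.dom a) →
      B.rep a a (U t s) =
        1 - ∫ r in s..t, A.form a (γ r) (velocity γ r) * B.rep a a (U r s)

open Classical in
/-- The parallel transport `U_{t,s}(γ)` of the connection `A`. -/
def parallelTransport (A : GConnection B) (γ : H1Curve d M) (t s : ℝ) :
    E (γ s) →ₗ[ℂ] E (γ t) :=
  if h : ∃ U : ∀ t s : ℝ, E (γ s) →ₗ[ℂ] E (γ t), IsParallelTransport A γ U then h.choose t s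
  else 0

/-! ### Sections over the Hilbert manifold of curves -/

variable (d E) in
/-- Sections of `𝓔`, the bundle over `Ω` with fiber `L(E_{γ(0)}, E_{γ(1)})` at `γ`. -/
abbrev ESection : Type _ := ∀ γ : H1Curve d M, E (γ 0) →ₗ[ℂ] E (γ 1)

variable (d E) in
/-- Sections of `𝓔 ⊗ 𝓗⁰`. The element `J(γ; t)` of `L(E_{γ(0)}, E_{γ(1)}) ⊗ T_{γ(t)}M` is viewed as
a linear map on the cotangent space; `J^μ = J(dx^μ)`, and `Φ ⊗ X` is `α ↦ α(X) Φ`. -/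
abbrev EH0Section : Type _ := ∀ (γ : H1Curve d M) (t : ℝ),
  Cotangent (d := d) (γ t) →ₗ[ℝ] (E (γ 0) →ₗ[ℂ] E (γ 1))

variable [IsManifold (𝓡 d) ∞ M]

/-- Smoothness (in the Fréchet sense) of a section of `𝓔`: for every `γ` it is smooth near `γ` in
the chart `exp_γ⁻¹` of `Ω`, with values in local trivializations of `E` around `γ(0)`, `γ(1)`. -/
def IsSmoothESection (g : RMetric d M) (B : GAtlas d E G) (φ : ESection d E) : Prop :=
  ∀ γ : H1Curve d M, ∃ e : H1Frame γ, ∀ a b : B.ι, γ 0 ∈ B.dom a → γ 1 ∈ B.dom b →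
    ContDiffAt ℝ ∞ (fun ξ : H1Model d => B.rep a b (φ (expCurve g γ (e.field ξ)))) 0

/-- The components `J^μ` of `J` at `η = exp_γ(eξ)`: the `𝓔`-part is taken in the trivializations `a`,
`b`, and `μ` refers to the normal chart at `γ(t)` (with respect to the frame `e(t)`), i.e. to the
local trivialization of `𝓗⁰` over the chart `exp_γ⁻¹` of `Ω`. -/
def repEH0 (g : RMetric d M) (B : GAtlas d E G) (J : EH0Section d E) {γ : H1Curve d M}
    (e : H1Frame γ) (a b : B.ι) (ξ : H1Model d) (t : ℝ) (μ : Fin d) : MatC N :=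
  let dx : EV d →L[ℝ] ℝ := EuclideanSpace.proj μ
  B.rep a b (J (expCurve g γ (e.field ξ)) t (dx.comp (normalFrame g e ξ t).inverse))

/-- Smoothness of a section of `𝓔 ⊗ 𝓗⁰`: near every `γ`, in the chart `exp_γ⁻¹` of `Ω` and the
local trivialization of the bundle over it, it is a smooth map to the space of `L²` functions. -/
def IsSmoothEH0Section (g : RMetric d M) (B : GAtlas d E G) (J : EH0Section d E) : Prop :=
  ∀ γ : H1Curve d M, ∃ e : H1Frame γ, ∀ a b : B.ι, γ 0 ∈ B.dom a → γ 1 ∈ B.dom b →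
    ∃ f : H1Model d → L2 (Fin d → MatC N),
      (∀ᶠ ξ in 𝓝 (0 : H1Model d), ∀ᵐ t ∂(volume.restrict (Icc (0 : ℝ) 1)),
        f ξ t = repEH0 g B J e a b ξ t) ∧
      ContDiffAt ℝ ∞ f 0

/-- `D = d_X φ(γ)`, the derivative of the section `φ` of `𝓔` at `γ` in the direction of a field `X`
that vanishes at the endpoints: the derivative along `s ↦ exp_γ(sX)`, in local trivializations of
`E` around the (fixed) endpoints. -/
def HasDirDeriv (g : RMetric d M) (B : GAtlas d E G) (φ : ESection d E) (γ : H1Curve d M)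
    (X : ∀ t : ℝ, TangentSpace (𝓡 d) (γ t)) (D : E (γ 0) →ₗ[ℂ] E (γ 1)) : Prop :=
  ∀ a b : B.ι, γ 0 ∈ B.dom a → γ 1 ∈ B.dom b →
    HasDerivAt (fun s : ℝ => B.rep a b (φ (expCurve g γ (fun t => s • X t)))) (B.rep a b D) 0

/-- `φ` lies in the domain of the `H⁰`-gradient, and `J` is its `H⁰`-gradient: `φ` and `J` are
smooth sections, and `g(J(γ), X ⊗ Φ) = g(d_X φ(γ), Φ)` for every `γ`, every `H¹` field `X` along
`γ` with `X(0) = X(1) = 0` and every `Φ` in the fiber of `𝓔`. Here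
`g(J(γ), X ⊗ Φ) = ∫₀¹ g(J(γ; t)(X(t)^♭), Φ) dt`, `X^♭ = g(X, ·)`. -/
structure IsH0Gradient (g : RMetric d M) (B : GAtlas d E G) (φ : ESection d E)
    (J : EH0Section d E) : Prop where
  smooth : IsSmoothESection g B φ
  smooth_grad : IsSmoothEH0Section g B J
  grad : ∀ (γ : H1Curve d M) (X : ∀ t : ℝ, TangentSpace (𝓡 d) (γ t)), IsH1Field γ X →
    X 0 = 0 → X 1 = 0 → ∃ D : E (γ 0) →ₗ[ℂ] E (γ 1), HasDirDeriv g B φ γ X D ∧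
      ∀ Φ : E (γ 0) →ₗ[ℂ] E (γ 1),
        ∫ t in (0 : ℝ)..1, homInner B (J γ t (g.inner (γ t) (X t))) Φ = homInner B D Φ

/-- The field `t ↦ - U_{1,t}(γ) F^μ_ν(γ(t)) γ̇^ν(t) U_{t,0}(γ)`, as a section of `𝓔 ⊗ 𝓗⁰`; its
contraction with a covector `α` is `- U_{1,t}(γ) F(α^♯, γ̇(t)) U_{t,0}(γ)`. -/
def transportGradient (g : RMetric d M) (A : GConnection B) : EH0Section d E := fun γ t =>
  { toFun := fun α => -(parallelTransport A γ 1 t ∘ₗ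
      A.curvature (γ t) (sharp g (γ t) α) (velocity γ t) ∘ₗ parallelTransport A γ t 0)
    map_add' := fun α β => by
      rw [map_add, A.curvature_add, LinearMap.add_comp, LinearMap.comp_add, neg_add]
    map_smul' := fun r α => by
      ext u
      simp only [map_smul, A.curvature_smul, LinearMap.comp_apply, LinearMap.smul_apply,
        LinearMap.neg_apply, RingHom.id_apply, smul_neg]
      rw [← Complex.coe_smul, map_smul, Complex.coe_smul] }

end VB

end LevyGrad

end

set_option linter.unusedSectionVars false

noncomputable section

namespace LevyGrad

/-! ### Absolutely continuous functions with square integrable derivative -/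

section WeakDeriv

variable {V W : Type*} [NormedAddCommGroup V] [NormedSpace ℝ V]
  [NormedAddCommGroup W] [NormedSpace ℝ W]

/-! Everything is local in time. Over a short interval `[α, β]` the curve lies in one chart and one
trivialization, and the nearby curves `exp_γ(eξ)` are obtained by composing one smooth function with
an `H¹` function that is affine in `ξ`. The coefficient `a = A(η̇)` of the transport equation along
`η = exp_γ(eξ)` is then a continuous function of time, depending smoothly on `ξ`
(`contDiffAt_superpos`), applied to an `L²` function that is affine in `ξ`. So `ξ ↦ a ∈ L²` is
smooth. The solution of `V' = -aV`, `V(0) = 1` is obtained by inverting `1 - K_a` with `K_a` a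
Volterra operator. Inversion is smooth on the units of a Banach algebra, so `V ∈ C([0,1])` depends
smoothly on `a` (`contDiff_linSolve`), hence on `ξ`. Transition functions at the endpoints and the
multiplicativity of transport glue the local statements.

The derivative comes from Duhamel's formula and one integration by parts. Let `Z = V⁻¹`, let `w` be
the variation of `V` and `δ` that of the curve `c` in coordinates, and let `θ` be the connection
form. The derivative of `Z(w + θ(δ)V)` contains no `δ̇` and equals `-Z F(δ, ċ) V`, with `F = dθ + θ
∧ θ` (`hasDerivAt_fwd_contract`). Integrating gives the curvature integral plus boundary terms
`θ(δ)` at the ends of the interval. Boundary terms of adjacent intervals cancel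
(`HasTransportVariation.trans`), and the outer ones vanish because `X(0) = X(1) = 0`. What remains
is `-∫ U_{1,t} F(X, γ̇) U_{t,0} dt`, the pairing of the claimed gradient with `X`. The gradient
itself is a smooth `L²`-valued map for the same reason as the coefficient `a`
(`smoothTransport_and_smoothGrad`).

The charts of `Ω` are built from the Riemannian exponential map, so its smoothness near the zero
section has to be established: the inverse function theorem on a space of continuous paths gives a
smooth flow near an equilibrium (`exists_flow`), and the quadratic homogeneity of the geodesic spray
turns short times into time one. Hausdorffness makes geodesics unique, and the derivative of `exp`
at a zero vector is the identity (`fderiv_expIn`), so normal frames are invertible for small `ξ`.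

Uniqueness is the fundamental lemma of the calculus of variations, applied to fields `χ(t) e(t) w`
with `χ` a bump function supported in `(0, 1)` (`ae_eq_of_forall_homInner`). -/

theorem absolutelyContinuousOnInterval_primitive {u : ℝ → V} {a b : ℝ}
    (h : IntervalIntegrable u volume a b) :
    AbsolutelyContinuousOnInterval (fun x => ∫ s in a..x, u s) a b := by
  -- Increments of the primitive of `u` are dominated in norm by those of the primitive of `‖u‖`,
  -- which reduces the vector-valued case to the scalar one.
  have h1 := h.norm.absolutelyContinuousOnInterval_intervalIntegral (c := a) left_mem_uIcc
  rw [absolutelyContinuousOnInterval_iff] at h1 ⊢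
  intro ε hε
  obtain ⟨δ, hδ, H⟩ := h1 ε hε
  refine ⟨δ, hδ, fun E hE hs => lt_of_le_of_lt (Finset.sum_le_sum fun i hi => ?_) (H E hE hs)⟩
  have hi1 := (hE.1 i (Finset.mem_range.mp hi |> Finset.mem_range.mpr)).1
  have hi2 := (hE.1 i (Finset.mem_range.mp hi |> Finset.mem_range.mpr)).2
  have hint : ∀ x ∈ uIcc a b, IntervalIntegrable u volume a x := fun x hx =>
    h.mono_set (uIcc_subset_uIcc left_mem_uIcc hx)
  rw [dist_eq_norm, dist_eq_norm, intervalIntegral.integral_interval_sub_left (hint _ hi1)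
    (hint _ hi2), intervalIntegral.integral_interval_sub_left (hint _ hi1).norm (hint _ hi2).norm,
    Real.norm_eq_abs]
  exact intervalIntegral.norm_integral_le_abs_integral_norm

set_option linter.unusedSectionVars false in
theorem AbsolutelyContinuousOnInterval.comp_lipschitzOn {f : ℝ → V} {F : V → W} {a b : ℝ}
    {K : NNReal} (hF : LipschitzOnWith K F (f '' uIcc a b))
    (hf : AbsolutelyContinuousOnInterval f a b) :
    AbsolutelyContinuousOnInterval (fun t => F (f t)) a b := by
  rw [absolutelyContinuousOnInterval_iff] at hf ⊢
  intro ε hε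
  obtain ⟨δ, hδ, H⟩ := hf (ε / (K + 1)) (by positivity)
  refine ⟨δ, hδ, fun E hE hs => ?_⟩
  calc ∑ i ∈ Finset.range E.1, dist (F (f (E.2 i).1)) (F (f (E.2 i).2))
      ≤ ∑ i ∈ Finset.range E.1, K * dist (f (E.2 i).1) (f (E.2 i).2) :=
        Finset.sum_le_sum fun i hi => hF.dist_le_mul _ (mem_image_of_mem f (hE.1 i hi).1) _
          (mem_image_of_mem f (hE.1 i hi).2)
    _ = K * ∑ i ∈ Finset.range E.1, dist (f (E.2 i).1) (f (E.2 i).2) := by rw [Finset.mul_sum]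
    _ ≤ K * (ε / (K + 1)) := by
        have := (H E hE hs).le
        gcongr
    _ < (K + 1) * (ε / (K + 1)) := by
        have : 0 < ε / ((K : ℝ) + 1) := by positivity
        nlinarith
    _ = ε := by field_simp

/-- `f` is absolutely continuous on `[a, b]` with derivative `u ∈ L²`. -/
def HasWeakDeriv (f u : ℝ → V) (a b : ℝ) : Prop :=
  MemLp u 2 (volume.restrict (Icc a b)) ∧ ∀ t ∈ Icc a b, f t = f a + ∫ s in a..t, u s

theorem isH1On_iff {f : ℝ → V} {a b : ℝ} : IsH1On f a b ↔ ∃ u, HasWeakDeriv f u a b := Iff.rfl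

set_option linter.unusedSectionVars false in
theorem MemLp.intervalIntegrable {u : ℝ → V} {a b : ℝ}
    (h : MemLp u 2 (volume.restrict (Icc a b))) {s t : ℝ} (hs : s ∈ Icc a b) (ht : t ∈ Icc a b) :
    IntervalIntegrable u volume s t := by
  have h1 : IntegrableOn u (Icc a b) := h.integrable (by norm_num)
  exact (h1.mono_set (by
    rcases le_total s t with hst | hst
    · rw [uIcc_of_le hst]; exact Icc_subset_Icc hs.1 ht.2
    · rw [uIcc_of_ge hst]; exact Icc_subset_Icc ht.1 hs.2)).intervalIntegrable

variable {f u : ℝ → V} {a b : ℝ}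

theorem HasWeakDeriv.intervalIntegrable (h : HasWeakDeriv f u a b) {s t : ℝ} (hs : s ∈ Icc a b)
    (ht : t ∈ Icc a b) : IntervalIntegrable u volume s t :=
  MemLp.intervalIntegrable h.1 hs ht

theorem HasWeakDeriv.eq_add (h : HasWeakDeriv f u a b) {s t : ℝ} (hs : s ∈ Icc a b)
    (ht : t ∈ Icc a b) : f t = f s + ∫ r in s..t, u r := by
  have ha : a ∈ Icc a b := ⟨le_rfl, hs.1.trans hs.2⟩
  rw [h.2 t ht, h.2 s hs, add_assoc, intervalIntegral.integral_add_adjacent_intervals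
    (h.intervalIntegrable ha hs) (h.intervalIntegrable hs ht)]

theorem HasWeakDeriv.mono (h : HasWeakDeriv f u a b) {c e : ℝ} (hc : a ≤ c) (he : e ≤ b) :
    HasWeakDeriv f u c e :=
  ⟨h.1.mono_measure (Measure.restrict_mono (Icc_subset_Icc hc he) le_rfl), fun _ ht =>
    h.eq_add ⟨hc, ht.1.trans (ht.2.trans he)⟩ ⟨hc.trans ht.1, ht.2.trans he⟩⟩

theorem HasWeakDeriv.continuousOn (h : HasWeakDeriv f u a b) : ContinuousOn f (Icc a b) := by
  rcases lt_or_ge b a with hab | hab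
  · simp [Icc_eq_empty_of_lt hab]
  have h1 : ContinuousOn (fun t => f a + ∫ s in a..t, u s) (Icc a b) := by
    have := intervalIntegral.continuousOn_primitive_interval (μ := volume) (f := u) (a := a) (b := b)
      (by rw [uIcc_of_le hab]; exact h.1.integrable (by norm_num))
    rw [uIcc_of_le hab] at this
    exact continuousOn_const.add this
  exact h1.congr h.2

theorem HasWeakDeriv.congr {g : ℝ → V} (h : HasWeakDeriv f u a b) (hg : EqOn g f (Icc a b)) :
    HasWeakDeriv g u a b :=
  ⟨h.1, fun t ht => by rw [hg ht, hg ⟨le_rfl, ht.1.trans ht.2⟩, h.2 t ht]⟩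

theorem HasWeakDeriv.congr_ae {v : ℝ → V} (h : HasWeakDeriv f u a b)
    (hv : v =ᵐ[volume.restrict (Icc a b)] u) : HasWeakDeriv f v a b := by
  refine ⟨(memLp_congr_ae hv).mpr h.1, fun t ht => ?_⟩
  rw [h.2 t ht]
  congr 1
  apply intervalIntegral.integral_congr_ae_restrict
  have : uIoc a t ⊆ Icc a b := by
    rw [uIoc_of_le ht.1]; exact Ioc_subset_Icc_self.trans (Icc_subset_Icc le_rfl ht.2)
  have h1 : v =ᵐ[volume.restrict (uIoc a t)] u := ae_restrict_of_ae_restrict_of_subset this hv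
  exact h1.symm

theorem HasWeakDeriv.absolutelyContinuousOnInterval (h : HasWeakDeriv f u a b) (hab : a ≤ b) :
    AbsolutelyContinuousOnInterval f a b := by
  have h1 := absolutelyContinuousOnInterval_primitive
    (h.intervalIntegrable (left_mem_Icc.mpr hab) (right_mem_Icc.mpr hab))
  rw [absolutelyContinuousOnInterval_iff] at h1 ⊢
  intro ε hε
  obtain ⟨δ, hδ, H⟩ := h1 ε hε
  refine ⟨δ, hδ, fun E hE hs => lt_of_le_of_lt (Finset.sum_le_sum fun i hi => ?_) (H E hE hs)⟩
  have hE' := hE.1 i hi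
  rw [uIcc_of_le hab] at hE'
  rw [h.2 _ hE'.1, h.2 _ hE'.2, dist_add_left]

theorem ae_mem_Ioo (a b : ℝ) : ∀ᵐ t ∂(volume.restrict (Icc a b)), t ∈ Ioo a b := by
  rw [← restrict_Ioo_eq_restrict_Icc]
  exact ae_restrict_mem measurableSet_Ioo

theorem HasWeakDeriv.ae_hasDerivAt [CompleteSpace V] (h : HasWeakDeriv f u a b) :
    ∀ᵐ t ∂(volume.restrict (Icc a b)), HasDerivAt f (u t) t := by
  rcases lt_or_ge b a with hab | hab
  · simp [Icc_eq_empty_of_lt hab]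
  have h1 := (h.intervalIntegrable (left_mem_Icc.mpr hab)
    (right_mem_Icc.mpr hab)).ae_hasDerivAt_integral
  filter_upwards [ae_restrict_of_ae h1, ae_mem_Ioo a b] with t ht hIoo
  rw [uIcc_of_le hab] at ht
  have h2 := (ht (Ioo_subset_Icc_self hIoo) a (left_mem_Icc.mpr hab)).const_add (f a)
  refine h2.congr_of_eventuallyEq ?_
  filter_upwards [isOpen_Ioo.mem_nhds hIoo] with r hr using h.2 r (Ioo_subset_Icc_self hr)

/-- After the primitive of `u` is subtracted, `f` becomes absolutely continuous with derivative zero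
almost everywhere, hence constant. -/
theorem HasWeakDeriv.of_ae_hasDerivAt [CompleteSpace V] (hab : a ≤ b)
    (hf : AbsolutelyContinuousOnInterval f a b)
    (hu : MemLp u 2 (volume.restrict (Icc a b)))
    (hd : ∀ᵐ t ∂(volume.restrict (Icc a b)), HasDerivAt f (u t) t) : HasWeakDeriv f u a b := by
  refine ⟨hu, ?_⟩
  have hi := MemLp.intervalIntegrable hu (left_mem_Icc.mpr hab) (right_mem_Icc.mpr hab)
  have h1 := hf.sub (absolutelyContinuousOnInterval_primitive hi)
  have h2 : ∀ᵐ t, t ∈ uIcc a b → HasDerivAt (f - fun x => ∫ s in a..x, u s) 0 t := by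
    rw [uIcc_of_le hab]
    have h3 := (ae_restrict_iff' measurableSet_Icc).mp hd
    have h4 := hi.ae_hasDerivAt_integral
    rw [uIcc_of_le hab] at h4
    filter_upwards [h3, h4] with t ht ht' hm
    simpa using (ht hm).sub (ht' hm a (left_mem_Icc.mpr hab))
  obtain ⟨C, hC⟩ := h1.const_of_ae_hasDerivAt_zero h2
  rw [uIcc_of_le hab] at hC
  intro t ht
  have e1 := hC t ht
  have e2 := hC a (left_mem_Icc.mpr hab)
  simp only [Pi.sub_apply, intervalIntegral.integral_same, sub_zero] at e1 e2
  rw [e2, ← e1]; abel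

theorem HasWeakDeriv.ae_unique [CompleteSpace V] {v : ℝ → V} (h : HasWeakDeriv f u a b)
    (h' : HasWeakDeriv f v a b) : u =ᵐ[volume.restrict (Icc a b)] v := by
  filter_upwards [h.ae_hasDerivAt, h'.ae_hasDerivAt] with t h1 h2 using h1.unique h2

theorem memLp_clm_apply {A : ℝ → V →L[ℝ] W} (hA : ContinuousOn A (Icc a b))
    (hu : MemLp u 2 (volume.restrict (Icc a b))) :
    MemLp (fun t => A t (u t)) 2 (volume.restrict (Icc a b)) := by
  obtain ⟨C, hC⟩ := isCompact_Icc.exists_bound_of_continuousOn hA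
  have hAm : AEStronglyMeasurable A (volume.restrict (Icc a b)) :=
    hA.aestronglyMeasurable_of_isCompact isCompact_Icc measurableSet_Icc
  refine MemLp.of_le_mul (c := C) hu ?_ ?_
  · exact (ContinuousLinearMap.aestronglyMeasurable_comp₂ (ContinuousLinearMap.id ℝ (V →L[ℝ] W))
      hAm hu.1)
  · filter_upwards [ae_restrict_mem measurableSet_Icc] with t ht
    exact (A t).le_of_opNorm_le (hC t ht) _

/-- The chain rule. -/
theorem HasWeakDeriv.comp [CompleteSpace V] [CompleteSpace W] (h : HasWeakDeriv f u a b)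
    {F : V → W} (hF : ∀ t ∈ Icc a b, ContDiffAt ℝ 1 F (f t)) :
    HasWeakDeriv (fun t => F (f t)) (fun t => fderiv ℝ F (f t) (u t)) a b := by
  rcases lt_or_ge b a with hab | hab
  · simp [HasWeakDeriv, Icc_eq_empty_of_lt hab]
  have hac := h.absolutelyContinuousOnInterval hab
  have hcomp : IsCompact (f '' uIcc a b) := by
    rw [uIcc_of_le hab]; exact isCompact_Icc.image_of_continuousOn h.continuousOn
  -- A `C¹` map is Lipschitz on the compact image of `f`, so `F ∘ f` is again absolutely continuous;
  -- its derivative may then be computed pointwise almost everywhere.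
  have hlip : LocallyLipschitzOn (f '' uIcc a b) F := by
    rintro _ ⟨t, ht, rfl⟩
    rw [uIcc_of_le hab] at ht
    obtain ⟨K, s, hs, hK⟩ := (hF t ht).exists_lipschitzOnWith
    exact ⟨K, s, mem_nhdsWithin_of_mem_nhds hs, hK⟩
  obtain ⟨K, hK⟩ := hlip.exists_lipschitzOnWith_of_compact hcomp
  refine HasWeakDeriv.of_ae_hasDerivAt hab (AbsolutelyContinuousOnInterval.comp_lipschitzOn hK hac)
    (memLp_clm_apply ?_ h.1) ?_
  · intro t ht
    exact ((hF t ht).continuousAt_fderiv one_ne_zero).comp_continuousWithinAt (h.continuousOn t ht)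
  · filter_upwards [h.ae_hasDerivAt, ae_restrict_mem measurableSet_Icc] with t ht hm
    exact ((hF t hm).differentiableAt one_ne_zero).hasFDerivAt.comp_hasDerivAt t ht

theorem HasWeakDeriv.const (c : V) (a b : ℝ) : HasWeakDeriv (fun _ => c) (fun _ => 0) a b :=
  ⟨MemLp.zero, fun t _ => by simp⟩

theorem HasWeakDeriv.prodMk [CompleteSpace V] [CompleteSpace W] (h : HasWeakDeriv f u a b)
    {g v : ℝ → W} (h' : HasWeakDeriv g v a b) :
    HasWeakDeriv (fun t => (f t, g t)) (fun t => (u t, v t)) a b := by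
  refine ⟨memLp_prod_iff.mpr ⟨h.1, h'.1⟩, fun t ht => ?_⟩
  have ha : a ∈ Icc a b := ⟨le_rfl, ht.1.trans ht.2⟩
  have hi : IntervalIntegrable (fun t => (u t, v t)) volume a t := by
    have h1 := h.intervalIntegrable ha ht
    have h2 := h'.intervalIntegrable ha ht
    exact ⟨h1.1.prodMk h2.1, h1.2.prodMk h2.2⟩
  have e1 := (ContinuousLinearMap.fst ℝ V W).intervalIntegral_comp_comm hi
  have e2 := (ContinuousLinearMap.snd ℝ V W).intervalIntegral_comp_comm hi
  simp only [ContinuousLinearMap.coe_fst', ContinuousLinearMap.coe_snd'] at e1 e2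
  refine Prod.ext ?_ ?_
  · simp only [Prod.fst_add, ← e1]
    exact h.2 t ht
  · simp only [Prod.snd_add, ← e2]
    exact h'.2 t ht

theorem HasWeakDeriv.clm [CompleteSpace V] [CompleteSpace W] (h : HasWeakDeriv f u a b)
    (L : V →L[ℝ] W) : HasWeakDeriv (fun t => L (f t)) (fun t => L (u t)) a b := by
  simpa using h.comp (F := L) fun t _ => L.contDiff.contDiffAt

theorem HasWeakDeriv.bilin [CompleteSpace V] [CompleteSpace W] {X : Type*} [NormedAddCommGroup X]
    [NormedSpace ℝ X] [CompleteSpace X] (h : HasWeakDeriv f u a b) {g v : ℝ → W}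
    (h' : HasWeakDeriv g v a b) (L : V →L[ℝ] W →L[ℝ] X) :
    HasWeakDeriv (fun t => L (f t) (g t)) (fun t => L (f t) (v t) + L (u t) (g t)) a b := by
  have h1 := (h.prodMk h').comp (F := fun p : V × W => L p.1 p.2)
    fun t _ => L.isBoundedBilinearMap.contDiff.contDiffAt
  have h2 : ∀ p q : V × W, fderiv ℝ (fun p : V × W => L p.1 p.2) p q = L p.1 q.2 + L q.1 p.2 :=
    fun p q => by rw [(L.isBoundedBilinearMap.hasFDerivAt p).fderiv]; rfl
  simpa only [h2] using h1

theorem HasWeakDeriv.add [CompleteSpace V] (h : HasWeakDeriv f u a b) {g v : ℝ → V}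
    (h' : HasWeakDeriv g v a b) :
    HasWeakDeriv (fun t => f t + g t) (fun t => u t + v t) a b :=
  (h.prodMk h').clm (ContinuousLinearMap.fst ℝ V V + ContinuousLinearMap.snd ℝ V V)

theorem HasWeakDeriv.mul {R : Type*} [NormedRing R] [NormedAlgebra ℝ R] [CompleteSpace R]
    {f u g v : ℝ → R} (h : HasWeakDeriv f u a b) (h' : HasWeakDeriv g v a b) :
    HasWeakDeriv (fun t => f t * g t) (fun t => f t * v t + u t * g t) a b :=
  h.bilin h' (ContinuousLinearMap.mul ℝ R)

theorem IsH1On.mono (h : IsH1On f a b) {c e : ℝ} (hc : a ≤ c) (he : e ≤ b) : IsH1On f c e := by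
  obtain ⟨u, hu⟩ := isH1On_iff.mp h
  exact ⟨u, hu.mono hc he⟩

theorem IsH1On.congr {g : ℝ → V} (h : IsH1On f a b) (hg : EqOn g f (Icc a b)) : IsH1On g a b := by
  obtain ⟨u, hu⟩ := isH1On_iff.mp h
  exact ⟨u, hu.congr hg⟩

theorem IsH1On.continuousOn (h : IsH1On f a b) : ContinuousOn f (Icc a b) := by
  obtain ⟨u, hu⟩ := isH1On_iff.mp h
  exact hu.continuousOn

theorem IsH1On.comp [CompleteSpace V] [CompleteSpace W] (h : IsH1On f a b)
    {F : V → W} (hF : ∀ t ∈ Icc a b, ContDiffAt ℝ 1 F (f t)) : IsH1On (fun t => F (f t)) a b := by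
  obtain ⟨u, hu⟩ := isH1On_iff.mp h
  exact ⟨_, hu.comp hF⟩

theorem HasWeakDeriv.append {c : ℝ} (hab : a ≤ b) (hbc : b ≤ c) (h : HasWeakDeriv f u a b)
    (h' : HasWeakDeriv f u b c) : HasWeakDeriv f u a c := by
  have hmem : MemLp u 2 (volume.restrict (Icc a c)) := by
    have h1 : (Icc a c) = Icc a b ∪ Icc b c := (Icc_union_Icc_eq_Icc hab hbc).symm
    rw [h1]
    have h2 : volume.restrict (Icc a b ∪ Icc b c) ≤
        volume.restrict (Icc a b) + volume.restrict (Icc b c) := Measure.restrict_union_le _ _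
    refine MemLp.mono_measure h2 ?_
    refine ⟨h.1.1.add_measure h'.1.1, ?_⟩
    rw [eLpNorm_lt_top_iff_lintegral_rpow_enorm_lt_top (by norm_num) (by norm_num),
      lintegral_add_measure]
    exact ENNReal.add_lt_top.mpr
      ⟨(eLpNorm_lt_top_iff_lintegral_rpow_enorm_lt_top (by norm_num) (by norm_num)).mp h.1.2,
        (eLpNorm_lt_top_iff_lintegral_rpow_enorm_lt_top (by norm_num) (by norm_num)).mp h'.1.2⟩
  refine ⟨hmem, fun t ht => ?_⟩
  rcases le_total t b with htb | htb
  · exact h.2 t ⟨ht.1, htb⟩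
  · rw [h'.2 t ⟨htb, ht.2⟩, h.2 b ⟨hab, le_rfl⟩, add_assoc,
      intervalIntegral.integral_add_adjacent_intervals
        (MemLp.intervalIntegrable hmem ⟨le_rfl, hab.trans hbc⟩ ⟨hab, hbc⟩)
        (MemLp.intervalIntegrable hmem ⟨hab, hbc⟩ ht)]

theorem IsH1On.append {c : ℝ} (hab : a ≤ b) (hbc : b ≤ c) (h : IsH1On f a b)
    (h' : IsH1On f b c) : IsH1On f a c := by
  obtain ⟨u, hu⟩ := isH1On_iff.mp h
  obtain ⟨v, hv⟩ := isH1On_iff.mp h'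
  classical
  -- At the junction `b` the two derivatives need not agree; a single point is negligible.
  let w : ℝ → V := (Iic b).piecewise u v
  have hw1 : HasWeakDeriv f w a b := hu.congr_ae <| by
    filter_upwards [ae_restrict_mem measurableSet_Icc] with t ht
    exact piecewise_eq_of_mem _ _ _ ht.2
  have hw2 : HasWeakDeriv f w b c := hv.congr_ae <| by
    filter_upwards [ae_mem_Ioo b c] with t ht
    exact piecewise_eq_of_notMem _ _ _ (not_le.mpr ht.1)
  exact ⟨w, hw1.append hab hbc hw2⟩

theorem IsH1On.add [CompleteSpace V] (h : IsH1On f a b) {g : ℝ → V} (h' : IsH1On g a b) :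
    IsH1On (fun t => f t + g t) a b := by
  obtain ⟨u, hu⟩ := isH1On_iff.mp h
  obtain ⟨v, hv⟩ := isH1On_iff.mp h'
  exact ⟨_, hu.add hv⟩

theorem IsH1On.clm [CompleteSpace V] [CompleteSpace W] (h : IsH1On f a b) (L : V →L[ℝ] W) :
    IsH1On (fun t => L (f t)) a b := by
  obtain ⟨u, hu⟩ := isH1On_iff.mp h
  exact ⟨_, hu.clm L⟩

theorem IsH1On.prodMk [CompleteSpace V] [CompleteSpace W] (h : IsH1On f a b) {g : ℝ → W}
    (h' : IsH1On g a b) : IsH1On (fun t => (f t, g t)) a b := by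
  obtain ⟨u, hu⟩ := isH1On_iff.mp h
  obtain ⟨v, hv⟩ := isH1On_iff.mp h'
  exact ⟨_, hu.prodMk hv⟩

theorem IsH1On.const (c : V) (a b : ℝ) : IsH1On (fun _ => c) a b := ⟨_, HasWeakDeriv.const c a b⟩

theorem isH1On_sum [CompleteSpace V] {ι : Type*} (s : Finset ι) {f : ι → ℝ → V}
    (h : ∀ i ∈ s, IsH1On (f i) a b) : IsH1On (fun t => ∑ i ∈ s, f i t) a b := by
  classical
  induction s using Finset.induction_on with
  | empty => simpa using IsH1On.const (0 : V) a b
  | insert i s hi ih =>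
    simp only [Finset.sum_insert hi]
    exact (h i (by simp)).add (ih fun j hj => h j (by simp [hj]))

end WeakDeriv

/-- A transitive relation on a compact interval that holds locally holds globally. -/
theorem interval_induction {R : ℝ → ℝ → Prop} {a b : ℝ} (hab : a ≤ b)
    (trans : ∀ r s t, a ≤ r → r ≤ s → s ≤ t → t ≤ b → R r s → R s t → R r t)
    (loc : ∀ t ∈ Icc a b, ∃ ε > 0, ∀ r s, r ∈ Icc a b → s ∈ Icc a b → |r - t| < ε → |s - t| < ε →
      r ≤ s → R r s) : R a b := by
  -- Points reachable from `a`. At the supremum of `S` the local hypothesis both reaches the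
  -- supremum and passes beyond it, unless it is `b`.
  let S : Set ℝ := {t | R a t} ∩ Icc a b
  have ha : a ∈ Icc a b := left_mem_Icc.mpr hab
  have haS : a ∈ S := by
    obtain ⟨ε, hε, h⟩ := loc a ha
    exact ⟨h a a ha ha (by simpa) (by simpa) le_rfl, ha⟩
  have hbdd : BddAbove S := ⟨b, fun t ht => ht.2.2⟩
  set c := sSup S with hc
  have hca : a ≤ c := le_csSup hbdd haS
  have hcb : c ≤ b := csSup_le ⟨a, haS⟩ fun t ht => ht.2.2
  obtain ⟨ε, hε, h⟩ := loc c ⟨hca, hcb⟩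
  obtain ⟨r, hrS, hr⟩ := exists_lt_of_lt_csSup ⟨a, haS⟩ (show c - ε < sSup S by linarith)
  have hrc : r ≤ c := le_csSup hbdd hrS
  have key : ∀ s ∈ Icc a b, r ≤ s → |s - c| < ε → R a s := fun s hs hrs hsc =>
    trans a r s le_rfl hrS.2.1 hrs hs.2 hrS.1
      (h r s hrS.2 hs (by rw [abs_lt]; constructor <;> linarith) hsc hrs)
  rcases eq_or_lt_of_le hcb with hcb' | hcb'
  · rw [← hcb']
    exact key c ⟨hca, hcb⟩ hrc (by simpa)
  · exfalso
    have hs : min b (c + ε / 2) ∈ S := by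
      have h1 : c < min b (c + ε / 2) := lt_min hcb' (by linarith)
      refine ⟨key _ ⟨hca.trans h1.le, min_le_left _ _⟩ (hrc.trans h1.le) ?_,
        hca.trans h1.le, min_le_left _ _⟩
      rw [abs_lt]
      constructor
      · linarith
      · linarith [min_le_right b (c + ε / 2)]
    have h1 : c < min b (c + ε / 2) := lt_min hcb' (by linarith)
    exact absurd (le_csSup hbdd hs) (not_le.mpr h1)

/-! ### Superposition operators on spaces of continuous functions -/

section Superposition

universe u

variable {K : Type*} {V W : Type u} [TopologicalSpace K] [CompactSpace K]
  [NormedAddCommGroup V] [NormedSpace ℝ V] [NormedAddCommGroup W] [NormedSpace ℝ W]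

set_option synthInstance.maxHeartbeats 400000 in
instance instNormedAddCommGroupContinuousMapCLM : NormedAddCommGroup C(K, V →L[ℝ] W) :=
  inferInstance

set_option synthInstance.maxHeartbeats 400000 in
instance instNormedSpaceContinuousMapCLM : NormedSpace ℝ C(K, V →L[ℝ] W) :=
  inferInstance

open Classical in
/-- The superposition operator `u ↦ F ∘ u` (with the value `0` where `F ∘ u` is not continuous). -/
def superpos (F : V → W) (u : C(K, V)) : C(K, W) :=
  if h : Continuous fun t => F (u t) then ⟨_, h⟩ else 0

set_option linter.unusedSectionVars false in
theorem superpos_apply {F : V → W} {u : C(K, V)} (h : ∀ t, ContinuousAt F (u t)) (t : K) :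
    superpos F u t = F (u t) := by
  have hc : Continuous fun t => F (u t) :=
    continuous_iff_continuousAt.mpr fun t => (h t).comp u.continuous.continuousAt
  simp [superpos, hc]

set_option linter.unusedSectionVars false in
/-- A property that holds near every value of `u` holds uniformly on a neighbourhood of `u`. -/
theorem eventually_forall_of_forall_eventually {P : V → Prop} {u : C(K, V)}
    (h : ∀ t, ∀ᶠ x in 𝓝 (u t), P x) : ∀ᶠ v in 𝓝 u, ∀ t, P (v t) := by
  -- Compactness of `K` provides one neighbourhood of zero that serves all `t`; the increment `v t -
  -- u t` then plays the role of `k`.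
  have h1 : ∀ᶠ k in 𝓝 (0 : V), ∀ t ∈ (univ : Set K), P (u t + k) := by
    refine isCompact_univ.eventually_forall_of_forall_eventually fun t _ => ?_
    have hc : ContinuousAt (fun z : V × K => u z.2 + z.1) (0, t) := by fun_prop
    refine hc.eventually ?_
    simpa using h t
  obtain ⟨ε, hε, H⟩ := Metric.eventually_nhds_iff.mp h1
  filter_upwards [Metric.ball_mem_nhds u hε] with v hv t
  have h2 : dist (v t - u t) 0 < ε := by
    rw [dist_zero_right, ← dist_eq_norm]
    exact lt_of_le_of_lt (ContinuousMap.dist_apply_le_dist t) hv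
  simpa using H h2 t (mem_univ t)

/-- Compactness makes the continuity estimates uniform in `t`. Continuity of `F` near, and not only
at, the values of `u` ensures that `F ∘ v` is continuous for `v` near `u`, so that the default value
`0` of `superpos` does not occur. -/
theorem continuousAt_superpos {F : V → W} {u : C(K, V)}
    (h : ∀ t, ∀ᶠ x in 𝓝 (u t), ContinuousAt F x) : ContinuousAt (superpos F) u := by
  rw [Metric.continuousAt_iff']
  intro ε hε
  have h1 : ∀ᶠ k in 𝓝 (0 : V), ∀ t ∈ (univ : Set K), dist (F (u t + k)) (F (u t)) < ε / 2 := by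
    refine isCompact_univ.eventually_forall_of_forall_eventually fun t _ => ?_
    have hF : ContinuousAt F (u t) := (h t).self_of_nhds
    have hc : ContinuousAt (fun z : V × K => dist (F (u z.2 + z.1)) (F (u z.2))) (0, t) := by
      refine Filter.Tendsto.dist ?_ ?_
      · exact ContinuousAt.comp (g := F) (f := fun z : V × K => u z.2 + z.1) (by simpa using hF)
          (by fun_prop)
      · exact ContinuousAt.comp (g := F) (f := fun z : V × K => u z.2) (by simpa using hF)
          (by fun_prop)
    refine hc.eventually_lt continuousAt_const ?_
    simpa using half_pos hε
  obtain ⟨δ, hδ, H⟩ := Metric.eventually_nhds_iff.mp h1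
  filter_upwards [Metric.ball_mem_nhds u hδ, eventually_forall_of_forall_eventually h] with v hv hvc
  refine lt_of_le_of_lt ((ContinuousMap.dist_le (half_pos hε).le).mpr fun t => ?_) (half_lt_self hε)
  rw [superpos_apply hvc, superpos_apply fun t => (h t).self_of_nhds]
  have h2 : dist (v t - u t) 0 < δ := by
    rw [dist_zero_right, ← dist_eq_norm]
    exact lt_of_le_of_lt (ContinuousMap.dist_apply_le_dist t) hv
  simpa using (H h2 t (mem_univ t)).le

variable (K V W) in
/-- Pointwise application of linear maps. -/
def applyC : C(K, V →L[ℝ] W) →L[ℝ] C(K, V) →L[ℝ] C(K, W) :=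
  LinearMap.mkContinuous₂
    (LinearMap.mk₂ ℝ (fun (A : C(K, V →L[ℝ] W)) (v : C(K, V)) => (⟨fun t => A t (v t), by fun_prop⟩ : C(K, W)))
      (fun A A' v => by ext t; simp) (fun c A v => by ext t; simp)
      (fun A v v' => by ext t; simp) (fun c A v => by ext t; simp)) 1 fun A v => by
    rw [ContinuousMap.norm_le _ (by positivity)]
    intro t
    rw [one_mul]
    exact (A t).le_of_opNorm_le_of_le (A.norm_coe_le_norm t) (v.norm_coe_le_norm t)

@[simp]
theorem applyC_apply (A : C(K, V →L[ℝ] W)) (v : C(K, V)) (t : K) :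
    applyC K V W A v t = A t (v t) := rfl

/-- The remainder must be small uniformly in `t`. A `C¹` function is strictly differentiable, so the
estimate at `u t` also covers base points `u t'` with `t'` near `t`, and compactness of `K` does the
rest. -/
theorem hasFDerivAt_superpos {F : V → W} {u : C(K, V)} (h : ∀ t, ContDiffAt ℝ 1 F (u t)) :
    HasFDerivAt (superpos F) (applyC K V W (superpos (fderiv ℝ F) u)) u := by
  have hd : ∀ t, ContinuousAt (fderiv ℝ F) (u t) := fun t => (h t).continuousAt_fderiv one_ne_zero
  have hev : ∀ t, ∀ᶠ x in 𝓝 (u t), ContinuousAt F x := fun t =>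
    ((h t).eventually (by simp)).mono fun x hx => hx.continuousAt
  rw [hasFDerivAt_iff_isLittleO, Asymptotics.isLittleO_iff]
  intro ε hε
  have h1 : ∀ᶠ k in 𝓝 (0 : V), ∀ t ∈ (univ : Set K),
      ‖F (u t + k) - F (u t) - fderiv ℝ F (u t) k‖ ≤ ε * ‖k‖ := by
    refine isCompact_univ.eventually_forall_of_forall_eventually fun t _ => ?_
    have hs := ((h t).hasStrictFDerivAt one_ne_zero).isLittleO.def (half_pos hε)
    have hc : ContinuousAt (fun z : V × K => (u z.2 + z.1, u z.2)) (0, t) := by fun_prop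
    have e1 := hc.eventually (p := fun p : V × V =>
      ‖F p.1 - F p.2 - fderiv ℝ F (u t) (p.1 - p.2)‖ ≤ ε / 2 * ‖p.1 - p.2‖) (by simpa using hs)
    have hc2 : ContinuousAt (fun z : V × K => ‖fderiv ℝ F (u z.2) - fderiv ℝ F (u t)‖) (0, t) := by
      refine (ContinuousAt.sub ?_ continuousAt_const).norm
      exact ContinuousAt.comp (g := fderiv ℝ F) (f := fun z : V × K => u z.2) (by simpa using hd t)
        (by fun_prop)
    have e2 := hc2.eventually_lt (continuousAt_const (y := ε / 2)) (by simpa using half_pos hε)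
    filter_upwards [e1, e2] with z hz1 hz2
    simp only [add_sub_cancel_left] at hz1
    calc ‖F (u z.2 + z.1) - F (u z.2) - fderiv ℝ F (u z.2) z.1‖
        = ‖(F (u z.2 + z.1) - F (u z.2) - fderiv ℝ F (u t) z.1) -
            (fderiv ℝ F (u z.2) - fderiv ℝ F (u t)) z.1‖ := by
          rw [sub_apply]; congr 1; abel
      _ ≤ ε / 2 * ‖z.1‖ + ε / 2 * ‖z.1‖ :=
          (norm_sub_le _ _).trans (add_le_add hz1 (ContinuousLinearMap.le_of_opNorm_le _ hz2.le _))
      _ = ε * ‖z.1‖ := by ring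
  obtain ⟨δ, hδ, H⟩ := Metric.eventually_nhds_iff.mp h1
  filter_upwards [Metric.ball_mem_nhds u hδ, eventually_forall_of_forall_eventually hev] with v hv hvc
  rw [ContinuousMap.norm_le _ (by positivity)]
  intro t
  have h2 : dist (v t - u t) 0 < δ := by
    rw [dist_zero_right, ← dist_eq_norm]
    exact lt_of_le_of_lt (ContinuousMap.dist_apply_le_dist t) hv
  have h3 := H h2 t (mem_univ t)
  rw [add_sub_cancel] at h3
  simp only [ContinuousMap.sub_apply, applyC_apply, superpos_apply hvc,
    superpos_apply fun t => (hev t).self_of_nhds, superpos_apply hd]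
  refine h3.trans ?_
  gcongr
  exact ((v - u).norm_coe_le_norm t)

/-- The derivative of superposition by `F` is pointwise application of superposition by `fderiv ℝ
F`, so the induction passes from `W` to `V →L[ℝ] W`. This is why `V` and `W` share a universe. -/
theorem contDiffAt_superpos_nat (n : ℕ) {F : V → W} {u : C(K, V)}
    (h : ∀ t, ContDiffAt ℝ n F (u t)) : ContDiffAt ℝ n (superpos F) u := by
  induction n generalizing W with
  | zero =>
    have h1 : ∀ t, ∀ᶠ x in 𝓝 (u t), ContDiffAt ℝ (0 : ℕ) F x := fun t =>
      (h t).eventually (by simp)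
    have h2 := eventually_forall_of_forall_eventually h1
    rw [Nat.cast_zero, contDiffAt_zero]
    refine ⟨_, h2, fun v hv => ContinuousAt.continuousWithinAt ?_⟩
    exact continuousAt_superpos fun t =>
      ((hv t).eventually (by simp)).mono fun x hx => hx.continuousAt
  | succ n ih =>
    have h1 : ∀ t, ∀ᶠ x in 𝓝 (u t), ContDiffAt ℝ (n + 1 : ℕ) F x := fun t =>
      (h t).eventually (by simp)
    rw [Nat.cast_succ, contDiffAt_succ_iff_hasFDerivAt]
    refine ⟨fun v => applyC K V W (superpos (fderiv ℝ F) v),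
      ⟨_, eventually_forall_of_forall_eventually h1, fun v hv =>
        hasFDerivAt_superpos fun t => (hv t).of_le (by exact_mod_cast Nat.le_add_left 1 n)⟩, ?_⟩
    exact (applyC K V W).contDiff.contDiffAt.comp u
      (ih fun t => (h t).fderiv_right (m := n) (by simp))

theorem contDiffAt_superpos {F : V → W} {u : C(K, V)}
    (h : ∀ t, ContDiffAt ℝ ∞ F (u t)) : ContDiffAt ℝ ∞ (superpos F) u :=
  contDiffAt_infty.mpr fun n => contDiffAt_superpos_nat n fun t => contDiffAt_infty.mp (h t) n

end Superposition

/-! ### Operators on `L²([0,1], V)` -/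

section L2Ops

variable {V W X Y Z : Type*} [NormedAddCommGroup V] [NormedSpace ℝ V]
  [NormedAddCommGroup W] [NormedSpace ℝ W] [NormedAddCommGroup X] [NormedSpace ℝ X]
  [NormedAddCommGroup Y] [NormedSpace ℝ Y] [NormedAddCommGroup Z] [NormedSpace ℝ Z]

/-- Lebesgue measure on `[0, 1]`. -/
abbrev volI : Measure ℝ := volume.restrict (Icc (0 : ℝ) 1)

instance : IsProbabilityMeasure volI := ⟨by simp⟩

/-- The retraction of `ℝ` onto `[0, 1]`. -/
abbrev projI (t : ℝ) : unitInterval := projIcc 0 1 zero_le_one t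

theorem L2.intervalIntegrable (y : L2 V) {s t : ℝ} (hs : s ∈ Icc (0 : ℝ) 1)
    (ht : t ∈ Icc (0 : ℝ) 1) : IntervalIntegrable y volume s t :=
  MemLp.intervalIntegrable (Lp.memLp y) hs ht

theorem L2.integral_congr {f g : ℝ → V} (h : f =ᵐ[volI] g) {s t : ℝ} (hs : s ∈ Icc (0 : ℝ) 1)
    (ht : t ∈ Icc (0 : ℝ) 1) : ∫ r in s..t, f r = ∫ r in s..t, g r := by
  apply intervalIntegral.integral_congr_ae_restrict
  have h1 : uIoc s t ⊆ Icc 0 1 := uIoc_subset_uIcc.trans (uIcc_subset_Icc hs ht)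
  exact ae_restrict_of_ae_restrict_of_subset h1 h

/-- On a probability space the `L¹` norm is at most the `L²` norm. -/
theorem L2.norm_integral_le (y : L2 V) (t : unitInterval) : ‖∫ s in (0 : ℝ)..t, y s‖ ≤ ‖y‖ := by
  have h1 : ‖∫ s in (0 : ℝ)..t, y s‖ ≤ ∫ s in Icc (0 : ℝ) 1, ‖y s‖ := by
    refine (intervalIntegral.norm_integral_le_integral_norm t.2.1).trans ?_
    rw [intervalIntegral.integral_of_le t.2.1]
    refine setIntegral_mono_set ((Lp.memLp y).integrable (by norm_num)).norm
      (Filter.Eventually.of_forall fun _ => norm_nonneg _)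
      (LE.le.eventuallyLE (Ioc_subset_Icc_self.trans (Icc_subset_Icc le_rfl t.2.2)))
  refine h1.trans ?_
  rw [integral_norm_eq_lintegral_enorm (Lp.aestronglyMeasurable y), ← eLpNorm_one_eq_lintegral_enorm,
    Lp.norm_def]
  exact ENNReal.toReal_mono (Lp.eLpNorm_ne_top y)
    (eLpNorm_le_eLpNorm_of_exponent_le (by norm_num) (Lp.aestronglyMeasurable y))

theorem L2.continuous_primitive (y : L2 V) :
    Continuous fun t : unitInterval => ∫ s in (0 : ℝ)..t, y s := by
  have h := intervalIntegral.continuousOn_primitive_interval (μ := volume) (f := (y : ℝ → V))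
    (a := 0) (b := 1) (by
      rw [uIcc_of_le zero_le_one]; exact (Lp.memLp y).integrable (by norm_num))
  rw [uIcc_of_le zero_le_one] at h
  exact continuousOn_iff_continuous_domRestrict.mp h

variable (V) in
/-- The operator `y ↦ ∫₀ᵗ y`. -/
def primC : L2 V →L[ℝ] C(unitInterval, V) :=
  LinearMap.mkContinuous
    { toFun := fun y => ⟨fun t => ∫ s in (0 : ℝ)..t, y s, y.continuous_primitive⟩
      map_add' := fun y y' => by
        ext t
        have h := L2.integral_congr (Lp.coeFn_add y y') (left_mem_Icc.mpr zero_le_one) t.2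
        simp only [ContinuousMap.coe_mk, ContinuousMap.add_apply, h, Pi.add_apply]
        exact intervalIntegral.integral_add (y.intervalIntegrable (by simp) t.2)
          (y'.intervalIntegrable (by simp) t.2)
      map_smul' := fun c y => by
        ext t
        have h := L2.integral_congr (Lp.coeFn_smul c y) (left_mem_Icc.mpr zero_le_one) t.2
        simp only [ContinuousMap.coe_mk, ContinuousMap.smul_apply, h, Pi.smul_apply,
          RingHom.id_apply, intervalIntegral.integral_smul] } 1 fun y => by
    rw [ContinuousMap.norm_le _ (by positivity)]
    intro t
    rw [one_mul]
    exact y.norm_integral_le t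

@[simp]
theorem primC_apply (y : L2 V) (t : unitInterval) : primC V y t = ∫ s in (0 : ℝ)..t, y s := rfl

theorem memLp_bilin (B : X →L[ℝ] Y →L[ℝ] Z) (x : C(unitInterval, X)) (y : L2 Y) :
    MemLp (fun t => B (x (projI t)) (y t)) 2 volI := by
  refine memLp_clm_apply (A := fun t => B (x (projI t))) ?_ (Lp.memLp y)
  exact (by fun_prop : Continuous fun t => B (x (projI t))).continuousOn

/-- A bilinear map `B : X × Y → Z` acting pointwise, `C([0,1], X) × L²(Y) → L²(Z)`. -/
def bilinL2 (B : X →L[ℝ] Y →L[ℝ] Z) : C(unitInterval, X) →L[ℝ] L2 Y →L[ℝ] L2 Z :=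
  LinearMap.mkContinuous₂
    (LinearMap.mk₂ ℝ (fun x y => (memLp_bilin B x y).toLp)
      (fun x x' y => by
        rw [← MemLp.toLp_add]
        exact MemLp.toLp_congr _ _ (Filter.Eventually.of_forall fun t => by simp))
      (fun c x y => by
        rw [← MemLp.toLp_const_smul]
        exact MemLp.toLp_congr _ _ (Filter.Eventually.of_forall fun t => by simp))
      (fun x y y' => by
        rw [← MemLp.toLp_add]
        refine MemLp.toLp_congr _ _ ?_
        filter_upwards [Lp.coeFn_add y y'] with t ht
        simp only [ht, Pi.add_apply, map_add])
      (fun c x y => by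
        rw [← MemLp.toLp_const_smul]
        refine MemLp.toLp_congr _ _ ?_
        filter_upwards [Lp.coeFn_smul c y] with t ht
        simp only [ht, Pi.smul_apply, map_smul])) ‖B‖ fun x y => by
    refine Lp.norm_le_mul_norm_of_ae_le_mul ?_
    simp only [LinearMap.mk₂_apply]
    filter_upwards [MemLp.coeFn_toLp (memLp_bilin B x y)] with t ht
    rw [ht]
    exact (B.le_opNorm₂ _ _).trans (by gcongr; exact x.norm_coe_le_norm _)

theorem coeFn_bilinL2 (B : X →L[ℝ] Y →L[ℝ] Z) (x : C(unitInterval, X)) (y : L2 Y) :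
    bilinL2 B x y =ᵐ[volI] fun t => B (x (projI t)) (y t) :=
  MemLp.coeFn_toLp (memLp_bilin B x y)

set_option linter.unusedSectionVars false in
theorem memLp_indicator {s : Set ℝ} (hs : MeasurableSet s) (y : L2 V) :
    MemLp (s.indicator y) 2 volI := (Lp.memLp y).indicator hs

variable (V) in
/-- Multiplication by the indicator function of a measurable set. -/
def indL2 (s : Set ℝ) (hs : MeasurableSet s) : L2 V →L[ℝ] L2 V :=
  LinearMap.mkContinuous
    { toFun := fun y => (memLp_indicator hs y).toLp
      map_add' := fun y y' => by
        rw [← MemLp.toLp_add]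
        refine MemLp.toLp_congr _ _ ?_
        filter_upwards [Lp.coeFn_add y y'] with t ht
        by_cases h : t ∈ s <;> simp only [Pi.add_apply, indicator_of_mem, indicator_of_notMem, h, ht,
          not_false_eq_true, add_zero]
      map_smul' := fun c y => by
        rw [RingHom.id_apply, ← MemLp.toLp_const_smul]
        refine MemLp.toLp_congr _ _ ?_
        filter_upwards [Lp.coeFn_smul c y] with t ht
        by_cases h : t ∈ s <;> simp only [Pi.smul_apply, indicator_of_mem, indicator_of_notMem, h,
          ht, not_false_eq_true, smul_zero] } 1 fun y => by
    refine Lp.norm_le_mul_norm_of_ae_le_mul ?_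
    filter_upwards [MemLp.coeFn_toLp (memLp_indicator hs y)] with t ht
    rw [one_mul]
    exact (congrArg norm ht).le.trans (norm_indicator_le_norm_self _ _)

theorem coeFn_indL2 (s : Set ℝ) (hs : MeasurableSet s) (y : L2 V) :
    indL2 V s hs y =ᵐ[volI] s.indicator y :=
  MemLp.coeFn_toLp (memLp_indicator hs y)

set_option synthInstance.maxHeartbeats 400000 in
instance instNormedAddCommGroupCLMContinuousMap {K L : Type*} [TopologicalSpace K] [CompactSpace K]
    [TopologicalSpace L] [CompactSpace L] :
    NormedAddCommGroup (C(K, V) →L[ℝ] C(L, W)) :=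
  inferInstance

set_option synthInstance.maxHeartbeats 400000 in
instance instNormedSpaceCLMContinuousMap {K L : Type*} [TopologicalSpace K] [CompactSpace K]
    [TopologicalSpace L] [CompactSpace L] :
    NormedSpace ℝ (C(K, V) →L[ℝ] C(L, W)) :=
  inferInstance

variable (W) in
/-- The Volterra operator `w ↦ ∫₀ᵗ a w`. -/
def volterra : L2 (W →L[ℝ] W) →L[ℝ] C(unitInterval, W) →L[ℝ] C(unitInterval, W) :=
  ((ContinuousLinearMap.compL ℝ (C(unitInterval, W)) (L2 W) (C(unitInterval, W)) (primC W)).comp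
    (bilinL2 (ContinuousLinearMap.id ℝ (W →L[ℝ] W)).flip).flip)

theorem volterra_apply (a : L2 (W →L[ℝ] W)) (w : C(unitInterval, W)) (t : unitInterval) :
    volterra W a w t = ∫ s in (0 : ℝ)..t, a s (w (projI s)) := by
  change (∫ s in (0 : ℝ)..t, (bilinL2 (ContinuousLinearMap.id ℝ (W →L[ℝ] W)).flip w a) s) = _
  exact L2.integral_congr (coeFn_bilinL2 _ w a) (by simp) t.2

/-- The usual factorial estimate for iterated integrals. As `a` is only square integrable, the time
variable is replaced by the accumulated mass `∫₀ᵗ ‖a‖`. -/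
theorem norm_volterra_pow_le (a : L2 (W →L[ℝ] W)) (n : ℕ) (w : C(unitInterval, W))
    (t : unitInterval) : ‖(volterra W a ^ n) w t‖ ≤
      (∫ s in (0 : ℝ)..t, ‖a s‖) ^ n / n.factorial * ‖w‖ := by
  set α : ℝ → ℝ := fun t => ∫ s in (0 : ℝ)..t, ‖a s‖ with hα
  have hα1 : HasWeakDeriv α (fun s => ‖a s‖) 0 1 := ⟨(Lp.memLp a).norm, fun t _ => by simp [hα]⟩
  induction n generalizing t with
  | zero => simpa using w.norm_coe_le_norm t
  | succ n ih =>
    -- The bound for `n + 1` is the primitive of `‖a‖` times the bound for `n`, by the chain rule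
    -- for the absolutely continuous function `α`.
    have h1 : HasWeakDeriv (fun t => α t ^ (n + 1) / (n + 1).factorial * ‖w‖)
        (fun s => ‖a s‖ * (α s ^ n / n.factorial * ‖w‖)) 0 1 := by
      have := hα1.comp (F := fun x => x ^ (n + 1) / (n + 1).factorial * ‖w‖)
        fun t _ => by fun_prop
      convert this using 2 with s
      have hd : HasDerivAt (fun x : ℝ => x ^ (n + 1) / (n + 1).factorial * ‖w‖)
          (α s ^ n / n.factorial * ‖w‖) (α s) := by
        have := ((hasDerivAt_pow (n + 1) (α s)).div_const ((n + 1).factorial : ℝ)).mul_const ‖w‖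
        have h0 : α s ^ n / n.factorial * ‖w‖ =
            ((n + 1 : ℕ) : ℝ) * α s ^ (n + 1 - 1) / (n + 1).factorial * ‖w‖ := by
          rw [Nat.factorial_succ, Nat.add_sub_cancel]
          push_cast
          have : (n.factorial : ℝ) ≠ 0 := by positivity
          field_simp
        rw [h0]
        exact this
      rw [hd.hasFDerivAt.fderiv]
      simp [mul_comm]
    rw [pow_succ', mul_apply_eq_comp, volterra_apply]
    have h2 := h1.2 t t.2
    have hα0 : α 0 = 0 := by simp [hα]
    simp only [hα0] at h2
    rw [h2]
    simp only [ne_eq, Nat.add_eq_zero_iff, one_ne_zero, and_false, not_false_eq_true, zero_pow,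
      zero_div, zero_mul, zero_add]
    refine intervalIntegral.norm_integral_le_of_norm_le t.2.1 ?_
      (h1.intervalIntegrable (by simp) t.2)
    refine Filter.Eventually.of_forall fun s hs => ?_
    have hs' : s ∈ Icc (0 : ℝ) 1 := ⟨hs.1.le, hs.2.trans t.2.2⟩
    have h3 := ih (projI s)
    rw [show projI s = ⟨s, hs'⟩ from projIcc_of_mem zero_le_one hs'] at h3 ⊢
    exact (a s).le_of_opNorm_le_of_le le_rfl h3

/-- Some power `K ^ n` has norm below one because `C ^ n / n!` tends to zero. Then `1 - K ^ n` is
invertible, and `1 - K` is one of its two commuting factors. No smallness of `a` is required. -/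
theorem isUnit_one_sub_volterra (a : L2 (W →L[ℝ] W)) : IsUnit (1 - volterra W a) := by
  set C := ∫ s in (0 : ℝ)..1, ‖a s‖ with hC
  have hi : IntervalIntegrable (fun s => ‖a s‖) volume 0 1 :=
    (a.intervalIntegrable (by simp) (by simp)).norm
  have hC0 : 0 ≤ C := intervalIntegral.integral_nonneg zero_le_one fun _ _ => norm_nonneg _
  have hn : ∀ n, ‖volterra W a ^ n‖ ≤ C ^ n / n.factorial := fun n => by
    refine ContinuousLinearMap.opNorm_le_bound _ (by positivity) fun w => ?_
    rw [ContinuousMap.norm_le _ (by positivity)]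
    intro t
    refine (norm_volterra_pow_le a n w t).trans ?_
    have h0 : 0 ≤ ∫ s in (0 : ℝ)..t, ‖a s‖ :=
      intervalIntegral.integral_nonneg t.2.1 fun _ _ => norm_nonneg _
    have h1 : ∫ s in (0 : ℝ)..t, ‖a s‖ ≤ C :=
      intervalIntegral.integral_mono_interval le_rfl t.2.1 t.2.2
        (Filter.Eventually.of_forall fun _ => norm_nonneg _) hi
    gcongr
  obtain ⟨n, hlt⟩ := ((FloorSemiring.tendsto_pow_div_factorial_atTop C).eventually
    (gt_mem_nhds one_pos)).exists
  by_cases hcs : CompleteSpace W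
  · have h1 : IsUnit (1 - volterra W a ^ n) :=
      isUnit_one_sub_of_norm_lt_one
        (R := C(unitInterval, W) →L[ℝ] C(unitInterval, W)) ((hn n).trans_lt hlt)
    rw [← mul_neg_geom_sum, Commute.isUnit_mul_iff] at h1
    · exact h1.1
    · have : Commute (volterra W a) (∑ i ∈ Finset.range n, volterra W a ^ i) :=
        Commute.sum_right _ _ _ fun i _ => (Commute.refl _).pow_right i
      exact (Commute.one_left _).sub_left this
  -- In a space that is not complete the Bochner integral is zero by convention.
  · have : volterra W a = 0 := by
      ext w t
      rw [volterra_apply, intervalIntegral, integral, integral]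
      simp [hcs]
    simp [this]

/-- The solution of `w' = a w`, `w(0) = w₀`. -/
def linSolve (w₀ : W) (a : L2 (W →L[ℝ] W)) : C(unitInterval, W) :=
  Ring.inverse (1 - volterra W a) (ContinuousMap.const _ w₀)

theorem linSolve_eq (w₀ : W) (a : L2 (W →L[ℝ] W)) :
    linSolve w₀ a = ContinuousMap.const _ w₀ + volterra W a (linSolve w₀ a) := by
  have h := DFunLike.congr_fun (Ring.mul_inverse_cancel _ (isUnit_one_sub_volterra a))
    (ContinuousMap.const _ w₀)
  rw [mul_apply_eq_comp] at h
  simp only [sub_apply, one_apply_eq_self] at h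
  exact sub_eq_iff_eq_add.mp h

theorem volterra_unique {a : L2 (W →L[ℝ] W)} {w w' z : C(unitInterval, W)}
    (h : w = z + volterra W a w) (h' : w' = z + volterra W a w') : w = w' := by
  have h0 : (1 - volterra W a) (w - w') = 0 := by
    simp only [sub_apply, one_apply_eq_self, map_sub]
    nth_rw 1 [h]
    nth_rw 1 [h']
    abel
  have h1 := DFunLike.congr_fun (Ring.inverse_mul_cancel _ (isUnit_one_sub_volterra a)) (w - w')
  rw [mul_apply_eq_comp, h0, map_zero] at h1
  exact sub_eq_zero.mp h1.symm

/-- Smooth dependence on coefficients costs nothing here: `volterra` is linear in `a`, and inversion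
in the Banach algebra of operators is smooth at units. -/
theorem contDiff_linSolve [CompleteSpace W] (w₀ : W) {n : WithTop ℕ∞} :
    ContDiff ℝ n (linSolve w₀) := by
  rw [contDiff_iff_contDiffAt]
  intro a
  have h1 : ContDiffAt ℝ n (fun a => Ring.inverse (1 - volterra W a)) a := by
    have h2 := contDiffAt_ringInverse ℝ (n := n)
      (R := C(unitInterval, W) →L[ℝ] C(unitInterval, W)) (isUnit_one_sub_volterra a).unit
    exact ContDiffAt.comp a h2 (contDiffAt_const.sub (volterra W).contDiff.contDiffAt)
  exact h1.clm_apply contDiffAt_const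

end L2Ops

/-! ### Linear equations with square integrable coefficients -/

section LinearODE

variable {V W : Type*} [NormedAddCommGroup V] [NormedSpace ℝ V] [NormedAddCommGroup W]
  [NormedSpace ℝ W]

/-- The retraction of `ℝ` onto `[α, β]`. -/
def clamp (α β t : ℝ) : ℝ := max α (min t β)

theorem continuous_clamp (α β : ℝ) : Continuous (clamp α β) := by unfold clamp; fun_prop

theorem clamp_mem {α β : ℝ} (h : α ≤ β) (t : ℝ) : clamp α β t ∈ Icc α β :=
  ⟨le_max_left _ _, max_le h (min_le_right _ _)⟩

theorem clamp_of_mem {α β t : ℝ} (ht : t ∈ Icc α β) : clamp α β t = t := by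
  rw [clamp, min_eq_left ht.2, max_eq_right ht.1]

theorem clamp_of_le {α β t : ℝ} (ht : t ≤ α) : clamp α β t = α := by
  rw [clamp, max_eq_left ((min_le_left _ _).trans ht)]

theorem integral_indicator_Icc {α β : ℝ} (hα : 0 ≤ α) (hαβ : α ≤ β) (g : ℝ → V) {t : ℝ}
    (ht : 0 ≤ t) : ∫ s in (0 : ℝ)..t, (Icc α β).indicator g s = ∫ s in α..clamp α β t, g s := by
  rw [intervalIntegral.integral_of_le ht, intervalIntegral.integral_of_le (clamp_mem hαβ t).1,
    setIntegral_indicator measurableSet_Icc]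
  apply setIntegral_congr_set
  -- The closed interval contains `α` while the domain of integration `Ioc` does not; all other
  -- points agree.
  have h0 : ∀ᵐ s : ℝ, s ≠ α := by simp [ae_iff]
  filter_upwards [h0] with s hs
  apply propext
  change s ∈ Ioc 0 t ∩ Icc α β ↔ s ∈ Ioc α (clamp α β t)
  simp only [clamp, mem_inter_iff, mem_Ioc, mem_Icc, le_max_iff, le_min_iff]
  constructor
  · rintro ⟨⟨h1, h2⟩, h3, h4⟩
    exact ⟨lt_of_le_of_ne h3 (Ne.symm hs), Or.inr ⟨h2, h4⟩⟩
  · rintro ⟨h1, h2 | h2⟩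
    · exact absurd h2 (not_le.mpr h1)
    · exact ⟨⟨hα.trans_lt h1, h2.1⟩, h1.le, h2.2⟩

/-- Extending a function constantly from `[α, β]` to `[0, 1]`. -/
theorem HasWeakDeriv.clamp {f u : ℝ → V} {α β : ℝ} (hα : 0 ≤ α) (hαβ : α ≤ β) (hβ : β ≤ 1)
    (h : HasWeakDeriv f u α β) :
    HasWeakDeriv (fun t => f (clamp α β t)) ((Icc α β).indicator u) 0 1 := by
  refine ⟨?_, fun t ht => ?_⟩
  · rw [memLp_indicator_iff_restrict measurableSet_Icc,
      Measure.restrict_restrict_of_subset (Icc_subset_Icc hα hβ)]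
    exact h.1
  · dsimp only
    rw [integral_indicator_Icc hα hαβ u ht.1, clamp_of_le hα]
    exact h.2 _ (clamp_mem hαβ t)

/-- Extending `f` constantly and the coefficient by zero turns the equation on `[α, β]` into a
Volterra equation on `[0, 1]`, where uniqueness is the injectivity of `1 - volterra W a`. -/
theorem linear_unique {A : ℝ → W →L[ℝ] W} {f : ℝ → W} {α β : ℝ} (hα : 0 ≤ α) (hβ : β ≤ 1)
    (hA : MemLp A 2 (volume.restrict (Icc α β))) (hf : ContinuousOn f (Icc α β))
    (h : ∀ t ∈ Icc α β, f t = ∫ s in α..t, A s (f s)) : ∀ t ∈ Icc α β, f t = 0 := by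
  intro t ht
  have hαβ : α ≤ β := ht.1.trans ht.2
  have hmem : MemLp ((Icc α β).indicator A) 2 volI := by
    refine (memLp_indicator_iff_restrict (s := Icc α β) (f := A) measurableSet_Icc).mpr ?_
    rwa [Measure.restrict_restrict_of_subset (Icc_subset_Icc hα hβ)]
  have hcont : Continuous fun t : unitInterval => f (clamp α β t) :=
    hf.comp_continuous ((continuous_clamp α β).comp continuous_subtype_val)
      fun t => clamp_mem hαβ t
  let w : C(unitInterval, W) := ⟨_, hcont⟩
  have hw : w = 0 + volterra W hmem.toLp w := by
    ext r
    rw [zero_add, volterra_apply]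
    have e1 : ∫ s in (0 : ℝ)..r, (hmem.toLp : ℝ → W →L[ℝ] W) s (w (projI s)) =
        ∫ s in (0 : ℝ)..r, (Icc α β).indicator (fun s => A s (f s)) s := by
      refine L2.integral_congr ?_ (by simp) r.2
      filter_upwards [hmem.coeFn_toLp, ae_restrict_mem measurableSet_Icc] with s hs hsI
      rw [hs, show projI s = ⟨s, hsI⟩ from projIcc_of_mem _ hsI]
      by_cases hm : s ∈ Icc α β
      · simp only [indicator_of_mem hm]
        change A s (f (LevyGrad.clamp α β s)) = _
        rw [clamp_of_mem hm]
      · simp [indicator_of_notMem hm]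
    rw [e1, integral_indicator_Icc hα hαβ _ r.2.1]
    exact h _ (clamp_mem hαβ _)
  have h0 : w = 0 := volterra_unique hw (by simp)
  have h1 := DFunLike.congr_fun h0 ⟨t, hα.trans ht.1, ht.2.trans hβ⟩
  change f (LevyGrad.clamp α β t) = 0 at h1
  rwa [clamp_of_mem ht] at h1

/-- Differentiability is already known, so the equation for the derivative follows by
differentiating the fixed point equation `linSolve_eq`. -/
theorem hasDerivAt_linSolve [CompleteSpace W] {A : ℝ → L2 (W →L[ℝ] W)} {A' : L2 (W →L[ℝ] W)}
    {s : ℝ} (hA : HasDerivAt A A' s) (w₀ : W) :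
    ∃ w : C(unitInterval, W), HasDerivAt (fun r => linSolve w₀ (A r)) w s ∧
      w = volterra W A' (linSolve w₀ (A s)) + volterra W (A s) w := by
  have hd : DifferentiableAt ℝ (fun r => linSolve w₀ (A r)) s :=
    ((contDiff_linSolve w₀ (n := 1)).differentiable one_ne_zero).differentiableAt.comp s
      hA.differentiableAt
  refine ⟨_, hd.hasDerivAt, ?_⟩
  have h1 : HasDerivAt (fun r => volterra W (A r)) (volterra W A') s :=
    (volterra W).hasFDerivAt.comp_hasDerivAt s hA
  have h2 : HasDerivAt
      (fun r => ContinuousMap.const unitInterval w₀ + volterra W (A r) (linSolve w₀ (A r)))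
      (volterra W A' (linSolve w₀ (A s)) + volterra W (A s) (deriv (fun r => linSolve w₀ (A r)) s))
      s := (h1.clm_apply hd.hasDerivAt).const_add _
  simp only [← linSolve_eq] at h2
  exact hd.hasDerivAt.unique h2

end LinearODE

section Transport

variable {R : Type*} [NormedRing R] [NormedAlgebra ℝ R]

/-- The solution of `V' = - a V`, `V(0) = 1`. -/
def fwd (a : L2 R) : C(unitInterval, R) :=
  linSolve 1 ((-ContinuousLinearMap.mul ℝ R).compLpL 2 volI a)

/-- The solution of `Z' = Z a`, `Z(0) = 1`. -/
def bwd (a : L2 R) : C(unitInterval, R) :=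
  linSolve 1 ((ContinuousLinearMap.mul ℝ R).flip.compLpL 2 volI a)

variable [CompleteSpace R]

theorem contDiff_fwd {n : WithTop ℕ∞} : ContDiff ℝ n (fwd : L2 R → C(unitInterval, R)) :=
  (contDiff_linSolve 1).comp ((-ContinuousLinearMap.mul ℝ R).compLpL 2 volI).contDiff

theorem contDiff_bwd {n : WithTop ℕ∞} : ContDiff ℝ n (bwd : L2 R → C(unitInterval, R)) :=
  (contDiff_linSolve 1).comp ((ContinuousLinearMap.mul ℝ R).flip.compLpL 2 volI).contDiff

theorem memLp_mul_left {a : L2 R} {f : ℝ → R} (hf : ContinuousOn f (Icc 0 1)) :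
    MemLp (fun t => a t * f t) 2 volI := by
  have hA : ContinuousOn (fun t => (ContinuousLinearMap.mul ℝ R).flip (f t)) (Icc 0 1) :=
    (ContinuousLinearMap.mul ℝ R).flip.continuous.comp_continuousOn hf
  exact memLp_clm_apply hA (Lp.memLp a)

theorem memLp_mul_right {a : L2 R} {f : ℝ → R} (hf : ContinuousOn f (Icc 0 1)) :
    MemLp (fun t => f t * a t) 2 volI := by
  have hA : ContinuousOn (fun t => (ContinuousLinearMap.mul ℝ R) (f t)) (Icc 0 1) :=
    (ContinuousLinearMap.mul ℝ R).continuous.comp_continuousOn hf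
  exact memLp_clm_apply hA (Lp.memLp a)

theorem continuousOn_comp_projI {V : Type*} [TopologicalSpace V] (f : C(unitInterval, V)) :
    ContinuousOn (fun t => f (projI t)) (Icc 0 1) :=
  (f.continuous.comp continuous_projIcc).continuousOn

theorem projI_coe (t : unitInterval) : projI t = t := projIcc_val _ t

theorem projI_of_mem {t : ℝ} (ht : t ∈ Icc (0 : ℝ) 1) : projI t = ⟨t, ht⟩ := projIcc_of_mem _ ht

theorem hasWeakDeriv_fwd (a : L2 R) :
    HasWeakDeriv (fun t => fwd a (projI t)) (fun t => -(a t * fwd a (projI t))) 0 1 := by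
  refine ⟨(memLp_mul_left (continuousOn_comp_projI _)).neg, fun t ht => ?_⟩
  have h : ∀ r : unitInterval, fwd a r = 1 + ∫ s in (0 : ℝ)..r, -(a s * fwd a (projI s)) := by
    intro r
    have h1 := DFunLike.congr_fun (linSolve_eq 1 ((-ContinuousLinearMap.mul ℝ R).compLpL 2 volI a)) r
    rw [ContinuousMap.add_apply, volterra_apply] at h1
    refine h1.trans ?_
    rw [ContinuousMap.const_apply]
    congr 1
    refine L2.integral_congr ?_ (by simp) r.2
    filter_upwards [(-ContinuousLinearMap.mul ℝ R).coeFn_compLpL (p := 2) (μ := volI) a] with s hs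
    rw [hs]
    simp [fwd]
  dsimp only
  rw [projI_of_mem ht, projI_of_mem (by simp : (0 : ℝ) ∈ Icc (0 : ℝ) 1), h, h ⟨0, _⟩]
  simp

theorem fwd_zero (a : L2 R) : fwd a 0 = 1 := by
  have h1 := DFunLike.congr_fun (linSolve_eq 1 ((-ContinuousLinearMap.mul ℝ R).compLpL 2 volI a)) 0
  rw [ContinuousMap.add_apply, volterra_apply] at h1
  exact h1.trans (by simp)

theorem hasWeakDeriv_bwd (a : L2 R) :
    HasWeakDeriv (fun t => bwd a (projI t)) (fun t => bwd a (projI t) * a t) 0 1 := by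
  refine ⟨memLp_mul_right (continuousOn_comp_projI _), fun t ht => ?_⟩
  have h : ∀ r : unitInterval, bwd a r = 1 + ∫ s in (0 : ℝ)..r, bwd a (projI s) * a s := by
    intro r
    have h1 := DFunLike.congr_fun
      (linSolve_eq 1 ((ContinuousLinearMap.mul ℝ R).flip.compLpL 2 volI a)) r
    rw [ContinuousMap.add_apply, volterra_apply] at h1
    refine h1.trans ?_
    rw [ContinuousMap.const_apply]
    congr 1
    refine L2.integral_congr ?_ (by simp) r.2
    filter_upwards [(ContinuousLinearMap.mul ℝ R).flip.coeFn_compLpL (p := 2) (μ := volI) a]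
      with s hs
    rw [hs]
    simp [bwd]
  dsimp only
  rw [projI_of_mem ht, projI_of_mem (by simp : (0 : ℝ) ∈ Icc (0 : ℝ) 1), h, h ⟨0, _⟩]
  simp

theorem bwd_zero (a : L2 R) : bwd a 0 = 1 := by
  have h1 := DFunLike.congr_fun
    (linSolve_eq 1 ((ContinuousLinearMap.mul ℝ R).flip.compLpL 2 volI a)) 0
  rw [ContinuousMap.add_apply, volterra_apply] at h1
  exact h1.trans (by simp)

/-- For `V' = -aV` and `Z' = Za` the two terms in the derivative of `ZV` cancel, so `ZV` keeps its
initial value. -/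
theorem bwd_mul_fwd (a : L2 R) (t : unitInterval) : bwd a t * fwd a t = 1 := by
  have h := (hasWeakDeriv_bwd a).mul (hasWeakDeriv_fwd a)
  have h1 := h.2 t t.2
  dsimp only at h1
  rw [projI_coe, show projI (0 : ℝ) = 0 from projI_coe 0, fwd_zero, bwd_zero] at h1
  rw [h1]
  simp [mul_assoc]

/-- In the opposite order no direct cancellation occurs, and in a general algebra a left inverse
need not be a right inverse. Instead `f = VZ - 1` solves the linear equation `f' = fa - af` with
`f(0) = 0`, so it vanishes. -/
theorem fwd_mul_bwd (a : L2 R) (t : unitInterval) : fwd a t * bwd a t = 1 := by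
  have h := ((hasWeakDeriv_fwd a).mul (hasWeakDeriv_bwd a)).add (HasWeakDeriv.const (-1) 0 1)
  let L : R →L[ℝ] R →L[ℝ] R :=
    (ContinuousLinearMap.mul ℝ R).flip - ContinuousLinearMap.mul ℝ R
  have h0 : ∀ t ∈ Icc (0 : ℝ) 1, fwd a (projI t) * bwd a (projI t) + -1 = 0 := by
    refine linear_unique (A := fun t => L (a t)) le_rfl le_rfl
      (L.comp_memLp' (Lp.memLp a)) h.continuousOn fun t ht => ?_
    refine (h.2 t ht).trans ?_
    dsimp only
    rw [show projI (0 : ℝ) = 0 from projI_coe 0, fwd_zero, bwd_zero]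
    simp only [mul_one, add_neg_cancel, zero_add, add_zero]
    congr 1
    ext s
    simp only [L, sub_apply, ContinuousLinearMap.flip_apply, ContinuousLinearMap.mul_apply']
    noncomm_ring
  have h1 := h0 t t.2
  rw [projI_coe] at h1
  exact add_neg_eq_zero.mp h1

/-- A curve over `[α, β]` extended by constants to `[0, 1]` has zero velocity before `α`; nothing is
transported there, and solving from `0` amounts to solving from `α`. -/
theorem fwd_eq_one {a : L2 R} {α : unitInterval}
    (ha : ∀ᵐ t ∂(volume.restrict (Icc (0 : ℝ) α)), a t = 0) : fwd a α = 1 := by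
  have h := (hasWeakDeriv_fwd a).2 α α.2
  dsimp only at h
  rw [projI_coe, show projI (0 : ℝ) = 0 from projI_coe 0, fwd_zero] at h
  rw [h]
  simp only [add_eq_left]
  refine (intervalIntegral.integral_congr_ae_restrict (g := fun _ => 0) ?_).trans (by simp)
  rw [uIoc_of_le α.2.1]
  filter_upwards [ae_restrict_of_ae_restrict_of_subset Ioc_subset_Icc_self ha] with t ht
  simp [ht]

theorem bwd_eq_one {a : L2 R} {α : unitInterval}
    (ha : ∀ᵐ t ∂(volume.restrict (Icc (0 : ℝ) α)), a t = 0) : bwd a α = 1 := by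
  have h := bwd_mul_fwd a α
  rwa [fwd_eq_one ha, mul_one] at h

/-- Solutions of `P' = - a P` on subintervals, in terms of the fundamental solution. -/
theorem eq_fwd_mul_bwd {a : L2 R} {P : ℝ → R} {s t : ℝ} (hs : 0 ≤ s) (hst : s ≤ t) (ht : t ≤ 1)
    (hP : ContinuousOn P (Icc s t))    (h : ∀ r ∈ Icc s t, P r = 1 - ∫ x in s..r, a x * P x) :
    P t = fwd a (projI t) * bwd a (projI s) := by
  have hsI : s ∈ Icc (0 : ℝ) 1 := ⟨hs, hst.trans ht⟩
  have hV := (hasWeakDeriv_fwd a).mono hs ht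
  have hW := hV.clm ((ContinuousLinearMap.mul ℝ R).flip (bwd a (projI s)))
  simp only [ContinuousLinearMap.flip_apply, ContinuousLinearMap.mul_apply'] at hW
  -- `V(r) Z(s)` solves the same equation and equals `1` at `r = s`, so the difference solves a
  -- homogeneous equation with initial value zero.
  have h0 : ∀ r ∈ Icc s t, P r - fwd a (projI r) * bwd a (projI s) = 0 := by
    refine linear_unique (A := fun t => -(ContinuousLinearMap.mul ℝ R (a t))) hs ht ?_
      (hP.sub hW.continuousOn) fun r hr => ?_
    · have := (-(ContinuousLinearMap.mul ℝ R)).comp_memLp' (Lp.memLp a)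
      exact this.mono_measure (Measure.restrict_mono (Icc_subset_Icc hs ht) le_rfl)
    · have e0 := hW.2 r hr
      dsimp only at e0
      rw [h r hr, e0]
      have e1 : fwd a (projI s) * bwd a (projI s) = 1 := fwd_mul_bwd a _
      rw [e1, sub_add_eq_sub_sub, sub_sub_cancel_left, ← intervalIntegral.integral_neg,
        ← intervalIntegral.integral_sub]
      · congr 1
        ext x
        simp only [ContinuousLinearMap.mul_apply', neg_apply]
        noncomm_ring
      · have hm : MemLp a 2 (volume.restrict (Icc s t)) :=
          (Lp.memLp a).mono_measure (Measure.restrict_mono (Icc_subset_Icc hs ht) le_rfl)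
        have hA : ContinuousOn (fun t => (ContinuousLinearMap.mul ℝ R).flip (P t)) (Icc s t) :=
          (ContinuousLinearMap.mul ℝ R).flip.continuous.comp_continuousOn hP
        exact (MemLp.intervalIntegrable (memLp_clm_apply hA hm) ⟨le_rfl, hst⟩ hr).neg
      · exact hW.intervalIntegrable ⟨le_rfl, hst⟩ hr
  exact sub_eq_zero.mp (h0 t ⟨hst, le_rfl⟩)

/-- The linearized equation `w' = -Aw - A'V`. The initial value of `V` does not depend on the
parameter, so `w` starts at zero. -/
theorem hasDerivAt_fwd {A : ℝ → L2 R} {A' : L2 R} {s : ℝ} (hA : HasDerivAt A A' s) :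
    ∃ w : C(unitInterval, R), HasDerivAt (fun r => fwd (A r)) w s ∧
      w 0 = 0 ∧ HasWeakDeriv (fun t => w (projI t))
        (fun t => -(A s t * w (projI t)) - A' t * fwd (A s) (projI t)) 0 1 := by
  set L := (-ContinuousLinearMap.mul ℝ R).compLpL 2 volI with hL
  have hLA : HasDerivAt (fun r => L (A r)) (L A') s := L.hasFDerivAt.comp_hasDerivAt s hA
  obtain ⟨w, hw, hw'⟩ := hasDerivAt_linSolve hLA (1 : R)
  have key : ∀ t : unitInterval, w t =
      ∫ r in (0 : ℝ)..t, (-(A s r * w (projI r)) - A' r * fwd (A s) (projI r)) := by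
    intro t
    have h1 := DFunLike.congr_fun hw' t
    rw [ContinuousMap.add_apply, volterra_apply, volterra_apply,
      ← intervalIntegral.integral_add] at h1
    · refine h1.trans (L2.integral_congr ?_ (by simp) t.2)
      filter_upwards [(-ContinuousLinearMap.mul ℝ R).coeFn_compLpL (p := 2) (μ := volI) A',
        (-ContinuousLinearMap.mul ℝ R).coeFn_compLpL (p := 2) (μ := volI) (A s)] with r h2 h3
      rw [hL, h2, h3]
      simp only [neg_apply, ContinuousLinearMap.mul_apply', fwd]
      abel
    · exact MemLp.intervalIntegrable
        (memLp_bilin (ContinuousLinearMap.id ℝ (R →L[ℝ] R)).flip _ (L A')) (by simp) t.2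
    · exact MemLp.intervalIntegrable
        (memLp_bilin (ContinuousLinearMap.id ℝ (R →L[ℝ] R)).flip _ (L (A s))) (by simp) t.2
  have h0 : w 0 = 0 := by simpa using key 0
  refine ⟨w, hw, h0, ?_, fun t ht => ?_⟩
  · exact (memLp_mul_left (continuousOn_comp_projI _)).neg.sub
      (memLp_mul_left (continuousOn_comp_projI _))
  · dsimp only
    rw [show projI (0 : ℝ) = 0 from projI_coe 0, h0, zero_add, projI_of_mem ht, key]

end Transport

/-! ### Matrix-valued 1-forms and the variation of parallel transport -/

section Forms

universe u

variable {Q R S : Type u} [NormedAddCommGroup Q] [NormedSpace ℝ Q] [NormedRing R]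
  [NormedAlgebra ℝ R] [NormedAddCommGroup S] [NormedSpace ℝ S]

/-- The curvature `dθ + θ ∧ θ` of a 1-form with values in an algebra. -/
def curv (θ : Q → Q →L[ℝ] R) (x v w : Q) : R :=
  fderiv ℝ θ x v w - fderiv ℝ θ x w v + (θ x v * θ x w - θ x w * θ x v)

/-- The function `t ↦ θ(c(t)) (p(t))`. -/
def contract (θ : Q → Q →L[ℝ] S) (c : C(unitInterval, Q)) (p : L2 Q) : L2 S :=
  bilinL2 (ContinuousLinearMap.id ℝ (Q →L[ℝ] S)) (superpos θ c) p

theorem coeFn_contract {θ : Q → Q →L[ℝ] S} {c : C(unitInterval, Q)}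
    (h : ∀ t, ContinuousAt θ (c t)) (p : L2 Q) :
    contract θ c p =ᵐ[volI] fun t => θ (c (projI t)) (p t) := by
  filter_upwards [coeFn_bilinL2 (ContinuousLinearMap.id ℝ (Q →L[ℝ] S)) (superpos θ c) p] with t ht
  rw [contract, ht, superpos_apply h]
  rfl

theorem contDiffAt_contract {P : Type*} [NormedAddCommGroup P] [NormedSpace ℝ P]
    {θ : Q → Q →L[ℝ] S} {c : P → C(unitInterval, Q)} {p : P → L2 Q} {ξ : P}
    (hc : ContDiffAt ℝ ∞ c ξ) (hp : ContDiffAt ℝ ∞ p ξ) (hθ : ∀ t, ContDiffAt ℝ ∞ θ (c ξ t)) :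
    ContDiffAt ℝ ∞ (fun ζ => contract θ (c ζ) (p ζ)) ξ := by
  have h1 : ContDiffAt ℝ ∞ (fun ζ => superpos θ (c ζ)) ξ := (contDiffAt_superpos hθ).comp ξ hc
  have h2 := (bilinL2 (ContinuousLinearMap.id ℝ (Q →L[ℝ] S))).contDiff.contDiffAt.comp ξ h1
  exact h2.clm_apply hp

theorem hasDerivAt_contract {θ : Q → Q →L[ℝ] S} {c δ : C(unitInterval, Q)} {p δp : L2 Q}
    (hθ : ∀ t, ContDiffAt ℝ 1 θ (c t)) :
    ∃ D : L2 S, HasDerivAt (fun s : ℝ => contract θ (c + s • δ) (p + s • δp)) D 0 ∧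
      D =ᵐ[volI] fun t => fderiv ℝ θ (c (projI t)) (δ (projI t)) (p t) +
        θ (c (projI t)) (δp t) := by
  have hc : HasDerivAt (fun s : ℝ => c + s • δ) δ 0 := by
    simpa using ((hasDerivAt_id (0 : ℝ)).smul_const δ).const_add c
  have hp : HasDerivAt (fun s : ℝ => p + s • δp) δp 0 := by
    simpa using ((hasDerivAt_id (0 : ℝ)).smul_const δp).const_add p
  have h1 : HasDerivAt (fun s : ℝ => superpos θ (c + s • δ))
      (applyC _ _ _ (superpos (fderiv ℝ θ) c) δ) 0 := by
    exact (hasFDerivAt_superpos hθ).comp_hasDerivAt_of_eq 0 hc (by simp)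
  have h2 := ((bilinL2 (ContinuousLinearMap.id ℝ (Q →L[ℝ] S))).hasFDerivAt.comp_hasDerivAt 0
    h1).clm_apply hp
  refine ⟨_, h2, ?_⟩
  simp only [zero_smul, add_zero]
  refine (Lp.coeFn_add _ _).trans ?_
  filter_upwards [coeFn_bilinL2 (ContinuousLinearMap.id ℝ (Q →L[ℝ] S))
      (applyC _ _ _ (superpos (fderiv ℝ θ) c) δ) p,
    coeFn_bilinL2 (ContinuousLinearMap.id ℝ (Q →L[ℝ] S)) (superpos θ c) δp] with t ht ht'
  simp only [Function.comp_apply, zero_smul, add_zero] at ht ht' ⊢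
  rw [Pi.add_apply, ht, ht', superpos_apply fun t => (hθ t).continuousAt, applyC_apply,
    superpos_apply fun t => (hθ t).continuousAt_fderiv one_ne_zero]
  rfl

/-- The variation of parallel transport. -/
theorem hasDerivAt_fwd_contract [CompleteSpace Q] [CompleteSpace R] {θ : Q → Q →L[ℝ] R}
    {c δ : C(unitInterval, Q)} {p δp : L2 Q} (hθ : ∀ t, ContDiffAt ℝ 1 θ (c t))
    (hc : HasWeakDeriv (fun t => c (projI t)) p 0 1)
    (hδ : HasWeakDeriv (fun t => δ (projI t)) δp 0 1) :
    ∃ w : C(unitInterval, R),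
      HasDerivAt (fun s : ℝ => fwd (contract θ (c + s • δ) (p + s • δp))) w 0 ∧
      ∀ t : unitInterval, w t = -(θ (c t) (δ t) * fwd (contract θ c p) t) +
        fwd (contract θ c p) t * θ (c 0) (δ 0) - fwd (contract θ c p) t *
          ∫ s in (0 : ℝ)..t, bwd (contract θ c p) (projI s) *
            curv θ (c (projI s)) (δ (projI s)) (p s) * fwd (contract θ c p) (projI s) := by
  obtain ⟨D, hD, hD'⟩ := hasDerivAt_contract (δ := δ) (p := p) (δp := δp) hθ
  obtain ⟨w, hw, hw0, hw'⟩ := hasDerivAt_fwd hD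
  refine ⟨w, hw, fun t => ?_⟩
  simp only [zero_smul, add_zero] at hw'
  set a := contract θ c p with ha
  have ha' := coeFn_contract (fun t => (hθ t).continuousAt) p
  rw [← ha] at ha'
  have hθc : HasWeakDeriv (fun t => θ (c (projI t))) _ 0 1 := hc.comp fun t _ => hθ (projI t)
  have hθδ := hθc.bilin hδ (ContinuousLinearMap.id ℝ (Q →L[ℝ] R))
  -- The integration by parts. The variation of the coefficient is `Dθ(δ)ċ + θ(δ̇)`; adding `θ(δ)V`
  -- to `w` cancels `θ(δ̇)V`, exchanges `δ` and `ċ` in the remaining derivative of `θ`, and produces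
  -- the commutator. The derivative of `Z(w + θ(δ)V)` is therefore minus the conjugated curvature.
  have hY := (hasWeakDeriv_bwd a).mul (hw'.add (hθδ.mul (hasWeakDeriv_fwd a)))
  have hY' := hY.congr_ae (v := fun s => -(bwd a (projI s) *
      curv θ (c (projI s)) (δ (projI s)) (p s) * fwd a (projI s))) <| by
    filter_upwards [ha', hD'] with s h1 h2
    simp only [ContinuousLinearMap.id_apply, h1, h2, curv]
    noncomm_ring
  have h3 := hY'.2 t t.2
  dsimp only at h3
  rw [projI_coe, show projI (0 : ℝ) = 0 from projI_coe 0, fwd_zero, bwd_zero, hw0,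
    intervalIntegral.integral_neg] at h3
  simp only [ContinuousLinearMap.id_apply, one_mul, zero_add, mul_one] at h3
  -- Multiplication by `V = Z⁻¹` on the left recovers `w`.
  have h4 := congrArg (fun x => fwd a t * x) h3
  simp only [← mul_assoc, fwd_mul_bwd, one_mul, mul_add, mul_neg] at h4
  rw [eq_sub_iff_add_eq.mpr h4]
  noncomm_ring

end Forms

/-! ### Calculus in coordinate charts -/

section Charts

variable {d : ℕ} {M : Type*} [TopologicalSpace M] [ChartedSpace (EV d) M]

/-- The differential of a chart. -/
def dchart (φ : OpenPartialHomeomorph M (EV d)) (x : M) : EV d →L[ℝ] EV d :=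
  mfderiv (𝓡 d) 𝓘(ℝ, EV d) φ x

/-- The differential of the inverse of a chart. -/
def dsymm (φ : OpenPartialHomeomorph M (EV d)) (y : EV d) : EV d →L[ℝ] EV d :=
  mfderiv 𝓘(ℝ, EV d) (𝓡 d) φ.symm y

variable [IsManifold (𝓡 d) ∞ M] {φ ψ : OpenPartialHomeomorph M (EV d)}

theorem isChart_chartAt (x : M) : IsChart (chartAt (EV d) x) :=
  IsManifold.chart_mem_maximalAtlas x

theorem IsChart.contMDiffAt (hφ : IsChart φ) {x : M} (hx : x ∈ φ.source) :
    ContMDiffAt (𝓡 d) 𝓘(ℝ, EV d) ∞ φ x :=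
  contMDiffAt_of_mem_maximalAtlas hφ hx

theorem IsChart.contMDiffAt_symm (hφ : IsChart φ) {y : EV d} (hy : y ∈ φ.target) :
    ContMDiffAt 𝓘(ℝ, EV d) (𝓡 d) ∞ φ.symm y :=
  contMDiffAt_symm_of_mem_maximalAtlas hφ hy

theorem IsChart.mdifferentiableAt (hφ : IsChart φ) {x : M} (hx : x ∈ φ.source) :
    MDifferentiableAt (𝓡 d) 𝓘(ℝ, EV d) φ x :=
  (hφ.contMDiffAt hx).mdifferentiableAt (by simp)

theorem IsChart.mdifferentiableAt_symm (hφ : IsChart φ) {y : EV d} (hy : y ∈ φ.target) :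
    MDifferentiableAt 𝓘(ℝ, EV d) (𝓡 d) φ.symm y :=
  (hφ.contMDiffAt_symm hy).mdifferentiableAt (by simp)

theorem IsChart.dsymm_dchart (hφ : IsChart φ) {x : M} (hx : x ∈ φ.source) (v : EV d) :
    dsymm φ (φ x) (dchart φ x v) = v := by
  have h1 := (hφ.mdifferentiableAt_symm (φ.map_source hx)).hasMFDerivAt.comp x
    (hφ.mdifferentiableAt hx).hasMFDerivAt
  have h2 : HasMFDerivAt (𝓡 d) (𝓡 d) (φ.symm ∘ φ) x
      (ContinuousLinearMap.id ℝ (TangentSpace (𝓡 d) x)) := by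
    refine (hasMFDerivAt_id x).congr_of_eventuallyEq ?_
    filter_upwards [φ.open_source.mem_nhds hx] with z hz using φ.left_inv hz
  exact DFunLike.congr_fun (hasMFDerivAt_unique h1 h2) v

theorem IsChart.dchart_dsymm (hφ : IsChart φ) {y : EV d} (hy : y ∈ φ.target) (v : EV d) :
    dchart φ (φ.symm y) (dsymm φ y v) = v := by
  have h1 := (hφ.mdifferentiableAt (φ.map_target hy)).hasMFDerivAt.comp y
    (hφ.mdifferentiableAt_symm hy).hasMFDerivAt
  have h2 : HasMFDerivAt 𝓘(ℝ, EV d) 𝓘(ℝ, EV d) (φ ∘ φ.symm) y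
      (ContinuousLinearMap.id ℝ (TangentSpace 𝓘(ℝ, EV d) y)) := by
    refine (hasMFDerivAt_id y).congr_of_eventuallyEq ?_
    filter_upwards [φ.open_target.mem_nhds hy] with z hz using φ.right_inv hz
  exact DFunLike.congr_fun (hasMFDerivAt_unique h1 h2) v

theorem IsChart.dchart_dsymm' (hφ : IsChart φ) {x : M} (hx : x ∈ φ.source) (v : EV d) :
    dchart φ x (dsymm φ (φ x) v) = v := by
  have h := hφ.dchart_dsymm (φ.map_source hx) v
  rwa [φ.left_inv hx] at h

/-- The differential of a chart, as an isomorphism. -/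
def dchartEquiv (hφ : IsChart φ) {x : M} (hx : x ∈ φ.source) : EV d ≃L[ℝ] EV d :=
  ContinuousLinearEquiv.equivOfInverse (dchart φ x) (dsymm φ (φ x)) (hφ.dsymm_dchart hx)
    (hφ.dchart_dsymm' hx)

theorem contDiffAt_transition (hφ : IsChart φ) (hψ : IsChart ψ) {y : EV d} (hy : y ∈ φ.target)
    (hy' : φ.symm y ∈ ψ.source) : ContDiffAt ℝ ∞ (fun z => ψ (φ.symm z)) y :=
  contMDiffAt_iff_contDiffAt.mp ((hψ.contMDiffAt hy').comp y (hφ.contMDiffAt_symm hy))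

theorem fderiv_transition (hφ : IsChart φ) (hψ : IsChart ψ) {y : EV d} (hy : y ∈ φ.target)
    (hy' : φ.symm y ∈ ψ.source) (v : EV d) :
    fderiv ℝ (fun z => ψ (φ.symm z)) y v = dchart ψ (φ.symm y) (dsymm φ y v) := by
  have h1 := (hψ.mdifferentiableAt hy').hasMFDerivAt.comp y
    (hφ.mdifferentiableAt_symm hy).hasMFDerivAt
  have h2 : HasFDerivAt (ψ ∘ φ.symm) ((dchart ψ (φ.symm y)).comp (dsymm φ y)) y :=
    hasMFDerivAt_iff_hasFDerivAt.mp h1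
  exact DFunLike.congr_fun h2.fderiv v

theorem dsymm_transition (hφ : IsChart φ) (hψ : IsChart ψ) {y : EV d} (hy : y ∈ φ.target)
    (hy' : φ.symm y ∈ ψ.source) (v : EV d) :
    dsymm ψ (ψ (φ.symm y)) (fderiv ℝ (fun z => ψ (φ.symm z)) y v) = dsymm φ y v := by
  rw [fderiv_transition hφ hψ hy hy', hψ.dsymm_dchart hy']

theorem dchart_transition (hφ : IsChart φ) (hψ : IsChart ψ) {x : M} (hx : x ∈ φ.source)
    (hx' : x ∈ ψ.source) (v : EV d) :
    fderiv ℝ (fun z => ψ (φ.symm z)) (φ x) (dchart φ x v) = dchart ψ x v := by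
  have h := fderiv_transition hφ hψ (φ.map_source hx) (by rwa [φ.left_inv hx]) (dchart φ x v)
  rwa [φ.left_inv hx, hφ.dsymm_dchart hx] at h

/-- The identification of `T_xM` with `ℝ^d` is by definition the one given by the preferred chart at
`x`. -/
theorem dchart_chartAt_self (x : M) (v : EV d) : dchart (chartAt (EV d) x) x v = v :=
  DFunLike.congr_fun (mfderiv_extChartAt_self (I := 𝓡 d) (x := x)) v

theorem hasDerivAt_chart_comp (hφ : IsChart φ) {c : ℝ → M} {t : ℝ} (hc : c t ∈ φ.source)
    (h : MDifferentiableAt 𝓘(ℝ, ℝ) (𝓡 d) c t) :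
    HasDerivAt (fun r => φ (c r)) (dchart φ (c t) (mfderiv 𝓘(ℝ, ℝ) (𝓡 d) c t (1 : ℝ))) t := by
  have h1 := (hφ.mdifferentiableAt hc).hasMFDerivAt.comp t h.hasMFDerivAt
  have h2 : HasFDerivAt (fun r => φ (c r))
      ((dchart φ (c t)).comp (show ℝ →L[ℝ] EV d from mfderiv 𝓘(ℝ, ℝ) (𝓡 d) c t)) t :=
    hasMFDerivAt_iff_hasFDerivAt.mp h1
  exact h2.hasDerivAt

theorem mdifferentiableAt_of_chart (hφ : IsChart φ) {c : ℝ → M} {t : ℝ} (hc : ContinuousAt c t)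
    (hs : c t ∈ φ.source) {u : EV d} (h : HasDerivAt (fun r => φ (c r)) u t) :
    MDifferentiableAt 𝓘(ℝ, ℝ) (𝓡 d) c t := by
  have h1 : MDifferentiableAt 𝓘(ℝ, ℝ) (𝓡 d) (φ.symm ∘ fun r => φ (c r)) t :=
    (hφ.mdifferentiableAt_symm (φ.map_source hs)).comp t
      (mdifferentiableAt_iff_differentiableAt.mpr h.differentiableAt)
  refine h1.congr_of_eventuallyEq ?_
  filter_upwards [hc.eventually_mem (φ.open_source.mem_nhds hs)] with r hr
  exact (φ.left_inv hr).symm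

/-! ### The metric in a chart -/

variable (g : RMetric d M)

theorem metricIn_apply (φ : OpenPartialHomeomorph M (EV d)) (y v w : EV d) :
    metricIn g φ y v w = g.inner (φ.symm y) (dsymm φ y v) (dsymm φ y w) := rfl

/-- Coordinate vector fields are smooth sections of `TM` along `φ.symm`, being the image of constant
fields under the tangent map. Evaluating the smooth metric on two of them gives a smooth function,
and finite dimension passes from values to the bilinear form. -/
theorem contDiffOn_metricIn (hφ : IsChart φ) : ContDiffOn ℝ ∞ (metricIn g φ) φ.target := by
  have hsec : ∀ v : EV d, ContMDiffOn 𝓘(ℝ, EV d) ((𝓡 d).prod 𝓘(ℝ, EV d)) ∞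
      (fun y => TotalSpace.mk' (EV d) (E := fun x : M => TangentSpace (𝓡 d) x) (φ.symm y)
        (dsymm φ y v)) φ.target := by
    intro v
    have h1 := (contMDiffOn_symm_of_mem_maximalAtlas hφ).contMDiffOn_tangentMapWithin
      (m := ∞) (by simp) φ.open_target.uniqueMDiffOn
    have h2 : ContMDiff 𝓘(ℝ, EV d) ((𝓘(ℝ, EV d)).prod 𝓘(ℝ, EV d)) ∞
        (fun y : EV d => (⟨y, v⟩ : TangentBundle 𝓘(ℝ, EV d) (EV d))) := by
      intro y
      rw [contMDiffAt_totalSpace]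
      refine ⟨contMDiffAt_id, ?_⟩
      simpa using contMDiffAt_const
    refine (h1.comp h2.contMDiffOn fun y hy => hy).congr fun y hy => ?_
    simp only [Function.comp_apply, tangentMapWithin]
    rw [mfderivWithin_of_isOpen φ.open_target hy]
    rfl
  have happ : ∀ v w : EV d, ContDiffOn ℝ ∞ (fun y => metricIn g φ y v w) φ.target := by
    intro v w
    have hg : ContMDiffOn 𝓘(ℝ, EV d) ((𝓡 d).prod 𝓘(ℝ, EV d →L[ℝ] EV d →L[ℝ] ℝ)) ∞
        (fun y => TotalSpace.mk' (EV d →L[ℝ] EV d →L[ℝ] ℝ)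
          (E := fun x : M => (TangentSpace (𝓡 d) x →L[ℝ] TangentSpace (𝓡 d) x →L[ℝ] ℝ))
          (φ.symm y) (g.inner (φ.symm y))) φ.target :=
      g.contMDiff.comp_contMDiffOn (contMDiffOn_symm_of_mem_maximalAtlas hφ)
    have h := ContMDiffOn.clm_bundle_apply₂ (F₁ := EV d) (F₂ := EV d) (F₃ := ℝ)
      (E₃ := Bundle.Trivial M ℝ) hg (hsec v) (hsec w)
    intro y hy
    have h3 := h y hy
    rw [contMDiffWithinAt_totalSpace] at h3
    exact contMDiffWithinAt_iff_contDiffWithinAt.mp h3.2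
  exact contDiffOn_clm_apply.mpr fun v => contDiffOn_clm_apply.mpr fun w => happ v w

theorem contDiffAt_metricIn (hφ : IsChart φ) {y : EV d} (hy : y ∈ φ.target) :
    ContDiffAt ℝ ∞ (metricIn g φ) y :=
  (contDiffOn_metricIn g hφ).contDiffAt (φ.open_target.mem_nhds hy)

theorem metricIn_symm (φ : OpenPartialHomeomorph M (EV d)) (y v w : EV d) :
    metricIn g φ y v w = metricIn g φ y w v := g.symm _ _ _

theorem metricIn_pos (hφ : IsChart φ) {y : EV d} (hy : y ∈ φ.target) {v : EV d} (hv : v ≠ 0) :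
    0 < metricIn g φ y v v := by
  refine g.pos (φ.symm y) (dsymm φ y v) fun h => hv ?_
  have h1 := hφ.dchart_dsymm hy v
  rw [show dsymm φ y v = 0 from h, map_zero] at h1
  exact h1.symm

/-- A positive definite bilinear form, as an isomorphism onto the dual space. -/
def posEquiv (G : EV d →L[ℝ] EV d →L[ℝ] ℝ) (h : ∀ v, v ≠ 0 → 0 < G v v) :
    EV d ≃L[ℝ] (EV d →L[ℝ] ℝ) :=
  (LinearEquiv.ofInjectiveOfFinrankEq (G : EV d →ₗ[ℝ] EV d →L[ℝ] ℝ) (by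
    rw [← LinearMap.ker_eq_bot, LinearMap.ker_eq_bot']
    intro v hv
    by_contra hne
    have h1 := h v hne
    have h2 : G v = 0 := hv
    rw [h2] at h1
    simp at h1) (by
      rw [LinearEquiv.finrank_eq (LinearMap.toContinuousLinearMap (𝕜 := ℝ) (E := EV d) (F' := ℝ)).symm,
        Subspace.dual_finrank_eq])).toContinuousLinearEquiv

theorem posEquiv_coe (G : EV d →L[ℝ] EV d →L[ℝ] ℝ) (h : ∀ v, v ≠ 0 → 0 < G v v) :
    (posEquiv G h : EV d →L[ℝ] (EV d →L[ℝ] ℝ)) = G := by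
  ext v w
  rfl

theorem metricIn_isInvertible (hφ : IsChart φ) {y : EV d} (hy : y ∈ φ.target) :
    (metricIn g φ y).IsInvertible :=
  ⟨posEquiv _ fun _ hv => metricIn_pos g hφ hy hv, posEquiv_coe _ _⟩

theorem metricIn_transition (hφ : IsChart φ) (hψ : IsChart ψ) {y : EV d} (hy : y ∈ φ.target)
    (hy' : φ.symm y ∈ ψ.source) (v w : EV d) :
    metricIn g φ y v w = metricIn g ψ (ψ (φ.symm y)) (fderiv ℝ (fun z => ψ (φ.symm z)) y v)
      (fderiv ℝ (fun z => ψ (φ.symm z)) y w) := by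
  rw [metricIn_apply, metricIn_apply, dsymm_transition hφ hψ hy hy', dsymm_transition hφ hψ hy hy']
  have h : ∀ x x' : M, x = x' → ∀ v w : EV d, g.inner x v w = g.inner x' v w := by
    rintro x _ rfl v w; rfl
  exact h _ _ (ψ.left_inv hy').symm _ _

set_option synthInstance.maxHeartbeats 400000 in
/-- The transformation law of the Christoffel symbols. -/
theorem christoffel_transition (hφ : IsChart φ) (hψ : IsChart ψ) {y : EV d} (hy : y ∈ φ.target)
    (hy' : φ.symm y ∈ ψ.source) (v z : EV d) :
    christoffel g φ y v v z =
      christoffel g ψ (ψ (φ.symm y)) (fderiv ℝ (fun z => ψ (φ.symm z)) y v)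
        (fderiv ℝ (fun z => ψ (φ.symm z)) y v) (fderiv ℝ (fun z => ψ (φ.symm z)) y z) +
      metricIn g ψ (ψ (φ.symm y)) (fderiv ℝ (fderiv ℝ (fun z => ψ (φ.symm z))) y v v)
        (fderiv ℝ (fun z => ψ (φ.symm z)) y z) := by
  set θ := fun z => ψ (φ.symm z) with hθ
  have hθd : ContDiffAt ℝ ∞ θ y := contDiffAt_transition hφ hψ hy hy'
  have hsymm : ∀ u w, fderiv ℝ (fderiv ℝ θ) y u w = fderiv ℝ (fderiv ℝ θ) y w u := fun u w =>
    (hθd.isSymmSndFDerivAt (by simpa using ENat.LEInfty.out)).eq u w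
  have hD : HasFDerivAt (fderiv ℝ θ) (fderiv ℝ (fderiv ℝ θ) y) y :=
    ((hθd.fderiv_right (m := ∞) (by simp)).differentiableAt (by simp)).hasFDerivAt
  have hG : HasFDerivAt (metricIn g ψ) (fderiv ℝ (metricIn g ψ) (θ y)) (θ y) :=
    ((contDiffAt_metricIn g hψ (ψ.map_source hy')).differentiableAt (by simp)).hasFDerivAt
  have hGθ : HasFDerivAt (fun y => metricIn g ψ (θ y))
      ((fderiv ℝ (metricIn g ψ) (θ y)).comp (fderiv ℝ θ y)) y :=
    HasFDerivAt.comp (g := metricIn g ψ) y hG (hθd.differentiableAt (by simp)).hasFDerivAt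
  have hGφ : HasFDerivAt (metricIn g φ) (fderiv ℝ (metricIn g φ) y) y :=
    ((contDiffAt_metricIn g hφ hy).differentiableAt (by simp)).hasFDerivAt
  have key : ∀ u v w, fderiv ℝ (metricIn g φ) y u v w =
      fderiv ℝ (metricIn g ψ) (θ y) (fderiv ℝ θ y u) (fderiv ℝ θ y v) (fderiv ℝ θ y w) +
      metricIn g ψ (θ y) (fderiv ℝ (fderiv ℝ θ) y u v) (fderiv ℝ θ y w) +
      metricIn g ψ (θ y) (fderiv ℝ θ y v) (fderiv ℝ (fderiv ℝ θ) y u w) := by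
    intro u v w
    have hv : HasFDerivAt (fun y => fderiv ℝ θ y v) _ y := hD.clm_apply (hasFDerivAt_const v y)
    have hw : HasFDerivAt (fun y => fderiv ℝ θ y w) _ y := hD.clm_apply (hasFDerivAt_const w y)
    have h1 := (hGθ.clm_apply hv).clm_apply hw
    have h2 := (hGφ.clm_apply (hasFDerivAt_const v y)).clm_apply (hasFDerivAt_const w y)
    have h3 : (fun y => metricIn g φ y v w) =ᶠ[𝓝 y]
        fun y => metricIn g ψ (θ y) (fderiv ℝ θ y v) (fderiv ℝ θ y w) := by
      have hc : ContinuousAt φ.symm y := φ.symm.continuousAt hy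
      filter_upwards [φ.open_target.mem_nhds hy,
        hc.eventually_mem (ψ.open_source.mem_nhds hy')] with z hz hz'
      exact metricIn_transition g hφ hψ hz hz' v w
    have h4 := DFunLike.congr_fun (h2.unique (h1.congr_of_eventuallyEq h3)) u
    simp at h4
    rw [h4]
    ring
  -- By the symmetry of `D²θ`, the terms pairing `D²θ(v, z)` with `Dθ v` cancel in this combination;
  -- only `D²θ(v, v)` paired with `Dθ z` survives.
  unfold christoffel
  rw [key, key, hsymm z v]
  rw [metricIn_symm g ψ (θ y) (fderiv ℝ (fderiv ℝ θ) y v z) (fderiv ℝ θ y v)]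
  ring

end Charts

/-! ### Norms on spaces of linear and bilinear maps. -/

section Instances

variable {V W F : Type*} [NormedAddCommGroup V] [NormedSpace ℝ V] [NormedAddCommGroup W]
    [NormedSpace ℝ W] [NormedAddCommGroup F] [NormedSpace ℝ F]

instance : NormedAddCommGroup (W →L[ℝ] F) := ContinuousLinearMap.toNormedAddCommGroup

instance : SeminormedAddCommGroup (W →L[ℝ] F) := ContinuousLinearMap.toSeminormedAddCommGroup

instance : NormedSpace ℝ (W →L[ℝ] F) := ContinuousLinearMap.toNormedSpace

instance : NormedAddCommGroup (V →L[ℝ] W →L[ℝ] F) := ContinuousLinearMap.toNormedAddCommGroup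

instance : SeminormedAddCommGroup (V →L[ℝ] W →L[ℝ] F) :=
  ContinuousLinearMap.toSeminormedAddCommGroup

instance : NormedSpace ℝ (V →L[ℝ] W →L[ℝ] F) := ContinuousLinearMap.toNormedSpace

end Instances

/-- `L ↦ L.flip`, as a continuous linear map. -/
def flipC (V W F : Type*) [NormedAddCommGroup V] [NormedSpace ℝ V] [NormedAddCommGroup W]
    [NormedSpace ℝ W] [NormedAddCommGroup F] [NormedSpace ℝ F] :
    (V →L[ℝ] W →L[ℝ] F) →L[ℝ] (W →L[ℝ] V →L[ℝ] F) :=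
  LinearMap.mkContinuous
    { toFun := ContinuousLinearMap.flip
      map_add' := fun _ _ => rfl
      map_smul' := fun _ _ => rfl } 1 fun L => by
    rw [one_mul]; exact (ContinuousLinearMap.opNorm_flip L).le
theorem contDiffAt_flip {X V W F : Type*} [NormedAddCommGroup X] [NormedSpace ℝ X]
    [NormedAddCommGroup V] [NormedSpace ℝ V] [NormedAddCommGroup W] [NormedSpace ℝ W]
    [NormedAddCommGroup F] [NormedSpace ℝ F] {n : WithTop ℕ∞} {L : X → V →L[ℝ] W →L[ℝ] F} {x : X}
    (h : ContDiffAt ℝ n L x) : ContDiffAt ℝ n (fun x => (L x).flip) x := 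
  ContDiffAt.comp (g := flipC V W F) x (flipC V W F).contDiff.contDiffAt h

/-! ### Smooth dependence of solutions near an equilibrium -/

section Flow

variable {E : Type*} [NormedAddCommGroup E] [NormedSpace ℝ E]

variable (E) in
/-- Constant functions. -/
def constC : E →L[ℝ] C(unitInterval, E) :=
  LinearMap.mkContinuous
    { toFun := fun v => ContinuousMap.const _ v
      map_add' := fun v w => by ext; simp
      map_smul' := fun c v => by ext; simp } 1 fun v => by
    rw [ContinuousMap.norm_le _ (by positivity), one_mul]
    intro t
    simp

@[simp] theorem constC_apply (v : E) (t : unitInterval) : constC E v t = v := rfl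

/-- The midpoint of `[0, 1]`. -/
def midI : unitInterval := ⟨1 / 2, by norm_num, by norm_num⟩

variable (E) in
/-- The operator `w ↦ ∫₀ᵗ w` on continuous functions. -/
def primCC : C(unitInterval, E) →L[ℝ] C(unitInterval, E) :=
  LinearMap.mkContinuous
    { toFun := fun w => ⟨fun t => ∫ s in (0 : ℝ)..t, w (projI s),
        (intervalIntegral.continuous_primitive (fun a b =>
          (w.continuous.comp continuous_projIcc).intervalIntegrable a b) 0).comp
            continuous_subtype_val⟩
      map_add' := fun w w' => by
        ext t
        simp only [ContinuousMap.coe_mk, ContinuousMap.add_apply]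
        exact intervalIntegral.integral_add
          ((w.continuous.comp continuous_projIcc).intervalIntegrable _ _)
          ((w'.continuous.comp continuous_projIcc).intervalIntegrable _ _)
      map_smul' := fun c w => by
        ext t
        simp } 1 fun w => by
    rw [ContinuousMap.norm_le _ (by positivity), one_mul]
    intro t
    have h := intervalIntegral.norm_integral_le_of_norm_le_const (a := (0 : ℝ)) (b := t)
      (f := fun s => w (projI s)) (C := ‖w‖) fun s _ => w.norm_coe_le_norm _
    refine h.trans ?_
    rw [sub_zero, abs_of_nonneg t.2.1]
    exact mul_le_of_le_one_right (norm_nonneg _) t.2.2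

variable (E) in
/-- The operator `w ↦ ∫_{1/2}ᵗ w` on continuous functions. -/
def primMid : C(unitInterval, E) →L[ℝ] C(unitInterval, E) :=
  primCC E - (constC E).comp ((ContinuousMap.evalCLM ℝ midI).comp (primCC E))

theorem primMid_apply (w : C(unitInterval, E)) (t : unitInterval) :
    primMid E w t = (∫ s in (0 : ℝ)..t, w (projI s)) - ∫ s in (0 : ℝ)..(1 / 2), w (projI s) := rfl

variable [CompleteSpace E]

/-- The integral equation `w = z + ε ∫_{1/2} X(w)` is solved by the inverse function theorem in `E ×
C([0,1], E)`. Since `X z₀ = 0`, the constant path solves it at `z₀`, and the superposition operator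
makes the equation smooth. Starting at the midpoint gives solutions on both sides of the initial
time. -/
theorem exists_flow {X : E → E} {z₀ : E} (hX : ContDiffAt ℝ ∞ X z₀) (h0 : X z₀ = 0) :
    ∃ ε > (0 : ℝ), ∃ W : E → C(unitInterval, E), W z₀ = constC E z₀ ∧ ContDiffAt ℝ ∞ W z₀ ∧
      ∀ᶠ z in 𝓝 z₀, W z midI = z ∧ ∀ τ ∈ Ioo (0 : ℝ) 1,
        HasDerivAt (fun r => W z (projI r)) (ε • X (W z (projI τ))) τ := by
  set u₀ : C(unitInterval, E) := constC E z₀ with hu₀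
  have hX' : ∀ t, ContDiffAt ℝ ∞ X (u₀ t) := fun t => hX
  set T : C(unitInterval, E) →L[ℝ] C(unitInterval, E) :=
    (primMid E).comp (applyC _ _ _ (superpos (fderiv ℝ X) u₀)) with hT
  -- Slowing down the field makes the linearization `1 - εT` in the path variable invertible by the
  -- Neumann series.
  obtain ⟨ε, hε, hεT⟩ : ∃ ε > (0 : ℝ), ‖ε • T‖ < 1 := by
    refine ⟨1 / (‖T‖ + 1), by positivity, ?_⟩
    rw [norm_smul, Real.norm_of_nonneg (by positivity), one_div, inv_mul_lt_iff₀ (by positivity)]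
    linarith [norm_nonneg T]
  let Ψ : E × C(unitInterval, E) → E × C(unitInterval, E) := fun q =>
    (q.1, q.2 - constC E q.1 - ε • primMid E (superpos X q.2))
  have hsup : ContDiffAt ℝ ∞ (superpos X) u₀ := contDiffAt_superpos hX'
  have hΨ : ContDiffAt ℝ ∞ Ψ (z₀, u₀) := by
    refine contDiffAt_fst.prodMk ((contDiffAt_snd.sub ?_).sub ?_)
    · exact (constC E).contDiff.contDiffAt.comp _ contDiffAt_fst
    · refine ContDiffAt.const_smul ε ?_
      exact (primMid E).contDiff.contDiffAt.comp _ (hsup.comp (z₀, u₀) contDiffAt_snd)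
  let U : C(unitInterval, E) ≃L[ℝ] C(unitInterval, E) :=
    ContinuousLinearEquiv.unitsEquiv ℝ _ (Units.oneSub (R := C(unitInterval, E) →L[ℝ] C(unitInterval, E)) (ε • T) hεT)
  have hU : ∀ w, U w = w - ε • T w := fun w => rfl
  -- The derivative of `Ψ` is triangular with diagonal blocks `1` and `1 - εT`.
  let e : (E × C(unitInterval, E)) ≃L[ℝ] (E × C(unitInterval, E)) :=
    (ContinuousLinearEquiv.refl ℝ E).skewProd U (-constC E)
  have he : HasFDerivAt Ψ (e : (E × C(unitInterval, E)) →L[ℝ] (E × C(unitInterval, E)))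
      (z₀, u₀) := by
    have h1 : HasFDerivAt (superpos X) (applyC _ _ _ (superpos (fderiv ℝ X) u₀)) u₀ :=
      hasFDerivAt_superpos fun t => (hX' t).of_le (by simp)
    have h2 : HasFDerivAt (fun q : E × C(unitInterval, E) => superpos X q.2)
        ((applyC _ _ _ (superpos (fderiv ℝ X) u₀)).comp (ContinuousLinearMap.snd ℝ _ _)) (z₀, u₀) :=
      HasFDerivAt.comp (g := superpos X) (f := Prod.snd) (z₀, u₀) h1 hasFDerivAt_snd
    have h3 := ((primMid E).hasFDerivAt.comp (z₀, u₀) h2).const_smul ε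
    have h4 := hasFDerivAt_fst.prodMk ((hasFDerivAt_snd.sub
      ((constC E).hasFDerivAt.comp (z₀, u₀) hasFDerivAt_fst)).sub h3)
    refine h4.congr_fderiv ?_
    refine ContinuousLinearMap.ext fun q => Prod.ext rfl ?_
    change q.2 - constC E q.1 - ε • T q.2 = U q.2 + (-constC E) q.1
    rw [hU, neg_apply]
    abel
  have hΨ0 : Ψ (z₀, u₀) = (z₀, 0) := by
    refine Prod.ext rfl ?_
    have : superpos X u₀ = 0 := by
      ext t
      rw [superpos_apply fun t => (hX' t).continuousAt]
      exact h0
    change u₀ - constC E z₀ - ε • primMid E (superpos X u₀) = 0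
    rw [this, map_zero, smul_zero, sub_zero, hu₀, sub_self]
  set Λ := hΨ.localInverse he (by simp) with hΛ
  have hΛ0 : Λ (z₀, 0) = (z₀, u₀) := by
    rw [← hΨ0]; exact hΨ.localInverse_apply_image he (by simp)
  have hΛs : ContDiffAt ℝ ∞ Λ (z₀, 0) := by
    rw [← hΨ0]; exact hΨ.to_localInverse he (by simp)
  have hincl : ContDiffAt ℝ ∞ (fun z : E => (z, (0 : C(unitInterval, E)))) z₀ :=
    contDiffAt_id.prodMk contDiffAt_const
  have hWs : ContDiffAt ℝ ∞ (fun z => (Λ (z, 0)).2) z₀ :=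
    contDiffAt_snd.comp z₀ (ContDiffAt.comp (g := Λ) z₀ hΛs hincl)
  refine ⟨ε, hε, fun z => (Λ (z, 0)).2, by simp [hΛ0], hWs, ?_⟩
  have hri : ∀ᶠ q in 𝓝 (z₀, (0 : C(unitInterval, E))), Ψ (Λ q) = q := by
    have h := (hΨ.hasStrictFDerivAt' he (by simp)).eventually_right_inverse
    rw [hΨ0] at h
    exact h
  have hXc : ∀ t, ∀ᶠ x in 𝓝 (u₀ t), ContinuousAt X x := fun t =>
    (((hX' t).of_le (m := 1) (by simp)).eventually (by simp)).mono fun x hx => hx.continuousAt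
  have hev := eventually_forall_of_forall_eventually hXc
  have hWc : Filter.Tendsto (fun z => (Λ (z, 0)).2) (𝓝 z₀) (𝓝 u₀) := by
    have := hWs.continuousAt.tendsto
    simpa [hΛ0] using this
  filter_upwards [hincl.continuousAt.eventually hri, hWc.eventually hev] with z hz hzc
  have h1 : (Λ (z, 0)).1 = z := congrArg Prod.fst hz
  have h2 : (Λ (z, 0)).2 - constC E z - ε • primMid E (superpos X (Λ (z, 0)).2) = 0 := by
    have := congrArg Prod.snd hz
    simp only [Ψ, h1] at this
    exact this
  set w := (Λ (z, 0)).2 with hw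
  have h3 : ∀ t, w t = z + ε • ((∫ s in (0 : ℝ)..t, superpos X w (projI s)) -
      ∫ s in (0 : ℝ)..(1 / 2), superpos X w (projI s)) := by
    intro t
    have := DFunLike.congr_fun h2 t
    change w t - z - ε • primMid E (superpos X w) t = 0 at this
    rw [primMid_apply, sub_sub, sub_eq_zero] at this
    exact this
  have hcont : Continuous fun s => superpos X w (projI s) :=
    (superpos X w).continuous.comp continuous_projIcc
  refine ⟨?_, fun τ hτ => ?_⟩
  · rw [h3 midI]; simp [midI]
  · have h4 := ((hcont.integral_hasStrictDerivAt 0 τ).hasDerivAt.sub_const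
      (∫ s in (0 : ℝ)..(1 / 2), superpos X w (projI s))).const_smul ε |>.const_add z
    rw [superpos_apply hzc] at h4
    refine h4.congr_of_eventuallyEq ?_
    filter_upwards [isOpen_Ioo.mem_nhds hτ] with r hr
    have hr' := projI_of_mem (Ioo_subset_Icc_self hr)
    rw [hr', h3]
    rfl

end Flow

/-! ### Geodesics in a chart -/

section Geodesics

variable {d : ℕ} {M : Type*} [TopologicalSpace M] [ChartedSpace (EV d) M]
  [IsManifold (𝓡 d) ∞ M] {φ ψ : OpenPartialHomeomorph M (EV d)} (g : RMetric d M)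

/-- The Christoffel form `z ↦ Γ_{z,pp}`. -/
def chrForm (φ : OpenPartialHomeomorph M (EV d)) (z : EV d × EV d) : EV d →L[ℝ] ℝ :=
  fderiv ℝ (metricIn g φ) z.1 z.2 z.2 -
    (1 / 2 : ℝ) • ((fderiv ℝ (metricIn g φ) z.1).flip z.2).flip z.2

theorem chrForm_apply (z : EV d × EV d) (w : EV d) :
    chrForm g φ z w = christoffel g φ z.1 z.2 z.2 w := by
  simp only [chrForm, christoffel, sub_apply, smul_apply, ContinuousLinearMap.flip_apply,
    smul_eq_mul]
  ring

/-- The geodesic spray: geodesics are the solutions of `y'' = spray(y, y')`. -/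
def spray (φ : OpenPartialHomeomorph M (EV d)) (z : EV d × EV d) : EV d :=
  (metricIn g φ z.1).inverse (-chrForm g φ z)

theorem metricIn_spray (hφ : IsChart φ) {z : EV d × EV d} (hz : z.1 ∈ φ.target) (w : EV d) :
    metricIn g φ z.1 (spray g φ z) w = -christoffel g φ z.1 z.2 z.2 w := by
  rw [spray, ContinuousLinearMap.IsInvertible.self_apply_inverse (metricIn_isInvertible g hφ hz)]
  rw [neg_apply, chrForm_apply]

theorem eq_spray (hφ : IsChart φ) {z : EV d × EV d} (hz : z.1 ∈ φ.target) {a : EV d}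
    (h : ∀ w, metricIn g φ z.1 a w + christoffel g φ z.1 z.2 z.2 w = 0) : a = spray g φ z := by
  refine (metricIn_isInvertible g hφ hz).injective ?_
  ext w
  rw [metricIn_spray g hφ hz, eq_neg_iff_add_eq_zero]
  exact h w

/-- Quadratic homogeneity in the velocity is what makes `t ↦ Y(ct)` a geodesic again; it trades
short times for small initial velocities. -/
theorem spray_smul (y p : EV d) (c : ℝ) : spray g φ (y, c • p) = (c * c) • spray g φ (y, p) := by
  have : chrForm g φ (y, c • p) = (c * c) • chrForm g φ (y, p) := by
    ext w
    simp only [chrForm, map_smul, smul_apply, sub_apply, ContinuousLinearMap.flip_apply,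
      smul_eq_mul]
    ring
  have h2 : -chrForm g φ (y, c • p) = (c * c) • -chrForm g φ (y, p) := by
    rw [this]; exact (smul_neg _ _).symm
  unfold spray
  rw [h2]
  exact ContinuousLinearMap.map_smul _ _ _

theorem contDiffAt_spray (hφ : IsChart φ) {z : EV d × EV d} (hz : z.1 ∈ φ.target) :
    ContDiffAt ℝ ∞ (spray g φ) z := by
  have hG : ContDiffAt ℝ ∞ (fun z : EV d × EV d => metricIn g φ z.1) z :=
    (contDiffAt_metricIn g hφ hz).comp z contDiffAt_fst
  have hD : ContDiffAt ℝ ∞ (fun z : EV d × EV d => fderiv ℝ (metricIn g φ) z.1) z :=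
    ((contDiffAt_metricIn g hφ hz).fderiv_right (m := ∞) (by simp)).comp z contDiffAt_fst
  have hinv : ContDiffAt ℝ ∞ (fun z : EV d × EV d => (metricIn g φ z.1).inverse) z :=
    ContDiffAt.comp (g := ContinuousLinearMap.inverse) z
      (metricIn_isInvertible g hφ hz).contDiffAt_map_inverse hG
  refine hinv.clm_apply (ContDiffAt.neg ?_)
  unfold chrForm
  refine ((hD.clm_apply contDiffAt_snd).clm_apply contDiffAt_snd).sub (ContDiffAt.const_smul _ ?_)
  exact (contDiffAt_flip ((contDiffAt_flip hD).clm_apply contDiffAt_snd)).clm_apply contDiffAt_snd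

/-- `Y` is a geodesic with velocity `P`, in coordinates. -/
structure IsChartGeodesic (φ : OpenPartialHomeomorph M (EV d)) (Y P : ℝ → EV d) (S : Set ℝ) :
    Prop where
  mem : ∀ t ∈ S, Y t ∈ φ.target
  pos : ∀ t ∈ S, HasDerivAt Y (P t) t
  vel : ∀ t ∈ S, HasDerivAt P (spray g φ (Y t, P t)) t

variable {g}

theorem IsChartGeodesic.comp_mul {Y P : ℝ → EV d} {S S' : Set ℝ} (h : IsChartGeodesic g φ Y P S)
    (c : ℝ) (hS : ∀ t ∈ S', c * t ∈ S) :
    IsChartGeodesic g φ (fun t => Y (c * t)) (fun t => c • P (c * t)) S' := by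
  have hc : ∀ t : ℝ, HasDerivAt (fun t => c * t) c t := fun t => by
    simpa using (hasDerivAt_id t).const_mul c
  refine ⟨fun t ht => h.mem _ (hS t ht), fun t ht => ?_, fun t ht => ?_⟩
  · exact (h.pos _ (hS t ht)).scomp t (hc t)
  · rw [spray_smul, mul_smul]
    exact ((h.vel _ (hS t ht)).scomp t (hc t)).const_smul c

theorem IsChartGeodesic.contDiffOn {Y P : ℝ → EV d} {S : Set ℝ} (hS : IsOpen S)
    (hφ : IsChart φ) (h : IsChartGeodesic g φ Y P S) : ContDiffOn ℝ 2 Y S := by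
  have hP : ContDiffOn ℝ 1 P S := by
    rw [show (1 : WithTop ℕ∞) = 0 + 1 from (zero_add 1).symm,
      contDiffOn_succ_iff_deriv_of_isOpen hS]
    refine ⟨fun t ht => (h.vel t ht).differentiableAt.differentiableWithinAt, by simp, ?_⟩
    rw [contDiffOn_zero]
    have hc : ContinuousOn (fun t => spray g φ (Y t, P t)) S := fun t ht =>
      (ContinuousAt.comp (f := fun t => (Y t, P t)) (contDiffAt_spray g hφ (h.mem t ht)).continuousAt
        ((h.pos t ht).continuousAt.prodMk (h.vel t ht).continuousAt)).continuousWithinAt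
    exact hc.congr fun t ht => (h.vel t ht).deriv
  rw [show (2 : WithTop ℕ∞) = 1 + 1 from one_add_one_eq_two.symm,
    contDiffOn_succ_iff_deriv_of_isOpen hS]
  exact ⟨fun t ht => (h.pos t ht).differentiableAt.differentiableWithinAt, by simp,
    hP.congr fun t ht => (h.pos t ht).deriv⟩

/-- The definition demands the geodesic equation in every chart. The second derivative in `ψ`
acquires the term `D²θ(P, P)`, and the transformation law of the Christoffel symbols compensates
exactly for it. -/
theorem IsChartGeodesic.isGeodesicOn {Y P : ℝ → EV d} {S : Set ℝ} (hS : IsOpen S)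
    (hφ : IsChart φ) (h : IsChartGeodesic g φ Y P S) :
    IsGeodesicOn g (fun t => φ.symm (Y t)) S := by
  refine ⟨?_, fun ψ hψ t ht hts w => ?_⟩
  · have h1 : ContMDiffOn 𝓘(ℝ, ℝ) 𝓘(ℝ, EV d) 2 Y S :=
      contMDiffOn_iff_contDiffOn.mpr (h.contDiffOn hS hφ)
    exact ((contMDiffOn_symm_of_mem_maximalAtlas hφ).of_le (ENat.LEInfty.out)).comp h1 h.mem
  · set θ := fun z => ψ (φ.symm z) with hθ
    have hy := h.mem t ht
    have hθd : ContDiffAt ℝ ∞ θ (Y t) := contDiffAt_transition hφ hψ hy hts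
    have hev : ∀ᶠ r in 𝓝 t, r ∈ S ∧ φ.symm (Y r) ∈ ψ.source := by
      have hc : ContinuousAt (fun r => φ.symm (Y r)) t :=
        (φ.symm.continuousAt hy).comp (h.pos t ht).continuousAt
      exact (hS.eventually_mem ht).and (hc.eventually_mem (ψ.open_source.mem_nhds hts))
    have hd1 : (deriv fun r => θ (Y r)) =ᶠ[𝓝 t] fun r => fderiv ℝ θ (Y r) (P r) := by
      filter_upwards [hev] with r hr
      exact (((contDiffAt_transition hφ hψ (h.mem r hr.1) hr.2).differentiableAt
        (by simp)).hasFDerivAt.comp_hasDerivAt r (h.pos r hr.1)).deriv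
    have hD : HasFDerivAt (fderiv ℝ θ) (fderiv ℝ (fderiv ℝ θ) (Y t)) (Y t) :=
      ((hθd.fderiv_right (m := ∞) (by simp)).differentiableAt (by simp)).hasFDerivAt
    have hd2 : deriv (deriv fun r => θ (Y r)) t =
        fderiv ℝ (fderiv ℝ θ) (Y t) (P t) (P t) + fderiv ℝ θ (Y t) (spray g φ (Y t, P t)) := by
      rw [hd1.deriv_eq]
      exact ((hD.comp_hasDerivAt t (h.pos t ht)).clm_apply (h.vel t ht)).deriv
    change metricIn g ψ (θ (Y t)) (deriv (deriv fun r => θ (Y r)) t) w +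
      christoffel g ψ (θ (Y t)) (deriv (fun r => θ (Y r)) t) (deriv (fun r => θ (Y r)) t) w = 0
    rw [hd2, hd1.self_of_nhds]
    -- The differential of a transition map is onto, so it is enough to test against images of
    -- vectors.
    obtain ⟨z, rfl⟩ : ∃ z, fderiv ℝ θ (Y t) z = w := by
      refine ⟨dchart φ (φ.symm (Y t)) (dsymm ψ (θ (Y t)) w), ?_⟩
      have h1 := dchart_transition hφ hψ (φ.map_target hy) hts (dsymm ψ (θ (Y t)) w)
      rw [φ.right_inv hy] at h1
      rw [h1]
      exact hψ.dchart_dsymm' hts w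
    have e1 := christoffel_transition g hφ hψ hy hts (P t) z
    have e2 := metricIn_transition g hφ hψ hy hts (spray g φ (Y t, P t)) z
    have e3 := metricIn_spray g hφ (z := (Y t, P t)) hy z
    rw [e1, e2] at e3
    rw [map_add, add_apply]
    change _ + metricIn g ψ (θ (Y t)) (fderiv ℝ θ (Y t) (spray g φ (Y t, P t))) (fderiv ℝ θ (Y t) z) + _ = 0
    change metricIn g ψ (θ (Y t)) (fderiv ℝ θ (Y t) (spray g φ (Y t, P t))) (fderiv ℝ θ (Y t) z) =
      -(christoffel g ψ (θ (Y t)) (fderiv ℝ θ (Y t) (P t)) (fderiv ℝ θ (Y t) (P t))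
        (fderiv ℝ θ (Y t) z) + metricIn g ψ (θ (Y t)) (fderiv ℝ (fderiv ℝ θ) (Y t) (P t) (P t))
          (fderiv ℝ θ (Y t) z)) at e3
    rw [e3]
    ring

theorem IsChartGeodesic.isGeodesicFrom {Y P : ℝ → EV d} {δ : ℝ} (hδ : 0 < δ) (hφ : IsChart φ)
    (h : IsChartGeodesic g φ Y P (Ioo (-δ) (1 + δ))) :
    IsGeodesicFrom g (φ.symm (Y 0)) (dsymm φ (Y 0) (P 0)) (fun t => φ.symm (Y t)) := by
  have h0 : (0 : ℝ) ∈ Ioo (-δ) (1 + δ) := ⟨by linarith, by linarith⟩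
  refine ⟨rfl, ?_, δ, hδ, h.isGeodesicOn isOpen_Ioo hφ⟩
  set x := φ.symm (Y 0) with hx
  have hy := h.mem 0 h0
  have h1 := ((contDiffAt_transition hφ (isChart_chartAt x) hy (mem_chart_source _ x)).differentiableAt
    (by simp)).hasFDerivAt.comp_hasDerivAt 0 (h.pos 0 h0)
  rw [fderiv_transition hφ (isChart_chartAt x) hy (mem_chart_source _ x),
    dchart_chartAt_self] at h1
  exact h1

/-- The competitor `c` may a priori leave the chart. The times at which position and velocity agree
form an open set by uniqueness for the first order system, and a closed one because `M` is
Hausdorff; `interval_induction` propagates the agreement from `0` to `1`. -/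
theorem IsGeodesicFrom.eqOn [T2Space M] (hφ : IsChart φ) {Y P : ℝ → EV d} {δ : ℝ} (hδ : 0 < δ)
    (h : IsChartGeodesic g φ Y P (Ioo (-δ) (1 + δ))) {c : ℝ → M}
    (hc : IsGeodesicFrom g (φ.symm (Y 0)) (dsymm φ (Y 0) (P 0)) c) :
    c 1 = φ.symm (Y 1) := by
  obtain ⟨hc0, hc1, δ', hδ', hgeo⟩ := hc
  set ρ := min δ δ' with hρ
  have hρ0 : 0 < ρ := lt_min hδ hδ'
  have hsub : Ioo (-ρ) (1 + ρ) ⊆ Ioo (-δ) (1 + δ) ∩ Ioo (-δ') (1 + δ') := fun t ht =>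
    ⟨⟨by linarith [ht.1, min_le_left δ δ'], by linarith [ht.2, min_le_left δ δ']⟩,
      ⟨by linarith [ht.1, min_le_right δ δ'], by linarith [ht.2, min_le_right δ δ']⟩⟩
  have hIcc : ∀ t ∈ Icc (0 : ℝ) 1, t ∈ Ioo (-ρ) (1 + ρ) := fun t ht =>
    ⟨by linarith [ht.1], by linarith [ht.2]⟩
  set p : ℝ → EV d := deriv fun r => φ (c r) with hp
  have hcc : ∀ t ∈ Ioo (-ρ) (1 + ρ), ContinuousAt c t := fun t ht =>
    (hgeo.1.continuousOn.continuousAt (isOpen_Ioo.mem_nhds (hsub ht).2))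
  have hcd : ∀ t ∈ Ioo (-ρ) (1 + ρ), c t ∈ φ.source → HasDerivAt (fun r => φ (c r)) (p t) t ∧
      HasDerivAt p (spray g φ (φ (c t), p t)) t := by
    intro t ht hts
    have h2 : ContDiffAt ℝ 2 (fun r => φ (c r)) t := by
      rw [← contMDiffAt_iff_contDiffAt]
      exact ((hφ.contMDiffAt hts).of_le ENat.LEInfty.out).comp t
        (hgeo.1.contMDiffAt (isOpen_Ioo.mem_nhds (hsub ht).2))
    have hd2 : DifferentiableAt ℝ p t :=
      by
        have h3 : ContDiffAt ℝ 1 (fderiv ℝ fun r => φ (c r)) t :=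
          h2.fderiv_right (m := 1) (by norm_num)
        exact (h3.differentiableAt one_ne_zero).clm_apply (differentiableAt_const (1 : ℝ))
    refine ⟨(h2.differentiableAt two_ne_zero).hasDerivAt, ?_⟩
    rw [← eq_spray g hφ (z := (φ (c t), p t)) (φ.map_source hts) (hgeo.2 φ hφ t (hsub ht).2 hts)]
    exact hd2.hasDerivAt
  have hYc : ∀ t ∈ Ioo (-ρ) (1 + ρ), ContinuousAt (fun t => φ.symm (Y t)) t := fun t ht =>
    (φ.symm.continuousAt (h.mem t (hsub ht).1)).comp (h.pos t (hsub ht).1).continuousAt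
  -- The initial velocity of `c` is prescribed in the preferred chart at the starting point and has
  -- to be converted to `φ`.
  have hstart : c 0 = φ.symm (Y 0) ∧ p 0 = P 0 := by
    refine ⟨hc0, ?_⟩
    set x := φ.symm (Y 0) with hx
    have hy : Y 0 ∈ φ.target := h.mem 0 (hsub (hIcc 0 (by simp))).1
    have hxs : x ∈ φ.source := φ.map_target hy
    have h1 : HasFDerivAt (fun z => φ ((chartAt (EV d) x).symm z)) _ (chartAt (EV d) x (c 0)) :=
      ((contDiffAt_transition (isChart_chartAt x) hφ (by rw [hc0]; exact mem_chart_target _ x)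
        (by rw [hc0, (chartAt (EV d) x).left_inv (mem_chart_source _ x)]; exact hxs)).differentiableAt
          (by simp)).hasFDerivAt
    have h2 := h1.comp_hasDerivAt 0 hc1
    have h3 : (fun r => φ (c r)) =ᶠ[𝓝 0]
        ((fun z => φ ((chartAt (EV d) x).symm z)) ∘ fun r => chartAt (EV d) x (c r)) := by
      have := (hcc 0 (hIcc 0 (by simp))).eventually_mem
        ((chartAt (EV d) x).open_source.mem_nhds (by rw [hc0]; exact mem_chart_source _ x))
      filter_upwards [this] with r hr
      simp [(chartAt (EV d) x).left_inv hr]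
    have h4 := (h2.congr_of_eventuallyEq h3).deriv
    rw [hp, h4, hc0]
    have h5 := dchart_transition (isChart_chartAt x) hφ (mem_chart_source _ x) hxs
      (dsymm φ (Y 0) (P 0))
    rw [dchart_chartAt_self] at h5
    exact h5.trans (hφ.dchart_dsymm hy _)
  let A : ℝ → Prop := fun t => c t = φ.symm (Y t) ∧ p t = P t
  suffices H : (fun r s => A r → A s) 0 1 from (H hstart).1
  refine interval_induction (R := fun r s => A r → A s) zero_le_one
    (fun r s t _ _ _ _ h1 h2 h3 => h2 (h1 h3)) fun t ht => ?_
  have ht' := hIcc t ht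
  have hts : φ.symm (Y t) ∈ φ.source := φ.map_target (h.mem t (hsub ht').1)
  -- Near every time the curves disagree throughout, and the implication is vacuous, or agree
  -- throughout.
  suffices hloc : (∀ᶠ r in 𝓝 t, ¬ A r) ∨ ∀ᶠ r in 𝓝 t, A r by
    rcases hloc with hloc | hloc
    · obtain ⟨ε, hε, H⟩ := Metric.eventually_nhds_iff.mp hloc
      exact ⟨ε, hε, fun r s _ _ hr _ _ hA => absurd hA (H (by rwa [Real.dist_eq]))⟩
    · obtain ⟨ε, hε, H⟩ := Metric.eventually_nhds_iff.mp hloc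
      exact ⟨ε, hε, fun r s _ _ _ hs _ _ => H (by rwa [Real.dist_eq])⟩
  by_cases h1 : c t = φ.symm (Y t)
  swap
  · left
    filter_upwards [((hcc t ht').prodMk (hYc t ht')).eventually_mem
      (isClosed_diagonal.isOpen_compl.mem_nhds (x := (c t, φ.symm (Y t))) h1)] with r hr hA using
      hr hA.1
  have hcs : ∀ᶠ r in 𝓝 t, c r ∈ φ.source ∧ r ∈ Ioo (-ρ) (1 + ρ) :=
    ((hcc t ht').eventually_mem (φ.open_source.mem_nhds (by rwa [h1]))).and
      (isOpen_Ioo.eventually_mem ht')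
  by_cases h2 : p t = P t
  swap
  · left
    have e1 := (hcd t ht' (by rwa [h1])).2.continuousAt
    have e2 := (h.vel t (hsub ht').1).continuousAt
    filter_upwards [(e1.prodMk e2).eventually_mem
      (isClosed_diagonal.isOpen_compl.mem_nhds (x := (p t, P t)) h2)] with r hr hA using hr hA.2
  right
  let X : EV d × EV d → EV d × EV d := fun z => (z.2, spray g φ z)
  have hX : ContDiffAt ℝ 1 X (Y t, P t) :=
    contDiffAt_snd.prodMk ((contDiffAt_spray g hφ (z := (Y t, P t)) (h.mem t (hsub ht').1)).of_le
      (by simp))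
  obtain ⟨K, s, hs, hK⟩ := hX.exists_lipschitzOnWith
  have hYP : ∀ r ∈ Ioo (-ρ) (1 + ρ), HasDerivAt (fun r => (Y r, P r)) (X (Y r, P r)) r := fun r hr =>
    (h.pos r (hsub hr).1).prodMk (h.vel r (hsub hr).1)
  have hcp : ∀ r ∈ Ioo (-ρ) (1 + ρ), c r ∈ φ.source →
      HasDerivAt (fun r => (φ (c r), p r)) (X (φ (c r), p r)) r := fun r hr hrs =>
    (hcd r hr hrs).1.prodMk (hcd r hr hrs).2
  have heq : (φ (c t), p t) = (Y t, P t) := by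
    rw [h1, h2, φ.right_inv (h.mem t (hsub ht').1)]
  have hu := ODE_solution_unique_of_eventually (v := fun _ => X) (s := fun _ => s) (K := K)
    (f := fun r => (φ (c r), p r)) (g := fun r => (Y r, P r)) (t₀ := t)
    (Filter.Eventually.of_forall fun _ => hK) (by
      have hm := (hcp t ht' (by rwa [h1])).continuousAt.eventually_mem (by rw [heq]; exact hs)
      filter_upwards [hcs, hm] with r hr hr' using ⟨hcp r hr.2 hr.1, hr'⟩) (by
      have hm := (hYP t ht').continuousAt.eventually_mem hs
      filter_upwards [hcs, hm] with r hr hr' using ⟨hYP r hr.2, hr'⟩) heq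
  filter_upwards [hu, hcs] with r hr hr'
  simp only [Prod.mk.injEq] at hr
  exact ⟨by rw [← hr.1, φ.left_inv hr'.1], hr.2⟩

/-- The choice of a geodesic in `expMap` is harmless, as any other geodesic with the same initial
data has the same endpoint. -/
theorem IsChartGeodesic.expMap_eq [T2Space M] {Y P : ℝ → EV d} {δ : ℝ} (hδ : 0 < δ)
    (hφ : IsChart φ) (h : IsChartGeodesic g φ Y P (Ioo (-δ) (1 + δ))) :
    expMap g (φ.symm (Y 0)) (dsymm φ (Y 0) (P 0)) = φ.symm (Y 1) := by
  have hex : ∃ c : ℝ → M, IsGeodesicFrom g (φ.symm (Y 0)) (dsymm φ (Y 0) (P 0)) c :=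
    ⟨_, h.isGeodesicFrom hδ hφ⟩
  have h1 : expMap g (φ.symm (Y 0)) (dsymm φ (Y 0) (P 0)) = hex.choose 1 := dif_pos hex
  rw [h1]
  exact IsGeodesicFrom.eqOn hφ hδ h hex.choose_spec

theorem IsChartGeodesic.expMap_eq' [T2Space M] {Y P : ℝ → EV d} {δ : ℝ} {y p : EV d} (hδ : 0 < δ)
    (hφ : IsChart φ) (h : IsChartGeodesic g φ Y P (Ioo (-δ) (1 + δ))) (hy : Y 0 = y)
    (hp : P 0 = p) : expMap g (φ.symm y) (dsymm φ y p) = φ.symm (Y 1) := by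
  subst hy hp
  exact h.expMap_eq hδ hφ

/-- The zero vector at `y` is an equilibrium of the spray as a first order system, so `exists_flow`
applies. Time and initial velocity are then rescaled so that small vectors have geodesics on a fixed
interval around `[0, 1]`. -/
theorem exists_chartGeodesics (hφ : IsChart φ) {y : EV d} (hy : y ∈ φ.target) :
    ∃ Y P : EV d × EV d → ℝ → EV d, ContDiffAt ℝ ∞ (fun z => Y z 1) (y, 0) ∧
      ∀ᶠ z in 𝓝 (y, 0), Y z 0 = z.1 ∧ P z 0 = z.2 ∧
        IsChartGeodesic g φ (Y z) (P z) (Ioo (-1 / 2) (1 + 1 / 2)) := by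
  let X : EV d × EV d → EV d × EV d := fun z => (z.2, spray g φ z)
  have hX : ContDiffAt ℝ ∞ X (y, 0) :=
    contDiffAt_snd.prodMk (contDiffAt_spray g hφ (z := (y, 0)) hy)
  have h0 : X (y, 0) = 0 := by
    have := spray_smul g (φ := φ) y 0 0
    simp only [zero_smul, mul_zero] at this
    simp [X, this]
  obtain ⟨ε, hε, W, hW0, hW, hev⟩ := exists_flow hX h0
  -- The flow has speed `ε` and `σ` has slope `1/4`; the factor `4 / ε` restores the prescribed
  -- initial velocity.
  let κ : EV d × EV d → EV d × EV d := fun z => (z.1, (4 / ε) • z.2)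
  have hκ : ContDiff ℝ ∞ κ := contDiff_fst.prodMk (contDiff_snd.const_smul _)
  have hκ0 : κ (y, 0) = (y, 0) := by simp [κ]
  -- Sends `0` to the initial time `1/2` of the flow and `(-1/2, 3/2)` to `(3/8, 7/8)`, inside the
  -- interval where the flow is differentiable.
  let σ : ℝ → ℝ := fun t => 1 / 2 + t / 4
  have hσ : ∀ t, HasDerivAt σ (1 / 4) t := fun t => by
    exact ((hasDerivAt_id t).div_const 4).const_add (1 / 2 : ℝ)
  have hWκ : ContDiffAt ℝ ∞ (fun z => W (κ z)) (y, 0) :=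
    ContDiffAt.comp (g := W) (y, 0) (by rwa [hκ0]) hκ.contDiffAt
  refine ⟨fun z t => (W (κ z) (projI (σ t))).1, fun z t => (ε / 4) • (W (κ z) (projI (σ t))).2,
    ?_, ?_⟩
  · have h1 := (ContinuousMap.evalCLM ℝ (projI (σ 1)) :
      C(unitInterval, EV d × EV d) →L[ℝ] EV d × EV d).contDiff.contDiffAt.comp (y, 0) hWκ
    exact contDiffAt_fst.comp (y, 0) h1
  · have htar : ∀ᶠ w in 𝓝 (W (y, 0)), ∀ t, (w t).1 ∈ φ.target := by
      refine eventually_forall_of_forall_eventually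
        (P := fun w : EV d × EV d => w.1 ∈ φ.target) (u := W (y, 0)) fun t => ?_
      rw [hW0]
      exact continuousAt_fst.eventually_mem (φ.open_target.mem_nhds hy)
    have hκt : Filter.Tendsto κ (𝓝 (y, 0)) (𝓝 (y, 0)) := by
      have := hκ.continuous.tendsto (y, 0)
      rwa [hκ0] at this
    have hWt : Filter.Tendsto (fun z => W (κ z)) (𝓝 (y, 0)) (𝓝 (W (y, 0))) := by
      have := hWκ.continuousAt.tendsto
      rwa [hκ0] at this
    filter_upwards [hκt.eventually hev, hWt.eventually htar] with z hz hz'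
    have hmid : projI (σ 0) = midI := by
      rw [projI_of_mem (by norm_num [σ])]
      simp [σ, midI]
    refine ⟨by rw [hmid, hz.1], ?_, fun t _ => hz' _, fun t ht => ?_, fun t ht => ?_⟩
    · rw [hmid, hz.1]
      simp only [κ, smul_smul]
      rw [show ε / 4 * (4 / ε) = 1 by field_simp, one_smul]
    all_goals
      have hst : σ t ∈ Ioo (0 : ℝ) 1 := by
        constructor <;> simp only [σ] <;> linarith [ht.1, ht.2]
      have h1 := (hz.2 (σ t) hst).scomp t (hσ t)
    · have h2 := (ContinuousLinearMap.fst ℝ (EV d) (EV d)).hasFDerivAt.comp_hasDerivAt t h1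
      simp only [X, smul_smul, ContinuousLinearMap.coe_fst'] at h2
      rw [show (1 / 4 : ℝ) * ε = ε / 4 by ring] at h2
      exact h2
    · have h2 := ((ContinuousLinearMap.snd ℝ (EV d) (EV d)).hasFDerivAt.comp_hasDerivAt t
        h1).const_smul (ε / 4)
      rw [spray_smul]
      simp only [X, smul_smul, ContinuousLinearMap.coe_snd'] at h2
      rw [show (1 / 4 : ℝ) * ε = ε / 4 by ring] at h2
      rw [mul_smul]
      exact h2

variable (g) in
/-- The exponential map in a chart. -/
def expIn (φ : OpenPartialHomeomorph M (EV d)) (z : EV d × EV d) : EV d :=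
  φ (expMap g (φ.symm z.1) (dsymm φ z.1 z.2))

theorem IsChartGeodesic.expIn_eq [T2Space M] {Y P : ℝ → EV d} {δ : ℝ} {y p : EV d} (hδ : 0 < δ)
    (hφ : IsChart φ) (h : IsChartGeodesic g φ Y P (Ioo (-δ) (1 + δ))) (hy : Y 0 = y)
    (hp : P 0 = p) : expIn g φ (y, p) = Y 1 :=
  (congrArg φ (h.expMap_eq' hδ hφ hy hp)).trans
    (φ.right_inv (h.mem 1 ⟨by linarith, by linarith⟩))

theorem eventually_expMap_mem [T2Space M] (hφ : IsChart φ) {y : EV d} (hy : y ∈ φ.target) :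
    ∀ᶠ z : EV d × EV d in 𝓝 (y, 0), expMap g (φ.symm z.1) (dsymm φ z.1 z.2) ∈ φ.source := by
  obtain ⟨Y, P, hYs, hev⟩ := exists_chartGeodesics (g := g) hφ hy
  filter_upwards [hev] with z ⟨h1, h2, h3⟩
  have h4 := IsChartGeodesic.expMap_eq' (by norm_num : (0 : ℝ) < 1 / 2) hφ
    (by simpa [neg_div] using h3) h1 h2
  rw [h4]
  exact φ.map_target (h3.mem 1 (by norm_num))

theorem eventually_expIn_eq [T2Space M] (hφ : IsChart φ) {y : EV d} {Y P : EV d × EV d → ℝ → EV d}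
    (hev : ∀ᶠ z in 𝓝 (y, 0), Y z 0 = z.1 ∧ P z 0 = z.2 ∧
        IsChartGeodesic g φ (Y z) (P z) (Ioo (-1 / 2) (1 + 1 / 2))) :
    expIn g φ =ᶠ[𝓝 (y, 0)] fun z => Y z 1 := by
  filter_upwards [hev] with z ⟨h1, h2, h3⟩
  exact IsChartGeodesic.expIn_eq (by norm_num : (0 : ℝ) < 1 / 2) hφ
    (by simpa [neg_div] using h3) h1 h2

theorem contDiffAt_expIn [T2Space M] (hφ : IsChart φ) {y : EV d} (hy : y ∈ φ.target) :
    ContDiffAt ℝ ∞ (expIn g φ) (y, 0) := by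
  obtain ⟨Y, P, hYs, hev⟩ := exists_chartGeodesics (g := g) hφ hy
  exact hYs.congr_of_eventuallyEq (eventually_expIn_eq hφ hev)

theorem expMap_zero [T2Space M] (x : M) : expMap g x 0 = x := by
  set φ := chartAt (EV d) x
  have hφ : IsChart φ := isChart_chartAt x
  have hx : x ∈ φ.source := mem_chart_source _ x
  have h : IsChartGeodesic g φ (fun _ => φ x) (fun _ => 0) (Ioo (-1) (1 + 1)) := by
    refine ⟨fun _ _ => φ.map_source hx, fun t _ => hasDerivAt_const _ _, fun t _ => ?_⟩
    have := spray_smul g (φ := φ) (φ x) 0 0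
    simp only [zero_smul, mul_zero] at this
    rw [this]
    exact hasDerivAt_const _ _
  have h1 := h.expMap_eq one_pos hφ
  rw [map_zero, φ.left_inv hx] at h1
  exact h1

theorem expIn_zero [T2Space M] {y : EV d} (hy : y ∈ φ.target) : expIn g φ (y, 0) = y := by
  have h : dsymm φ y 0 = 0 := map_zero _
  have h2 : expMap g (φ.symm y) (dsymm φ y 0) = φ.symm y := by
    rw [h]; exact expMap_zero _
  exact (congrArg φ h2).trans (φ.right_inv hy)

/-- By rescaling, `r ↦ exp(rv)` is itself a geodesic with initial velocity `v`. -/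
theorem fderiv_expIn [T2Space M] (hφ : IsChart φ) {y : EV d} (hy : y ∈ φ.target) (v : EV d) :
    fderiv ℝ (expIn g φ) (y, 0) (0, v) = v := by
  obtain ⟨Y, P, hYs, hev⟩ := exists_chartGeodesics (g := g) hφ hy
  have hd := ((contDiffAt_expIn (g := g) hφ hy).differentiableAt (by simp)).hasFDerivAt
  have hline : HasDerivAt (fun s : ℝ => ((y, s • v) : EV d × EV d)) (0, v) 0 := by
    simpa using (hasDerivAt_const (0 : ℝ) y).prodMk ((hasDerivAt_id (0 : ℝ)).smul_const v)
  have hcurve : HasDerivAt (fun s : ℝ => expIn g φ (y, s • v))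
      (fderiv ℝ (expIn g φ) (y, 0) (0, v)) 0 := hd.comp_hasDerivAt_of_eq 0 hline (by simp)
  have hc : Filter.Tendsto (fun s : ℝ => ((y, s • v) : EV d × EV d)) (𝓝 0) (𝓝 (y, 0)) := by
    have := hline.continuousAt.tendsto
    simpa using this
  -- One small `s > 0` is fixed, and the geodesic with velocity `sv` is run at speed `1/s`. This
  -- describes the ray for `r ∈ [0, s]` only, so derivatives at `0` are compared from the right.
  obtain ⟨s, hs0, ⟨h1, h2, h3⟩⟩ : ∃ s : ℝ, 0 < s ∧ Y (y, s • v) 0 = y ∧ P (y, s • v) 0 = s • v ∧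
      IsChartGeodesic g φ (Y (y, s • v)) (P (y, s • v)) (Ioo (-1 / 2) (1 + 1 / 2)) := by
    have h := (hc.eventually hev).filter_mono (nhdsWithin_le_nhds (s := Ioi 0))
    obtain ⟨s, hs, hs'⟩ := ((eventually_mem_nhdsWithin (a := (0 : ℝ)) (s := Ioi 0)).and h).exists
    exact ⟨s, hs, hs'⟩
  have hgeo : ∀ r ∈ Icc (0 : ℝ) s, expIn g φ (y, r • v) = Y (y, s • v) (r / s) := by
    intro r hr
    have hrs0 : 0 ≤ r / s := div_nonneg hr.1 hs0.le
    have hrs1 : r / s ≤ 1 := (div_le_one hs0).mpr hr.2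
    have hg := h3.comp_mul (S' := Ioo (-(1 / 2)) (1 + 1 / 2)) (r / s) fun t ht => by
      constructor <;> nlinarith [ht.1, ht.2]
    have h4 := hg.expIn_eq (y := y) (p := r • v) (by norm_num) hφ (by rw [mul_zero, h1])
      (by rw [mul_zero, h2, smul_smul, div_mul_cancel₀ _ hs0.ne'])
    rwa [mul_one] at h4
  have hYd : HasDerivAt (fun r => Y (y, s • v) (r / s)) v 0 := by
    have hdiv : HasDerivAt (fun r : ℝ => r / s) (1 / s) 0 := (hasDerivAt_id (0 : ℝ)).div_const s
    have h5 := (h3.pos 0 (by norm_num))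
    rw [h2] at h5
    have h6 := h5.scomp_of_eq (0 : ℝ) hdiv (by simp)
    rw [smul_smul, one_div, inv_mul_cancel₀ hs0.ne', one_smul] at h6
    exact h6
  have huniq : UniqueDiffWithinAt ℝ (Icc (0 : ℝ) s) 0 :=
    uniqueDiffOn_Icc hs0 0 (left_mem_Icc.mpr hs0.le)
  exact huniq.eq_deriv _ hcurve.hasDerivWithinAt
    (hYd.hasDerivWithinAt.congr hgeo (hgeo 0 (left_mem_Icc.mpr hs0.le)))

end Geodesics

/-! ### Pullback and gauge transformation of curvature -/

section Forms

universe u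

variable {Q Q' R : Type u} [NormedAddCommGroup Q] [NormedSpace ℝ Q] [NormedAddCommGroup Q']
  [NormedSpace ℝ Q'] [NormedRing R] [NormedAlgebra ℝ R]

/-- The pullback of a 1-form. -/
def pullForm {S : Type*} [NormedAddCommGroup S] [NormedSpace ℝ S] (h : Q → Q')
    (θ : Q' → Q' →L[ℝ] S) (x : Q) : Q →L[ℝ] S :=
  (θ (h x)).comp (fderiv ℝ h x)

theorem pullForm_apply {S : Type*} [NormedAddCommGroup S] [NormedSpace ℝ S] (h : Q → Q')
    (θ : Q' → Q' →L[ℝ] S) (x v : Q) : pullForm h θ x v = θ (h x) (fderiv ℝ h x v) := rfl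

theorem contDiffAt_pullForm {S : Type*} [NormedAddCommGroup S] [NormedSpace ℝ S] {h : Q → Q'}
    {θ : Q' → Q' →L[ℝ] S} {x : Q} (hh : ContDiffAt ℝ ∞ h x) (hθ : ContDiffAt ℝ ∞ θ (h x)) :
    ContDiffAt ℝ ∞ (pullForm h θ) x :=
  ContDiffAt.clm_comp (hθ.comp x hh) (hh.fderiv_right (m := ∞) (by simp))

theorem curv_congr {θ θ' : Q → Q →L[ℝ] R} {x : Q} (h : θ =ᶠ[𝓝 x] θ') (v w : Q) :
    curv θ x v w = curv θ' x v w := by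
  rw [curv, curv, h.fderiv_eq, h.self_of_nhds]

theorem fderiv_pullForm_apply {h : Q → Q'} {θ : Q' → Q' →L[ℝ] R} {x : Q}
    (hh : ContDiffAt ℝ 2 h x) (hθ : DifferentiableAt ℝ θ (h x)) (v w : Q) :
    fderiv ℝ (pullForm h θ) x v w = θ (h x) (fderiv ℝ (fderiv ℝ h) x v w) +
      fderiv ℝ θ (h x) (fderiv ℝ h x v) (fderiv ℝ h x w) := by
  have h1 : HasFDerivAt (fun x => θ (h x)) ((fderiv ℝ θ (h x)).comp (fderiv ℝ h x)) x :=
    hθ.hasFDerivAt.comp x (hh.differentiableAt two_ne_zero).hasFDerivAt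
  have h2 : HasFDerivAt (fderiv ℝ h) (fderiv ℝ (fderiv ℝ h) x) x :=
    ((hh.fderiv_right (m := 1) (by norm_num)).differentiableAt one_ne_zero).hasFDerivAt
  have h3 := DFunLike.congr_fun (DFunLike.congr_fun (h1.clm_comp h2).fderiv v) w
  exact h3

/-- Second derivatives of `h` enter symmetrically and drop out of the antisymmetrized derivative. -/
theorem curv_pullForm {h : Q → Q'} {θ : Q' → Q' →L[ℝ] R} {x : Q} (hh : ContDiffAt ℝ 2 h x)
    (hθ : DifferentiableAt ℝ θ (h x)) (v w : Q) :
    curv (pullForm h θ) x v w = curv θ (h x) (fderiv ℝ h x v) (fderiv ℝ h x w) := by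
  have hs : fderiv ℝ (fderiv ℝ h) x v w = fderiv ℝ (fderiv ℝ h) x w v :=
    (hh.isSymmSndFDerivAt (by simp)) v w
  rw [curv, curv, fderiv_pullForm_apply hh hθ, fderiv_pullForm_apply hh hθ, hs, pullForm_apply,
    pullForm_apply]
  abel

/-- With `T' = T⁻¹`, the terms containing derivatives of `T` in `dθ'` are cancelled by the cross
terms of `θ' ∧ θ'`, and `D²T'` is symmetric. Thus curvature is conjugated, although the connection
form transforms inhomogeneously. -/
theorem curv_gauge {θ θ' : Q → Q →L[ℝ] R} {T T' : Q → R} {x : Q} (hT : DifferentiableAt ℝ T x)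
    (hT' : ContDiffAt ℝ 2 T' x) (hθ : DifferentiableAt ℝ θ x) (h1 : ∀ᶠ z in 𝓝 x, T z * T' z = 1)
    (h2 : T' x * T x = 1)
    (h : ∀ᶠ z in 𝓝 x, ∀ w, θ' z w = T z * θ z w * T' z + T z * fderiv ℝ T' z w) (v w : Q) :
    curv θ' x v w = T x * curv θ x v w * T' x := by
  have hd' : HasFDerivAt T' (fderiv ℝ T' x) x := (hT'.differentiableAt two_ne_zero).hasFDerivAt
  have hD : HasFDerivAt (fderiv ℝ T') (fderiv ℝ (fderiv ℝ T') x) x :=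
    ((hT'.fderiv_right (m := 1) (by norm_num)).differentiableAt one_ne_zero).hasFDerivAt
  have hs : fderiv ℝ (fderiv ℝ T') x v w = fderiv ℝ (fderiv ℝ T') x w v :=
    (hT'.isSymmSndFDerivAt (by simp)) v w
  have key : ∀ v, T x * fderiv ℝ T' x v + fderiv ℝ T x v * T' x = 0 := fun v => by
    have e1 := (hT.hasFDerivAt.mul' hd').congr_of_eventuallyEq
      (h1.mono fun z hz => hz.symm : (fun _ => (1 : R)) =ᶠ[𝓝 x] _)
    have e2 := DFunLike.congr_fun (e1.unique (hasFDerivAt_const (1 : R) x)) v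
    simpa using e2
  have hθ' : DifferentiableAt ℝ θ' x := by
    have e1 : DifferentiableAt ℝ (fun z => (ContinuousLinearMap.mul ℝ R (T z)).comp
        (((ContinuousLinearMap.mul ℝ R).flip (T' z)).comp (θ z)) +
          (ContinuousLinearMap.mul ℝ R (T z)).comp (fderiv ℝ T' z)) x := by
      have a1 : DifferentiableAt ℝ (fun z => ContinuousLinearMap.mul ℝ R (T z)) x :=
        (ContinuousLinearMap.mul ℝ R).differentiableAt.comp x hT
      have a2 : DifferentiableAt ℝ (fun z => (ContinuousLinearMap.mul ℝ R).flip (T' z)) x :=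
        (ContinuousLinearMap.mul ℝ R).flip.differentiableAt.comp x hd'.differentiableAt
      exact (a1.clm_comp (a2.clm_comp hθ)).add (a1.clm_comp hD.differentiableAt)
    refine e1.congr_of_eventuallyEq (h.mono fun z hz => ?_)
    ext w
    simp [hz, mul_assoc]
  have hfd : ∀ v w, fderiv ℝ θ' x v w = fderiv ℝ T x v * θ x w * T' x +
      T x * fderiv ℝ θ x v w * T' x + T x * θ x w * fderiv ℝ T' x v +
      (fderiv ℝ T x v * fderiv ℝ T' x w + T x * fderiv ℝ (fderiv ℝ T') x v w) := by
    intro v w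
    have e1 : HasFDerivAt (fun z => θ' z w) _ x :=
      hθ'.hasFDerivAt.clm_apply (hasFDerivAt_const w x)
    have a1 : HasFDerivAt (fun z => θ z w) _ x :=
      hθ.hasFDerivAt.clm_apply (hasFDerivAt_const w x)
    have a2 : HasFDerivAt (fun z => fderiv ℝ T' z w) _ x :=
      hD.clm_apply (hasFDerivAt_const w x)
    have e2 := (((hT.hasFDerivAt.mul' a1).mul' hd').add (hT.hasFDerivAt.mul' a2)).congr_of_eventuallyEq
      (h.mono fun z hz => hz w)
    have e3 := DFunLike.congr_fun (e1.unique e2) v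
    simp only [ContinuousLinearMap.comp_zero, zero_add, ContinuousLinearMap.flip_apply,
      add_apply, smul_apply, smul_eq_mul, MulOpposite.smul_eq_mul_unop, MulOpposite.unop_op] at e3
    rw [e3, Pi.mul_apply]
    noncomm_ring
  have k1 := key v
  have k2 := key w
  rw [curv, hfd, hfd, hs, h.self_of_nhds v, h.self_of_nhds w, curv]
  -- The derivative of an inverse, from differentiating `T T' = 1` and cancelling with `T' T = 1`.
  have k1' : T x * fderiv ℝ T' x v * T x = -fderiv ℝ T x v := by
    rw [eq_neg_of_add_eq_zero_left k1, neg_mul, mul_assoc, h2, mul_one]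
  have k2' : T x * fderiv ℝ T' x w * T x = -fderiv ℝ T x w := by
    rw [eq_neg_of_add_eq_zero_left k2, neg_mul, mul_assoc, h2, mul_one]
  -- In a product of two transformed forms every inner `T' T` collapses; the remaining factors `T B
  -- T` are those evaluated by `k1'` and `k2'`.
  have m : ∀ A B A' B' : R, T x * A * T' x + T x * B = T x * A * T' x + T x * B →
      (T x * A * T' x + T x * B) * (T x * A' * T' x + T x * B') =
      T x * A * A' * T' x + T x * A * B' + (T x * B * T x) * A' * T' x + (T x * B * T x) * B' := by
    intro A B A' B' _
    have : T x * A * T' x * (T x * A' * T' x) = T x * A * A' * T' x := by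
      rw [show T x * A * T' x * (T x * A' * T' x) = T x * A * (T' x * T x) * A' * T' x by
        noncomm_ring, h2, mul_one]
    have h' : T x * A * T' x * (T x * B') = T x * A * B' := by
      rw [show T x * A * T' x * (T x * B') = T x * A * (T' x * T x) * B' by noncomm_ring, h2,
        mul_one]
    rw [add_mul, mul_add, mul_add, this, h']
    noncomm_ring
  rw [m _ _ _ _ rfl, m _ _ _ _ rfl, k1', k2']
  noncomm_ring

end Forms

/-! ### Linear maps between fibers in trivializations -/

section VB

variable {d N : ℕ} {M : Type*} [TopologicalSpace M] [ChartedSpace (EV d) M]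
  {E : M → Type*} [∀ x, AddCommGroup (E x)] [∀ x, Module ℂ (E x)]
  [∀ x, TopologicalSpace (E x)] [TopologicalSpace (TotalSpace (CV N) E)]
  [FiberBundle (CV N) E] [VectorBundle ℂ (CV N) E]

section Conj

variable (a b c : Trivialization (CV N) (π (CV N) E)) [a.IsLinear ℂ] [b.IsLinear ℂ] [c.IsLinear ℂ]
  {x y z : M}

theorem conjTriv_comp (hy : y ∈ b.baseSet) (L : E x →ₗ[ℂ] E y) (L' : E y →ₗ[ℂ] E z) :
    conjTriv a c x z (L' ∘ₗ L) = conjTriv b c y z L' * conjTriv a b x y L := by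
  have h := LinearMap.toMatrix'_comp (c.linearMapAt ℂ z ∘ₗ L' ∘ₗ b.symmₗ ℂ y)
    (b.linearMapAt ℂ y ∘ₗ L ∘ₗ a.symmₗ ℂ x)
  refine Eq.trans ?_ h
  unfold conjTriv
  congr 1
  refine LinearMap.ext fun v => ?_
  simp only [LinearMap.comp_apply]
  rw [b.symmₗ_linearMapAt hy]

theorem conjTriv_id (hx : x ∈ a.baseSet) : conjTriv a a x x LinearMap.id = 1 := by
  unfold conjTriv
  have : a.linearMapAt ℂ x ∘ₗ LinearMap.id ∘ₗ a.symmₗ ℂ x = LinearMap.id := by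
    refine LinearMap.ext fun v => ?_
    simp only [LinearMap.comp_apply, LinearMap.id_apply]
    rw [a.linearMapAt_symmₗ hx]
  rw [this]
  exact LinearMap.toMatrix'_id

/-- The linear map with a given matrix. -/
def ofConj (x y : M) (P : MatC N) : E x →ₗ[ℂ] E y :=
  b.symmₗ ℂ y ∘ₗ Matrix.toLin' P ∘ₗ a.linearMapAt ℂ x

theorem conjTriv_ofConj (hx : x ∈ a.baseSet) (hy : y ∈ b.baseSet) (P : MatC N) :
    conjTriv a b x y (ofConj a b x y P) = P := by
  unfold conjTriv ofConj
  have : b.linearMapAt ℂ y ∘ₗ (b.symmₗ ℂ y ∘ₗ Matrix.toLin' P ∘ₗ a.linearMapAt ℂ x) ∘ₗ a.symmₗ ℂ x =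
      Matrix.toLin' P := by
    refine LinearMap.ext fun v => ?_
    simp only [LinearMap.comp_apply]
    rw [b.linearMapAt_symmₗ hy, a.linearMapAt_symmₗ hx]
  rw [this]
  exact LinearMap.toMatrix'_toLin' P

theorem ofConj_conjTriv (hx : x ∈ a.baseSet) (hy : y ∈ b.baseSet) (L : E x →ₗ[ℂ] E y) :
    ofConj a b x y (conjTriv a b x y L) = L := by
  unfold conjTriv ofConj
  refine LinearMap.ext fun v => ?_
  rw [Matrix.toLin'_toMatrix']
  simp only [LinearMap.comp_apply]
  rw [b.symmₗ_linearMapAt hy, a.symmₗ_linearMapAt hx]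

theorem conjTriv_injective (hx : x ∈ a.baseSet) (hy : y ∈ b.baseSet) {L L' : E x →ₗ[ℂ] E y}
    (h : conjTriv a b x y L = conjTriv a b x y L') : L = L' := by
  rw [← ofConj_conjTriv a b hx hy L, h, ofConj_conjTriv a b hx hy]

theorem conjTriv_add (L L' : E x →ₗ[ℂ] E y) :
    conjTriv a b x y (L + L') = conjTriv a b x y L + conjTriv a b x y L' := by
  unfold conjTriv
  rw [LinearMap.add_comp, LinearMap.comp_add]
  exact map_add LinearMap.toMatrix' _ _

theorem conjTriv_neg (L : E x →ₗ[ℂ] E y) : conjTriv a b x y (-L) = -conjTriv a b x y L := by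
  unfold conjTriv
  rw [LinearMap.neg_comp, LinearMap.comp_neg]
  exact map_neg LinearMap.toMatrix' _

theorem conjTriv_smul (r : ℝ) (L : E x →ₗ[ℂ] E y) :
    conjTriv a b x y (r • L) = r • conjTriv a b x y L := by
  have h1 : b.linearMapAt ℂ y ∘ₗ (r • L) ∘ₗ a.symmₗ ℂ x =
      (r : ℂ) • (b.linearMapAt ℂ y ∘ₗ L ∘ₗ a.symmₗ ℂ x) := by
    refine LinearMap.ext fun v => ?_
    simp only [LinearMap.comp_apply, LinearMap.smul_apply]
    rw [← Complex.coe_smul, map_smul]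
  unfold conjTriv
  rw [h1, map_smul]
  rfl

end Conj

variable {G : Subgroup (Matrix.specialUnitaryGroup (Fin N) ℂ)} {B : GAtlas d E G}

theorem GAtlas.mem_idxAt (B : GAtlas d E G) (x : M) : x ∈ B.dom (B.idxAt x) :=
  (B.cover x).choose_spec

theorem GAtlas.isOpen_dom (B : GAtlas d E G) (a : B.ι) : IsOpen (B.dom a) := (B.triv a).open_baseSet

theorem GAtlas.trans_mul_trans (B : GAtlas d E G) (a b c : B.ι) {x : M} (hx : x ∈ B.dom b) :
    B.trans a b x * B.trans b c x = B.trans a c x :=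
  (conjTriv_comp (B.triv c) (B.triv b) (B.triv a) hx LinearMap.id LinearMap.id).symm

theorem GAtlas.trans_self (B : GAtlas d E G) (a : B.ι) {x : M} (hx : x ∈ B.dom a) :
    B.trans a a x = 1 :=
  conjTriv_id _ hx

theorem GAtlas.rep_comp (B : GAtlas d E G) (a b c : B.ι) {x y z : M} (hy : y ∈ B.dom b)
    (L : E x →ₗ[ℂ] E y) (L' : E y →ₗ[ℂ] E z) : B.rep a c (L' ∘ₗ L) = B.rep b c L' * B.rep a b L :=
  conjTriv_comp _ _ _ hy L L'

theorem GAtlas.rep_change (B : GAtlas d E G) (a a' b b' : B.ι) {x y : M} (hx : x ∈ B.dom a)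
    (hy : y ∈ B.dom b) (L : E x →ₗ[ℂ] E y) :
    B.rep a' b' L = B.trans b' b y * B.rep a b L * B.trans a a' x := by
  have h1 := B.rep_comp a' b b' hy L LinearMap.id
  have h2 := B.rep_comp a' a b hx LinearMap.id L
  rw [LinearMap.id_comp] at h1
  rw [LinearMap.comp_id] at h2
  rw [h1, h2, mul_assoc]
  rfl

section Curvature

variable [IsManifold (𝓡 d) ∞ M] {φ ψ : OpenPartialHomeomorph M (EV d)} {A : GConnection B}

theorem formIn_apply (θ : ∀ x : M, TangentSpace (𝓡 d) x →L[ℝ] MatC N)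
    (φ : OpenPartialHomeomorph M (EV d)) (y v : EV d) :
    formIn θ φ y v = θ (φ.symm y) (dsymm φ y v) := rfl

theorem form_congr (θ : ∀ x : M, TangentSpace (𝓡 d) x →L[ℝ] MatC N) {x x' : M} (h : x = x')
    (v : EV d) : θ x v = θ x' v := by
  subst h; rfl

theorem formIn_dchart (θ : ∀ x : M, TangentSpace (𝓡 d) x →L[ℝ] MatC N) (hφ : IsChart φ) {x : M}
    (hx : x ∈ φ.source) (v : EV d) : formIn θ φ (φ x) (dchart φ x v) = θ x v := by
  rw [formIn_apply]
  refine (congrArg (θ (φ.symm (φ x))) (hφ.dsymm_dchart hx v)).trans ?_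
  exact form_congr θ (φ.left_inv hx) v

theorem GConnection.contDiffAt_formIn (A : GConnection B) (a : B.ι) (hφ : IsChart φ) {y : EV d}
    (hy : y ∈ φ.target) (hy' : φ.symm y ∈ B.dom a) : ContDiffAt ℝ ∞ (formIn (A.form a) φ) y :=
  (A.smooth a φ hφ).contDiffAt ((φ.symm.isOpen_inter_preimage (B.isOpen_dom a)).mem_nhds ⟨hy, hy'⟩)

/-- A change of coordinates is a pullback of the local form by the transition map, to which
`curv_pullForm` applies. -/
theorem curv_formIn_transition (A : GConnection B) (a : B.ι) (hφ : IsChart φ) (hψ : IsChart ψ)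
    {y : EV d} (hy : y ∈ φ.target) (hy' : φ.symm y ∈ ψ.source) (ha : φ.symm y ∈ B.dom a)
    (v w : EV d) :
    curv (formIn (A.form a) φ) y v w = curv (formIn (A.form a) ψ) (ψ (φ.symm y))
      (fderiv ℝ (fun z => ψ (φ.symm z)) y v) (fderiv ℝ (fun z => ψ (φ.symm z)) y w) := by
  have h1 : formIn (A.form a) φ =ᶠ[𝓝 y]
      pullForm (fun z => ψ (φ.symm z)) (formIn (A.form a) ψ) := by
    filter_upwards [(φ.symm.isOpen_inter_preimage ψ.open_source).mem_nhds ⟨hy, hy'⟩] with z hz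
    ext1 v
    rw [pullForm_apply, formIn_apply, formIn_apply]
    refine Eq.trans ?_ (congrArg (A.form a (ψ.symm (ψ (φ.symm z))))
      (dsymm_transition hφ hψ hz.1 hz.2 v).symm)
    exact (form_congr _ (ψ.left_inv hz.2) _).symm
  rw [curv_congr h1]
  refine curv_pullForm ((contDiffAt_transition hφ hψ hy hy').of_le ENat.LEInfty.out) ?_ v w
  exact (A.contDiffAt_formIn a hψ (ψ.map_source hy') (by rwa [ψ.left_inv hy'])).differentiableAt
    (by simp)

theorem contDiffAt_trans (B : GAtlas d E G) (a b : B.ι) (hφ : IsChart φ) {y : EV d}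
    (hy : y ∈ φ.target) (ha : φ.symm y ∈ B.dom a) (hb : φ.symm y ∈ B.dom b) :
    ContDiffAt ℝ ∞ (fun z => B.trans a b (φ.symm z)) y := by
  have h1 : ContMDiffAt (𝓡 d) 𝓘(ℝ, MatC N) ∞ (B.trans a b) (φ.symm y) :=
    (B.smooth a b).contMDiffAt (((B.isOpen_dom a).inter (B.isOpen_dom b)).mem_nhds ⟨ha, hb⟩)
  exact contMDiffAt_iff_contDiffAt.mp (h1.comp y (hφ.contMDiffAt_symm hy))

theorem formIn_gauge (A : GConnection B) (a b : B.ι) (hφ : IsChart φ) {y : EV d}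
    (hy : y ∈ φ.target) (ha : φ.symm y ∈ B.dom a) (hb : φ.symm y ∈ B.dom b) (w : EV d) :
    formIn (A.form b) φ y w = B.trans b a (φ.symm y) * formIn (A.form a) φ y w *
      B.trans a b (φ.symm y) + B.trans b a (φ.symm y) *
        fderiv ℝ (fun z => B.trans a b (φ.symm z)) y w := by
  have h := A.compat a b (φ.symm y) ⟨ha, hb⟩ (dsymm φ y w)
  refine h.trans ?_
  have h1 : MDifferentiableAt (𝓡 d) 𝓘(ℝ, MatC N) (B.trans a b) (φ.symm y) :=
    ((B.smooth a b).contMDiffAt (((B.isOpen_dom a).inter (B.isOpen_dom b)).mem_nhds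
      ⟨ha, hb⟩)).mdifferentiableAt (by simp)
  have h2 := h1.hasMFDerivAt.comp y (hφ.mdifferentiableAt_symm hy).hasMFDerivAt
  have h3 : HasFDerivAt (fun z => B.trans a b (φ.symm z))
      ((show EV d →L[ℝ] MatC N from mfderiv (𝓡 d) 𝓘(ℝ, MatC N) (B.trans a b) (φ.symm y)).comp
        (dsymm φ y)) y :=
    hasMFDerivAt_iff_hasFDerivAt.mp h2
  rw [h3.fderiv]
  rfl

theorem curv_formIn_gauge (A : GConnection B) (a b : B.ι) (hφ : IsChart φ) {y : EV d}
    (hy : y ∈ φ.target) (ha : φ.symm y ∈ B.dom a) (hb : φ.symm y ∈ B.dom b) (v w : EV d) :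
    curv (formIn (A.form b) φ) y v w = B.trans b a (φ.symm y) * curv (formIn (A.form a) φ) y v w *
      B.trans a b (φ.symm y) := by
  have hev : ∀ᶠ z in 𝓝 y, z ∈ φ.target ∧ φ.symm z ∈ B.dom a ∩ B.dom b :=
    (φ.symm.isOpen_inter_preimage ((B.isOpen_dom a).inter (B.isOpen_dom b))).mem_nhds ⟨hy, ha, hb⟩
  refine curv_gauge (T := fun z => B.trans b a (φ.symm z)) (T' := fun z => B.trans a b (φ.symm z))
    ((contDiffAt_trans B b a hφ hy hb ha).differentiableAt (by simp))
    ((contDiffAt_trans B a b hφ hy ha hb).of_le ENat.LEInfty.out)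
    ((A.contDiffAt_formIn a hφ hy ha).differentiableAt (by simp)) ?_ ?_ ?_ v w
  · filter_upwards [hev] with z hz
    rw [B.trans_mul_trans b a b hz.2.1, B.trans_self b hz.2.2]
  · rw [B.trans_mul_trans a b a hb, B.trans_self a ha]
  · filter_upwards [hev] with z hz w
    exact formIn_gauge A a b hφ hz.1 hz.2.1 hz.2.2 w

/-- `curvature` is defined through the preferred chart and a chosen trivialization. Gauge covariance
and the coordinate change together make the formula available in any chart and trivialization. -/
theorem rep_curvature (A : GConnection B) (a : B.ι) (hφ : IsChart φ) {x : M} (hx : x ∈ φ.source)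
    (ha : x ∈ B.dom a) (v w : EV d) :
    B.rep a a (A.curvature x v w) =
      curv (formIn (A.form a) φ) (φ x) (dchart φ x v) (dchart φ x w) := by
  set c := B.idxAt x with hc
  have hxc : x ∈ B.dom c := B.mem_idxAt x
  set ψ := chartAt (EV d) x with hψ'
  have hψ : IsChart ψ := isChart_chartAt x
  have hxψ : x ∈ ψ.source := mem_chart_source _ x
  have hinv : ψ.symm (ψ x) = x := ψ.left_inv hxψ
  have h1 : B.rep c c (A.curvature x v w) = curv (formIn (A.form c) ψ) (ψ x) v w := by
    have e : A.localCurvature c x v w = curv (formIn (A.form c) ψ) (ψ x) v w := by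
      have f : ∀ v : EV d, A.form c x v = formIn (A.form c) ψ (ψ x) v := fun v => by
        rw [← formIn_dchart (A.form c) hψ hxψ v, dchart_chartAt_self]
      unfold GConnection.localCurvature curv
      rw [← f, ← f]
    rw [← e]
    exact conjTriv_ofConj (B.triv c) (B.triv c) hxc hxc (A.localCurvature c x v w)
  rw [B.rep_change c a c a hxc hxc, h1]
  have h2 := curv_formIn_gauge A c a hψ (ψ.map_source hxψ) (by rwa [hinv]) (by rwa [hinv]) v w
  rw [hinv] at h2
  rw [← h2]
  have h3 := curv_formIn_transition A a hψ hφ (ψ.map_source hxψ) (by rwa [hinv]) (by rwa [hinv]) v w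
  have h4 := dchart_transition hψ hφ hxψ hx v
  have h5 := dchart_transition hψ hφ hxψ hx w
  rw [dchart_chartAt_self] at h4 h5
  rw [h3, h4, h5, hinv]

end Curvature

end VB

/-! ### `H¹` regularity along curves, chart by chart. -/

theorem isH1On_of_apply {d : ℕ} {W : Type*} [NormedAddCommGroup W] [NormedSpace ℝ W]
    [CompleteSpace W] {L : ℝ → EV d →L[ℝ] W} {a b : ℝ} (h : ∀ v, IsH1On (fun t => L t v) a b) :
    IsH1On L a b := by
  let B := EuclideanSpace.basisFun (Fin d) ℝ
  have h1 : ∀ i ∈ Finset.univ, IsH1On (fun t =>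
      ContinuousLinearMap.smulRightL ℝ (EV d) W (EuclideanSpace.proj i) (L t (B i))) a b :=
    fun i _ => (h (B i)).clm _
  refine (isH1On_sum Finset.univ h1).congr fun t _ => ?_
  ext1 v
  simp only [sum_apply, ContinuousLinearMap.smulRightL_apply_apply]
  conv_lhs => rw [← B.sum_repr v]
  rw [map_sum]
  refine Finset.sum_congr rfl fun i _ => ?_
  rw [map_smul]
  rfl

/-- The condition `p` (in use: being mapped into a given chart) may hold on an interval that
contains the junction `s` in its interior; such an interval is cut at `s`. -/
theorem forall_isH1On_trans {V : Type*} [NormedAddCommGroup V] [NormedSpace ℝ V] [CompleteSpace V]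
    {f : ℝ → V} {p : ℝ → Prop} {r s t : ℝ}
    (h1 : ∀ a b, r ≤ a → a ≤ b → b ≤ s → (∀ τ ∈ Icc a b, p τ) → IsH1On f a b)
    (h2 : ∀ a b, s ≤ a → a ≤ b → b ≤ t → (∀ τ ∈ Icc a b, p τ) → IsH1On f a b) :
    ∀ a b, r ≤ a → a ≤ b → b ≤ t → (∀ τ ∈ Icc a b, p τ) → IsH1On f a b := by
  intro a b ha hab hb hp
  rcases le_total b s with hbs | hsb
  · exact h1 a b ha hab hbs hp
  rcases le_total s a with hsa | has
  · exact h2 a b hsa hab hb hp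
  · exact (h1 a s ha has le_rfl fun τ hτ => hp τ ⟨hτ.1, hτ.2.trans hsb⟩).append has hsb
      (h2 s b le_rfl hsb hb fun τ hτ => hp τ ⟨has.trans hτ.1, hτ.2⟩)

section Curves

variable {d : ℕ} {M : Type*} [TopologicalSpace M] [ChartedSpace (EV d) M]

theorem H1Curve.continuousOn (γ : H1Curve d M) : ContinuousOn γ (Icc 0 1) := γ.isH1.1

/-- A transitive relation on `[0, 1]` that holds on the intervals that a curve maps into small open
sets holds on `[0, 1]`. -/
theorem curve_induction {c : ℝ → M} (hc : ContinuousOn c (Icc 0 1)) {R : ℝ → ℝ → Prop}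
    (trans : ∀ r s t, 0 ≤ r → r ≤ s → s ≤ t → t ≤ 1 → R r s → R s t → R r t)
    (U : M → Set M) (hU : ∀ x, IsOpen (U x)) (hxU : ∀ x, x ∈ U x)
    (loc : ∀ x r s, 0 ≤ r → r ≤ s → s ≤ 1 → (∀ τ ∈ Icc r s, c τ ∈ U x) → R r s) : R 0 1 := by
  refine interval_induction zero_le_one trans fun t ht => ?_
  have h1 := (hc t ht).eventually_mem ((hU (c t)).mem_nhds (hxU (c t)))
  obtain ⟨ε, hε, H⟩ := Metric.eventually_nhds_iff.mp (eventually_nhdsWithin_iff.mp h1)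
  refine ⟨ε, hε, fun r s hr hs hrt hst hrs => loc (c t) r s hr.1 hrs hs.2 fun τ hτ => ?_⟩
  refine H ?_ ⟨hr.1.trans hτ.1, hτ.2.trans hs.2⟩
  rw [Real.dist_eq, abs_lt]
  rw [abs_lt] at hrt hst
  constructor <;> linarith [hτ.1, hτ.2]

variable [IsManifold (𝓡 d) ∞ M] {φ ψ : OpenPartialHomeomorph M (EV d)}

theorem IsH1On.of_chart (hφ : IsChart φ) (hψ : IsChart ψ) {c : ℝ → M} {a b : ℝ}
    (hc : ∀ t ∈ Icc a b, c t ∈ φ.source) (hc' : ∀ t ∈ Icc a b, c t ∈ ψ.source)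
    (h : IsH1On (fun t => φ (c t)) a b) : IsH1On (fun t => ψ (c t)) a b := by
  refine (h.comp (F := fun z => ψ (φ.symm z)) fun t ht => ?_).congr fun t ht => ?_
  · refine (contDiffAt_transition hφ hψ (φ.map_source (hc t ht)) ?_).of_le (by simp)
    rw [φ.left_inv (hc t ht)]
    exact hc' t ht
  · simp only [φ.left_inv (hc t ht)]

variable (d) in
/-- `c` is an `H¹` path on `[r, s]`. -/
def IsH1PathOn (c : ℝ → M) (r s : ℝ) : Prop :=
  ContinuousOn c (Icc r s) ∧ ∀ φ : OpenPartialHomeomorph M (EV d), IsChart φ →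
    ∀ a b : ℝ, r ≤ a → a ≤ b → b ≤ s → (∀ t ∈ Icc a b, c t ∈ φ.source) →
      IsH1On (fun t => φ (c t)) a b

theorem IsH1PathOn.trans {c : ℝ → M} {r s t : ℝ} (hrs : r ≤ s) (hst : s ≤ t)
    (h1 : IsH1PathOn d c r s) (h2 : IsH1PathOn d c s t) : IsH1PathOn d c r t := by
  refine ⟨?_, fun φ hφ => forall_isH1On_trans (h1.2 φ hφ) (h2.2 φ hφ)⟩
  rw [← Icc_union_Icc_eq_Icc hrs hst]
  exact h1.1.union_of_isClosed h2.1 isClosed_Icc isClosed_Icc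

theorem isH1PathOn_of_chart (hφ : IsChart φ) {c : ℝ → M} {r s : ℝ}
    (hc : ∀ t ∈ Icc r s, c t ∈ φ.source) (h : IsH1On (fun t => φ (c t)) r s) :
    IsH1PathOn d c r s := by
  refine ⟨?_, fun ψ hψ a b ha hab hb hψs => ?_⟩
  · refine (φ.continuousOn_symm.comp h.continuousOn fun t ht => φ.map_source (hc t ht)).congr ?_
    intro t ht
    exact (φ.left_inv (hc t ht)).symm
  · exact IsH1On.of_chart hφ hψ (fun t ht => hc t ⟨ha.trans ht.1, ht.2.trans hb⟩) hψs (h.mono ha hb)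

/-! ### Frames -/

/-- Coordinate frames serve on short intervals. In another chart `ψ` such a frame reads `D(ψ ∘ φ⁻¹)`
evaluated along the curve, which is `H¹` by the chain rule. -/
theorem exists_h1Frame (γ : H1Curve d M) : Nonempty (H1Frame γ) := by
  let R : ℝ → ℝ → Prop := fun r s => ∃ e : ℝ → (EV d ≃L[ℝ] EV d), ∀ v : EV d,
    ∀ φ : OpenPartialHomeomorph M (EV d), IsChart φ → ∀ a b : ℝ, r ≤ a → a ≤ b → b ≤ s →
      (∀ t ∈ Icc a b, γ t ∈ φ.source) → IsH1On (fun t => dchart φ (γ t) (e t v)) a b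
  have H : R 0 1 := by
    refine curve_induction γ.continuousOn ?_ (fun x => (chartAt (EV d) x).source)
      (fun x => (chartAt (EV d) x).open_source) (fun x => mem_chart_source _ x) ?_
    · rintro r s t hr hrs hst ht ⟨e, he⟩ ⟨e', he'⟩
      classical
      -- A constant change of basis makes the second frame continue the first one at the junction
      -- without affecting its regularity.
      let C := (e s).trans (e' s).symm
      refine ⟨fun τ => if τ ≤ s then e τ else C.trans (e' τ), fun v φ hφ => ?_⟩
      refine forall_isH1On_trans (s := s) (fun a b ha hab hb hs => ?_) fun a b ha hab hb hs => ?_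
      · refine (he v φ hφ a b ha hab hb hs).congr fun τ hτ => ?_
        simp only [if_pos (hτ.2.trans hb)]
      · refine (he' (C v) φ hφ a b ha hab hb hs).congr fun τ hτ => ?_
        dsimp only
        split_ifs with h
        · obtain rfl : τ = s := le_antisymm h (ha.trans hτ.1)
          simp [C]
        · rfl
    · intro x r s hr hrs hs hx
      classical
      set φ := chartAt (EV d) x
      have hφ : IsChart φ := isChart_chartAt x
      refine ⟨fun τ => if h : γ τ ∈ φ.source then (dchartEquiv hφ h).symm else
        ContinuousLinearEquiv.refl ℝ _, fun v ψ hψ a b ha hab hb hψs => ?_⟩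
      have hab' : ∀ t ∈ Icc a b, γ t ∈ φ.source := fun t ht =>
        hx t ⟨ha.trans ht.1, ht.2.trans hb⟩
      have h1 : IsH1On (fun t => φ (γ t)) a b :=
        γ.isH1.2 φ hφ a b (hr.trans ha) hab (hb.trans hs) hab'
      refine (h1.comp (F := fun y => fderiv ℝ (fun z => ψ (φ.symm z)) y v) fun t ht => ?_).congr
        fun t ht => ?_
      · have h2 : ContDiffAt ℝ ∞ (fun z => ψ (φ.symm z)) (φ (γ t)) :=
          contDiffAt_transition hφ hψ (φ.map_source (hab' t ht))
            (by rw [φ.left_inv (hab' t ht)]; exact hψs t ht)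
        exact ((h2.fderiv_right (m := ∞) (by simp)).clm_apply contDiffAt_const).of_le (by simp)
      · dsimp only
        rw [dif_pos (hab' t ht), fderiv_transition hφ hψ (φ.map_source (hab' t ht))
          (by rw [φ.left_inv (hab' t ht)]; exact hψs t ht), φ.left_inv (hab' t ht)]
        rfl
  obtain ⟨e, he⟩ := H
  exact ⟨⟨fun t => (show EV d ≃L[ℝ] TangentSpace (𝓡 d) (γ t) from e t), he⟩⟩

/-- The frame at time `t`, as an isomorphism of `ℝ^d` with itself. -/
def H1Frame.equiv {γ : H1Curve d M} (e : H1Frame γ) (t : ℝ) : EV d ≃L[ℝ] EV d := e.toEquiv t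

/-- The frame in a chart. -/
def H1Frame.inChart {γ : H1Curve d M} (e : H1Frame γ) (φ : OpenPartialHomeomorph M (EV d))
    (t : ℝ) : EV d →L[ℝ] EV d :=
  (dchart φ (γ t)).comp (e.equiv t : EV d →L[ℝ] EV d)

theorem H1Frame.inChart_apply {γ : H1Curve d M} (e : H1Frame γ)
    (φ : OpenPartialHomeomorph M (EV d)) (t : ℝ) (v : EV d) :
    e.inChart φ t v = dchart φ (γ t) (e.equiv t v) := rfl

theorem H1Frame.isH1On_inChart {γ : H1Curve d M} (e : H1Frame γ) (hφ : IsChart φ) {a b : ℝ}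
    (ha : 0 ≤ a) (hab : a ≤ b) (hb : b ≤ 1) (h : ∀ t ∈ Icc a b, γ t ∈ φ.source) :
    IsH1On (e.inChart φ) a b :=
  isH1On_of_apply fun v => e.isH1 v φ hφ a b ha hab hb h

/-- The frame in a chart, as an isomorphism. -/
def H1Frame.inChartEquiv {γ : H1Curve d M} (e : H1Frame γ) (hφ : IsChart φ) {t : ℝ}
    (h : γ t ∈ φ.source) : EV d ≃L[ℝ] EV d :=
  (e.equiv t).trans (dchartEquiv hφ h)

theorem H1Frame.coe_inChartEquiv {γ : H1Curve d M} (e : H1Frame γ) (hφ : IsChart φ) {t : ℝ}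
    (h : γ t ∈ φ.source) : (e.inChartEquiv hφ h : EV d →L[ℝ] EV d) = e.inChart φ t := rfl

/-- In a chart, the components of `X` in the frame are the inverse of the frame matrix applied to
the chart components of `X`; inversion is smooth at invertible maps, so the result is `H¹`. Hence
every `H¹` field comes from a point of the model space. -/
theorem exists_field_eq {γ : H1Curve d M} (e : H1Frame γ)
    {X : ∀ t : ℝ, TangentSpace (𝓡 d) (γ t)} (hX : IsH1Field γ X) :
    ∃ ξ : H1Model d, ∀ t ∈ Icc (0 : ℝ) 1, e.field ξ t = X t := by
  let f : ℝ → EV d := fun t => (e.equiv t).symm (X t)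
  have H : IsH1On f 0 1 := by
    refine curve_induction (R := fun r s => IsH1On f r s) γ.continuousOn
      (fun r s t _ hrs hst _ h1 h2 => h1.append hrs hst h2) (fun x => (chartAt (EV d) x).source)
      (fun x => (chartAt (EV d) x).open_source) (fun x => mem_chart_source _ x) ?_
    intro x r s hr hrs hs hx
    set φ := chartAt (EV d) x
    have hφ : IsChart φ := isChart_chartAt x
    have h1 := (e.isH1On_inChart hφ hr hrs hs hx).prodMk (hX φ hφ r s hr hrs hs hx)
    refine (h1.comp (F := fun q => q.1.inverse q.2) fun t ht => ?_).congr fun t ht => ?_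
    · dsimp only
      rw [← e.coe_inChartEquiv hφ (hx t ht)]
      have h2 := (contDiffAt_map_inverse (𝕜 := ℝ) (n := 1) (e.inChartEquiv hφ (hx t ht)))
      exact ContDiffAt.clm_apply (ContDiffAt.comp (g := ContinuousLinearMap.inverse) _ h2
        contDiffAt_fst) contDiffAt_snd
    · dsimp only
      rw [← e.coe_inChartEquiv hφ (hx t ht), ContinuousLinearMap.inverse_equiv]
      refine ((e.inChartEquiv hφ (hx t ht)).symm_apply_eq.mpr ?_).symm
      exact congrArg (dchart φ (γ t)) ((e.equiv t).apply_symm_apply (X t)).symm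
  obtain ⟨u, hu⟩ := isH1On_iff.mp H
  refine ⟨(f 0, hu.1.toLp), fun t ht => ?_⟩
  have h1 : H1Model.eval (f 0, hu.1.toLp) t = f t := by
    rw [hu.2 t ht, H1Model.eval]
    congr 1
    exact L2.integral_congr (MemLp.coeFn_toLp hu.1) (by simp) ht
  change (e.equiv t) (H1Model.eval (f 0, hu.1.toLp) t) = X t
  rw [h1]
  exact ContinuousLinearEquiv.apply_symm_apply _ _

end Curves

theorem hasWeakDeriv_primC {V : Type*} [NormedAddCommGroup V] [NormedSpace ℝ V] (y : L2 V) :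
    HasWeakDeriv (fun t => primC V y (projI t)) y 0 1 := by
  refine ⟨Lp.memLp y, fun t ht => ?_⟩
  simp only [primC_apply, projI_of_mem ht]
  simp

/-- The representative of `r • ξ.2` is a multiple of that of `ξ.2` only almost everywhere on `[0,
1]`, so linearity is read off from the operator `primC`, and only for times in `[0, 1]`. -/
theorem H1Model.eval_smul {d : ℕ} (r : ℝ) (ξ : H1Model d) {t : ℝ} (ht : t ∈ Icc (0 : ℝ) 1) :
    (r • ξ).eval t = r • ξ.eval t := by
  have h := congrArg (fun f : C(unitInterval, EV d) => f ⟨t, ht⟩) (map_smul (primC (EV d)) r ξ.2)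
  change (∫ s in (0 : ℝ)..t, (r • ξ.2 : L2 (EV d)) s) =
    r • (∫ s in (0 : ℝ)..t, (ξ.2 : ℝ → EV d) s) at h
  simp only [H1Model.eval, Prod.smul_fst, Prod.smul_snd]
  rw [h, smul_add]

theorem H1Model.eval_zero_left {d : ℕ} {t : ℝ} (ht : t ∈ Icc (0 : ℝ) 1) :
    (0 : H1Model d).eval t = 0 := by
  have h := H1Model.eval_smul 0 (0 : H1Model d) ht
  rwa [zero_smul, zero_smul] at h

/-- The position, frame and field at a time, in a chart. -/
abbrev FrameState (d : ℕ) : Type := EV d × (EV d →L[ℝ] EV d) × EV d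

instance (d : ℕ) : NormedAddCommGroup (FrameState d) := Prod.normedAddCommGroup

instance (d : ℕ) : NormedSpace ℝ (FrameState d) := Prod.normedSpace

instance (d : ℕ) : NormedAddCommGroup C(unitInterval, FrameState d) :=
  ContinuousMap.instNormedAddCommGroup

instance (d : ℕ) : NormedSpace ℝ C(unitInterval, FrameState d) := ContinuousMap.normedSpace

variable (d : ℕ) in
/-- The inclusion of the field component. -/
def FrameState.incl : EV d →L[ℝ] FrameState d :=
  (ContinuousLinearMap.inr ℝ (EV d) ((EV d →L[ℝ] EV d) × EV d)).comp
    (ContinuousLinearMap.inr ℝ (EV d →L[ℝ] EV d) (EV d))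

theorem FrameState.incl_apply {d : ℕ} (v : EV d) : FrameState.incl d v = (0, 0, v) := rfl

/-! ### Curves near a given curve, in one chart. -/

section State

variable {d : ℕ} {M : Type*} [TopologicalSpace M] [ChartedSpace (EV d) M]
  [IsManifold (𝓡 d) ∞ M] {φ ψ : OpenPartialHomeomorph M (EV d)}

/-- The base curve, the frame and the field `ξ` on `[α, β]` in a chart, as functions of `ξ`, extended
to `[0, 1]` by constants. -/
structure ChartState {γ : H1Curve d M} (e : H1Frame γ) (φ : OpenPartialHomeomorph M (EV d))
    (α β : ℝ) where
  c : H1Model d → C(unitInterval, FrameState d)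
  p : H1Model d → L2 (FrameState d)
  weak : ∀ ξ, HasWeakDeriv (fun t => c ξ (projI t)) (p ξ) 0 1
  contDiff_c : ContDiff ℝ ∞ c
  contDiff_p : ContDiff ℝ ∞ p
  c_apply : ∀ ξ (t : unitInterval), c ξ t =
    (φ (γ (clamp α β t)), e.inChart φ (clamp α β t), ξ.eval (clamp α β t))
  p_smul : ∀ (s : ℝ) ξ, p (s • ξ) = p 0 + s • (p ξ - p 0)

/-- Position and frame do not depend on `ξ`, and the field depends on it linearly. Both the state
and its velocity are thus affine continuous functions of `ξ`, hence smooth. Clamping time to `[α,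
β]` keeps all function spaces over `[0, 1]`. -/
theorem exists_chartState {γ : H1Curve d M} (e : H1Frame γ) (hφ : IsChart φ) {α β : ℝ}
    (hα : 0 ≤ α) (hαβ : α ≤ β) (hβ : β ≤ 1) (h : ∀ t ∈ Icc α β, γ t ∈ φ.source) :
    Nonempty (ChartState e φ α β) := by
  have h0 : IsH1On (fun t => ((φ (γ t), e.inChart φ t, 0) : FrameState d)) α β :=
    (γ.isH1.2 φ hφ α β hα hαβ hβ h).prodMk ((e.isH1On_inChart hφ hα hαβ hβ h).prodMk
      (IsH1On.const 0 α β))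
  obtain ⟨u, hu⟩ := isH1On_iff.mp h0
  have hw := hu.clamp hα hαβ hβ
  let c₀ : C(unitInterval, FrameState d) :=
    ⟨fun t => (φ (γ (clamp α β t)), e.inChart φ (clamp α β t), 0),
      hu.continuousOn.comp_continuous ((continuous_clamp α β).comp continuous_subtype_val)
        fun t => clamp_mem hαβ _⟩
  let p₀ : L2 (FrameState d) := hw.1.toLp
  let Iα : unitInterval := ⟨α, hα, hαβ.trans hβ⟩
  let eα : H1Model d →L[ℝ] EV d := ContinuousLinearMap.fst ℝ _ _ +
    (ContinuousMap.evalCLM ℝ Iα).comp ((primC (EV d)).comp (ContinuousLinearMap.snd ℝ _ _))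
  let D : H1Model d →L[ℝ] L2 (EV d) :=
    (indL2 (EV d) (Icc α β) measurableSet_Icc).comp (ContinuousLinearMap.snd ℝ _ _)
  -- The clamped field is its value at `α` plus the primitive of the derivative restricted to `[α,
  -- β]`.
  let cL : H1Model d →L[ℝ] C(unitInterval, EV d) :=
    (constC (EV d)).comp eα + (primC (EV d)).comp D
  let cQ : H1Model d →L[ℝ] C(unitInterval, FrameState d) :=
    (applyC unitInterval (EV d) (FrameState d) (constC _ (FrameState.incl d))).comp cL
  let pQ : H1Model d →L[ℝ] L2 (FrameState d) := ((FrameState.incl d).compLpL 2 volI).comp D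
  have hcL : ∀ ξ (t : unitInterval), cL ξ t = ξ.eval (clamp α β t) := by
    intro ξ t
    change ξ.1 + (∫ s in (0 : ℝ)..α, (ξ.2 : ℝ → EV d) s) + ∫ s in (0 : ℝ)..t,
      (indL2 (EV d) (Icc α β) measurableSet_Icc ξ.2 : ℝ → EV d) s = _
    have hc := clamp_mem hαβ (t : ℝ)
    rw [L2.integral_congr (coeFn_indL2 (Icc α β) measurableSet_Icc ξ.2) (by simp) t.2,
      integral_indicator_Icc hα hαβ _ t.2.1, H1Model.eval, add_assoc,
      intervalIntegral.integral_add_adjacent_intervals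
        (L2.intervalIntegrable _ (by simp) ⟨hα, hαβ.trans hβ⟩)
        (L2.intervalIntegrable _ ⟨hα, hαβ.trans hβ⟩ ⟨hα.trans hc.1, hc.2.trans hβ⟩)]
  have hcw : ∀ ξ, HasWeakDeriv (fun t => cL ξ (projI t)) (D ξ) 0 1 := fun ξ => by
    refine ((HasWeakDeriv.const (eα ξ) 0 1).add (hasWeakDeriv_primC (D ξ))).congr_ae ?_ |>.congr ?_
    · simp
    · intro t _; rfl
  refine ⟨⟨fun ξ => c₀ + cQ ξ, fun ξ => p₀ + pQ ξ, fun ξ => ?_, contDiff_const.add cQ.contDiff,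
    contDiff_const.add pQ.contDiff, fun ξ t => ?_, fun s ξ => ?_⟩⟩
  · refine ((hw.add ((hcw ξ).clm (FrameState.incl d))).congr_ae ?_).congr fun t ht => ?_
    · filter_upwards [Lp.coeFn_add p₀ (pQ ξ), MemLp.coeFn_toLp hw.1,
        (FrameState.incl d).coeFn_compLpL (p := 2) (D ξ)] with t h1 h2 h3
      rw [h1, Pi.add_apply, h2]
      congr 1
    · simp only [ContinuousMap.add_apply, projI_of_mem ht]
      rfl
  · change c₀ t + FrameState.incl d (cL ξ t) = _
    rw [hcL, FrameState.incl_apply]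
    change ((φ (γ (clamp α β t)), e.inChart φ (clamp α β t), 0) : FrameState d) + _ = _
    simp
  · simp

theorem ChartState.c_smul {γ : H1Curve d M} {e : H1Frame γ} {α β : ℝ} (hα : 0 ≤ α)
    (hαβ : α ≤ β) (hβ : β ≤ 1) (S : ChartState e φ α β) (s : ℝ) (ξ : H1Model d) :
    S.c (s • ξ) = S.c 0 + s • (S.c ξ - S.c 0) := by
  ext1 t
  have hc := clamp_mem hαβ (t : ℝ)
  have hc' : clamp α β t ∈ Icc (0 : ℝ) 1 := ⟨hα.trans hc.1, hc.2.trans hβ⟩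
  simp only [ContinuousMap.add_apply, ContinuousMap.smul_apply, ContinuousMap.sub_apply, S.c_apply,
    H1Model.eval_smul _ _ hc', H1Model.eval_zero_left hc']
  simp

theorem ChartState.c_sub {γ : H1Curve d M} {e : H1Frame γ} {α β : ℝ} (hα : 0 ≤ α)
    (hαβ : α ≤ β) (hβ : β ≤ 1) (S : ChartState e φ α β) (ξ : H1Model d) (t : unitInterval) :
    (S.c ξ - S.c 0) t = FrameState.incl d (ξ.eval (clamp α β t)) := by
  have hc := clamp_mem hαβ (t : ℝ)
  have hc' : clamp α β t ∈ Icc (0 : ℝ) 1 := ⟨hα.trans hc.1, hc.2.trans hβ⟩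
  simp only [ContinuousMap.sub_apply, S.c_apply, H1Model.eval_zero_left hc', FrameState.incl_apply]
  simp

theorem ChartState.c_zero {γ : H1Curve d M} {e : H1Frame γ} {α β : ℝ} (hα : 0 ≤ α)
    (hαβ : α ≤ β) (hβ : β ≤ 1) (S : ChartState e φ α β) (t : unitInterval) :
    S.c 0 t = (φ (γ (clamp α β t)), e.inChart φ (clamp α β t), 0) := by
  have hc := clamp_mem hαβ (t : ℝ)
  rw [S.c_apply, H1Model.eval_zero_left ⟨hα.trans hc.1, hc.2.trans hβ⟩]

theorem ChartState.weak_sub {γ : H1Curve d M} {e : H1Frame γ} {α β : ℝ}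
    (S : ChartState e φ α β) (ξ : H1Model d) :
    HasWeakDeriv (fun t => (S.c ξ - S.c 0) (projI t)) (S.p ξ - S.p 0 : L2 (FrameState d)) 0 1 := by
  have h := (S.weak ξ).add ((S.weak 0).clm (-ContinuousLinearMap.id ℝ _))
  refine (h.congr_ae ?_).congr fun t _ => ?_
  · filter_upwards [Lp.coeFn_sub (S.p ξ) (S.p 0)] with t ht
    rw [ht, Pi.sub_apply, sub_eq_add_neg]
    rfl
  · simp [sub_eq_add_neg]

theorem ChartState.c_projI {γ : H1Curve d M} {e : H1Frame γ} {α β : ℝ} (hα : 0 ≤ α) (hβ : β ≤ 1)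
    (S : ChartState e φ α β) (ξ : H1Model d) {t : ℝ} (ht : t ∈ Icc α β) :
    S.c ξ (projI t) = (φ (γ t), e.inChart φ t, ξ.eval t) := by
  rw [S.c_apply, projI_of_mem ⟨hα.trans ht.1, ht.2.trans hβ⟩, clamp_of_mem ht]

variable (g : RMetric d M)

/-- The exponential map in a chart, as a function of position, frame and field. -/
def expState (φ : OpenPartialHomeomorph M (EV d)) (q : FrameState d) : EV d :=
  expIn g φ (q.1, q.2.1 q.2.2)

/-- The coordinate frame of the normal chart. -/
def stateFrame (φ : OpenPartialHomeomorph M (EV d)) (q : FrameState d) : EV d →L[ℝ] EV d :=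
  (fderiv ℝ (expState g φ) q).comp (FrameState.incl d)

/-- The exponential map is well behaved near `q`. -/
structure IsRegularState (φ : OpenPartialHomeomorph M (EV d)) (q : FrameState d) : Prop where
  mem_source : ∀ᶠ q' in 𝓝 q,
    expMap g (φ.symm q'.1) (dsymm φ q'.1 (q'.2.1 q'.2.2)) ∈ φ.source
  contDiffAt : ContDiffAt ℝ 1 (expState g φ) q
  isInvertible : (stateFrame g φ q).IsInvertible

variable {g}

section

variable [T2Space M]

theorem contDiffAt_expState (hφ : IsChart φ) {y : EV d} (hy : y ∈ φ.target)
    (L : EV d →L[ℝ] EV d) : ContDiffAt ℝ ∞ (expState g φ) (y, L, 0) := by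
  have h1 : ContDiffAt ℝ ∞ (fun q : FrameState d => (q.1, q.2.1 q.2.2)) (y, L, 0) :=
    contDiffAt_fst.prodMk
      ((contDiffAt_fst.comp _ contDiffAt_snd).clm_apply (contDiffAt_snd.comp _ contDiffAt_snd))
  refine ContDiffAt.comp (g := expIn g φ) _ ?_ h1
  simp only [map_zero]
  exact contDiffAt_expIn hφ hy

theorem expState_zero {y : EV d} (hy : y ∈ φ.target) (L : EV d →L[ℝ] EV d) :
    expState g φ (y, L, 0) = y := by
  simp only [expState, map_zero]
  exact expIn_zero hy

/-- As `exp` has the identity as derivative at a zero vector, the normal frame at `ξ = 0` is the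
given frame. -/
theorem stateFrame_zero (hφ : IsChart φ) {y : EV d} (hy : y ∈ φ.target)
    (L : EV d →L[ℝ] EV d) : stateFrame g φ (y, L, 0) = L := by
  have h1 := ((contDiffAt_expState (g := g) hφ hy L).differentiableAt (by simp)).hasFDerivAt
  ext1 v
  have h2 : HasDerivAt (fun s : ℝ => ((y, L, s • v) : FrameState d)) (0, 0, v) 0 := by
    simpa using (hasDerivAt_const (0 : ℝ) y).prodMk
      ((hasDerivAt_const (0 : ℝ) L).prodMk ((hasDerivAt_id (0 : ℝ)).smul_const v))
  have h3 := h1.comp_hasDerivAt_of_eq 0 h2 (by simp)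
  have h4 := ((contDiffAt_expIn (g := g) hφ hy).differentiableAt (by simp)).hasFDerivAt
  have h5 : HasDerivAt (fun s : ℝ => ((y, s • L v) : EV d × EV d)) (0, L v) 0 := by
    simpa using (hasDerivAt_const (0 : ℝ) y).prodMk ((hasDerivAt_id (0 : ℝ)).smul_const (L v))
  have h6 := h4.comp_hasDerivAt_of_eq 0 h5 (by simp)
  rw [fderiv_expIn hφ hy] at h6
  refine h3.unique (h6.congr_of_eventuallyEq (Filter.Eventually.of_forall fun s => ?_))
  simp [expState]

theorem contDiffAt_stateFrame (hφ : IsChart φ) {y : EV d} (hy : y ∈ φ.target)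
    (L : EV d →L[ℝ] EV d) : ContDiffAt ℝ ∞ (stateFrame g φ) (y, L, 0) :=
  ((contDiffAt_expState (g := g) hφ hy L).fderiv_right (m := ∞) (by simp)).clm_comp contDiffAt_const

/-- At the zero field the normal frame is `L`; invertibility, `C¹` regularity and membership in the
chart domain all persist on a neighbourhood. -/
theorem eventually_isRegularState (hφ : IsChart φ) {y : EV d} (hy : y ∈ φ.target)
    {L : EV d →L[ℝ] EV d} (hL : L.IsInvertible) :
    ∀ᶠ q in 𝓝 ((y, L, 0) : FrameState d), IsRegularState g φ q := by
  have hc : ContinuousAt (fun q : FrameState d => (q.1, q.2.1 q.2.2)) (y, L, 0) := by fun_prop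
  have h1 : ∀ᶠ q : FrameState d in 𝓝 (y, L, 0),
      expMap g (φ.symm q.1) (dsymm φ q.1 (q.2.1 q.2.2)) ∈ φ.source := by
    refine hc.eventually (p := fun z => expMap g (φ.symm z.1) (dsymm φ z.1 z.2) ∈ φ.source) ?_
    simp only [map_zero]
    exact eventually_expMap_mem hφ hy
  have h2 : ∀ᶠ q in 𝓝 ((y, L, 0) : FrameState d), ContDiffAt ℝ 1 (expState g φ) q :=
    ((contDiffAt_expState hφ hy L).of_le (by simp)).eventually (by simp)
  have h3 : ∀ᶠ q in 𝓝 ((y, L, 0) : FrameState d), (stateFrame g φ q).IsInvertible := by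
    refine (contDiffAt_stateFrame (g := g) hφ hy L).continuousAt.eventually ?_
    rw [stateFrame_zero hφ hy]
    obtain ⟨L', rfl⟩ := hL
    exact L'.nhds
  filter_upwards [h1.eventually_nhds, h2, h3] with q q1 q2 q3 using ⟨q1, q2, q3⟩

end

theorem expMap_congr {x x' : M} (h : x = x') (v : EV d) : expMap g x v = expMap g x' v := by
  subst h; rfl

theorem expMap_eq_chart (hφ : IsChart φ) {x : M} (hx : x ∈ φ.source) (v : EV d) :
    expMap g x v = expMap g (φ.symm (φ x)) (dsymm φ (φ x) (dchart φ x v)) :=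
  (expMap_congr (φ.left_inv hx) v).symm.trans
    (congrArg (expMap g (φ.symm (φ x))) (hφ.dsymm_dchart hx v).symm)

theorem expMap_frame_eq (hφ : IsChart φ) {γ : H1Curve d M} (e : H1Frame γ) {t : ℝ}
    (ht : γ t ∈ φ.source) (v : EV d) : expMap g (γ t) (e.toEquiv t v) =
      expMap g (φ.symm (φ (γ t))) (dsymm φ (φ (γ t)) (e.inChart φ t v)) :=
  expMap_eq_chart hφ ht _

end State

/-! ### The curves `exp_γ(eξ)` for small `ξ`. -/

section ExpCurve

variable {d : ℕ} {M : Type*} [TopologicalSpace M] [ChartedSpace (EV d) M]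
  [IsManifold (𝓡 d) ∞ M] {φ ψ : OpenPartialHomeomorph M (EV d)} {g : RMetric d M}
  {γ : H1Curve d M} {e : H1Frame γ} {α β : ℝ} {ξ : H1Model d}

theorem extendPath_apply (f : unitInterval → M) {t : ℝ} (ht : t ∈ Icc (0 : ℝ) 1) :
    extendPath f t = f ⟨t, ht⟩ :=
  congrArg f (projI_of_mem ht)

theorem dchart_velocity (hφ : IsChart φ) {t : ℝ} (hc : ContinuousAt γ t) (ht : γ t ∈ φ.source)
    {u : EV d} (h : HasDerivAt (fun r => φ (γ r)) u t) : dchart φ (γ t) (velocity γ t) = u :=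
  (hasDerivAt_chart_comp hφ ht (mdifferentiableAt_of_chart hφ hc ht h)).unique h

theorem H1Curve.continuousAt (γ : H1Curve d M) {t : ℝ} (ht : t ∈ Ioo (0 : ℝ) 1) :
    ContinuousAt γ t :=
  γ.continuousOn.continuousAt (Icc_mem_nhds ht.1 ht.2)

theorem ae_dchart_velocity (hφ : IsChart φ) (hα : 0 ≤ α) (hβ : β ≤ 1)
    (hγ : ∀ t ∈ Icc α β, γ t ∈ φ.source) {u : ℝ → EV d}
    (h : HasWeakDeriv (fun t => φ (γ t)) u α β) :
    ∀ᵐ t ∂(volume.restrict (Icc α β)), dchart φ (γ t) (velocity γ t) = u t := by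
  filter_upwards [h.ae_hasDerivAt, ae_mem_Ioo α β] with t ht hti
  exact dchart_velocity hφ (γ.continuousAt ⟨hα.trans_lt hti.1, hti.2.trans_le hβ⟩)
    (hγ t (Ioo_subset_Icc_self hti)) ht

theorem IsH1PathOn.congr {c c' : ℝ → M} {r s : ℝ} (h : IsH1PathOn d c r s)
    (hc : EqOn c' c (Icc r s)) : IsH1PathOn d c' r s := by
  refine ⟨h.1.congr hc, fun φ hφ a b ha hab hb hs => ?_⟩
  have hsub : ∀ t ∈ Icc a b, c' t = c t := fun t ht => hc ⟨ha.trans ht.1, ht.2.trans hb⟩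
  exact (h.2 φ hφ a b ha hab hb fun t ht => hsub t ht ▸ hs t ht).congr fun t ht => by
    rw [hsub t ht]

open Classical in
/-- `f` as an `H¹` curve, with the value `γ` if it is not one. -/
def expOfPath (γ : H1Curve d M) (f : unitInterval → M) : H1Curve d M :=
  if h : IsH1Path (d := d) (extendPath f) then ⟨f, h⟩ else γ

theorem expCurve_congr {X Y : ∀ t : ℝ, TangentSpace (𝓡 d) (γ t)}
    (h : ∀ t ∈ Icc (0 : ℝ) 1, X t = Y t) : expCurve g γ X = expCurve g γ Y := by
  have h1 : (fun t : unitInterval => expMap g (γ t) (X t)) = fun t : unitInterval =>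
      expMap g (γ t) (Y t) := funext fun t => by rw [h t t.2]
  have h2 : ∀ f f' : unitInterval → M, f = f' → expOfPath γ f = expOfPath γ f' := by
    rintro f _ rfl; rfl
  exact h2 _ _ h1

theorem expCurve_apply {X : ∀ t : ℝ, TangentSpace (𝓡 d) (γ t)}
    (h : IsH1Path (d := d) (extendPath fun t : unitInterval => expMap g (γ t) (X t))) {t : ℝ}
    (ht : t ∈ Icc (0 : ℝ) 1) : expCurve g γ X t = expMap g (γ t) (X t) := by
  have h1 : expCurve g γ X = ⟨_, h⟩ := dif_pos h
  rw [h1]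
  exact extendPath_apply _ ht

/-- `exp_γ(eξ)` is given by the pointwise formula. -/
def IsExpCurve (g : RMetric d M) (e : H1Frame γ) (ξ : H1Model d) : Prop :=
  ∀ t ∈ Icc (0 : ℝ) 1, expCurve g γ (e.field ξ) t = expMap g (γ t) (e.toEquiv t (ξ.eval t))

theorem exp_mem_source (hφ : IsChart φ) (hα : 0 ≤ α) (hβ : β ≤ 1)
    (hγ : ∀ t ∈ Icc α β, γ t ∈ φ.source) (S : ChartState e φ α β)
    (hξ : ∀ t, IsRegularState g φ (S.c ξ t)) {t : ℝ} (ht : t ∈ Icc α β) :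
    expMap g (γ t) (e.toEquiv t (ξ.eval t)) ∈ φ.source := by
  have h := (hξ (projI t)).mem_source.self_of_nhds
  rw [S.c_projI hα hβ ξ ht] at h
  rw [expMap_frame_eq hφ e (hγ t ht)]
  exact h

theorem chart_exp (hφ : IsChart φ) (hα : 0 ≤ α) (hβ : β ≤ 1)
    (hγ : ∀ t ∈ Icc α β, γ t ∈ φ.source) (S : ChartState e φ α β) {t : ℝ} (ht : t ∈ Icc α β) :
    φ (expMap g (γ t) (e.toEquiv t (ξ.eval t))) = expState g φ (S.c ξ (projI t)) := by
  rw [S.c_projI hα hβ ξ ht, expMap_frame_eq hφ e (hγ t ht)]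
  rfl

theorem hasWeakDeriv_expState (hα : 0 ≤ α) (hβ : β ≤ 1) (S : ChartState e φ α β)
    (hξ : ∀ t, IsRegularState g φ (S.c ξ t)) :
    HasWeakDeriv (fun t => expState g φ (S.c ξ (projI t)))
    (fun t => fderiv ℝ (expState g φ) (S.c ξ (projI t)) (S.p ξ t)) α β :=
  ((S.weak ξ).comp fun t _ => (hξ (projI t)).contDiffAt).mono hα hβ

theorem isH1PathOn_exp (hφ : IsChart φ) (hα : 0 ≤ α) (hβ : β ≤ 1)
    (hγ : ∀ t ∈ Icc α β, γ t ∈ φ.source) (S : ChartState e φ α β)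
    (hξ : ∀ t, IsRegularState g φ (S.c ξ t)) :
    IsH1PathOn d (fun t => expMap g (γ t) (e.toEquiv t (ξ.eval t))) α β := by
  refine isH1PathOn_of_chart hφ (fun t ht => exp_mem_source hφ hα hβ hγ S hξ ht) ?_
  exact (isH1On_iff.mpr ⟨_, hasWeakDeriv_expState hα hβ S hξ⟩).congr fun t ht =>
    chart_exp hφ hα hβ hγ S ht

theorem expCurve_mem_source (hφ : IsChart φ) (hα : 0 ≤ α) (hβ : β ≤ 1)
    (hγ : ∀ t ∈ Icc α β, γ t ∈ φ.source) (S : ChartState e φ α β)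
    (hξ : ∀ t, IsRegularState g φ (S.c ξ t)) (hexp : IsExpCurve g e ξ) {t : ℝ} (ht : t ∈ Icc α β) :
    expCurve g γ (e.field ξ) t ∈ φ.source := by
  rw [hexp t ⟨hα.trans ht.1, ht.2.trans hβ⟩]
  exact exp_mem_source hφ hα hβ hγ S hξ ht

theorem chart_expCurve (hφ : IsChart φ) (hα : 0 ≤ α) (hβ : β ≤ 1)
    (hγ : ∀ t ∈ Icc α β, γ t ∈ φ.source) (S : ChartState e φ α β)
    (hexp : IsExpCurve g e ξ) {t : ℝ} (ht : t ∈ Icc α β) :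
    φ (expCurve g γ (e.field ξ) t) = expState g φ (S.c ξ (projI t)) := by
  rw [hexp t ⟨hα.trans ht.1, ht.2.trans hβ⟩]
  exact chart_exp hφ hα hβ hγ S ht

theorem ae_dchart_velocity_expCurve (hφ : IsChart φ) (hα : 0 ≤ α) (hβ : β ≤ 1)
    (hγ : ∀ t ∈ Icc α β, γ t ∈ φ.source) (S : ChartState e φ α β)
    (hξ : ∀ t, IsRegularState g φ (S.c ξ t)) (hexp : IsExpCurve g e ξ) : ∀ᵐ t ∂(volume.restrict (Icc α β)),
    dchart φ (expCurve g γ (e.field ξ) t) (velocity (expCurve g γ (e.field ξ)) t) =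
      fderiv ℝ (expState g φ) (S.c ξ (projI t)) (S.p ξ t) :=
  ae_dchart_velocity hφ hα hβ (fun _ ht => expCurve_mem_source hφ hα hβ hγ S hξ hexp ht)
    ((hasWeakDeriv_expState hα hβ S hξ).congr fun _ ht =>
      chart_expCurve hφ hα hβ hγ S hexp ht)

/-- The normal frame is a derivative of an `M`-valued map of the field variable alone. Near `ξ(t)`
that map stays in the chart, where it becomes `expState` with position and frame frozen. -/
theorem dchart_normalFrame (hφ : IsChart φ) (hα : 0 ≤ α) (hβ : β ≤ 1)
    (hγ : ∀ t ∈ Icc α β, γ t ∈ φ.source) (S : ChartState e φ α β)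
    (hξ : ∀ t, IsRegularState g φ (S.c ξ t)) (hexp : IsExpCurve g e ξ) {t : ℝ} (ht : t ∈ Icc α β) (v : EV d) :
    dchart φ (expCurve g γ (e.field ξ) t) (normalFrame g e ξ t v) =
      stateFrame g φ (S.c ξ (projI t)) v := by
  have hq := S.c_projI hα hβ ξ ht
  have hreg := hξ (projI t)
  rw [hq] at hreg
  set y := φ (γ t)
  set L := e.inChart φ t
  set k : EV d → M := fun u => expMap g (γ t) (e.toEquiv t u) with hk
  have hc : ContinuousAt (fun u : EV d => ((y, L, u) : FrameState d)) (ξ.eval t) := by fun_prop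
  have hsrc : ∀ᶠ u in 𝓝 (ξ.eval t), k u ∈ φ.source := by
    filter_upwards [hc.eventually hreg.mem_source] with u hu
    rw [hk]
    dsimp only
    rw [expMap_frame_eq hφ e (hγ t ht)]
    exact hu
  have hkeq : k =ᶠ[𝓝 (ξ.eval t)] φ.symm ∘ fun u => expState g φ (y, L, u) := by
    filter_upwards [hsrc] with u hu
    have h1 : φ (k u) = expState g φ (y, L, u) :=
      congrArg φ (expMap_frame_eq hφ e (hγ t ht) u)
    rw [Function.comp_apply, ← h1, φ.left_inv hu]
  have hφk : expState g φ (y, L, ξ.eval t) = φ (expCurve g γ (e.field ξ) t) := by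
    rw [chart_expCurve hφ hα hβ hγ S hexp ht, hq]
  have hd : HasFDerivAt (fun u => expState g φ (y, L, u)) (stateFrame g φ (y, L, ξ.eval t))
      (ξ.eval t) := by
    have h1 := (hreg.contDiffAt.differentiableAt one_ne_zero).hasFDerivAt
    have h2 : HasFDerivAt (fun u : EV d => ((y, L, u) : FrameState d)) (FrameState.incl d)
        (ξ.eval t) :=
      ((hasFDerivAt_const y _).prodMk ((hasFDerivAt_const L _).prodMk
        (hasFDerivAt_id _))).congr_fderiv (by ext1 v; rfl)
    exact h1.comp (ξ.eval t) h2
  have htar : expState g φ (y, L, ξ.eval t) ∈ φ.target := by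
    rw [hφk]; exact φ.map_source (expCurve_mem_source hφ hα hβ hγ S hξ hexp ht)
  have hm : HasMFDerivAt 𝓘(ℝ, EV d) (𝓡 d) k (ξ.eval t)
      ((dsymm φ (expState g φ (y, L, ξ.eval t))).comp (stateFrame g φ (y, L, ξ.eval t))) :=
    ((hφ.mdifferentiableAt_symm htar).hasMFDerivAt.comp (ξ.eval t)
      hd.hasMFDerivAt).congr_of_eventuallyEq hkeq
  have h3 : normalFrame g e ξ t v =
      dsymm φ (expState g φ (y, L, ξ.eval t)) (stateFrame g φ (y, L, ξ.eval t) v) :=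
    DFunLike.congr_fun hm.mfderiv v
  rw [h3, hq, hφk]
  exact hφ.dchart_dsymm' (expCurve_mem_source hφ hα hβ hγ S hξ hexp ht) _

variable [T2Space M]

theorem ChartState.eventually_isRegularState (hφ : IsChart φ) (hα : 0 ≤ α) (hαβ : α ≤ β)
    (hβ : β ≤ 1) (hγ : ∀ t ∈ Icc α β, γ t ∈ φ.source) (S : ChartState e φ α β) :
    ∀ᶠ ξ in 𝓝 (0 : H1Model d), ∀ t, IsRegularState g φ (S.c ξ t) := by
  have hc : Filter.Tendsto S.c (𝓝 0) (𝓝 (S.c 0)) := S.contDiff_c.continuous.tendsto 0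
  suffices h : ∀ᶠ v in 𝓝 (S.c 0), ∀ t, IsRegularState g φ (v t) from hc.eventually h
  have key : ∀ t, ∀ᶠ q in 𝓝 (S.c 0 t), IsRegularState g φ q := by
    intro t
    have ht := hγ _ (clamp_mem hαβ (t : ℝ))
    rw [S.c_zero hα hαβ hβ]
    exact LevyGrad.eventually_isRegularState hφ (φ.map_source ht)
      ⟨e.inChartEquiv hφ ht, e.coe_inChartEquiv hφ ht⟩
  exact eventually_forall_of_forall_eventually key

-- How small `ξ` must be depends on the interval, but joining two intervals only intersects two
-- neighbourhoods of zero, so `curve_induction` applies to the eventual statement itself.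
variable (g e) in
theorem eventually_isH1PathOn : ∀ᶠ ξ in 𝓝 (0 : H1Model d),
    IsH1PathOn d (fun t => expMap g (γ t) (e.toEquiv t (ξ.eval t))) 0 1 := by
  let R : ℝ → ℝ → Prop := fun r s => ∀ᶠ ξ in 𝓝 (0 : H1Model d),
    IsH1PathOn d (fun t => expMap g (γ t) (e.toEquiv t (ξ.eval t))) r s
  have htrans : ∀ r s t, 0 ≤ r → r ≤ s → s ≤ t → t ≤ 1 → R r s → R s t → R r t := by
    intro r s t _ hrs hst _ h1 h2
    filter_upwards [h1, h2] with ξ h1 h2 using h1.trans hrs hst h2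
  have hloc : ∀ x α β, 0 ≤ α → α ≤ β → β ≤ 1 →
      (∀ τ ∈ Icc α β, γ τ ∈ (chartAt (EV d) x).source) → R α β := by
    intro x α β hα hαβ hβ hx
    obtain ⟨S⟩ := exists_chartState e (isChart_chartAt x) hα hαβ hβ hx
    filter_upwards [S.eventually_isRegularState (g := g) (isChart_chartAt x) hα hαβ hβ hx] with ξ hξ
    exact isH1PathOn_exp (isChart_chartAt x) hα hβ hx S hξ
  exact curve_induction (R := R) γ.continuousOn htrans (fun x => (chartAt (EV d) x).source)
    (fun x => (chartAt (EV d) x).open_source) (fun x => mem_chart_source _ x) hloc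

theorem isExpCurve_of_isH1PathOn
    (h : IsH1PathOn d (fun t => expMap g (γ t) (e.toEquiv t (ξ.eval t))) 0 1) :
    IsExpCurve g e ξ := by
  have h1 : IsH1Path (d := d) (extendPath fun t : unitInterval => expMap g (γ t) (e.field ξ t)) :=
    h.congr fun t ht => extendPath_apply _ ht
  exact fun t ht => expCurve_apply h1 ht

variable (g e) in
theorem eventually_isExpCurve : ∀ᶠ ξ in 𝓝 (0 : H1Model d), IsExpCurve g e ξ :=
  (eventually_isH1PathOn g e).mono fun _ h => isExpCurve_of_isH1PathOn h

variable (g e) in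
theorem expCurve_zero : expCurve g γ (e.field 0) = γ := by
  have h0 := (eventually_isExpCurve g e).self_of_nhds
  have h1 : ∀ t : unitInterval, expCurve g γ (e.field 0) t = γ t := fun t => by
    rw [h0 t t.2, H1Model.eval_zero_left t.2]
    exact (congrArg (expMap g (γ t)) (map_zero (e.equiv t))).trans (expMap_zero _)
  have h2 : (expCurve g γ (e.field 0)).toPath = γ.toPath := funext fun t => by
    have h3 := h1 t
    rw [extendPath_apply _ t.2, extendPath_apply _ t.2] at h3
    exact h3
  cases hη : expCurve g γ (e.field 0)
  cases hγ : γ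
  simp_all

theorem field_smul (s : ℝ) (ζ : H1Model d) {t : ℝ} (ht : t ∈ Icc (0 : ℝ) 1) :
    e.field (s • ζ) t = s • e.field ζ t := by
  unfold H1Frame.field
  rw [H1Model.eval_smul _ _ ht, map_smul]

end ExpCurve

theorem forall_hasWeakDeriv_trans {V : Type*} [NormedAddCommGroup V] [NormedSpace ℝ V]
    [CompleteSpace V] {f u : ℝ → V} {p : ℝ → Prop} {r s t : ℝ}
    (h1 : ∀ a b, r ≤ a → a ≤ b → b ≤ s → (∀ τ ∈ Icc a b, p τ) → HasWeakDeriv f u a b)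
    (h2 : ∀ a b, s ≤ a → a ≤ b → b ≤ t → (∀ τ ∈ Icc a b, p τ) → HasWeakDeriv f u a b) :
    ∀ a b, r ≤ a → a ≤ b → b ≤ t → (∀ τ ∈ Icc a b, p τ) → HasWeakDeriv f u a b := by
  intro a b ha hab hb hp
  rcases le_total b s with hbs | hsb
  · exact h1 a b ha hab hbs hp
  rcases le_total s a with hsa | has
  · exact h2 a b hsa hab hb hp
  · exact (h1 a s ha has le_rfl fun τ hτ => hp τ ⟨hτ.1, hτ.2.trans hsb⟩).append has hsb
      (h2 s b le_rfl hsb hb fun τ hτ => hp τ ⟨has.trans hτ.1, hτ.2⟩)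

theorem HasWeakDeriv.mul_const {R : Type*} [NormedRing R] [NormedAlgebra ℝ R] [CompleteSpace R]
    {f u : ℝ → R} {a b : ℝ} (h : HasWeakDeriv f (fun t => -(u t * f t)) a b) (c : R) :
    HasWeakDeriv (fun t => f t * c) (fun t => -(u t * (f t * c))) a b := by
  refine (h.clm ((ContinuousLinearMap.mul ℝ R).flip c)).congr_ae
    (Filter.Eventually.of_forall fun t => ?_)
  simp [mul_assoc]

/-! ### Parallel frames and the existence of parallel transport. -/

section VB

variable {d N : ℕ} {M : Type*} [TopologicalSpace M] [ChartedSpace (EV d) M]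
  {E : M → Type*} [∀ x, AddCommGroup (E x)] [∀ x, Module ℂ (E x)]
  [∀ x, TopologicalSpace (E x)] [TopologicalSpace (TotalSpace (CV N) E)]
  [FiberBundle (CV N) E] [VectorBundle ℂ (CV N) E]
  {G : Subgroup (Matrix.specialUnitaryGroup (Fin N) ℂ)} {B : GAtlas d E G}

/-- The matrix of a linear map. -/
def toMatC (L : CV N →ₗ[ℂ] CV N) : MatC N := LinearMap.toMatrix' L

/-- The matrix of a linear map `ℂ^N → E_x` in a trivialization. -/
def GAtlas.coord (B : GAtlas d E G) (b : B.ι) {x : M} (L : CV N →ₗ[ℂ] E x) : MatC N :=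
  LinearMap.toMatrix' ((B.triv b).linearMapAt ℂ x ∘ₗ L)

theorem GAtlas.coord_comp_toLin (B : GAtlas d E G) (b : B.ι) {x : M} (L : CV N →ₗ[ℂ] E x)
    (K : CV N →ₗ[ℂ] CV N) :
    B.coord b (L ∘ₗ K) = B.coord b L * toMatC K :=
  LinearMap.toMatrix'_comp ((B.triv b).linearMapAt ℂ x ∘ₗ L) K

theorem GAtlas.coord_comp (B : GAtlas d E G) (a b : B.ι) {x y : M} (hx : x ∈ B.dom a)
    (L : CV N →ₗ[ℂ] E x) (K : E x →ₗ[ℂ] E y) : B.coord b (K ∘ₗ L) = B.rep a b K * B.coord a L := by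
  have h := LinearMap.toMatrix'_comp ((B.triv b).linearMapAt ℂ y ∘ₗ K ∘ₗ (B.triv a).symmₗ ℂ x)
    ((B.triv a).linearMapAt ℂ x ∘ₗ L)
  refine Eq.trans ?_ h
  unfold GAtlas.coord
  congr 1
  refine LinearMap.ext fun v => ?_
  simp only [LinearMap.comp_apply]
  rw [(B.triv a).symmₗ_linearMapAt hx]

theorem GAtlas.rep_comp_symm (B : GAtlas d E G) (b : B.ι) {x y : M} (L : CV N →ₗ[ℂ] E y)
    (K : E x →ₗ[ℂ] CV N) : B.rep b b (L ∘ₗ K) =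
      B.coord b L * toMatC (K ∘ₗ (B.triv b).symmₗ ℂ x) :=
  LinearMap.toMatrix'_comp ((B.triv b).linearMapAt ℂ y ∘ₗ L) (K ∘ₗ (B.triv b).symmₗ ℂ x)

/-- The connection along a curve, in a trivialization. -/
def GConnection.along (A : GConnection B) (a : B.ι) (γ : H1Curve d M) (t : ℝ) : MatC N :=
  A.form a (γ t) (velocity γ t)

variable [IsManifold (𝓡 d) ∞ M] {φ : OpenPartialHomeomorph M (EV d)} {γ : H1Curve d M}
  {α β : ℝ}

/-- The gauge law without inverses, `T A^a = A^b T + dT` for `T = ψ_{ba}`: the form needed for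
differentiating transition functions along curves. -/
theorem trans_mul_formIn (A : GConnection B) (a b : B.ι) (hφ : IsChart φ) {y : EV d}
    (hy : y ∈ φ.target) (ha : φ.symm y ∈ B.dom a) (hb : φ.symm y ∈ B.dom b) (w : EV d) :
    B.trans b a (φ.symm y) * formIn (A.form a) φ y w = formIn (A.form b) φ y w *
      B.trans b a (φ.symm y) + fderiv ℝ (fun z => B.trans b a (φ.symm z)) y w := by
  have h1 : B.trans b a (φ.symm y) * B.trans a b (φ.symm y) = 1 := by
    rw [B.trans_mul_trans b a b ha, B.trans_self b hb]
  rw [formIn_gauge A b a hφ hy hb ha w, mul_add, ← mul_assoc, ← mul_assoc, ← mul_assoc, h1,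
    one_mul, one_mul]

theorem ae_along (A : GConnection B) (a : B.ι) (hφ : IsChart φ) (hα : 0 ≤ α) (hβ : β ≤ 1)
    (hγ : ∀ t ∈ Icc α β, γ t ∈ φ.source) {u : ℝ → EV d}
    (h : HasWeakDeriv (fun t => φ (γ t)) u α β) :
    A.along a γ =ᵐ[volume.restrict (Icc α β)] fun t => formIn (A.form a) φ (φ (γ t)) (u t) := by
  filter_upwards [ae_dchart_velocity hφ hα hβ hγ h, ae_restrict_mem measurableSet_Icc] with t ht hti
  rw [← ht]
  exact (formIn_dchart (A.form a) hφ (hγ t hti) (velocity γ t)).symm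

theorem memLp_along (A : GConnection B) (a : B.ι) (hφ : IsChart φ) (hα : 0 ≤ α) (hαβ : α ≤ β)
    (hβ : β ≤ 1) (hγ : ∀ t ∈ Icc α β, γ t ∈ φ.source) (ha : ∀ t ∈ Icc α β, γ t ∈ B.dom a) :
    MemLp (A.along a γ) 2 (volume.restrict (Icc α β)) := by
  obtain ⟨u, hu⟩ := isH1On_iff.mp (γ.isH1.2 φ hφ α β hα hαβ hβ hγ)
  refine MemLp.ae_eq (ae_along A a hφ hα hβ hγ hu).symm (memLp_clm_apply ?_ hu.1)
  intro t ht
  have h1 : ContinuousAt (formIn (A.form a) φ) (φ (γ t)) :=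
    (A.contDiffAt_formIn a hφ (φ.map_source (hγ t ht))
      (by rw [φ.left_inv (hγ t ht)]; exact ha t ht)).continuousAt
  exact ContinuousAt.comp_continuousWithinAt (f := fun t => φ (γ t)) h1 (hu.continuousOn t ht)

/-- The equation `T' = T A^a - A^b T` for `T = ψ_{ba}` along `γ` means that `V ↦ TV` carries
solutions of the transport equation in the trivialization `a` to solutions in `b`. -/
theorem hasWeakDeriv_trans (A : GConnection B) (a b : B.ι) (hφ : IsChart φ) (hα : 0 ≤ α)
    (hαβ : α ≤ β) (hβ : β ≤ 1) (hγ : ∀ t ∈ Icc α β, γ t ∈ φ.source)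
    (ha : ∀ t ∈ Icc α β, γ t ∈ B.dom a) (hb : ∀ t ∈ Icc α β, γ t ∈ B.dom b) :
    HasWeakDeriv (fun t => B.trans b a (γ t)) (fun t => B.trans b a (γ t) * A.along a γ t -
      A.along b γ t * B.trans b a (γ t)) α β := by
  obtain ⟨u, hu⟩ := isH1On_iff.mp (γ.isH1.2 φ hφ α β hα hαβ hβ hγ)
  have hinv : ∀ t ∈ Icc α β, φ.symm (φ (γ t)) = γ t := fun t ht => φ.left_inv (hγ t ht)
  have h1 := hu.comp (F := fun z => B.trans b a (φ.symm z)) fun t ht =>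
    (contDiffAt_trans B b a hφ (φ.map_source (hγ t ht)) (by rw [hinv t ht]; exact hb t ht)
      (by rw [hinv t ht]; exact ha t ht)).of_le (by simp)
  refine (h1.congr_ae ?_).congr fun t ht => by simp only [hinv t ht]
  filter_upwards [ae_along A a hφ hα hβ hγ hu, ae_along A b hφ hα hβ hγ hu,
    ae_restrict_mem measurableSet_Icc] with t h1 h2 ht
  have h3 := trans_mul_formIn A a b hφ (φ.map_source (hγ t ht))
    (by rw [hinv t ht]; exact ha t ht) (by rw [hinv t ht]; exact hb t ht) (u t)
  rw [hinv t ht] at h3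
  rw [h1, h2, h3, add_sub_cancel_left]

/-- `P` is a parallel frame along `γ` on `[r, s]`. -/
def IsParallelFrame (A : GConnection B) (γ : H1Curve d M) (P : ∀ t, CV N ≃ₗ[ℂ] E (γ t))
    (r s : ℝ) : Prop :=
  ∀ b : B.ι, ∀ x y, r ≤ x → x ≤ y → y ≤ s → (∀ t ∈ Icc x y, γ t ∈ B.dom b) →
    HasWeakDeriv (fun t => B.coord b (P t : CV N →ₗ[ℂ] E (γ t)))
      (fun t => -(A.along b γ t * B.coord b (P t : CV N →ₗ[ℂ] E (γ t)))) x y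

/-- The fundamental solution in the trivialization `a` is invertible by `bwd_mul_fwd` and
`fwd_mul_bwd`, so it defines a frame; the product rule with the transition functions gives the
equation in any other trivialization. -/
theorem exists_parallelFrame_chart (A : GConnection B) (γ : H1Curve d M) (a : B.ι)
    (hφ : IsChart φ) (hα : 0 ≤ α) (hαβ : α ≤ β) (hβ : β ≤ 1)
    (hγ : ∀ t ∈ Icc α β, γ t ∈ φ.source) (ha : ∀ t ∈ Icc α β, γ t ∈ B.dom a) :
    ∃ P : ∀ t, CV N ≃ₗ[ℂ] E (γ t), IsParallelFrame A γ P α β := by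
  classical
  have hm : MemLp ((Icc α β).indicator (A.along a γ)) 2 volI := by
    rw [memLp_indicator_iff_restrict measurableSet_Icc,
      Measure.restrict_restrict_of_subset (Icc_subset_Icc hα hβ)]
    exact memLp_along A a hφ hα hαβ hβ hγ ha
  set a₀ : L2 (MatC N) := hm.toLp with ha₀
  have ha₀' : a₀ =ᵐ[volume.restrict (Icc α β)] A.along a γ := by
    have h1 := ae_restrict_of_ae_restrict_of_subset (Icc_subset_Icc hα hβ) (MemLp.coeFn_toLp hm)
    filter_upwards [h1, ae_restrict_mem measurableSet_Icc] with t ht hti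
    rw [ha₀, ht, indicator_of_mem hti]
  let Q : ∀ t : ℝ, CV N ≃ₗ[ℂ] CV N := fun t =>
    Matrix.toLin'OfInv (M := (bwd a₀ (projI t) : Matrix (Fin N) (Fin N) ℂ))
      (M' := (fwd a₀ (projI t) : Matrix (Fin N) (Fin N) ℂ))
      (bwd_mul_fwd a₀ (projI t)) (fwd_mul_bwd a₀ (projI t))
  -- Outside `[α, β]` only some isomorphism is required, whence the fallback to a chosen
  -- trivialization.
  let P : ∀ t, CV N ≃ₗ[ℂ] E (γ t) := fun t => if h : γ t ∈ B.dom a then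
    (Q t).trans ((B.triv a).linearEquivAt ℂ (γ t) h).symm else
    ((B.triv (B.idxAt (γ t))).linearEquivAt ℂ (γ t) (B.mem_idxAt _)).symm
  have hP : ∀ t ∈ Icc α β, B.coord a (P t : CV N →ₗ[ℂ] E (γ t)) = fwd a₀ (projI t) := by
    intro t ht
    have h1 : (B.triv a).linearMapAt ℂ (γ t) ∘ₗ (P t : CV N →ₗ[ℂ] E (γ t)) =
        Matrix.toLin' (fwd a₀ (projI t) : Matrix (Fin N) (Fin N) ℂ) := by
      refine LinearMap.ext fun v => ?_
      have h2 : P t = (Q t).trans ((B.triv a).linearEquivAt ℂ (γ t) (ha t ht)).symm :=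
        dif_pos (ha t ht)
      rw [h2, (B.triv a).linearMapAt_def_of_mem (ha t ht)]
      simp only [LinearMap.comp_apply, LinearEquiv.coe_coe, LinearEquiv.trans_apply,
        LinearEquiv.apply_symm_apply]
      rfl
    unfold GAtlas.coord
    rw [h1]
    exact LinearMap.toMatrix'_toLin' _
  refine ⟨P, fun b x y hx hxy hy hb => ?_⟩
  have hsub : ∀ t ∈ Icc x y, t ∈ Icc α β := fun t ht => ⟨hx.trans ht.1, ht.2.trans hy⟩
  have h1 : HasWeakDeriv (fun t => fwd a₀ (projI t))
      (fun t => -(A.along a γ t * fwd a₀ (projI t))) x y := by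
    refine ((hasWeakDeriv_fwd a₀).mono (hα.trans hx) (hy.trans hβ)).congr_ae ?_
    filter_upwards [ae_restrict_of_ae_restrict_of_subset hsub ha₀'] with t ht
    rw [ht]
  have h2 := (hasWeakDeriv_trans A a b hφ (hα.trans hx) hxy (hy.trans hβ)
    (fun t ht => hγ t (hsub t ht)) (fun t ht => ha t (hsub t ht)) hb).mul h1
  have hcoord : ∀ t ∈ Icc x y, B.coord b (P t : CV N →ₗ[ℂ] E (γ t)) =
      B.trans b a (γ t) * fwd a₀ (projI t) := fun t ht => by
    rw [← hP t (hsub t ht)]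
    exact B.coord_comp a b (ha t (hsub t ht)) (P t : CV N →ₗ[ℂ] E (γ t)) LinearMap.id
  refine (h2.congr_ae ?_).congr hcoord
  filter_upwards [ae_restrict_mem measurableSet_Icc] with t ht
  rw [hcoord t ht]
  noncomm_ring

theorem exists_parallelFrame (A : GConnection B) (γ : H1Curve d M) :
    ∃ P : ∀ t, CV N ≃ₗ[ℂ] E (γ t), IsParallelFrame A γ P 0 1 := by
  let R : ℝ → ℝ → Prop := fun r s => ∃ P : ∀ t, CV N ≃ₗ[ℂ] E (γ t), IsParallelFrame A γ P r s
  have htrans : ∀ r s t, 0 ≤ r → r ≤ s → s ≤ t → t ≤ 1 → R r s → R s t → R r t := by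
    rintro r s t hr hrs hst ht ⟨P, hP⟩ ⟨P', hP'⟩
    classical
    -- The transport equation is invariant under right multiplication by constants, so the second
    -- frame can be matched to the first at `s`.
    let C : CV N ≃ₗ[ℂ] CV N := (P s).trans (P' s).symm
    refine ⟨fun τ => if τ ≤ s then P τ else C.trans (P' τ), fun b => ?_⟩
    refine forall_hasWeakDeriv_trans (s := s) (fun x y hx hxy hy hb => ?_) fun x y hx hxy hy hb => ?_
    · have h1 := hP b x y hx hxy hy hb
      refine (h1.congr_ae ?_).congr fun τ hτ => ?_
      · filter_upwards [ae_restrict_mem measurableSet_Icc] with τ hτ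
        simp only [if_pos (hτ.2.trans hy)]
      · simp only [if_pos (hτ.2.trans hy)]
    · have h1 := (hP' b x y hx hxy hy hb).mul_const (toMatC (C : CV N →ₗ[ℂ] CV N))
      have h2 : ∀ τ ∈ Icc x y, B.coord b ((if τ ≤ s then P τ else C.trans (P' τ) :
          CV N ≃ₗ[ℂ] E (γ τ)) : CV N →ₗ[ℂ] E (γ τ)) = B.coord b (P' τ : CV N →ₗ[ℂ] E (γ τ)) *
            toMatC (C : CV N →ₗ[ℂ] CV N) := by
        intro τ hτ
        rw [← B.coord_comp_toLin]
        congr 1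
        split_ifs with h
        · obtain rfl : τ = s := le_antisymm h (hx.trans hτ.1)
          refine LinearMap.ext fun v => ?_
          simp [C]
        · rfl
      refine (h1.congr_ae ?_).congr h2
      filter_upwards [ae_restrict_mem measurableSet_Icc] with τ hτ
      rw [h2 τ hτ]
  have hloc : ∀ x α β, 0 ≤ α → α ≤ β → β ≤ 1 →
      (∀ τ ∈ Icc α β, γ τ ∈ (chartAt (EV d) x).source ∩ B.dom (B.idxAt x)) → R α β :=
    fun x α β hα hαβ hβ hx => exists_parallelFrame_chart A γ (B.idxAt x) (isChart_chartAt x) hα hαβ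
      hβ (fun t ht => (hx t ht).1) fun t ht => (hx t ht).2
  exact curve_induction (R := R) γ.continuousOn htrans _
    (fun x => (chartAt (EV d) x).open_source.inter (B.isOpen_dom (B.idxAt x)))
    (fun x => ⟨mem_chart_source _ x, B.mem_idxAt x⟩) hloc

/-- `U_{t,s} = P_t P_s⁻¹` for a parallel frame `P`; multiplicativity is then immediate, and the
equation is that of `P` multiplied by a constant. -/
theorem isParallelTransport_parallelTransport (A : GConnection B) (γ : H1Curve d M) :
    IsParallelTransport A γ (parallelTransport A γ) := by
  have hex : ∃ U : ∀ t s : ℝ, E (γ s) →ₗ[ℂ] E (γ t), IsParallelTransport A γ U := by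
    obtain ⟨P, hP⟩ := exists_parallelFrame A γ
    have hid : ∀ t, (P t : CV N →ₗ[ℂ] E (γ t)) ∘ₗ ((P t).symm : E (γ t) →ₗ[ℂ] CV N) =
        LinearMap.id := fun t => LinearMap.ext fun v => by simp
    have hwd : ∀ a : B.ι, ∀ s t : ℝ, 0 ≤ s → s ≤ t → t ≤ 1 → (∀ r ∈ Icc s t, γ r ∈ B.dom a) →
        HasWeakDeriv (fun r => B.rep a a ((P r : CV N →ₗ[ℂ] E (γ r)) ∘ₗ
          ((P s).symm : E (γ s) →ₗ[ℂ] CV N))) (fun r => -(A.along a γ r *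
            B.rep a a ((P r : CV N →ₗ[ℂ] E (γ r)) ∘ₗ ((P s).symm : E (γ s) →ₗ[ℂ] CV N)))) s t := by
      intro a s t hs hst ht ha
      have h1 := (hP a s t hs hst ht ha).mul_const
        (toMatC (((P s).symm : E (γ s) →ₗ[ℂ] CV N) ∘ₗ (B.triv a).symmₗ ℂ (γ s)))
      refine (h1.congr_ae ?_).congr fun r _ => B.rep_comp_symm a _ _
      refine Filter.Eventually.of_forall fun r => ?_
      dsimp only
      rw [B.rep_comp_symm]
    refine ⟨fun t s => (P t : CV N →ₗ[ℂ] E (γ t)) ∘ₗ ((P s).symm : E (γ s) →ₗ[ℂ] CV N), ?_, ?_, ?_,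
      ?_⟩
    · exact fun t _ => hid t
    · intro r s t _ _ _ _
      refine LinearMap.ext fun v => ?_
      simp
    · exact fun a s t hs hst ht ha => (hwd a s t hs hst ht ha).continuousOn
    · intro a s t hs hst ht ha
      have h1 := (hwd a s t hs hst ht ha).2 t (right_mem_Icc.mpr hst)
      dsimp only at h1
      rw [intervalIntegral.integral_neg, hid s, ← sub_eq_add_neg] at h1
      refine h1.trans (congrArg₂ _ ?_ rfl)
      exact conjTriv_id (B.triv a) (ha s (left_mem_Icc.mpr hst))
  have h1 : parallelTransport A γ = hex.choose := by
    funext t s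
    exact dif_pos (c := ∃ U : ∀ t s : ℝ, E (γ s) →ₗ[ℂ] E (γ t), IsParallelTransport A γ U) hex
  rw [h1]
  exact hex.choose_spec

/-- `parallelTransport` is a chosen family, so its local expression has to come from uniqueness for
the transport equation. The coefficient `a₀` matters only almost everywhere on `[α, β]`. -/
theorem rep_parallelTransport (A : GConnection B) (γ : H1Curve d M) (a : B.ι) (hα : 0 ≤ α)
    (hβ : β ≤ 1) (ha : ∀ t ∈ Icc α β, γ t ∈ B.dom a) {a₀ : L2 (MatC N)}
    (h : a₀ =ᵐ[volume.restrict (Icc α β)] A.along a γ) {s t : ℝ} (hs : α ≤ s) (hst : s ≤ t)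
    (ht : t ≤ β) : B.rep a a (parallelTransport A γ t s) =
      fwd a₀ (projI t) * bwd a₀ (projI s) := by
  have hU := isParallelTransport_parallelTransport A γ
  have hsub : ∀ r ∈ Icc s t, r ∈ Icc α β := fun r hr => ⟨hs.trans hr.1, hr.2.trans ht⟩
  refine eq_fwd_mul_bwd (P := fun r => B.rep a a (parallelTransport A γ r s)) (hα.trans hs) hst
    (ht.trans hβ) (hU.continuousOn a s t (hα.trans hs) hst (ht.trans hβ) fun r hr => ha r (hsub r hr))
    fun r hr => ?_
  have h1 := hU.equation a s r (hα.trans hs) hr.1 (hr.2.trans (ht.trans hβ))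
    fun x hx => ha x (hsub x ⟨hx.1, hx.2.trans hr.2⟩)
  refine h1.trans ?_
  congr 1
  apply intervalIntegral.integral_congr_ae_restrict
  rw [uIoc_of_le hr.1]
  have hsub' : Ioc s r ⊆ Icc α β := fun x hx => hsub x ⟨hx.1.le, hx.2.trans hr.2⟩
  filter_upwards [ae_restrict_of_ae_restrict_of_subset hsub' h] with x hx
  rw [hx]
  rfl

end VB

/-! ### The curvature as a bilinear map -/

section Forms

universe u

variable {Q R : Type u} [NormedAddCommGroup Q] [NormedSpace ℝ Q] [NormedRing R] [NormedAlgebra ℝ R]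

/-- The product of two linear forms with values in an algebra. -/
def formProd (K L : Q →L[ℝ] R) : Q →L[ℝ] Q →L[ℝ] R :=
  (((ContinuousLinearMap.mul ℝ R).comp K).flip.comp L).flip

/-- The curvature at a point, as a bilinear map. -/
def curvL (θ : Q → Q →L[ℝ] R) (x : Q) : Q →L[ℝ] Q →L[ℝ] R :=
  fderiv ℝ θ x - (fderiv ℝ θ x).flip + (formProd (θ x) (θ x) - (formProd (θ x) (θ x)).flip)

theorem curvL_apply (θ : Q → Q →L[ℝ] R) (x v w : Q) : curvL θ x v w = curv θ x v w := rfl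

theorem contDiffAt_curvL {θ : Q → Q →L[ℝ] R} {x : Q} (h : ContDiffAt ℝ ∞ θ x) :
    ContDiffAt ℝ ∞ (curvL θ) x := by
  have h1 : ContDiffAt ℝ ∞ (fderiv ℝ θ) x := h.fderiv_right (m := ∞) (by simp)
  have h2 : ContDiffAt ℝ ∞ (fun x => formProd (θ x) (θ x)) x :=
    contDiffAt_flip ((contDiffAt_flip (contDiffAt_const.clm_comp h)).clm_comp h)
  exact (h1.sub (contDiffAt_flip h1)).add (h2.sub (contDiffAt_flip h2))

end Forms

/-! ### Parallel transport along nearby curves over a short interval. -/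

section VB

variable {d N : ℕ} {M : Type*} [TopologicalSpace M] [ChartedSpace (EV d) M]
  {E : M → Type*} [∀ x, AddCommGroup (E x)] [∀ x, Module ℂ (E x)]
  [∀ x, TopologicalSpace (E x)] [TopologicalSpace (TotalSpace (CV N) E)]
  [FiberBundle (CV N) E] [VectorBundle ℂ (CV N) E]
  {G : Subgroup (Matrix.specialUnitaryGroup (Fin N) ℂ)} {B : GAtlas d E G}

variable [IsManifold (𝓡 d) ∞ M] {φ : OpenPartialHomeomorph M (EV d)} {γ : H1Curve d M}
  {α β : ℝ} {g : RMetric d M} {e : H1Frame γ} {a : B.ι} {ξ : H1Model d}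

variable (B) in
/-- A chart and a trivialization along the part of `γ` over `[α, β]`. -/
structure LocalData (e : H1Frame γ) (φ : OpenPartialHomeomorph M (EV d)) (a : B.ι) (α β : ℝ) where
  chart : IsChart φ
  nonneg : 0 ≤ α
  le : α ≤ β
  le_one : β ≤ 1
  mem_source : ∀ t ∈ Icc α β, γ t ∈ φ.source
  mem_dom : ∀ t ∈ Icc α β, γ t ∈ B.dom a
  state : ChartState e φ α β

variable (B e) in
theorem exists_localData (x : M) {α β : ℝ} (hα : 0 ≤ α) (hαβ : α ≤ β) (hβ : β ≤ 1)
    (hx : ∀ t ∈ Icc α β, γ t ∈ (chartAt (EV d) x).source ∩ B.dom (B.idxAt x)) :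
    Nonempty (LocalData B e (chartAt (EV d) x) (B.idxAt x) α β) := by
  obtain ⟨S⟩ := exists_chartState e (isChart_chartAt x) hα hαβ hβ fun t ht => (hx t ht).1
  exact ⟨⟨isChart_chartAt x, hα, hαβ, hβ, fun t ht => (hx t ht).1, fun t ht => (hx t ht).2, S⟩⟩

/-- A transitive relation on `[0, 1]` that holds wherever there are local data holds on `[0, 1]`. -/
theorem localData_induction (B : GAtlas d E G) (e : H1Frame γ) {R : ℝ → ℝ → Prop}
    (trans : ∀ r s t, 0 ≤ r → r ≤ s → s ≤ t → t ≤ 1 → R r s → R s t → R r t)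
    (loc : ∀ φ a α β, LocalData B e φ a α β → R α β) : R 0 1 := by
  refine curve_induction (R := R) γ.continuousOn trans _
    (fun x => (chartAt (EV d) x).open_source.inter (B.isOpen_dom (B.idxAt x)))
    (fun x => ⟨mem_chart_source _ x, B.mem_idxAt x⟩) ?_
  intro x r s hr hrs hs hx
  obtain ⟨D⟩ := exists_localData B e x hr hrs hs hx
  exact loc _ _ _ _ D

namespace LocalData

/-- The field `ξ` is small enough. -/
structure Admissible (g : RMetric d M) (D : LocalData B e φ a α β) (ξ : H1Model d) : Prop where
  reg : ∀ t, IsRegularState g φ (D.state.c ξ t)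
  mem : ∀ t, expState g φ (D.state.c ξ t) ∈ φ.target ∩ φ.symm ⁻¹' B.dom a
  exp : IsExpCurve g e ξ

variable (D : LocalData B e φ a α β)

theorem left_mem (D : LocalData B e φ a α β) : α ∈ Icc α β := left_mem_Icc.mpr D.le

theorem right_mem (D : LocalData B e φ a α β) : β ∈ Icc α β := right_mem_Icc.mpr D.le

theorem subset (D : LocalData B e φ a α β) : Icc α β ⊆ Icc 0 1 := Icc_subset_Icc D.nonneg D.le_one

theorem c_zero (t : unitInterval) :
    D.state.c 0 t = (φ (γ (clamp α β t)), e.inChart φ (clamp α β t), 0) :=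
  D.state.c_zero D.nonneg D.le D.le_one t

theorem clamp_source (D : LocalData B e φ a α β) (t : ℝ) : γ (clamp α β t) ∈ φ.source := D.mem_source _ (clamp_mem D.le t)

theorem clamp_dom (D : LocalData B e φ a α β) (t : ℝ) : γ (clamp α β t) ∈ B.dom a := D.mem_dom _ (clamp_mem D.le t)

section

variable [T2Space M]

variable (g) in
theorem contDiffAt_expState_zero (t : unitInterval) :
    ContDiffAt ℝ ∞ (expState g φ) (D.state.c 0 t) := by
  rw [D.c_zero]
  exact contDiffAt_expState D.chart (φ.map_source (D.clamp_source t)) _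

variable (g) in
theorem expState_c_zero (t : unitInterval) :
    expState g φ (D.state.c 0 t) = φ (γ (clamp α β t)) := by
  rw [D.c_zero]
  exact expState_zero (φ.map_source (D.clamp_source t)) _

variable (g) in
theorem stateFrame_c_zero (t : unitInterval) :
    stateFrame g φ (D.state.c 0 t) = e.inChart φ (clamp α β t) := by
  rw [D.c_zero]
  exact stateFrame_zero D.chart (φ.map_source (D.clamp_source t)) _

theorem expState_mem_zero (t : unitInterval) :
    expState g φ (D.state.c 0 t) ∈ φ.target ∩ φ.symm ⁻¹' B.dom a := by
  rw [D.expState_c_zero g]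
  refine ⟨φ.map_source (D.clamp_source t), ?_⟩
  rw [mem_preimage, φ.left_inv (D.clamp_source t)]
  exact D.clamp_dom t

-- Each requirement is open in the state, uniformly in time by compactness, and holds for the zero
-- field; the state depends continuously on `ξ`.
variable (g) in
theorem eventually_admissible : ∀ᶠ ξ in 𝓝 (0 : H1Model d), D.Admissible g ξ := by
  have hc : Filter.Tendsto D.state.c (𝓝 0) (𝓝 (D.state.c 0)) :=
    D.state.contDiff_c.continuous.tendsto 0
  have h1 : ∀ᶠ v in 𝓝 (D.state.c 0), ∀ t,
      expState g φ (v t) ∈ φ.target ∩ φ.symm ⁻¹' B.dom a := by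
    have key : ∀ t, ∀ᶠ q in 𝓝 (D.state.c 0 t),
        expState g φ q ∈ φ.target ∩ φ.symm ⁻¹' B.dom a := fun t =>
      (D.contDiffAt_expState_zero g t).continuousAt.eventually_mem
        ((φ.symm.isOpen_inter_preimage (B.isOpen_dom a)).mem_nhds (D.expState_mem_zero t))
    exact eventually_forall_of_forall_eventually key
  filter_upwards [D.state.eventually_isRegularState (g := g) D.chart D.nonneg D.le D.le_one
    D.mem_source, hc.eventually h1, eventually_isExpCurve g e] with ξ q1 q2 q3 using ⟨q1, q2, q3⟩

end

variable {D}

theorem Admissible.mem_source (h : D.Admissible g ξ) {t : ℝ} (ht : t ∈ Icc α β) :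
    expCurve g γ (e.field ξ) t ∈ φ.source :=
  expCurve_mem_source D.chart D.nonneg D.le_one D.mem_source D.state h.reg h.exp ht

theorem Admissible.chart_eq (h : D.Admissible g ξ) {t : ℝ} (ht : t ∈ Icc α β) :
    φ (expCurve g γ (e.field ξ) t) = expState g φ (D.state.c ξ (projI t)) :=
  chart_expCurve D.chart D.nonneg D.le_one D.mem_source D.state h.exp ht

theorem Admissible.mem_dom (h : D.Admissible g ξ) {t : ℝ} (ht : t ∈ Icc α β) :
    expCurve g γ (e.field ξ) t ∈ B.dom a := by
  have h1 := (h.mem (projI t)).2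
  rwa [mem_preimage, ← h.chart_eq ht, φ.left_inv (h.mem_source ht)] at h1

theorem Admissible.ae_dchart_velocity (h : D.Admissible g ξ) :
    ∀ᵐ t ∂(volume.restrict (Icc α β)),
    dchart φ (expCurve g γ (e.field ξ) t) (velocity (expCurve g γ (e.field ξ)) t) =
      fderiv ℝ (expState g φ) (D.state.c ξ (projI t)) (D.state.p ξ t) :=
  ae_dchart_velocity_expCurve D.chart D.nonneg D.le_one D.mem_source D.state h.reg h.exp

theorem Admissible.dchart_normalFrame (h : D.Admissible g ξ) {t : ℝ} (ht : t ∈ Icc α β)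
    (v : EV d) : dchart φ (expCurve g γ (e.field ξ) t) (normalFrame g e ξ t v) =
      stateFrame g φ (D.state.c ξ (projI t)) v :=
  LevyGrad.dchart_normalFrame D.chart D.nonneg D.le_one D.mem_source D.state h.reg h.exp ht v

/-- The connection, as a form on states. -/
def form (g : RMetric d M) (A : GConnection B) (_ : LocalData B e φ a α β) :
    FrameState d → FrameState d →L[ℝ] MatC N :=
  pullForm (expState g φ) (formIn (A.form a) φ)

/-- The connection along `exp_γ(eξ)`. -/
def coeff (g : RMetric d M) (A : GConnection B) (D : LocalData B e φ a α β) (ξ : H1Model d) :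
    L2 (MatC N) :=
  contract (D.form g A) (D.state.c ξ) (D.state.p ξ)

variable (A : GConnection B)

theorem Admissible.contDiffAt_formIn (h : D.Admissible g ξ) (t : unitInterval) :
    ContDiffAt ℝ ∞ (formIn (A.form a) φ) (expState g φ (D.state.c ξ t)) :=
  A.contDiffAt_formIn a D.chart (h.mem t).1 (h.mem t).2

theorem Admissible.continuousAt_form (h : D.Admissible g ξ) (t : unitInterval) :
    ContinuousAt (D.form g A) (D.state.c ξ t) := by
  have h1 := (h.reg t).contDiffAt
  have h2 : ContinuousAt (fun q => formIn (A.form a) φ (expState g φ q)) (D.state.c ξ t) :=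
    ContinuousAt.comp (g := formIn (A.form a) φ) (h.contDiffAt_formIn A t).continuousAt
      h1.continuousAt
  exact h2.clm_comp (h1.continuousAt_fderiv one_ne_zero)

theorem Admissible.coeff_ae (h : D.Admissible g ξ) : D.coeff g A ξ =ᵐ[volI] fun t =>
    formIn (A.form a) φ (expState g φ (D.state.c ξ (projI t)))
      (fderiv ℝ (expState g φ) (D.state.c ξ (projI t)) (D.state.p ξ t)) :=
  coeFn_contract (h.continuousAt_form A) _

/-- The connection form on states is a pullback, so contracting it with the velocity of the state
gives `A(η̇)` along `η = exp_γ(eξ)`, by the chain rule. -/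
theorem Admissible.coeff_ae_along (h : D.Admissible g ξ) :
    D.coeff g A ξ =ᵐ[volume.restrict (Icc α β)] A.along a (expCurve g γ (e.field ξ)) := by
  filter_upwards [ae_restrict_of_ae_restrict_of_subset D.subset (h.coeff_ae A),
    h.ae_dchart_velocity, ae_restrict_mem measurableSet_Icc] with t h1 h2 ht
  rw [h1, ← h2, ← h.chart_eq ht]
  exact formIn_dchart (A.form a) D.chart (h.mem_source ht) _

-- Clamping makes the state constant on `[0, α]`, and weak derivatives are unique almost everywhere.
variable (D) in
theorem p_ae_zero (ξ : H1Model d) : ∀ᵐ t ∂(volume.restrict (Icc 0 α)), D.state.p ξ t = 0 := by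
  have h1 := (D.state.weak ξ).mono le_rfl (D.le.trans D.le_one)
  have h2 : HasWeakDeriv (fun t => D.state.c ξ (projI t)) (fun _ => 0) 0 α := by
    refine (HasWeakDeriv.const (D.state.c ξ 0) 0 α).congr fun t ht => ?_
    have ht1 : t ∈ Icc (0 : ℝ) 1 := ⟨ht.1, ht.2.trans (D.le.trans D.le_one)⟩
    dsimp only
    rw [D.state.c_apply, D.state.c_apply, projI_of_mem ht1, clamp_of_le ht.2,
      clamp_of_le (t := ((0 : unitInterval) : ℝ)) D.nonneg]
  exact h1.ae_unique h2

/-- The coefficient vanishes before `α`, so the fundamental solution based at `0` is also the one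
based at `α`. -/
theorem Admissible.bwd_left (h : D.Admissible g ξ) : bwd (D.coeff g A ξ) (projI α) = 1 := by
  have hα : α ∈ Icc (0 : ℝ) 1 := D.subset D.left_mem
  rw [projI_of_mem hα]
  refine bwd_eq_one ?_
  have hsub : Icc (0 : ℝ) α ⊆ Icc 0 1 := Icc_subset_Icc le_rfl hα.2
  filter_upwards [ae_restrict_of_ae_restrict_of_subset hsub (h.coeff_ae A), D.p_ae_zero ξ]
    with t h1 h2
  rw [h1, h2, map_zero, map_zero]

theorem Admissible.rep_transport (h : D.Admissible g ξ) {s t : ℝ} (hs : α ≤ s) (hst : s ≤ t)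
    (ht : t ≤ β) : B.rep a a (parallelTransport A (expCurve g γ (e.field ξ)) t s) =
      fwd (D.coeff g A ξ) (projI t) * bwd (D.coeff g A ξ) (projI s) :=
  rep_parallelTransport A _ a D.nonneg D.le_one (fun _ hr => h.mem_dom hr) (h.coeff_ae_along A) hs
    hst ht

variable [T2Space M]

variable (g) in
theorem admissible_zero (D : LocalData B e φ a α β) : D.Admissible g 0 :=
  (D.eventually_admissible g).self_of_nhds

variable (g) in
theorem contDiffAt_form (D : LocalData B e φ a α β) (t : unitInterval) :
    ContDiffAt ℝ ∞ (D.form g A) (D.state.c 0 t) :=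
  contDiffAt_pullForm (D.contDiffAt_expState_zero g t)
    ((D.admissible_zero g).contDiffAt_formIn A t)

-- Here the smooth dependence on the curve enters: the form is evaluated by a superposition operator
-- on continuous states, and then paired bilinearly with the `L²` velocity.
variable (g) in
theorem contDiffAt_coeff (D : LocalData B e φ a α β) : ContDiffAt ℝ ∞ (D.coeff g A) 0 :=
  contDiffAt_contract D.state.contDiff_c.contDiffAt D.state.contDiff_p.contDiffAt
    (D.contDiffAt_form g A)

variable (g) in
theorem contDiffAt_fwd (D : LocalData B e φ a α β) :
    ContDiffAt ℝ ∞ (fun ξ => fwd (D.coeff g A ξ)) 0 :=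
  contDiff_fwd.contDiffAt.comp _ (D.contDiffAt_coeff g A)

variable (g) in
theorem contDiffAt_bwd (D : LocalData B e φ a α β) :
    ContDiffAt ℝ ∞ (fun ξ => bwd (D.coeff g A ξ)) 0 :=
  contDiff_bwd.contDiffAt.comp _ (D.contDiffAt_coeff g A)

variable (g) in
/-- The transition functions at `exp_γ(eξ)(t)` depend smoothly on `ξ`. -/
theorem contDiffAt_trans_expCurve (D : LocalData B e φ a α β) {t : ℝ} (ht : t ∈ Icc α β)
    {b c : B.ι} (hb : γ t ∈ B.dom b) (hc : γ t ∈ B.dom c) :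
    ContDiffAt ℝ ∞ (fun ξ => B.trans b c (expCurve g γ (e.field ξ) t)) 0 := by
  have h1 : ContDiffAt ℝ ∞ (fun ξ => expState g φ (D.state.c ξ (projI t))) 0 := by
    refine ContDiffAt.comp (g := expState g φ) 0 (D.contDiffAt_expState_zero g _) ?_
    exact (ContinuousMap.evalCLM ℝ (projI t)).contDiff.contDiffAt.comp 0
      D.state.contDiff_c.contDiffAt
  have hγt : expState g φ (D.state.c 0 (projI t)) = φ (γ t) := by
    rw [D.expState_c_zero g, projI_of_mem (D.subset ht), clamp_of_mem ht]
  have hinv := φ.left_inv (D.mem_source t ht)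
  have h2 : ContDiffAt ℝ ∞ (fun ξ =>
      B.trans b c (φ.symm (expState g φ (D.state.c ξ (projI t))))) 0 := by
    refine ContDiffAt.comp (g := fun z => B.trans b c (φ.symm z)) 0 ?_ h1
    rw [hγt]
    exact contDiffAt_trans B b c D.chart (φ.map_source (D.mem_source t ht)) (by rwa [hinv])
      (by rwa [hinv])
  refine h2.congr_of_eventuallyEq ?_
  filter_upwards [D.eventually_admissible g] with ξ hξ
  rw [← hξ.chart_eq ht, φ.left_inv (hξ.mem_source ht)]

end LocalData

variable [T2Space M]

/-- Evaluation at a fixed time is continuous in `ξ`, as seen from local data on the degenerate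
interval `[t, t]`. It keeps nearby curves inside the trivialization used at a junction. -/
theorem eventually_expCurve_mem (B : GAtlas d E G) (g : RMetric d M) (e : H1Frame γ) {t : ℝ} (ht : t ∈ Icc (0 : ℝ) 1) {U : Set M} (hU : IsOpen U)
    (hγU : γ t ∈ U) : ∀ᶠ ξ in 𝓝 (0 : H1Model d), expCurve g γ (e.field ξ) t ∈ U := by
  obtain ⟨D⟩ := exists_localData B e (γ t) (α := t) (β := t) ht.1 le_rfl ht.2 fun r hr => by
    obtain rfl : r = t := le_antisymm hr.2 hr.1
    exact ⟨mem_chart_source _ _, B.mem_idxAt _⟩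
  set φ := chartAt (EV d) (γ t)
  have htt : t ∈ Icc t t := ⟨le_rfl, le_rfl⟩
  have h1 : ContinuousAt (fun ξ => expState g φ (D.state.c ξ (projI t))) 0 := by
    refine ContinuousAt.comp (g := expState g φ) (D.contDiffAt_expState_zero g _).continuousAt ?_
    exact ((ContinuousMap.evalCLM ℝ (projI t)).continuous.comp
      D.state.contDiff_c.continuous).continuousAt
  have h2 : expState g φ (D.state.c 0 (projI t)) ∈ φ.target ∩ φ.symm ⁻¹' U := by
    rw [D.expState_c_zero g, projI_of_mem ht, clamp_of_mem htt]
    refine ⟨φ.map_source (D.mem_source t htt), ?_⟩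
    rwa [mem_preimage, φ.left_inv (D.mem_source t htt)]
  filter_upwards [D.eventually_admissible g,
    h1.eventually_mem ((φ.symm.isOpen_inter_preimage hU).mem_nhds h2)] with ξ hξ hξ'
  have h3 := hξ'.2
  rwa [mem_preimage, ← hξ.chart_eq htt, φ.left_inv (hξ.mem_source htt)] at h3

end VB

/-! ### Smooth families of continuous and of square integrable functions. -/

section Bilin

variable {P V X Y Z : Type*} [NormedAddCommGroup P] [NormedSpace ℝ P] [NormedAddCommGroup V]
  [NormedSpace ℝ V] [NormedAddCommGroup X] [NormedSpace ℝ X] [NormedAddCommGroup Y]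
  [NormedSpace ℝ Y] [NormedAddCommGroup Z] [NormedSpace ℝ Z]

theorem ContDiffAt.bilinL2 (b : X →L[ℝ] Y →L[ℝ] Z) {m : P → C(unitInterval, X)} {y : P → L2 Y}
    {ξ : P} (hm : ContDiffAt ℝ ∞ m ξ) (hy : ContDiffAt ℝ ∞ y ξ) :
    ContDiffAt ℝ ∞ (fun ζ => bilinL2 b (m ζ) (y ζ)) ξ := by
  have h := (LevyGrad.bilinL2 b).contDiff.contDiffAt.comp ξ hm
  exact h.clm_apply hy

theorem ContDiffAt.evalC {f : P → C(unitInterval, V)} {ξ : P} (hf : ContDiffAt ℝ ∞ f ξ)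
    (t : unitInterval) : ContDiffAt ℝ ∞ (fun ζ => f ζ t) ξ := by
  have h := (ContinuousMap.evalCLM ℝ t : C(unitInterval, V) →L[ℝ] V).contDiff.contDiffAt.comp ξ hf
  exact h

theorem ContDiffAt.indL2 {s : Set ℝ} (hs : MeasurableSet s) {y : P → L2 V} {ξ : P}
    (hy : ContDiffAt ℝ ∞ y ξ) : ContDiffAt ℝ ∞ (fun ζ => indL2 V s hs (y ζ)) ξ :=
  (LevyGrad.indL2 V s hs).contDiff.contDiffAt.comp ξ hy

theorem ContDiffAt.constC {m : P → V} {ξ : P} (hm : ContDiffAt ℝ ∞ m ξ) :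
    ContDiffAt ℝ ∞ (fun ζ => constC V (m ζ)) ξ :=
  (LevyGrad.constC V).contDiff.contDiffAt.comp ξ hm

end Bilin

section Mul

variable {P R : Type*} [NormedAddCommGroup P] [NormedSpace ℝ P] [NormedRing R] [NormedAlgebra ℝ R]

/-- Multiplication of an `L²` function by a continuous one from the left. -/
def lmulL2 (m : C(unitInterval, R)) (y : L2 R) : L2 R := bilinL2 (ContinuousLinearMap.mul ℝ R) m y

/-- Multiplication of an `L²` function by a continuous one from the right. -/
def rmulL2 (m : C(unitInterval, R)) (y : L2 R) : L2 R :=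
  bilinL2 (ContinuousLinearMap.mul ℝ R).flip m y

theorem coeFn_lmulL2 (m : C(unitInterval, R)) (y : L2 R) :
    lmulL2 m y =ᵐ[volI] fun t => m (projI t) * y t := coeFn_bilinL2 _ m y

theorem coeFn_rmulL2 (m : C(unitInterval, R)) (y : L2 R) :
    rmulL2 m y =ᵐ[volI] fun t => y t * m (projI t) := coeFn_bilinL2 _ m y

theorem ContDiffAt.lmulL2 {m : P → C(unitInterval, R)} {y : P → L2 R} {ξ : P}
    (hm : ContDiffAt ℝ ∞ m ξ) (hy : ContDiffAt ℝ ∞ y ξ) :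
    ContDiffAt ℝ ∞ (fun ζ => lmulL2 (m ζ) (y ζ)) ξ :=
  ContDiffAt.bilinL2 _ hm hy

theorem ContDiffAt.rmulL2 {m : P → C(unitInterval, R)} {y : P → L2 R} {ξ : P}
    (hm : ContDiffAt ℝ ∞ m ξ) (hy : ContDiffAt ℝ ∞ y ξ) :
    ContDiffAt ℝ ∞ (fun ζ => rmulL2 (m ζ) (y ζ)) ξ :=
  ContDiffAt.bilinL2 _ hm hy

end Mul

section VB

variable {d N : ℕ} {M : Type*} [TopologicalSpace M] [ChartedSpace (EV d) M]
  {E : M → Type*} [∀ x, AddCommGroup (E x)] [∀ x, Module ℂ (E x)]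
  [∀ x, TopologicalSpace (E x)] [TopologicalSpace (TotalSpace (CV N) E)]
  [FiberBundle (CV N) E] [VectorBundle ℂ (CV N) E]
  {G : Subgroup (Matrix.specialUnitaryGroup (Fin N) ℂ)} {B : GAtlas d E G}

variable [IsManifold (𝓡 d) ∞ M] {φ : OpenPartialHomeomorph M (EV d)} {γ : H1Curve d M}
  {α β : ℝ} {g : RMetric d M} {e : H1Frame γ} {a : B.ι} {ξ : H1Model d}

theorem parallelTransport_comp (A : GConnection B) (γ : H1Curve d M) {r s t : ℝ} (hr : 0 ≤ r)
    (hrs : r ≤ s) (hst : s ≤ t) (ht : t ≤ 1) :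
    parallelTransport A γ t s ∘ₗ parallelTransport A γ s r = parallelTransport A γ t r :=
  (isParallelTransport_parallelTransport A γ).mul r s t hr hrs hst ht

/-! ### Raising indices in charts -/

/-- The metric at a point. -/
def metricAt (g : RMetric d M) (x : M) : EV d →L[ℝ] EV d →L[ℝ] ℝ := g.inner x

theorem exists_metricAt_eq (g : RMetric d M) (x : M) :
    ∃ L : EV d ≃L[ℝ] (EV d →L[ℝ] ℝ), metricAt g x = L ∧
      ∀ κ : EV d →L[ℝ] ℝ, sharp g x κ = L.symm κ := by
  have hpos : ∀ v : EV d, v ≠ 0 → 0 < metricAt g x v v := fun v hv => g.pos x v hv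
  refine ⟨posEquiv (metricAt g x) hpos, (posEquiv_coe _ _).symm, fun κ => ?_⟩
  have h2 : (metricAt g x).inverse =
      ((posEquiv (metricAt g x) hpos).symm : (EV d →L[ℝ] ℝ) →L[ℝ] EV d) := by
    refine Eq.trans ?_ (ContinuousLinearMap.inverse_equiv (posEquiv (metricAt g x) hpos))
    rw [posEquiv_coe]
  exact DFunLike.congr_fun h2 κ

theorem sharp_inner (g : RMetric d M) (x : M) (v : TangentSpace (𝓡 d) x) :
    sharp g x (g.inner x v) = v := by
  obtain ⟨L, hL, hs⟩ := exists_metricAt_eq g x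
  refine (hs (metricAt g x v)).trans ?_
  rw [hL]
  exact L.symm_apply_apply v

theorem inner_sharp (g : RMetric d M) (x : M) (κ : EV d →L[ℝ] ℝ) :
    metricAt g x (sharp g x κ) = κ := by
  obtain ⟨L, hL, hs⟩ := exists_metricAt_eq g x
  rw [hs κ, hL]
  exact L.apply_symm_apply κ

/-- In coordinates the index is raised by the inverse of the matrix `g_{ij}`, applied to the chart
components of `κ`. -/
theorem dchart_sharp (g : RMetric d M) (hφ : IsChart φ) {x : M} (hx : x ∈ φ.source)
    (κ : EV d →L[ℝ] ℝ) : dchart φ x (sharp g x κ) =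
      (metricIn g φ (φ x)).inverse (κ.comp (dsymm φ (φ x))) := by
  have hG : ∀ x' : M, x' = x → ∀ v v' : EV d, g.inner x' v v' = metricAt g x v v' := by
    rintro x' rfl v v'; rfl
  have h4 : metricIn g φ (φ x) (dchart φ x (sharp g x κ)) = κ.comp (dsymm φ (φ x)) := by
    ext v
    rw [metricIn_apply]
    refine (hG _ (φ.left_inv hx) _ _).trans ?_
    refine (congrArg (fun w => metricAt g x w (dsymm φ (φ x) v)) (hφ.dsymm_dchart hx _)).trans ?_
    exact DFunLike.congr_fun (inner_sharp g x κ) _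
  obtain ⟨K, hK⟩ := metricIn_isInvertible g hφ (φ.map_source hx)
  rw [← h4, ← hK, ContinuousLinearMap.inverse_equiv]
  exact (K.symm_apply_apply _).symm

/-! ### Parallel transport and its gradient along the curves of a chart of `Ω` -/

/-- Parallel transport along `exp_γ(eξ)`, in trivializations. -/
def expRep (A : GConnection B) (g : RMetric d M) (e : H1Frame γ) (a b : B.ι) (r s : ℝ)
    (ξ : H1Model d) : MatC N :=
  B.rep a b (parallelTransport A (expCurve g γ (e.field ξ)) s r)

/-- The components of the gradient of parallel transport along `exp_γ(eξ)`, up to sign. -/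
def gradRep (A : GConnection B) (g : RMetric d M) (e : H1Frame γ) (μ : Fin d) (a b : B.ι)
    (r s : ℝ) (ξ : H1Model d) (t : ℝ) : MatC N :=
  let η := expCurve g γ (e.field ξ)
  let dx : EV d →L[ℝ] ℝ := EuclideanSpace.proj μ
  B.rep a b (parallelTransport A η s t ∘ₗ
    A.curvature (η t) (sharp g (η t) (dx.comp (normalFrame g e ξ t).inverse)) (velocity η t) ∘ₗ
      parallelTransport A η t r)

theorem expRep_comp (A : GConnection B) {a b c : B.ι} {r s t : ℝ} (hr : 0 ≤ r) (hrs : r ≤ s)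
    (hst : s ≤ t) (ht : t ≤ 1) (hc : expCurve g γ (e.field ξ) s ∈ B.dom c) :
    expRep A g e a b r t ξ = expRep A g e c b s t ξ * expRep A g e a c r s ξ := by
  unfold expRep
  rw [← parallelTransport_comp A _ hr hrs hst ht]
  exact B.rep_comp a c b hc _ _

/-- For a time before `s`, the transport from that time to `t` factors through `s`, and the later
piece comes out on the left. Behind a junction the earlier piece comes out on the right, as
`gradRep_right` records. -/
theorem gradRep_left (A : GConnection B) {μ : Fin d} {a b c : B.ι} {r s t τ : ℝ}
    (hr : 0 ≤ r) (hτ : τ ∈ Icc r s) (hst : s ≤ t) (ht : t ≤ 1)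
    (hc : expCurve g γ (e.field ξ) s ∈ B.dom c) :
    gradRep A g e μ a b r t ξ τ = expRep A g e c b s t ξ * gradRep A g e μ a c r s ξ τ := by
  unfold gradRep expRep
  dsimp only
  rw [← parallelTransport_comp A _ (hr.trans hτ.1) hτ.2 hst ht, LinearMap.comp_assoc]
  exact B.rep_comp a c b hc _ _

theorem gradRep_right (A : GConnection B) {μ : Fin d} {a b c : B.ι} {r s t τ : ℝ}
    (hr : 0 ≤ r) (hrs : r ≤ s) (hτ : τ ∈ Icc s t) (ht : t ≤ 1)
    (hc : expCurve g γ (e.field ξ) s ∈ B.dom c) :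
    gradRep A g e μ a b r t ξ τ = gradRep A g e μ c b s t ξ τ * expRep A g e a c r s ξ := by
  unfold gradRep expRep
  dsimp only
  rw [← parallelTransport_comp A _ hr hrs hτ.1 (hτ.2.trans ht), ← LinearMap.comp_assoc,
    ← LinearMap.comp_assoc]
  exact B.rep_comp a c b hc _ _

variable [T2Space M]

/-- Parallel transport over `[r, s]` depends smoothly on the curve. -/
def SmoothTransport (A : GConnection B) (g : RMetric d M) (e : H1Frame γ) (r s : ℝ) : Prop :=
  ∀ a b : B.ι, γ r ∈ B.dom a → γ s ∈ B.dom b → ContDiffAt ℝ ∞ (expRep A g e a b r s) 0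

/-- The middle point of a nearby curve stays in one trivialization around `γ s`, in which the two
transports multiply as matrices. -/
theorem SmoothTransport.trans {A : GConnection B} {r s t : ℝ} (hr : 0 ≤ r) (hrs : r ≤ s)
    (hst : s ≤ t) (ht : t ≤ 1) (h1 : SmoothTransport A g e r s) (h2 : SmoothTransport A g e s t) :
    SmoothTransport A g e r t := by
  intro a b ha hb
  have hc := B.mem_idxAt (γ s)
  refine ((h2 _ b hc hb).mul (h1 a _ ha hc)).congr_of_eventuallyEq ?_
  filter_upwards [eventually_expCurve_mem B g e ⟨hr.trans hrs, hst.trans ht⟩ (B.isOpen_dom _) hc]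
    with ξ hξ
  exact expRep_comp A hr hrs hst ht hξ

namespace LocalData

theorem smoothTransport (D : LocalData B e φ a α β) (A : GConnection B) :
    SmoothTransport A g e α β := by
  intro b c hb hc
  have h1 : ContDiffAt ℝ ∞ (fun ξ => fwd (D.coeff g A ξ) (projI β)) 0 :=
    ContDiffAt.evalC (D.contDiffAt_fwd g A) _
  have h2 : ContDiffAt ℝ ∞ (fun ξ => bwd (D.coeff g A ξ) (projI α)) 0 :=
    ContDiffAt.evalC (D.contDiffAt_bwd g A) _
  refine (((D.contDiffAt_trans_expCurve g D.right_mem hc (D.mem_dom β D.right_mem)).mul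
    (h1.mul h2)).mul (D.contDiffAt_trans_expCurve g D.left_mem (D.mem_dom α D.left_mem)
      hb)).congr_of_eventuallyEq ?_
  filter_upwards [D.eventually_admissible g] with ξ hξ
  unfold expRep
  rw [B.rep_change a b a c (hξ.mem_dom D.left_mem) (hξ.mem_dom D.right_mem),
    hξ.rep_transport A le_rfl D.le le_rfl]

/-- The curvature in the direction of the index `μ`, as a form on states. -/
def gradForm (g : RMetric d M) (A : GConnection B) (μ : Fin d) (_ : LocalData B e φ a α β)
    (q : FrameState d) : FrameState d →L[ℝ] MatC N :=
  (curvL (formIn (A.form a) φ) (expState g φ q) ((metricIn g φ (expState g φ q)).inverse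
    ((EuclideanSpace.proj μ : EV d →L[ℝ] ℝ).comp (stateFrame g φ q).inverse))).comp
      (fderiv ℝ (expState g φ) q)

-- All ingredients are smooth functions of the state, the two inversions being taken at invertible
-- maps: the metric, and the normal frame at the zero field.
variable (g) in
theorem contDiffAt_gradForm (D : LocalData B e φ a α β) (A : GConnection B) (μ : Fin d)
    (t : unitInterval) : ContDiffAt ℝ ∞ (D.gradForm g A μ) (D.state.c 0 t) := by
  have hE := D.contDiffAt_expState_zero g t
  have hmem := D.expState_mem_zero (g := g) t
  have h1 : ContDiffAt ℝ ∞ (fun q => curvL (formIn (A.form a) φ) (expState g φ q))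
      (D.state.c 0 t) :=
    ContDiffAt.comp (g := curvL (formIn (A.form a) φ)) _
      (contDiffAt_curvL (A.contDiffAt_formIn a D.chart hmem.1 hmem.2)) hE
  have h2 : ContDiffAt ℝ ∞ (fun q => (metricIn g φ (expState g φ q)).inverse)
      (D.state.c 0 t) := by
    have h3 : ContDiffAt ℝ ∞ (fun q => metricIn g φ (expState g φ q)) (D.state.c 0 t) :=
      ContDiffAt.comp (g := metricIn g φ) _ (contDiffAt_metricIn g D.chart hmem.1) hE
    exact ContDiffAt.comp (g := ContinuousLinearMap.inverse) _
      (metricIn_isInvertible g D.chart hmem.1).contDiffAt_map_inverse h3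
  have h4 : ContDiffAt ℝ ∞ (stateFrame g φ) (D.state.c 0 t) :=
    (hE.fderiv_right (m := ∞) (by simp)).clm_comp contDiffAt_const
  have h5 : ContDiffAt ℝ ∞ (fun q => (stateFrame g φ q).inverse) (D.state.c 0 t) :=
    ContDiffAt.comp (g := ContinuousLinearMap.inverse) _
      ((D.admissible_zero g).reg t).isInvertible.contDiffAt_map_inverse h4
  exact (h1.clm_apply (h2.clm_apply (contDiffAt_const.clm_comp h5))).clm_comp
    (hE.fderiv_right (m := ∞) (by simp))

end LocalData

end VB

/-! ### Smoothness of the gradient. -/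

section VB

variable {d N : ℕ} {M : Type*} [TopologicalSpace M] [ChartedSpace (EV d) M]
  {E : M → Type*} [∀ x, AddCommGroup (E x)] [∀ x, Module ℂ (E x)]
  [∀ x, TopologicalSpace (E x)] [TopologicalSpace (TotalSpace (CV N) E)]
  [FiberBundle (CV N) E] [VectorBundle ℂ (CV N) E]
  {G : Subgroup (Matrix.specialUnitaryGroup (Fin N) ℂ)} {B : GAtlas d E G}

variable [IsManifold (𝓡 d) ∞ M] {φ : OpenPartialHomeomorph M (EV d)} {γ : H1Curve d M}
  {α β : ℝ} {g : RMetric d M} {e : H1Frame γ} {a : B.ι} {ξ : H1Model d}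

/-- `normalFrame` is the invertible chart expression `stateFrame` followed by the inverse
differential of the chart, so its formal inverse is a genuine one. -/
theorem LocalData.Admissible.normalFrame_inverse {D : LocalData B e φ a α β}
    (h : D.Admissible g ξ) {t : ℝ} (ht : t ∈ Icc α β) (v : EV d) :
    (normalFrame g e ξ t).inverse (dsymm φ (φ (expCurve g γ (e.field ξ) t)) v) =
      (stateFrame g φ (D.state.c ξ (projI t))).inverse v := by
  have hx := h.mem_source ht
  obtain ⟨K, hK⟩ := (h.reg (projI t)).isInvertible
  set L : EV d ≃L[ℝ] EV d := K.trans (dchartEquiv D.chart hx).symm with hL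
  have h1 : (L : EV d →L[ℝ] EV d) = normalFrame g e ξ t := by
    ext1 v
    have h2 : dchart φ (expCurve g γ (e.field ξ) t) (normalFrame g e ξ t v) = K v := by
      rw [h.dchart_normalFrame ht v, ← hK]; rfl
    refine ((dchartEquiv D.chart hx).symm_apply_eq.mpr ?_)
    exact h2.symm
  have h3 : ContinuousLinearMap.inverse (L : EV d →L[ℝ] EV d) =
      ContinuousLinearMap.inverse (normalFrame g e ξ t : EV d →L[ℝ] EV d) :=
    congrArg ContinuousLinearMap.inverse h1
  refine (DFunLike.congr_fun h3 _).symm.trans ?_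
  rw [ContinuousLinearMap.inverse_equiv, ← hK, ContinuousLinearMap.inverse_equiv]
  change K.symm (dchartEquiv D.chart hx (dsymm φ (φ (expCurve g γ (e.field ξ) t)) v)) = K.symm v
  exact congrArg K.symm (D.chart.dchart_dsymm' hx v)

theorem LocalData.Admissible.rep_curvature_ae {D : LocalData B e φ a α β}
    (h : D.Admissible g ξ) (A : GConnection B) (μ : Fin d) :
    ∀ᵐ t ∂(volume.restrict (Icc α β)),
      B.rep a a (A.curvature (expCurve g γ (e.field ξ) t) (sharp g (expCurve g γ (e.field ξ) t)
        ((EuclideanSpace.proj μ : EV d →L[ℝ] ℝ).comp (normalFrame g e ξ t).inverse))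
          (velocity (expCurve g γ (e.field ξ)) t)) =
        D.gradForm g A μ (D.state.c ξ (projI t)) (D.state.p ξ t) := by
  filter_upwards [h.ae_dchart_velocity, ae_restrict_mem measurableSet_Icc] with t hv ht
  refine (rep_curvature A a D.chart (h.mem_source ht) (h.mem_dom ht) _ _).trans ?_
  have h1 := dchart_sharp g D.chart (h.mem_source ht)
    ((EuclideanSpace.proj μ : EV d →L[ℝ] ℝ).comp (normalFrame g e ξ t).inverse)
  have h2 : ((EuclideanSpace.proj μ : EV d →L[ℝ] ℝ).comp
      (normalFrame g e ξ t).inverse).comp (dsymm φ (φ (expCurve g γ (e.field ξ) t))) =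
        (EuclideanSpace.proj μ : EV d →L[ℝ] ℝ).comp
          (stateFrame g φ (D.state.c ξ (projI t))).inverse := by
    ext1 v
    exact congrArg (EuclideanSpace.proj μ : EV d →L[ℝ] ℝ) (h.normalFrame_inverse ht v)
  refine (congrArg₂ (curv (formIn (A.form a) φ) (φ (expCurve g γ (e.field ξ) t)))
    (h1.trans (congrArg _ h2)) hv).trans ?_
  rw [h.chart_eq ht]
  rfl

variable [T2Space M]

/-- The gradient of parallel transport over `[r, s]` depends smoothly on the curve. -/
def SmoothGrad (A : GConnection B) (g : RMetric d M) (e : H1Frame γ) (μ : Fin d) (r s : ℝ) :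
    Prop :=
  ∀ a b : B.ι, γ r ∈ B.dom a → γ s ∈ B.dom b → ∃ f : H1Model d → L2 (MatC N),
    ContDiffAt ℝ ∞ f 0 ∧
      ∀ᶠ ξ in 𝓝 (0 : H1Model d), f ξ =ᵐ[volI] (Icc r s).indicator (gradRep A g e μ a b r s ξ)

/-- Over the union the gradient is the first piece multiplied on the left by the transport over `[s,
t]`, plus the second piece multiplied on the right by the transport over `[r, s]`. These factors are
constant in time and smooth in `ξ`. -/
theorem SmoothGrad.trans {A : GConnection B} {μ : Fin d} {r s t : ℝ} (hr : 0 ≤ r) (hrs : r ≤ s)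
    (hst : s ≤ t) (ht : t ≤ 1) (h1 : SmoothTransport A g e r s) (h2 : SmoothTransport A g e s t)
    (h3 : SmoothGrad A g e μ r s) (h4 : SmoothGrad A g e μ s t) : SmoothGrad A g e μ r t := by
  intro a b ha hb
  have hc := B.mem_idxAt (γ s)
  set c := B.idxAt (γ s)
  obtain ⟨f, hf, hf'⟩ := h3 a c ha hc
  obtain ⟨k, hk, hk'⟩ := h4 c b hc hb
  refine ⟨fun ξ => lmulL2 (constC _ (expRep A g e c b s t ξ)) (f ξ) +
    rmulL2 (constC _ (expRep A g e a c r s ξ)) (k ξ),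
    (ContDiffAt.lmulL2 (ContDiffAt.constC (h2 c b hc hb)) hf).add
      (ContDiffAt.rmulL2 (ContDiffAt.constC (h1 a c ha hc)) hk), ?_⟩
  filter_upwards [hf', hk', eventually_expCurve_mem B g e ⟨hr.trans hrs, hst.trans ht⟩
    (B.isOpen_dom _) hc] with ξ q1 q2 q3
  -- At `τ = s` both closed intervals contribute, so the junction is discarded as a null set.
  have hne : ∀ᵐ τ ∂volI, τ ≠ s := ae_restrict_of_ae (Measure.ae_ne volume s)
  filter_upwards [q1, q2, Lp.coeFn_add (lmulL2 (constC _ (expRep A g e c b s t ξ)) (f ξ))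
    (rmulL2 (constC _ (expRep A g e a c r s ξ)) (k ξ)),
    coeFn_lmulL2 (constC _ (expRep A g e c b s t ξ)) (f ξ),
    coeFn_rmulL2 (constC _ (expRep A g e a c r s ξ)) (k ξ), hne] with τ w1 w2 w3 w4 w5 hτ
  rw [w3, Pi.add_apply, w4, w5, w1, w2, constC_apply, constC_apply]
  rcases lt_or_gt_of_ne hτ with hτ | hτ
  · have n2 : τ ∉ Icc s t := fun h => absurd h.1 (not_le.mpr hτ)
    rw [indicator_of_notMem n2, zero_mul, add_zero]
    by_cases hm : r ≤ τ
    · rw [indicator_of_mem (mem_Icc.mpr ⟨hm, hτ.le⟩),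
        indicator_of_mem (mem_Icc.mpr ⟨hm, hτ.le.trans hst⟩)]
      exact (gradRep_left A hr ⟨hm, hτ.le⟩ hst ht q3).symm
    · rw [indicator_of_notMem (fun h => hm h.1), indicator_of_notMem (fun h => hm h.1), mul_zero]
  · have n2 : τ ∉ Icc r s := fun h => absurd h.2 (not_le.mpr hτ)
    rw [indicator_of_notMem n2, mul_zero, zero_add]
    by_cases hm : τ ≤ t
    · rw [indicator_of_mem (mem_Icc.mpr ⟨hτ.le, hm⟩),
        indicator_of_mem (mem_Icc.mpr ⟨hrs.trans hτ.le, hm⟩)]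
      exact (gradRep_right A hr hrs ⟨hτ.le, hm⟩ ht q3).symm
    · rw [indicator_of_notMem (fun h => hm h.2), indicator_of_notMem (fun h => hm h.2), zero_mul]

namespace LocalData

theorem eventually_continuousAt_gradForm (D : LocalData B e φ a α β) (A : GConnection B)
    (μ : Fin d) : ∀ᶠ ξ in 𝓝 (0 : H1Model d), ∀ t,
      ContinuousAt (D.gradForm g A μ) (D.state.c ξ t) := by
  have hc : Filter.Tendsto D.state.c (𝓝 0) (𝓝 (D.state.c 0)) :=
    D.state.contDiff_c.continuous.tendsto 0
  have h1 : ∀ᶠ v in 𝓝 (D.state.c 0), ∀ t, ContinuousAt (D.gradForm g A μ) (v t) := by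
    have key : ∀ t, ∀ᶠ q in 𝓝 (D.state.c 0 t), ContinuousAt (D.gradForm g A μ) q := fun t =>
      (((D.contDiffAt_gradForm g A μ t).of_le (m := 1) (by simp)).eventually (by simp)).mono
        fun q hq => hq.continuousAt
    exact eventually_forall_of_forall_eventually key
  exact hc.eventually h1

/-- With `V` the fundamental solution and `Z = V⁻¹`, the quantity `U_{β,t} F U_{t,α}` reads `T V(β)
Z(t) F(t) V(t) Z(α) T'` in trivializations, with `T`, `T'` transition functions at the endpoints.
The outer factors depend on `ξ` only, the inner ones are continuous in time, and `F(t)` is an `L²`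
contraction. -/
theorem smoothGrad (D : LocalData B e φ a α β) (A : GConnection B) (μ : Fin d) :
    SmoothGrad A g e μ α β := by
  intro b c hb hc
  have hl := D.mem_dom α D.left_mem
  have hr := D.mem_dom β D.right_mem
  let l : H1Model d → MatC N := fun ξ =>
    B.trans c a (expCurve g γ (e.field ξ) β) * fwd (D.coeff g A ξ) (projI β)
  let r : H1Model d → MatC N := fun ξ =>
    bwd (D.coeff g A ξ) (projI α) * B.trans a b (expCurve g γ (e.field ξ) α)
  have hl' : ContDiffAt ℝ ∞ l 0 := (D.contDiffAt_trans_expCurve g D.right_mem hc hr).mul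
    (ContDiffAt.evalC (D.contDiffAt_fwd g A) _)
  have hr' : ContDiffAt ℝ ∞ r 0 := (ContDiffAt.evalC (D.contDiffAt_bwd g A) _).mul
    (D.contDiffAt_trans_expCurve g D.left_mem hl hb)
  let f₀ : H1Model d → L2 (MatC N) := fun ξ =>
    contract (D.gradForm g A μ) (D.state.c ξ) (D.state.p ξ)
  have hf₀ : ContDiffAt ℝ ∞ f₀ 0 := contDiffAt_contract D.state.contDiff_c.contDiffAt
    D.state.contDiff_p.contDiffAt (D.contDiffAt_gradForm g A μ)
  let f₁ : H1Model d → L2 (MatC N) := fun ξ =>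
    rmulL2 (constC _ (r ξ)) (rmulL2 (fwd (D.coeff g A ξ)) (f₀ ξ))
  have hf₁ : ContDiffAt ℝ ∞ f₁ 0 := ContDiffAt.rmulL2 (ContDiffAt.constC hr')
    (ContDiffAt.rmulL2 (D.contDiffAt_fwd g A) hf₀)
  let f₂ : H1Model d → L2 (MatC N) := fun ξ =>
    lmulL2 (constC _ (l ξ)) (lmulL2 (bwd (D.coeff g A ξ)) (f₁ ξ))
  have hf₂ : ContDiffAt ℝ ∞ f₂ 0 := ContDiffAt.lmulL2 (ContDiffAt.constC hl')
    (ContDiffAt.lmulL2 (D.contDiffAt_bwd g A) hf₁)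
  refine ⟨fun ξ => indL2 _ (Icc α β) measurableSet_Icc (f₂ ξ),
    ContDiffAt.indL2 measurableSet_Icc hf₂, ?_⟩
  filter_upwards [D.eventually_admissible g, D.eventually_continuousAt_gradForm A μ] with ξ hξ hcont
  have h1 := (ae_restrict_iff' measurableSet_Icc).mp (hξ.rep_curvature_ae A μ)
  filter_upwards [coeFn_indL2 (Icc α β) measurableSet_Icc (f₂ ξ),
    coeFn_lmulL2 (constC _ (l ξ)) (lmulL2 (bwd (D.coeff g A ξ)) (f₁ ξ)),
    coeFn_lmulL2 (bwd (D.coeff g A ξ)) (f₁ ξ),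
    coeFn_rmulL2 (constC _ (r ξ)) (rmulL2 (fwd (D.coeff g A ξ)) (f₀ ξ)),
    coeFn_rmulL2 (fwd (D.coeff g A ξ)) (f₀ ξ), coeFn_contract hcont (D.state.p ξ),
    ae_restrict_of_ae h1] with t w1 w2 w3 w4 w5 w6 w7
  rw [w1]
  by_cases ht : t ∈ Icc α β
  swap
  · rw [indicator_of_notMem ht, indicator_of_notMem ht]
  rw [indicator_of_mem ht, indicator_of_mem ht]
  refine w2.trans ?_
  rw [w3, w4, w5, w6, ← w7 ht, constC_apply, constC_apply]
  have hm := hξ.mem_dom ht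
  unfold gradRep
  dsimp only
  rw [B.rep_change a b a c (hξ.mem_dom D.left_mem) (hξ.mem_dom D.right_mem),
    B.rep_comp a a a hm, B.rep_comp a a a hm, hξ.rep_transport A ht.1 ht.2 le_rfl,
    hξ.rep_transport A le_rfl ht.1 ht.2]
  simp only [l, r, mul_assoc]

end LocalData

/-- The two statements go through the induction together, since concatenating gradients uses the
smoothness of the transports over both pieces. -/
theorem smoothTransport_and_smoothGrad (A : GConnection B) (g : RMetric d M) (e : H1Frame γ) :
    SmoothTransport A g e 0 1 ∧ ∀ μ, SmoothGrad A g e μ 0 1 := by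
  refine localData_induction B e (R := fun r s => SmoothTransport A g e r s ∧
    ∀ μ, SmoothGrad A g e μ r s) ?_ ?_
  · intro r s t hr hrs hst ht h1 h2
    exact ⟨h1.1.trans hr hrs hst ht h2.1, fun μ =>
      (h1.2 μ).trans hr hrs hst ht h1.1 h2.1 (h2.2 μ)⟩
  · exact fun φ a α β D => ⟨D.smoothTransport A, D.smoothGrad A⟩

end VB

/-! ### The first variation of parallel transport. -/

section Algebra

variable {R : Type*} [NormedRing R] [NormedAlgebra ℝ R] [CompleteSpace R]

theorem intervalIntegral_mul_mul (l r : R) {f : ℝ → R} {α β : ℝ}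
    (hf : IntervalIntegrable f volume α β) :
    IntervalIntegrable (fun t => l * f t * r) volume α β ∧
      ∫ t in α..β, l * f t * r = l * (∫ t in α..β, f t) * r := by
  let L : R →L[ℝ] R := ((ContinuousLinearMap.mul ℝ R).flip r).comp (ContinuousLinearMap.mul ℝ R l)
  exact ⟨⟨L.integrable_comp hf.1, L.integrable_comp hf.2⟩, L.intervalIntegral_comp_comm hf⟩

end Algebra

section Forms

universe u

variable {Q R : Type u} [NormedAddCommGroup Q] [NormedSpace ℝ Q] [NormedRing R] [NormedAlgebra ℝ R]
  [CompleteSpace Q] [CompleteSpace R]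

/-- The variation of parallel transport over `[α, β]`. -/
theorem hasDerivAt_fwd_contract_of_ae_zero {θ : Q → Q →L[ℝ] R} {c δ : C(unitInterval, Q)}
    {p δp : L2 Q} {α β : ℝ} (hα : α ∈ Icc (0 : ℝ) 1) (hβ : β ∈ Icc (0 : ℝ) 1)
    (hθ : ∀ t, ContDiffAt ℝ ∞ θ (c t)) (hc : HasWeakDeriv (fun t => c (projI t)) p 0 1)
    (hδ : HasWeakDeriv (fun t => δ (projI t)) δp 0 1)
    (hp : ∀ᵐ t ∂(volume.restrict (Icc 0 α)), p t = 0) :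
    ∃ Y : L2 R, (Y =ᵐ[volI] fun s => bwd (contract θ c p) (projI s) *
        curv θ (c (projI s)) (δ (projI s)) (p s) * fwd (contract θ c p) (projI s)) ∧
      HasDerivAt (fun s : ℝ => fwd (contract θ (c + s • δ) (p + s • δp)) (projI β))
        (-(θ (c (projI β)) (δ (projI β)) * fwd (contract θ c p) (projI β)) +
          fwd (contract θ c p) (projI β) * θ (c 0) (δ 0) -
            fwd (contract θ c p) (projI β) * ∫ s in α..β, Y s) 0 := by
  obtain ⟨w, hw, hw'⟩ := hasDerivAt_fwd_contract
    (fun t => (hθ t).of_le (by simp : (1 : WithTop ℕ∞) ≤ ∞)) hc hδ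
  set f := fwd (contract θ c p)
  set k := bwd (contract θ c p)
  let m : C(unitInterval, Q →L[ℝ] R) := ⟨fun t => curvL θ (c t) (δ t), by
    rw [continuous_iff_continuousAt]
    intro t
    have h1 : ContinuousAt (fun t => curvL θ (c t)) t :=
      ContinuousAt.comp (g := curvL θ) (contDiffAt_curvL (hθ t)).continuousAt
        c.continuous.continuousAt
    exact h1.clm_apply δ.continuous.continuousAt⟩
  -- The curvature integrand as an element of `L²`, so that its integrability need not be discussed
  -- separately.
  let Y : L2 R := lmulL2 k (rmulL2 f (bilinL2 (ContinuousLinearMap.id ℝ (Q →L[ℝ] R)) m p))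
  have hY : Y =ᵐ[volI] fun s => k (projI s) * curv θ (c (projI s)) (δ (projI s)) (p s) *
      f (projI s) := by
    filter_upwards [coeFn_lmulL2 k (rmulL2 f (bilinL2 (ContinuousLinearMap.id ℝ (Q →L[ℝ] R)) m p)),
      coeFn_rmulL2 f (bilinL2 (ContinuousLinearMap.id ℝ (Q →L[ℝ] R)) m p),
      coeFn_bilinL2 (ContinuousLinearMap.id ℝ (Q →L[ℝ] R)) m p] with t h1 h2 h3
    refine h1.trans ?_
    rw [h2, h3, ← mul_assoc]
    rfl
  have h0 : (0 : ℝ) ∈ Icc (0 : ℝ) 1 := by simp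
  -- The velocity `p` vanishes before `α`, so the curvature integral effectively starts there.
  have hY0 : ∫ s in (0 : ℝ)..α, Y s = 0 := by
    have h1 : ∫ s in (0 : ℝ)..α, Y s = ∫ s in (0 : ℝ)..α, (0 : R) := by
      apply intervalIntegral.integral_congr_ae_restrict
      rw [uIoc_of_le hα.1]
      filter_upwards [ae_restrict_of_ae_restrict_of_subset
        (Ioc_subset_Icc_self.trans (Icc_subset_Icc le_rfl hα.2)) hY,
        ae_restrict_of_ae_restrict_of_subset Ioc_subset_Icc_self hp] with t h1 h2
      rw [h1, h2, ← curvL_apply, map_zero, mul_zero, zero_mul]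
    rw [h1, intervalIntegral.integral_zero]
  refine ⟨Y, hY, ?_⟩
  have h1 : HasDerivAt (fun s : ℝ => fwd (contract θ (c + s • δ) (p + s • δp)) (projI β))
      (w (projI β)) 0 :=
    (ContinuousMap.evalCLM ℝ (projI β) : C(unitInterval, R) →L[ℝ] R).hasFDerivAt.comp_hasDerivAt
      0 hw
  rw [hw' (projI β)] at h1
  have h2 : ∫ s in (0 : ℝ)..(projI β : unitInterval), k (projI s) *
      curv θ (c (projI s)) (δ (projI s)) (p s) * f (projI s) = ∫ s in α..β, Y s := by
    rw [← L2.integral_congr hY h0 (projI β).2, projI_of_mem hβ,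
      ← intervalIntegral.integral_add_adjacent_intervals (L2.intervalIntegrable Y h0 hα)
      (L2.intervalIntegrable Y hα hβ), hY0, zero_add]
  rw [h2] at h1
  exact h1

end Forms

section VB

variable {d N : ℕ} {M : Type*} [TopologicalSpace M] [ChartedSpace (EV d) M]
  {E : M → Type*} [∀ x, AddCommGroup (E x)] [∀ x, Module ℂ (E x)]
  [∀ x, TopologicalSpace (E x)] [TopologicalSpace (TotalSpace (CV N) E)]
  [FiberBundle (CV N) E] [VectorBundle ℂ (CV N) E]
  {G : Subgroup (Matrix.specialUnitaryGroup (Fin N) ℂ)} {B : GAtlas d E G}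

variable [IsManifold (𝓡 d) ∞ M] {φ : OpenPartialHomeomorph M (EV d)} {γ : H1Curve d M}
  {α β : ℝ} {g : RMetric d M} {e : H1Frame γ} {a : B.ι} {ζ : H1Model d}

/-- The curvature along `γ`, transported to the endpoints of `[r, s]`, in trivializations. -/
def curvRep (A : GConnection B) (γ : H1Curve d M) (X : ∀ t : ℝ, TangentSpace (𝓡 d) (γ t))
    (a b : B.ι) (r s t : ℝ) : MatC N :=
  B.rep a b (parallelTransport A γ s t ∘ₗ A.curvature (γ t) (X t) (velocity γ t) ∘ₗ
    parallelTransport A γ t r)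

theorem curvRep_left (A : GConnection B) {X : ∀ t : ℝ, TangentSpace (𝓡 d) (γ t)} {a b c : B.ι}
    {r s t τ : ℝ} (hr : 0 ≤ r) (hτ : τ ∈ Icc r s) (hst : s ≤ t) (ht : t ≤ 1)
    (hc : γ s ∈ B.dom c) : curvRep A γ X a b r t τ =
      B.rep c b (parallelTransport A γ t s) * curvRep A γ X a c r s τ := by
  unfold curvRep
  rw [← parallelTransport_comp A _ (hr.trans hτ.1) hτ.2 hst ht, LinearMap.comp_assoc]
  exact B.rep_comp a c b hc _ _

theorem curvRep_right (A : GConnection B) {X : ∀ t : ℝ, TangentSpace (𝓡 d) (γ t)} {a b c : B.ι}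
    {r s t τ : ℝ} (hr : 0 ≤ r) (hrs : r ≤ s) (hτ : τ ∈ Icc s t) (ht : t ≤ 1)
    (hc : γ s ∈ B.dom c) : curvRep A γ X a b r t τ =
      curvRep A γ X c b s t τ * B.rep a c (parallelTransport A γ s r) := by
  unfold curvRep
  rw [← parallelTransport_comp A _ hr hrs hτ.1 (hτ.2.trans ht), ← LinearMap.comp_assoc,
    ← LinearMap.comp_assoc]
  exact B.rep_comp a c b hc _ _

/-- Fibers and tangent spaces depend on the curve, so `exp_γ(0) = γ` is applied to matrix-valued
functions of the whole curve. -/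
theorem expCurve_congr_zero [T2Space M] {P : H1Curve d M → MatC N} :
    P (expCurve g γ (e.field 0)) = P γ := by rw [expCurve_zero]

theorem expRep_zero [T2Space M] (A : GConnection B) (g : RMetric d M) (e : H1Frame γ)
    (a b : B.ι) (r s : ℝ) : expRep A g e a b r s 0 = B.rep a b (parallelTransport A γ s r) :=
  expCurve_congr_zero (P := fun η => B.rep a b (parallelTransport A η s r))

/-- The variation of parallel transport over `[r, s]` in the direction of the field `eζ`. -/
def HasTransportVariation (A : GConnection B) (g : RMetric d M) (e : H1Frame γ) (ζ : H1Model d)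
    (r s : ℝ) : Prop :=
  ∀ a b : B.ι, γ r ∈ B.dom a → γ s ∈ B.dom b →
    IntervalIntegrable (curvRep A γ (e.field ζ) a b r s) volume r s ∧
      HasDerivAt (fun σ : ℝ => expRep A g e a b r s (σ • ζ))
        (-(A.form b (γ s) (e.field ζ s) * B.rep a b (parallelTransport A γ s r)) +
          B.rep a b (parallelTransport A γ s r) * A.form a (γ r) (e.field ζ r) -
            ∫ t in r..s, curvRep A γ (e.field ζ) a b r s t) 0

variable [T2Space M]

theorem tendsto_smul_zero (ζ : H1Model d) :
    Filter.Tendsto (fun σ : ℝ => σ • ζ) (𝓝 0) (𝓝 0) := by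
  have h : Continuous fun σ : ℝ => σ • ζ := by fun_prop
  simpa using h.tendsto 0

/-- The Leibniz rule for the product of the two transports. The connection term at the junction `s`
arises once as the upper boundary term of the first piece and once, with opposite sign, as the lower
boundary term of the second. -/
theorem HasTransportVariation.trans {A : GConnection B} {r s t : ℝ} (hr : 0 ≤ r) (hrs : r ≤ s)
    (hst : s ≤ t) (ht : t ≤ 1) (h1 : HasTransportVariation A g e ζ r s)
    (h2 : HasTransportVariation A g e ζ s t) : HasTransportVariation A g e ζ r t := by
  intro a b ha hb
  have hc := B.mem_idxAt (γ s)
  set c := B.idxAt (γ s)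
  obtain ⟨i1, d1⟩ := h1 a c ha hc
  obtain ⟨i2, d2⟩ := h2 c b hc hb
  set P := B.rep a c (parallelTransport A γ s r)
  set P' := B.rep c b (parallelTransport A γ t s)
  have hP : B.rep a b (parallelTransport A γ t r) = P' * P := by
    rw [← parallelTransport_comp A γ hr hrs hst ht]
    exact B.rep_comp a c b hc _ _
  obtain ⟨j1, e1⟩ := intervalIntegral_mul_mul P' 1 i1
  obtain ⟨j2, e2⟩ := intervalIntegral_mul_mul 1 P i2
  simp only [mul_one, one_mul] at j1 e1 j2 e2
  have c1 : EqOn (fun τ => P' * curvRep A γ (e.field ζ) a c r s τ)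
      (curvRep A γ (e.field ζ) a b r t) (uIcc r s) := fun τ hτ => by
    rw [uIcc_of_le hrs] at hτ
    exact (curvRep_left A hr hτ hst ht hc).symm
  have c2 : EqOn (fun τ => curvRep A γ (e.field ζ) c b s t τ * P)
      (curvRep A γ (e.field ζ) a b r t) (uIcc s t) := fun τ hτ => by
    rw [uIcc_of_le hst] at hτ
    exact (curvRep_right A hr hrs hτ ht hc).symm
  have k1 := j1.congr (c1.mono uIoc_subset_uIcc)
  have k2 := j2.congr (c2.mono uIoc_subset_uIcc)
  rw [intervalIntegral.integral_congr c1] at e1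
  rw [intervalIntegral.integral_congr c2] at e2
  refine ⟨k1.trans k2, ?_⟩
  have hev : ∀ᶠ σ : ℝ in 𝓝 0, expRep A g e a b r t (σ • ζ) =
      expRep A g e c b s t (σ • ζ) * expRep A g e a c r s (σ • ζ) := by
    filter_upwards [(tendsto_smul_zero ζ).eventually (eventually_expCurve_mem B g e
      ⟨hr.trans hrs, hst.trans ht⟩ (B.isOpen_dom _) hc)] with σ hσ
    exact expRep_comp A hr hrs hst ht hσ
  refine ((d2.mul d1).congr_of_eventuallyEq hev).congr_deriv ?_
  simp only [zero_smul, expRep_zero]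
  rw [hP, ← intervalIntegral.integral_add_adjacent_intervals k1 k2, e1, e2]
  noncomm_ring

namespace LocalData

variable (A : GConnection B)

/-- The derivative of `exp` at zero vectors being the identity, the variation of `exp_γ(σeζ)` at `σ
= 0` is the field `eζ`. -/
theorem fderiv_expState_c_zero (D : LocalData B e φ a α β) (g : RMetric d M) (ζ : H1Model d)
    {t : ℝ} (ht : t ∈ Icc α β) : fderiv ℝ (expState g φ) (D.state.c 0 (projI t))
      ((D.state.c ζ - D.state.c 0) (projI t)) = dchart φ (γ t) (e.field ζ t) := by
  have h1 := D.stateFrame_c_zero g (projI t)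
  rw [D.state.c_sub D.nonneg D.le D.le_one]
  rw [projI_of_mem (D.subset ht), clamp_of_mem ht] at h1 ⊢
  exact DFunLike.congr_fun h1 (ζ.eval t)

theorem expState_c_zero_projI (D : LocalData B e φ a α β) (g : RMetric d M) {t : ℝ}
    (ht : t ∈ Icc α β) : expState g φ (D.state.c 0 (projI t)) = φ (γ t) := by
  rw [D.expState_c_zero g, projI_of_mem (D.subset ht), clamp_of_mem ht]

/-- The derivative of the transition functions along `σ ↦ exp_γ(σeζ)(t)`. -/
theorem hasDerivAt_trans_expCurve (D : LocalData B e φ a α β) (g : RMetric d M) (ζ : H1Model d)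
    {t : ℝ} (ht : t ∈ Icc α β) {b c : B.ι} (hb : γ t ∈ B.dom b) (hc : γ t ∈ B.dom c) :
    HasDerivAt (fun σ : ℝ => B.trans c b (expCurve g γ (e.field (σ • ζ)) t))
      (B.trans c b (γ t) * A.form b (γ t) (e.field ζ t) -
        A.form c (γ t) (e.field ζ t) * B.trans c b (γ t)) 0 := by
  have hx := D.mem_source t ht
  have hinv := φ.left_inv hx
  have h1 : HasDerivAt (fun σ : ℝ => D.state.c (σ • ζ) (projI t))
      ((D.state.c ζ - D.state.c 0) (projI t)) 0 := by
    have h2 : (fun σ : ℝ => D.state.c (σ • ζ) (projI t)) = fun σ : ℝ =>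
        D.state.c 0 (projI t) + σ • (D.state.c ζ - D.state.c 0) (projI t) := by
      funext σ
      rw [D.state.c_smul D.nonneg D.le D.le_one]
      rfl
    rw [h2]
    simpa using ((hasDerivAt_id (0 : ℝ)).smul_const
      ((D.state.c ζ - D.state.c 0) (projI t))).const_add (D.state.c 0 (projI t))
  have h3 : HasDerivAt (fun σ : ℝ => expState g φ (D.state.c (σ • ζ) (projI t)))
      (dchart φ (γ t) (e.field ζ t)) 0 := by
    have h4 := ((D.contDiffAt_expState_zero g (projI t)).differentiableAt
      (by simp)).hasFDerivAt.comp_hasDerivAt_of_eq (0 : ℝ) h1 (by rw [zero_smul])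
    rw [D.fderiv_expState_c_zero g ζ ht] at h4
    exact h4
  have h5 : DifferentiableAt ℝ (fun z => B.trans c b (φ.symm z)) (φ (γ t)) :=
    (contDiffAt_trans B c b D.chart (φ.map_source hx) (by rwa [hinv])
      (by rwa [hinv])).differentiableAt (by simp)
  have h6 := h5.hasFDerivAt.comp_hasDerivAt_of_eq (0 : ℝ) h3
    (by rw [zero_smul, D.expState_c_zero_projI g ht])
  have h7 := trans_mul_formIn A b c D.chart (φ.map_source hx) (by rwa [hinv]) (by rwa [hinv])
    (dchart φ (γ t) (e.field ζ t))
  rw [formIn_dchart (A.form b) D.chart hx (e.field ζ t),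
    formIn_dchart (A.form c) D.chart hx (e.field ζ t), hinv] at h7
  refine (h6.congr_of_eventuallyEq ?_).congr_deriv (eq_sub_iff_add_eq'.mpr h7.symm)
  filter_upwards [(tendsto_smul_zero ζ).eventually (D.eventually_admissible g)] with σ hσ
  rw [Function.comp_apply, ← hσ.chart_eq ht, φ.left_inv (hσ.mem_source ht)]

theorem form_c_zero (D : LocalData B e φ a α β) (g : RMetric d M) (ζ : H1Model d) {t : ℝ}
    (ht : t ∈ Icc α β) : D.form g A (D.state.c 0 (projI t))
      ((D.state.c ζ - D.state.c 0) (projI t)) = A.form a (γ t) (e.field ζ t) := by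
  have h1 := formIn_dchart (A.form a) D.chart (D.mem_source t ht) (e.field ζ t)
  refine Eq.trans ?_ h1
  rw [form, pullForm_apply, D.fderiv_expState_c_zero g ζ ht, D.expState_c_zero_projI g ht]

/-- Curvature commutes with pullback, and `expState` carries the variation and the velocity of the
state to the field and to `γ̇`. -/
theorem curv_c_zero_ae (D : LocalData B e φ a α β) (g : RMetric d M) (ζ : H1Model d) :
    ∀ᵐ t ∂(volume.restrict (Icc α β)),
      curv (D.form g A) (D.state.c 0 (projI t)) ((D.state.c ζ - D.state.c 0) (projI t))
        (D.state.p 0 t) = B.rep a a (A.curvature (γ t) (e.field ζ t) (velocity γ t)) := by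
  have h0 := (D.admissible_zero g).ae_dchart_velocity
  have h0' : ∀ᵐ t ∂(volume.restrict (Icc α β)), dchart φ (γ t) (velocity γ t) =
      fderiv ℝ (expState g φ) (D.state.c 0 (projI t)) (D.state.p 0 t) := by
    have key : ∀ η : H1Curve d M, η = γ →
        (∀ᵐ t ∂(volume.restrict (Icc α β)), dchart φ (η t) (velocity η t) =
          fderiv ℝ (expState g φ) (D.state.c 0 (projI t)) (D.state.p 0 t)) →
        ∀ᵐ t ∂(volume.restrict (Icc α β)), dchart φ (γ t) (velocity γ t) =
          fderiv ℝ (expState g φ) (D.state.c 0 (projI t)) (D.state.p 0 t) := by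
      rintro η rfl h
      exact h
    exact key _ (expCurve_zero g e) h0
  filter_upwards [h0', ae_restrict_mem measurableSet_Icc] with t hv ht
  have hx := D.mem_source t ht
  have hmem := D.expState_mem_zero (g := g) (projI t)
  rw [form, curv_pullForm ((D.contDiffAt_expState_zero g (projI t)).of_le (by
      exact_mod_cast ENat.LEInfty.out))
    ((A.contDiffAt_formIn a D.chart hmem.1 hmem.2).differentiableAt (by simp)), ← hv,
    D.fderiv_expState_c_zero g ζ ht, D.expState_c_zero_projI g ht]
  exact (rep_curvature A a D.chart hx (D.mem_dom t ht) _ _).symm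

theorem rep_transport_zero (D : LocalData B e φ a α β) (g : RMetric d M) {s t : ℝ} (hs : α ≤ s)
    (hst : s ≤ t) (ht : t ≤ β) : B.rep a a (parallelTransport A γ t s) =
      fwd (D.coeff g A 0) (projI t) * bwd (D.coeff g A 0) (projI s) := by
  rw [← (D.admissible_zero g).rep_transport A hs hst ht]
  exact (expCurve_congr_zero (P := fun η => B.rep a a (parallelTransport A η t s))).symm

/-- The state along `σ ↦ σζ` is an affine path with direction `c ζ - c 0`, and its derivative is
affine with direction `p ζ - p 0`; this is the situation of the abstract variation formula. -/
theorem exists_hasDerivAt_fwd_coeff (D : LocalData B e φ a α β) (g : RMetric d M)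
    (ζ : H1Model d) : ∃ Y : L2 (MatC N),
      (Y =ᵐ[volume.restrict (Icc α β)] fun t => bwd (D.coeff g A 0) (projI t) *
        B.rep a a (A.curvature (γ t) (e.field ζ t) (velocity γ t)) *
          fwd (D.coeff g A 0) (projI t)) ∧
      HasDerivAt (fun σ : ℝ => fwd (D.coeff g A (σ • ζ)) (projI β))
        (-(A.form a (γ β) (e.field ζ β) * fwd (D.coeff g A 0) (projI β)) +
          fwd (D.coeff g A 0) (projI β) * A.form a (γ α) (e.field ζ α) -
            fwd (D.coeff g A 0) (projI β) * ∫ t in α..β, Y t) 0 := by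
  have hα := D.subset D.left_mem
  obtain ⟨Y, hY, hd⟩ := hasDerivAt_fwd_contract_of_ae_zero hα (D.subset D.right_mem)
    (D.contDiffAt_form g A) (D.state.weak 0) (D.state.weak_sub ζ) (D.p_ae_zero 0)
  refine ⟨Y, ?_, ?_⟩
  · filter_upwards [ae_restrict_of_ae_restrict_of_subset D.subset hY, D.curv_c_zero_ae A g ζ]
      with t h1 h2
    rw [h1, h2]
    rfl
  -- The abstract formula has its lower boundary term at time `0`; by clamping, the state there
  -- equals the state at `α`.
  have h0 : D.form g A (D.state.c 0 0) ((D.state.c ζ - D.state.c 0) 0) =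
      A.form a (γ α) (e.field ζ α) := by
    have h1 : clamp α β ((0 : unitInterval) : ℝ) = α := clamp_of_le D.nonneg
    have h2 : clamp α β ((projI α : unitInterval) : ℝ) = α := by
      rw [projI_of_mem hα]
      exact clamp_of_mem D.left_mem
    rw [← D.form_c_zero A g ζ D.left_mem, D.state.c_sub D.nonneg D.le D.le_one,
      D.state.c_sub D.nonneg D.le D.le_one, D.c_zero, D.c_zero, h1, h2]
  rw [h0, D.form_c_zero A g ζ D.right_mem] at hd
  have h3 : (fun σ : ℝ => fwd (D.coeff g A (σ • ζ)) (projI β)) = fun σ : ℝ =>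
      fwd (contract (D.form g A) (D.state.c 0 + σ • (D.state.c ζ - D.state.c 0))
        (D.state.p 0 + σ • (D.state.p ζ - D.state.p 0))) (projI β) := by
    funext σ
    rw [coeff, D.state.c_smul D.nonneg D.le D.le_one, D.state.p_smul]
  rw [h3]
  exact hd

/-- The transport in arbitrary trivializations is `T V T'` with transition functions `T`, `T'` at
the moving endpoints. Differentiating them contributes terms in `A^a` that cancel the boundary terms
of `V`, and leaves those of the trivializations `b` and `c`. -/
theorem hasTransportVariation (D : LocalData B e φ a α β) (g : RMetric d M) (ζ : H1Model d) :
    HasTransportVariation A g e ζ α β := by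
  intro b c hb hc
  have hα := D.subset D.left_mem
  have hβ := D.subset D.right_mem
  have hl := D.mem_dom α D.left_mem
  have hr := D.mem_dom β D.right_mem
  obtain ⟨Y, hY, hd⟩ := D.exists_hasDerivAt_fwd_coeff A g ζ
  have hbwd := (D.admissible_zero g).bwd_left A
  have hrep : ∀ {s t : ℝ}, α ≤ s → s ≤ t → t ≤ β → B.rep a a (parallelTransport A γ t s) =
      fwd (D.coeff g A 0) (projI t) * bwd (D.coeff g A 0) (projI s) :=
    fun h1 h2 h3 => D.rep_transport_zero A g h1 h2 h3
  have z4 : fwd (D.coeff g A ((0 : ℝ) • ζ)) = fwd (D.coeff g A 0) := by rw [zero_smul]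
  have hev : ∀ᶠ σ : ℝ in 𝓝 0, expRep A g e b c α β (σ • ζ) =
      B.trans c a (expCurve g γ (e.field (σ • ζ)) β) * fwd (D.coeff g A (σ • ζ)) (projI β) *
        B.trans a b (expCurve g γ (e.field (σ • ζ)) α) := by
    filter_upwards [(tendsto_smul_zero ζ).eventually (D.eventually_admissible g)] with σ hσ
    unfold expRep
    rw [B.rep_change a b a c (hσ.mem_dom D.left_mem) (hσ.mem_dom D.right_mem),
      hσ.rep_transport A le_rfl D.le le_rfl, hσ.bwd_left A, mul_one]
  generalize fwd (D.coeff g A 0) = f at *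
  generalize bwd (D.coeff g A 0) = k at *
  set T := B.trans c a (γ β)
  set T' := B.trans a b (γ α)
  have hP : B.rep b c (parallelTransport A γ β α) = T * f (projI β) * T' := by
    rw [B.rep_change a b a c hl hr, hrep le_rfl D.le le_rfl, hbwd, mul_one]
  obtain ⟨i1, e1⟩ := intervalIntegral_mul_mul (T * f (projI β)) T' (L2.intervalIntegrable Y hα hβ)
  have hK : (fun t => T * f (projI β) * Y t * T') =ᵐ[volume.restrict (uIoc α β)]
      curvRep A γ (e.field ζ) b c α β := by
    rw [uIoc_of_le D.le]
    filter_upwards [ae_restrict_of_ae_restrict_of_subset Ioc_subset_Icc_self hY,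
      ae_restrict_mem measurableSet_Ioc] with t h1 ht
    have hm := D.mem_dom t (Ioc_subset_Icc_self ht)
    unfold curvRep
    rw [h1, B.rep_change a b a c hl hr, B.rep_comp a a a hm, B.rep_comp a a a hm,
      hrep ht.1.le ht.2 le_rfl, hrep le_rfl ht.1.le ht.2, hbwd]
    simp only [mul_assoc, one_mul]
    rfl
  refine ⟨i1.congr_ae hK, ?_⟩
  rw [← intervalIntegral.integral_congr_ae_restrict hK, e1]
  have d1 := D.hasDerivAt_trans_expCurve A g ζ D.right_mem hr hc
  have d2 := D.hasDerivAt_trans_expCurve A g ζ D.left_mem hb hl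
  refine (((d1.mul hd).mul d2).congr_of_eventuallyEq hev).congr_deriv ?_
  have z1 : B.trans c a (expCurve g γ (e.field ((0 : ℝ) • ζ)) β) = T := by
    rw [zero_smul]
    exact expCurve_congr_zero (P := fun η => B.trans c a (η β))
  have z2 : B.trans a b (expCurve g γ (e.field ((0 : ℝ) • ζ)) α) = T' := by
    rw [zero_smul]
    exact expCurve_congr_zero (P := fun η => B.trans a b (η α))
  have t1 : B.trans c a (γ β) = T := rfl
  have t2 : B.trans a b (γ α) = T' := rfl
  rw [Pi.mul_apply, z1, z2, z4, hP, t1, t2]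
  noncomm_ring

end LocalData

theorem hasTransportVariation (A : GConnection B) (g : RMetric d M) (e : H1Frame γ)
    (ζ : H1Model d) : HasTransportVariation A g e ζ 0 1 :=
  localData_induction B e (R := HasTransportVariation A g e ζ)
    (fun _ _ _ hr hrs hst ht h1 h2 => h1.trans hr hrs hst ht h2)
    fun _ _ _ _ D => D.hasTransportVariation A g ζ

end VB

/-! ### The trace pairing -/

section Trace

variable {N : ℕ}

/-- The pairing `Re tr(P^* Q)`. -/
def traceRe (P Q : Matrix (Fin N) (Fin N) ℂ) : ℝ := (P.conjTranspose * Q).trace.re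

/-- The linear form `P ↦ Re tr(P^* Q)`. -/
def traceForm (Q : MatC N) : MatC N →L[ℝ] ℝ :=
  LinearMap.toContinuousLinearMap
    { toFun := fun P => traceRe P Q
      map_add' := fun P P' => by
        have h : ∀ P P' Q : Matrix (Fin N) (Fin N) ℂ, ((P + P').conjTranspose * Q).trace.re =
            (P.conjTranspose * Q).trace.re + (P'.conjTranspose * Q).trace.re := fun P P' Q => by
          rw [Matrix.conjTranspose_add, add_mul, Matrix.trace_add, Complex.add_re]
        exact h P P' Q
      map_smul' := fun r P => by
        have h : ∀ P Q : Matrix (Fin N) (Fin N) ℂ, ((r • P).conjTranspose * Q).trace.re =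
            r * (P.conjTranspose * Q).trace.re := fun P Q => by
          rw [Matrix.conjTranspose_smul, smul_mul_assoc, Matrix.trace_smul, star_trivial,
            Complex.smul_re, smul_eq_mul]
        exact h P Q }

/-- Testing with `Q = P` gives the sum of the squared moduli of the entries. -/
theorem eq_zero_of_traceForm {P : MatC N} (h : ∀ Q, traceForm Q P = 0) : P = 0 := by
  have key : ∀ P : Matrix (Fin N) (Fin N) ℂ, (P.conjTranspose * P).trace.re = 0 → P = 0 := by
    intro P hP
    have h1 : (P.conjTranspose * P).trace.re = ∑ i, ∑ j, Complex.normSq (P j i) := by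
      simp only [Matrix.trace, Matrix.diag_apply, Matrix.mul_apply, Matrix.conjTranspose_apply,
        Complex.re_sum]
      refine Finset.sum_congr rfl fun i _ => Finset.sum_congr rfl fun j _ => ?_
      simp [Complex.normSq_apply]
    rw [h1] at hP
    have h2 := (Finset.sum_eq_zero_iff_of_nonneg fun i _ =>
      Finset.sum_nonneg fun j _ => Complex.normSq_nonneg (P j i)).mp hP
    ext j i
    have h3 := (Finset.sum_eq_zero_iff_of_nonneg fun j _ =>
      Complex.normSq_nonneg (P j i)).mp (h2 i (Finset.mem_univ i))
    exact Complex.normSq_eq_zero.mp (h3 j (Finset.mem_univ j))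
  exact key P (h P)

end Trace

/-! ### The gradient of parallel transport. -/

section VB

variable {d N : ℕ} {M : Type*} [TopologicalSpace M] [ChartedSpace (EV d) M]
  {E : M → Type*} [∀ x, AddCommGroup (E x)] [∀ x, Module ℂ (E x)]
  [∀ x, TopologicalSpace (E x)] [TopologicalSpace (TotalSpace (CV N) E)]
  [FiberBundle (CV N) E] [VectorBundle ℂ (CV N) E]
  {G : Subgroup (Matrix.specialUnitaryGroup (Fin N) ℂ)} {B : GAtlas d E G}

/-- Linear maps between fibers, in trivializations, as a linear map. -/
def GAtlas.repL (B : GAtlas d E G) (a b : B.ι) (x y : M) : (E x →ₗ[ℂ] E y) →ₗ[ℝ] MatC N where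
  toFun L := B.rep a b L
  map_add' L L' := conjTriv_add _ _ L L'
  map_smul' r L := conjTriv_smul _ _ r L

theorem homInner_eq (B : GAtlas d E G) {x y : M} (Φ Ψ : E x →ₗ[ℂ] E y) :
    homInner B Φ Ψ = traceForm (B.rep (B.idxAt x) (B.idxAt y) Ψ)
      (B.rep (B.idxAt x) (B.idxAt y) Φ) := rfl

variable [IsManifold (𝓡 d) ∞ M] [T2Space M]

theorem isSmoothESection_parallelTransport (A : GConnection B) (g : RMetric d M) :
    IsSmoothESection g B (fun γ => parallelTransport A γ 1 0) := fun γ => by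
  obtain ⟨e⟩ := exists_h1Frame γ
  exact ⟨e, fun a b ha hb => (smoothTransport_and_smoothGrad A g e).1 a b ha hb⟩

theorem exists_repEH0_transportGradient (A : GConnection B) (g : RMetric d M) {γ : H1Curve d M}
    (e : H1Frame γ) (a b : B.ι) (ha : γ 0 ∈ B.dom a) (hb : γ 1 ∈ B.dom b) :
    ∃ f : H1Model d → L2 (Fin d → MatC N),
      (∀ᶠ ξ in 𝓝 (0 : H1Model d), ∀ᵐ t ∂(volume.restrict (Icc (0 : ℝ) 1)),
        f ξ t = repEH0 g B (transportGradient g A) e a b ξ t) ∧ ContDiffAt ℝ ∞ f 0 := by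
  have h := fun μ => (smoothTransport_and_smoothGrad A g e).2 μ a b ha hb
  choose k hk hk' using h
  -- Places the `μ`-th component in its slot, including the minus sign that `gradRep` leaves out.
  let S : Fin d → L2 (MatC N) →L[ℝ] L2 (Fin d → MatC N) := fun μ =>
    ((-ContinuousLinearMap.single ℝ (fun _ : Fin d => MatC N) μ :
      MatC N →L[ℝ] (Fin d → MatC N))).compLpL 2 volI
  refine ⟨fun ξ => ∑ μ, S μ (k μ ξ), ?_, ContDiffAt.sum fun μ _ =>
    (S μ).contDiff.contDiffAt.comp 0 (hk μ)⟩
  filter_upwards [Filter.eventually_all.mpr hk'] with ξ hξ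
  have h1 : ∀ᵐ t ∂volI, ∀ μ, (S μ (k μ ξ) : ℝ → Fin d → MatC N) t =
      -Pi.single μ (k μ ξ t) := by
    rw [ae_all_iff]
    intro μ
    filter_upwards [ContinuousLinearMap.coeFn_compLpL (p := 2) (μ := volI)
      (-ContinuousLinearMap.single ℝ (fun _ : Fin d => MatC N) μ) (k μ ξ)] with t ht
    exact ht
  filter_upwards [Lp.coeFn_finsetSum Finset.univ fun μ => S μ (k μ ξ), h1, ae_all_iff.mpr hξ,
    ae_restrict_mem measurableSet_Icc] with t h2 h3 h4 ht
  rw [h2]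
  funext μ
  rw [Finset.sum_apply, Finset.sum_apply]
  simp only [h3, Pi.neg_apply]
  rw [Finset.sum_eq_single μ (fun ν _ hν => by rw [Pi.single_eq_of_ne hν.symm, neg_zero])
    (fun h => absurd (Finset.mem_univ μ) h), Pi.single_eq_same, h4 μ, indicator_of_mem ht]
  exact (conjTriv_neg _ _ _).symm

theorem isSmoothEH0Section_transportGradient (A : GConnection B) (g : RMetric d M) :
    IsSmoothEH0Section g B (transportGradient g A) := fun γ => by
  obtain ⟨e⟩ := exists_h1Frame γ
  exact ⟨e, fun a b ha hb => exists_repEH0_transportGradient A g e a b ha hb⟩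

theorem transportGradient_inner (A : GConnection B) (g : RMetric d M) (γ : H1Curve d M) (t : ℝ)
    (v : TangentSpace (𝓡 d) (γ t)) : transportGradient g A γ t (g.inner (γ t) v) =
      -(parallelTransport A γ 1 t ∘ₗ A.curvature (γ t) v (velocity γ t) ∘ₗ
        parallelTransport A γ t 0) := by
  have h : ∀ v', v' = v → -(parallelTransport A γ 1 t ∘ₗ A.curvature (γ t) v' (velocity γ t) ∘ₗ
        parallelTransport A γ t 0) = -(parallelTransport A γ 1 t ∘ₗ
          A.curvature (γ t) v (velocity γ t) ∘ₗ parallelTransport A γ t 0) := by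
    rintro _ rfl; rfl
  exact h _ (sharp_inner g (γ t) v)

/-- In the variation formula both boundary terms are linear in `X` at the endpoints and vanish. The
curvature integral that remains is the pairing with the gradient, as lowering and raising the index
of `X` cancel. -/
theorem exists_hasDirDeriv_parallelTransport (A : GConnection B) (g : RMetric d M)
    (γ : H1Curve d M) {X : ∀ t : ℝ, TangentSpace (𝓡 d) (γ t)} (hX : IsH1Field γ X)
    (h0 : X 0 = 0) (h1 : X 1 = 0) : ∃ D : E (γ 0) →ₗ[ℂ] E (γ 1),
      HasDirDeriv g B (fun γ => parallelTransport A γ 1 0) γ X D ∧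
        ∀ Φ : E (γ 0) →ₗ[ℂ] E (γ 1),
          ∫ t in (0 : ℝ)..1, homInner B (transportGradient g A γ t (g.inner (γ t) (X t))) Φ =
            homInner B D Φ := by
  obtain ⟨e⟩ := exists_h1Frame γ
  obtain ⟨ζ, hζ⟩ := exists_field_eq e hX
  have hvar := hasTransportVariation A g e ζ
  set a₀ := B.idxAt (γ 0)
  set b₀ := B.idxAt (γ 1)
  have ha₀ : γ 0 ∈ B.dom a₀ := B.mem_idxAt _
  have hb₀ : γ 1 ∈ B.dom b₀ := B.mem_idxAt _
  have hcurve : ∀ σ : ℝ, expCurve g γ (e.field (σ • ζ)) = expCurve g γ (fun t => σ • X t) :=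
    fun σ => expCurve_congr fun t ht => by rw [field_smul σ ζ ht, hζ t ht]
  have hvar' : ∀ a b : B.ι, γ 0 ∈ B.dom a → γ 1 ∈ B.dom b →
      HasDerivAt (fun σ : ℝ => B.rep a b
        (parallelTransport A (expCurve g γ (fun t => σ • X t)) 1 0))
        (-∫ t in (0 : ℝ)..1, curvRep A γ (e.field ζ) a b 0 1 t) 0 := by
    intro a b ha hb
    have hd := (hvar a b ha hb).2
    rw [hζ 0 (by simp), hζ 1 (by simp), h0, h1, map_zero, map_zero, zero_mul, mul_zero, neg_zero,
      add_zero, zero_sub] at hd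
    refine hd.congr_of_eventuallyEq (Filter.Eventually.of_forall fun σ => ?_)
    have key : ∀ η η' : H1Curve d M, η = η' → B.rep a b (parallelTransport A η' 1 0) =
        B.rep a b (parallelTransport A η 1 0) := by
      rintro η _ rfl; rfl
    exact key _ _ (hcurve σ)
  obtain ⟨i0, -⟩ := hvar a₀ b₀ ha₀ hb₀
  set I := ∫ t in (0 : ℝ)..1, curvRep A γ (e.field ζ) a₀ b₀ 0 1 t
  have hD : B.rep a₀ b₀ (ofConj (B.triv a₀) (B.triv b₀) (γ 0) (γ 1) (-I)) = -I :=
    conjTriv_ofConj _ _ ha₀ hb₀ _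
  -- The derivative is defined in the chosen trivializations. The endpoints are fixed, so passing to
  -- others multiplies by constant matrices, which move through the integral.
  refine ⟨ofConj (B.triv a₀) (B.triv b₀) (γ 0) (γ 1) (-I), fun a b ha hb => ?_, fun Φ => ?_⟩
  · refine (hvar' a b ha hb).congr_deriv ?_
    rw [B.rep_change a₀ a b₀ b ha₀ hb₀, hD]
    have h2 := (intervalIntegral_mul_mul (B.trans b b₀ (γ 1)) (B.trans a₀ a (γ 0)) i0).2
    rw [mul_neg, neg_mul, ← h2]
    congr 1
    refine intervalIntegral.integral_congr fun t _ => ?_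
    exact B.rep_change a₀ a b₀ b ha₀ hb₀ _
  · rw [homInner_eq, hD, map_neg, ← ContinuousLinearMap.intervalIntegral_comp_comm _ i0,
      ← intervalIntegral.integral_neg]
    refine intervalIntegral.integral_congr fun t ht => ?_
    rw [uIcc_of_le zero_le_one] at ht
    rw [transportGradient_inner, homInner_eq, ← map_neg]
    refine congrArg _ ((conjTriv_neg _ _ _).trans (congrArg Neg.neg ?_))
    unfold curvRep
    rw [hζ t ht]

theorem isH0Gradient_transportGradient (A : GConnection B) (g : RMetric d M) :
    IsH0Gradient g B (fun γ => parallelTransport A γ 1 0) (transportGradient g A) :=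
  ⟨isSmoothESection_parallelTransport A g, isSmoothEH0Section_transportGradient A g,
    fun γ _ hX h0 h1 => exists_hasDirDeriv_parallelTransport A g γ hX h0 h1⟩

end VB

/-! ### Uniqueness of the gradient. -/

theorem isH1On_id (a b : ℝ) : IsH1On (fun t : ℝ => t) a b :=
  ⟨fun _ => 1, memLp_const 1, fun t _ => by simp⟩

section VB

variable {d N : ℕ} {M : Type*} [TopologicalSpace M] [ChartedSpace (EV d) M]
  {E : M → Type*} [∀ x, AddCommGroup (E x)] [∀ x, Module ℂ (E x)]
  [∀ x, TopologicalSpace (E x)] [TopologicalSpace (TotalSpace (CV N) E)]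
  [FiberBundle (CV N) E] [VectorBundle ℂ (CV N) E]
  {G : Subgroup (Matrix.specialUnitaryGroup (Fin N) ℂ)} {B : GAtlas d E G}

variable [IsManifold (𝓡 d) ∞ M] {γ : H1Curve d M}

/-- These are the test fields: localized in time by `χ`, and in every direction as `w` varies. -/
theorem isH1Field_smul (e : H1Frame γ) {χ : ℝ → ℝ} (hχ : ContDiff ℝ ∞ χ) (w : EV d) :
    IsH1Field γ (fun t => χ t • e.toEquiv t w) := by
  intro φ hφ a b ha hab hb hs
  have h1 : IsH1On χ a b := (isH1On_id a b).comp fun t _ => (hχ.of_le (by simp)).contDiffAt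
  refine ((h1.prodMk (e.isH1 w φ hφ a b ha hab hb hs)).comp (F := fun q : ℝ × EV d => q.1 • q.2)
    fun t _ => (contDiff_fst.smul contDiff_snd).contDiffAt).congr fun t _ => ?_
  exact map_smul (dchart φ (γ t)) (χ t) (e.equiv t w)

theorem continuousOn_metricAt (g : RMetric d M) (e : H1Frame γ) (v w : EV d) :
    ContinuousOn (fun t => metricAt g (γ t) (e.equiv t v) (e.equiv t w)) (Icc 0 1) := by
  let R : ℝ → ℝ → Prop := fun r s =>
    ContinuousOn (fun t => metricAt g (γ t) (e.equiv t v) (e.equiv t w)) (Icc r s)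
  have htrans : ∀ r s t, 0 ≤ r → r ≤ s → s ≤ t → t ≤ 1 → R r s → R s t → R r t := by
    intro r s t _ hrs hst _ h1 h2
    have h3 := h1.union_of_isClosed h2 isClosed_Icc isClosed_Icc
    rwa [Icc_union_Icc_eq_Icc hrs hst] at h3
  have hloc : ∀ x r s, 0 ≤ r → r ≤ s → s ≤ 1 →
      (∀ τ ∈ Icc r s, γ τ ∈ (chartAt (EV d) x).source) → R r s := by
    intro x r s hr hrs hs hx
    set φ := chartAt (EV d) x
    have hφ : IsChart φ := isChart_chartAt x
    have h1 : ContinuousOn (fun t => φ (γ t)) (Icc r s) :=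
      (γ.isH1.2 φ hφ r s hr hrs hs hx).continuousOn
    have h2 : ContinuousOn (fun t => metricIn g φ (φ (γ t))) (Icc r s) := fun t ht =>
      ContinuousAt.comp_continuousWithinAt (f := fun t => φ (γ t))
        (contDiffAt_metricIn g hφ (φ.map_source (hx t ht))).continuousAt (h1 t ht)
    have h3 := (e.isH1On_inChart hφ hr hrs hs hx).continuousOn
    refine ((h2.clm_apply (h3.clm_apply (continuousOn_const (c := v)))).clm_apply
      (h3.clm_apply (continuousOn_const (c := w)))).congr fun t ht => ?_
    dsimp only
    rw [metricIn_apply, e.inChart_apply, e.inChart_apply, hφ.dsymm_dchart (hx t ht),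
      hφ.dsymm_dchart (hx t ht)]
    have key : ∀ x', x' = γ t → metricAt g (γ t) (e.equiv t v) (e.equiv t w) =
        g.inner x' (e.equiv t v) (e.equiv t w) := by
      rintro _ rfl; rfl
    exact key _ (φ.left_inv (hx t ht))
  exact curve_induction (R := R) γ.continuousOn htrans (fun x => (chartAt (EV d) x).source)
    (fun x => (chartAt (EV d) x).open_source) (fun x => mem_chart_source _ x) hloc

/-- Expansion in the dual frame of `e(t)`. -/
theorem covector_eq_sum (e : H1Frame γ) (t : ℝ) (κ : EV d →L[ℝ] ℝ) :
    κ = ∑ μ, κ (e.equiv t (EuclideanSpace.single μ 1)) •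
      (EuclideanSpace.proj μ : EV d →L[ℝ] ℝ).comp ((e.equiv t).symm : EV d →L[ℝ] EV d) := by
  ext v
  obtain ⟨u, rfl⟩ := (e.equiv t).surjective v
  have h1 : u = ∑ μ, u μ • (EuclideanSpace.single μ (1 : ℝ) : EV d) := by
    ext ν
    simp [Pi.single_apply]
  conv_lhs => rw [h1, map_sum, map_sum]
  rw [sum_apply]
  refine Finset.sum_congr rfl fun μ _ => ?_
  simp [mul_comm]

/-- Smoothness of a section controls its components on the dual frame. The covector `g(e w, ·)` has
continuous coefficients in that frame, so its pairing with `J` is again square integrable; this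
justifies the integrals in the uniqueness argument. -/
theorem memLp_rep_inner (g : RMetric d M) (e : H1Frame γ) (J : EH0Section d E) (a b : B.ι)
    {f : L2 (Fin d → MatC N)}
    (hf : ∀ᵐ t ∂volI, ∀ μ, f t μ = B.rep a b (J γ t
      ((EuclideanSpace.proj μ : EV d →L[ℝ] ℝ).comp ((e.equiv t).symm : EV d →L[ℝ] EV d))))
    (w : EV d) : MemLp (fun t => B.rep a b (J γ t (g.inner (γ t) (e.toEquiv t w)))) 2 volI := by
  let A : ℝ → (Fin d → MatC N) →L[ℝ] MatC N := fun t => ∑ μ,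
    metricAt g (γ t) (e.equiv t w) (e.equiv t (EuclideanSpace.single μ 1)) •
      (ContinuousLinearMap.proj μ : (Fin d → MatC N) →L[ℝ] MatC N)
  have hA : ContinuousOn A (Icc 0 1) := continuousOn_finsetSum _ fun μ _ =>
    (continuousOn_metricAt g e w _).smul continuousOn_const
  refine (memLp_clm_apply hA (Lp.memLp f)).ae_eq ?_
  filter_upwards [hf] with t ht
  let Λ : (EV d →L[ℝ] ℝ) →ₗ[ℝ] MatC N := B.repL a b (γ 0) (γ 1) ∘ₗ J γ t
  have h1 : B.rep a b (J γ t (g.inner (γ t) (e.toEquiv t w))) =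
      Λ (metricAt g (γ t) (e.equiv t w)) := rfl
  rw [h1, covector_eq_sum e t (metricAt g (γ t) (e.equiv t w)), map_sum,
    sum_apply]
  refine Finset.sum_congr rfl fun μ _ => ?_
  rw [map_smul, smul_apply, ContinuousLinearMap.proj_apply, ht μ]
  rfl

variable [T2Space M]

/-- At the zero field the derivative of `exp` is the identity, so the normal coordinate frame is the
frame `e` itself. -/
theorem normalFrame_zero (B : GAtlas d E G) (g : RMetric d M) (e : H1Frame γ) {t : ℝ}
    (ht : t ∈ Icc (0 : ℝ) 1) :
    (normalFrame g e 0 t : EV d →L[ℝ] EV d) = (e.equiv t : EV d →L[ℝ] EV d) := by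
  obtain ⟨D⟩ := exists_localData B e (γ t) (α := t) (β := t) ht.1 le_rfl ht.2 fun r hr => by
    obtain rfl : r = t := le_antisymm hr.2 hr.1
    exact ⟨mem_chart_source _ _, B.mem_idxAt _⟩
  have htt : t ∈ Icc t t := ⟨le_rfl, le_rfl⟩
  refine ContinuousLinearMap.ext fun v => ?_
  have h1 := (D.admissible_zero g).dchart_normalFrame htt v
  rw [D.stateFrame_c_zero g, projI_of_mem ht, clamp_of_mem htt, e.inChart_apply] at h1
  have h2 : dchart (chartAt (EV d) (γ t)) (γ t) (normalFrame g e 0 t v : EV d) =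
      dchart (chartAt (EV d) (γ t)) (γ t) (e.equiv t v) := by
    have key : ∀ η : H1Curve d M, η = γ → ∀ u u' : EV d,
        dchart (chartAt (EV d) (γ t)) (η t) u = u' →
          dchart (chartAt (EV d) (γ t)) (γ t) u = u' := by
      rintro _ rfl u u' h; exact h
    exact key _ (expCurve_zero g e) _ _ h1
  have h3 := congrArg (dsymm (chartAt (EV d) (γ t)) (chartAt (EV d) (γ t) (γ t))) h2
  exact ((D.chart.dsymm_dchart (D.mem_source t htt) (normalFrame g e 0 t v : EV d)).symm.trans
    h3).trans (D.chart.dsymm_dchart (D.mem_source t htt) (e.equiv t v))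

theorem repEH0_zero (g : RMetric d M) (J : EH0Section d E) (e : H1Frame γ) (a b : B.ι) {t : ℝ}
    (ht : t ∈ Icc (0 : ℝ) 1) (μ : Fin d) : repEH0 g B J e a b 0 t μ = B.rep a b (J γ t
      ((EuclideanSpace.proj μ : EV d →L[ℝ] ℝ).comp ((e.equiv t).symm : EV d →L[ℝ] EV d))) := by
  have h1 : ∀ K : EV d →L[ℝ] EV d, K = (e.equiv t : EV d →L[ℝ] EV d) →
      K.inverse = ((e.equiv t).symm : EV d →L[ℝ] EV d) := by
    rintro _ rfl
    exact ContinuousLinearMap.inverse_equiv _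
  have key : ∀ η : H1Curve d M, η = γ → ∀ K : EV d →L[ℝ] EV d,
      K = ((e.equiv t).symm : EV d →L[ℝ] EV d) →
      B.rep a b (J η t ((EuclideanSpace.proj μ : EV d →L[ℝ] ℝ).comp K)) = B.rep a b (J γ t
        ((EuclideanSpace.proj μ : EV d →L[ℝ] ℝ).comp ((e.equiv t).symm : EV d →L[ℝ] EV d))) := by
    rintro _ rfl _ rfl; rfl
  exact key _ (expCurve_zero g e) _ (h1 _ (normalFrame_zero B g e ht))

theorem IsSmoothEH0Section.memLp_rep_inner {g : RMetric d M} (J : EH0Section d E) (e : H1Frame γ)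
    {a b : B.ι} {f : H1Model d → L2 (Fin d → MatC N)}
    (hf : ∀ᶠ ξ in 𝓝 (0 : H1Model d), ∀ᵐ t ∂(volume.restrict (Icc (0 : ℝ) 1)),
      f ξ t = repEH0 g B J e a b ξ t) (w : EV d) :
    MemLp (fun t => B.rep a b (J γ t (g.inner (γ t) (e.toEquiv t w)))) 2 volI := by
  refine LevyGrad.memLp_rep_inner g e J a b (f := f 0) ?_ w
  filter_upwards [hf.self_of_nhds, ae_restrict_mem measurableSet_Icc] with t h1 ht μ
  rw [h1, repEH0_zero g J e a b ht μ]

/-- The fundamental lemma of the calculus of variations: testing with `χ e w` for all bump functions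
`χ` on `(0, 1)` gives equality almost everywhere on the covector `g(e w, ·)`. Finitely many `w`
suffice, because the metric and the frame are invertible and those covectors span the cotangent
space. -/
theorem ae_eq_of_forall_homInner {g : RMetric d M} {J J' : EH0Section d E} (e : H1Frame γ)
    (hJ : ∀ w, MemLp (fun t => B.rep (B.idxAt (γ 0)) (B.idxAt (γ 1))
      (J γ t (g.inner (γ t) (e.toEquiv t w)))) 2 volI)
    (hJ' : ∀ w, MemLp (fun t => B.rep (B.idxAt (γ 0)) (B.idxAt (γ 1))
      (J' γ t (g.inner (γ t) (e.toEquiv t w)))) 2 volI)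
    (h : ∀ X : ∀ t : ℝ, TangentSpace (𝓡 d) (γ t), IsH1Field γ X → X 0 = 0 → X 1 = 0 →
      ∀ Φ : E (γ 0) →ₗ[ℂ] E (γ 1),
        ∫ t in (0 : ℝ)..1, homInner B (J γ t (g.inner (γ t) (X t))) Φ =
          ∫ t in (0 : ℝ)..1, homInner B (J' γ t (g.inner (γ t) (X t))) Φ) :
    ∀ᵐ t ∂volI, J γ t = J' γ t := by
  set a := B.idxAt (γ 0)
  set b := B.idxAt (γ 1)
  have ha : γ 0 ∈ B.dom a := B.mem_idxAt _
  have hb : γ 1 ∈ B.dom b := B.mem_idxAt _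
  have key : ∀ w : EV d, ∀ᵐ t ∂volI, B.rep a b (J γ t (g.inner (γ t) (e.toEquiv t w))) =
      B.rep a b (J' γ t (g.inner (γ t) (e.toEquiv t w))) := by
    intro w
    set k := fun t => B.rep a b (J γ t (g.inner (γ t) (e.toEquiv t w))) with hk
    set k' := fun t => B.rep a b (J' γ t (g.inner (γ t) (e.toEquiv t w))) with hk'
    have hint : IntegrableOn (fun t => k t - k' t) (Icc 0 1) :=
      ((hJ w).sub (hJ' w)).integrable (by norm_num)
    have h1 := isOpen_Ioo.ae_eq_zero_of_integral_contDiff_smul_eq_zero (μ := volume)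
      (U := Ioo (0 : ℝ) 1) (f := fun t => k t - k' t)
      (hint.mono_set Ioo_subset_Icc_self).locallyIntegrableOn ?_
    · have h2 : ∀ᵐ t ∂volI, t ∈ Ioo (0 : ℝ) 1 := ae_mem_Ioo 0 1
      filter_upwards [ae_restrict_of_ae h1, h2] with t h3 h4
      exact sub_eq_zero.mp (h3 h4)
    intro χ hχ _ hsupp
    have hχ0 : ∀ t, t ∉ Ioo (0 : ℝ) 1 → χ t = 0 := fun t ht =>
      image_eq_zero_of_notMem_tsupport fun h => ht (hsupp h)
    have h3 := h (fun t => χ t • e.toEquiv t w) (isH1Field_smul e hχ w)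
      (by rw [hχ0 0 (by simp), zero_smul]) (by rw [hχ0 1 (by simp), zero_smul])
    have hmul : ∀ k : ℝ → MatC N, MemLp k 2 volI → IntervalIntegrable (fun t => χ t • k t) volume 0 1 :=
      fun k hk => by
        have h4 : IntervalIntegrable k volume 0 1 :=
          (intervalIntegrable_iff_integrableOn_Icc_of_le zero_le_one).mpr
            (hk.integrable (by norm_num))
        exact h4.continuousOn_smul hχ.continuous.continuousOn
    have hrep : ∀ J : EH0Section d E, ∀ (Φ : E (γ 0) →ₗ[ℂ] E (γ 1)) (t : ℝ),
        homInner B (J γ t (g.inner (γ t) (χ t • e.toEquiv t w))) Φ = traceForm (B.rep a b Φ)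
          (χ t • B.rep a b (J γ t (g.inner (γ t) (e.toEquiv t w)))) := by
      intro J Φ t
      rw [homInner_eq, map_smul, map_smul]
      exact congrArg _ (conjTriv_smul _ _ _ _)
    have h5 : ∫ t in (0 : ℝ)..1, χ t • k t = ∫ t in (0 : ℝ)..1, χ t • k' t := by
      -- The fiber element `Φ` is arbitrary, so its matrix `Q` is too, and the trace pairing is
      -- nondegenerate.
      refine sub_eq_zero.mp (eq_zero_of_traceForm fun Q => ?_)
      have h6 := h3 (ofConj (B.triv a) (B.triv b) (γ 0) (γ 1) Q)
      simp only [hrep] at h6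
      have h7 : B.rep a b (ofConj (B.triv a) (B.triv b) (γ 0) (γ 1) Q) = Q :=
        conjTriv_ofConj _ _ ha hb Q
      rw [h7, ContinuousLinearMap.intervalIntegral_comp_comm _ (hmul k (hJ w)),
        ContinuousLinearMap.intervalIntegral_comp_comm _ (hmul k' (hJ' w))] at h6
      rw [map_sub, h6, sub_self]
    have h8 : ∫ t, χ t • (k t - k' t) = ∫ t in Ioc (0 : ℝ) 1, χ t • (k t - k' t) := by
      refine (setIntegral_eq_integral_of_forall_compl_eq_zero fun t ht => ?_).symm
      rw [hχ0 t fun h => ht (Ioo_subset_Ioc_self h), zero_smul]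
    rw [h8, ← intervalIntegral.integral_of_le zero_le_one]
    simp only [smul_sub]
    rw [intervalIntegral.integral_sub (hmul k (hJ w)) (hmul k' (hJ' w)), h5, sub_self]
  -- One null set must serve all covectors, so only the basis vectors are used and linearity does
  -- the rest.
  have hall := ae_all_iff.mpr fun μ : Fin d => key (EuclideanSpace.single μ 1)
  filter_upwards [hall] with t ht
  let Λ : EH0Section d E → EV d →ₗ[ℝ] MatC N := fun J => B.repL a b (γ 0) (γ 1) ∘ₗ J γ t ∘ₗ
    ((metricAt g (γ t) ∘L (e.equiv t : EV d →L[ℝ] EV d) : EV d →L[ℝ] EV d →L[ℝ] ℝ) :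
      EV d →ₗ[ℝ] EV d →L[ℝ] ℝ)
  have hΛ : Λ J = Λ J' := by
    refine (EuclideanSpace.basisFun (Fin d) ℝ).toBasis.ext fun μ => ?_
    rw [OrthonormalBasis.coe_toBasis, EuclideanSpace.basisFun_apply]
    exact ht μ
  refine LinearMap.ext fun κ => conjTriv_injective _ _ ha hb ?_
  have h9 : ∀ J : EH0Section d E, B.rep a b (J γ t κ) =
      Λ J ((e.equiv t).symm (sharp g (γ t) κ)) := by
    intro J
    have h10 : metricAt g (γ t) (e.equiv t ((e.equiv t).symm (sharp g (γ t) κ))) = κ :=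
      (congrArg (metricAt g (γ t)) ((e.equiv t).apply_symm_apply _)).trans (inner_sharp g (γ t) κ)
    exact (congrArg (fun κ' => B.rep a b (J γ t κ')) h10).symm
  exact (h9 J).trans ((DFunLike.congr_fun hΛ _).trans (h9 J').symm)

/-- Both sections represent the same directional derivatives, which are unique as ordinary
derivatives in one pair of trivializations. -/
theorem IsH0Gradient.ae_eq {g : RMetric d M} {A : GConnection B} {J : EH0Section d E}
    (hJ : IsH0Gradient g B (fun γ => parallelTransport A γ 1 0) J) (γ : H1Curve d M) :
    ∀ᵐ t ∂volI, J γ t = transportGradient g A γ t := by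
  obtain ⟨e, he⟩ := hJ.smooth_grad γ
  have ha := B.mem_idxAt (γ 0)
  have hb := B.mem_idxAt (γ 1)
  obtain ⟨f, hf, -⟩ := he _ _ ha hb
  -- The explicit gradient is smooth with respect to every frame, so the frame supplied by `J` can
  -- be used for both.
  obtain ⟨f', hf', -⟩ := exists_repEH0_transportGradient A g e _ _ ha hb
  refine ae_eq_of_forall_homInner e (IsSmoothEH0Section.memLp_rep_inner J e hf)
    (IsSmoothEH0Section.memLp_rep_inner _ e hf') fun X hX h0 h1 Φ => ?_
  obtain ⟨D, hD, hD'⟩ := hJ.grad γ X hX h0 h1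
  obtain ⟨D₁, hD₁, hD₁'⟩ := exists_hasDirDeriv_parallelTransport A g γ hX h0 h1
  rw [hD' Φ, hD₁' Φ, homInner_eq, homInner_eq, (hD _ _ ha hb).unique (hD₁ _ _ ha hb)]

end VB

end LevyGrad

end

theorem proposition3p3 {d N : ℕ}
    {M : Type*} [TopologicalSpace M] [T2Space M] [ChartedSpace (LevyGrad.EV d) M]
    [IsManifold (𝓡 d) ∞ M] (g : LevyGrad.RMetric d M)
    {E : M → Type*} [∀ x, AddCommGroup (E x)] [∀ x, Module ℂ (E x)] [∀ x, TopologicalSpace (E x)]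
    [TopologicalSpace (TotalSpace (LevyGrad.CV N) E)] [FiberBundle (LevyGrad.CV N) E]
    [VectorBundle ℂ (LevyGrad.CV N) E]
    {G : Subgroup (Matrix.specialUnitaryGroup (Fin N) ℂ)}
    (B : LevyGrad.GAtlas d E G) (A : LevyGrad.GConnection B) :
    LevyGrad.IsH0Gradient g B (fun γ => LevyGrad.parallelTransport A γ 1 0)
        (LevyGrad.transportGradient g A) ∧
      ∀ J : LevyGrad.EH0Section d E,
        LevyGrad.IsH0Gradient g B (fun γ => LevyGrad.parallelTransport A γ 1 0) J →
          ∀ γ : LevyGrad.H1Curve d M, ∀ᵐ t ∂(volume.restrict (Icc (0 : ℝ) 1)),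
            J γ t = LevyGrad.transportGradient g A γ t :=
  ⟨LevyGrad.isH0Gradient_transportGradient A g, fun _ hJ γ => hJ.ae_eq γ⟩
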